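/- **Theories.** An *operational theory with control* (OTC) $\Theta$ consists of a category (its objects are *systems*, its arrows *events*), a distinguished trivial system $I$, a specification of which finite indexed collections of events $\{f_x\colon A\to B_x\}_{x\in X}$ with a common domain are *tests* (not depending on the names of the indices; a *partial test* is a subcollection of a test, $f,g\colon A\to B$ are *compatible* if $\{f,g\}$ is a partial test, and $f$ is *deterministic* if $\{f\}$ is a test), a partial operation $\ovee$ (*coarse-graining*) defined on compatible pairs, and *impossible events* $0_{A,B}\colon A\to B$, such that: (a) if $\{f_x\colon A\to B_x\}_{x\in X}$ is a test and $\{g_{x,y}\colon B_x\to C_{x,y}\}_{y\in Y_x}$ is a test for every $x$, then $\{g_{x,y}\circ f_x\}_{x\in X,\,y\in Y_x}$ is a test; (b) if $\{f_x\}_{x\in X}\cup\{g,h\}$ is a test with $g,h\colon A\to B$, so is $\{f_x\}_{x\in X}\cup\{g\ovee h\}$; moreover $\ovee$ is associative on partial tests, commutative, and satisfies $f\circ(g\ovee h)=f\circ g\ovee f\circ h$ and $(g\ovee h)\circ k=g\circ k\ovee h\circ k$; (c) $g\circ 0=0$, $0\circ f=0$, $f\ovee 0=f$, and a collection is a test iff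 it is one after adding an impossible event; (d) identities are deterministic, and every event belongs to a test; (e) for every effect $e\colon A\to I$ there is a unique effect $e^\perp\colon A\to I$ such that $\{e,e^\perp\}$ is a test. Every system $A$ then has a unique deterministic effect $\mathrm{disc}_A\colon A\to I$, and finite partial tests of events of one type have a coarse-graining $\bigovee$. A *morphism* of OTCs is a functor $F$ between the categories of events which preserves tests and $\ovee$, and for which $\mathrm{disc}_{F(I)}\colon F(I)\to I$ is an isomorphism. In a *monoidal* OTC the category of events is symmetric monoidal with unit $I$; if $\{f_x\}_x$ and $\{g_y\}_y$ are tests so is $\{f_x\otimes g_y\}_{x,y}$; $f\otimes(g\ovee h)=f\otimes g\ovee f\otimes h$; $f\otimes 0=0$; and $\lambda_I\colon I\otimes I\to I$ is deterministic. Its morphisms are, in addition, strong symmetric monoidal functors with coherence isomorphism $\mathrm{disc}_{F(I)}^{-1}\colon I\to F(I)$. Write $(\mathbf{Mon})\mathbf{OTC}$ for the resulting categories. A theory is *positive* if, whenever $\{f_x\}_{x\in X}$ and $\{f_x\}_{x\in X}\cup\{g_y\}_{y\in Y}$ are tests, every $g_y$ is impossible. It *satisfies combining* if any partial tests $\{f_x\}_{x\in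 X}$, $\{g_y\}_{y\in Y}$ on the same system with $\bigovee_x \mathrm{disc}\circ f_x=(\bigovee_y\mathrm{disc}\circ g_y)^\perp$ form a test $\{f_x\}_{x\in X}\cup\{g_y\}_{y\in Y}$. **Operational categories.** An *operational category* is a category $\mathbf B$ with finite coproducts $(+,0)$ and a terminal object $1$ such that the arrows $[[\kappa_1,\kappa_2\circ{!}],\kappa_2]$ and $[[\kappa_2\circ{!},\kappa_1],\kappa_2]\colon (A+A)+1\to A+1$ are jointly monic, and the square $({!}+{!})\circ\kappa_1=\kappa_1\circ{!}\colon A\to 1+1$, with $\kappa_1\colon A\to A+1$ and ${!}\colon A\to 1$, is a pullback. It is *monoidal* if it is symmetric monoidal with tensor unit $1$ and the tensor distributes over finite coproducts. It is a *(monoidal) effectus* (in total form) if, moreover, the squares $({!}+{!})\circ\kappa_1=\kappa_1\circ{!}\colon A\to 1+1$, with $\kappa_1\colon A\to A+B$, and $({!}+{!})\circ({!}+\mathrm{id})=({!}+{!})\circ(\mathrm{id}+{!})\colon A+B\to 1+1$, with the two sides passing through $1+B$ and $A+1$, are pullbacks. Let $(\mathbf{Mon})\mathbf{OpCat}_{\mathrm{strict}}$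 be the category of (monoidal) operational categories with specified binary coproducts and initial object, and (strong symmetric monoidal) functors which preserve the terminal object, and preserve the specified coproducts strictly: $F(0)=0$, $F(A+B)=F(A)+F(B)$, $F(\kappa_i)=\kappa_i$. **The functors.** For an OTC $\Theta$, $\mathrm{OpCat}(\Theta)$ is the category whose objects are finite indexed collections $\{A_x\}_{x\in X}$ of systems, where $X$ ranges over the finite sets formally generated from $\emptyset$ and a one-point set by binary disjoint union (every finite set is in bijection with one of these). An arrow $M\colon\{A_x\}_{x\in X}\to\{B_y\}_{y\in Y}$ is a matrix of events $M(x,y)\colon A_x\to B_y$ such that $\{M(x,y)\}_{y\in Y}$ is a test for every $x$; composition is $(N\circ M)(x,z)=\bigovee_{y}N(y,z)\circ M(x,y)$. The specified coproducts are given by disjoint union of index sets and the empty collection, and $1=\{I\}$. If $\Theta$ is monoidal, $\{A_x\}_{x\in X}\otimes\{B_y\}_{y\in Y}=\{A_x\otimes B_y\}_{(x,y)\in X\times Y}$ and $(M\otimes N)((x,y),(x',y'))=M(x,x')\otimes N(y,y')$. Morphisms of theories are applied to all systems and all entries. For an operational category $\mathbf B$ with specified coproducts, $\mathrm{Par}(\mathbf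 B)$ has the objects of $\mathbf B$, arrows $A\to B$ given by arrows $A\to B+1$ of $\mathbf B$, and composition $g\bullet f=[g,\kappa_2]\circ f$ (and the tensor product of $\mathbf B$ on objects, with $f\otimes g$ given by distributivity, in the monoidal case); it has coproducts as in $\mathbf B$, zero arrows $\kappa_2\circ{!}$, projections $\triangleright_x$, and discarding maps $\kappa_1\circ{!}\colon A\to 1$. The theory $\mathrm{OTC}(\mathrm{Par}(\mathbf B))$ has category of events $\mathrm{Par}(\mathbf B)$ and trivial system $1$; $\{f_x\colon A\to B_x\}_{x\in X}$ is a test iff there is $f\colon A\to\coprod_x B_x$ in $\mathrm{Par}(\mathbf B)$ with $\triangleright_x\bullet f=f_x$ for all $x$ which preserves discarding; and $f\ovee g=\triangledown\bullet h$, where $\triangledown\colon B+B\to B$ is the codiagonal and $h$ is the unique arrow with $\triangleright_1\bullet h=f$, $\triangleright_2\bullet h=g$. A morphism $F\colon\mathbf B\to\mathbf B'$ sends a partial arrow $f\colon A\to B+1$ to the composite of $F(f)$ with $F(B+1)=F(B)+F(1)\cong F(B)+1$. **Corollary 7.5.** In both the monoidal and the non-monoidal case, these assignments are well-defined functors and form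 an adjunction $$\mathrm{OpCat}(-)\;\dashv\;\mathrm{OTC}(\mathrm{Par}(-)),\qquad \mathrm{OpCat}(-)\colon(\mathbf{Mon})\mathbf{OTC}\to(\mathbf{Mon})\mathbf{OpCat}_{\mathrm{strict}}.$$ It restricts to an adjunction between the full subcategory of $(\mathbf{Mon})\mathbf{OTC}$ on the positive theories satisfying combining and the full subcategory of $(\mathbf{Mon})\mathbf{OpCat}_{\mathrm{strict}}$ on the (monoidal) effectuses: both functors restrict to these subcategories, and the restricted functors are adjoint with the same unit. -/

import Mathlib

open CategoryTheory CategoryTheory.Limits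

universe v u

noncomputable section

namespace OpTheory

/-! ## Operational theories with control -/

/-- An event with input system `A`, together with its output system. -/
abbrev Out {E : Type u} [Category.{v} E] (A : E) := Σ B : E, A ⟶ B

/-- An event `f : A ⟶ B`, as a member of a collection of events with input `A`. -/
abbrev ev {E : Type u} [Category.{v} E] {A B : E} (f : A ⟶ B) : Out A := ⟨B, f⟩

/-- A specification of which finite indexed collections `{f_x : A ⟶ B_x}_{x ∈ X}` are tests. -/
structure TestSpec (E : Type u) [Category.{v} E] where
  IsTest : ∀ {X : Type} [Finite X] {A : E}, (X → Out A) → Prop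

namespace TestSpec

variable {E : Type u} [Category.{v} E] (T : TestSpec E)

/-- A partial test: a collection which is contained in a test. The union of two indexed collections
is indexed by the disjoint union of their index sets. -/
def IsPartialTest {X : Type} [Finite X] {A : E} (f : X → Out A) : Prop :=
  ∃ (Y : Type) (_ : Finite Y) (g : Y → Out A), T.IsTest (Sum.elim f g)

/-- Two events of the same type are compatible when they form a partial test. -/
def Compat {A B : E} (f g : A ⟶ B) : Prop := T.IsPartialTest ![ev f, ev g]

/-- An event is deterministic when it forms a test on its own. -/
def IsDet {A B : E} (f : A ⟶ B) : Prop := T.IsTest ![ev f]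

end TestSpec

/-- The data of an operational theory on a category of events `E` with trivial system `I`: the
allowed tests, the coarse-graining `f ⊻ g` of compatible pairs of events, and the (automatically
unique) family of impossible events. -/
structure OTCData (E : Type u) [Category.{v} E] (I : E) extends TestSpec E where
  ovee : ∀ {A B : E} (f g : A ⟶ B), toTestSpec.Compat f g → (A ⟶ B)
  zero : ∀ A B : E, A ⟶ B

/-- The assumptions on an operational theory with control. -/
structure OTCData.Axioms {E : Type u} [Category.{v} E] {I : E} (D : OTCData E I) : Prop where
  /-- The names of the outcomes of a test are irrelevant. -/
  reindex : ∀ {X Y : Type} [Finite X] [Finite Y] {A : E} (e : X ≃ Y) (f : Y → Out A),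
    D.IsTest f → D.IsTest (f ∘ e)
  /-- Control. -/
  control : ∀ {X : Type} [Finite X] {Y : X → Type} [∀ x, Finite (Y x)] {A : E}
    (f : X → Out A) (g : ∀ x, Y x → Out (f x).1),
    D.IsTest f → (∀ x, D.IsTest (g x)) →
    D.IsTest (fun p : (Σ x, Y x) => ev ((f p.1).2 ≫ (g p.1 p.2).2))
  /-- Coarse-graining two outcomes of a test gives a test. -/
  ovee_test : ∀ {X : Type} [Finite X] {A B : E} (f : X → Out A) (g h : A ⟶ B)
    (c : D.Compat g h), D.IsTest (Sum.elim f ![ev g, ev h]) →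
    D.IsTest (Sum.elim f ![ev (D.ovee g h c)])
  ovee_assoc : ∀ {A B : E} (f g h : A ⟶ B), D.IsPartialTest ![ev f, ev g, ev h] →
    ∀ (c₁ : D.Compat f g) (c₂ : D.Compat (D.ovee f g c₁) h)
      (c₃ : D.Compat g h) (c₄ : D.Compat f (D.ovee g h c₃)),
      D.ovee (D.ovee f g c₁) h c₂ = D.ovee f (D.ovee g h c₃) c₄
  ovee_comm : ∀ {A B : E} (g h : A ⟶ B) (c : D.Compat g h) (c' : D.Compat h g),
    D.ovee g h c = D.ovee h g c'
  ovee_comp : ∀ {B C F : E} (g h : B ⟶ C) (c : D.Compat g h) (f : C ⟶ F)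
    (c' : D.Compat (g ≫ f) (h ≫ f)), D.ovee g h c ≫ f = D.ovee (g ≫ f) (h ≫ f) c'
  comp_ovee : ∀ {A B C : E} (k : A ⟶ B) (g h : B ⟶ C) (c : D.Compat g h)
    (c' : D.Compat (k ≫ g) (k ≫ h)), k ≫ D.ovee g h c = D.ovee (k ≫ g) (k ≫ h) c'
  zero_comp : ∀ {A B C : E} (g : B ⟶ C), D.zero A B ≫ g = D.zero A C
  comp_zero : ∀ {A B C : E} (f : A ⟶ B), f ≫ D.zero B C = D.zero A C
  /-- A collection is a test iff it is one after adding an impossible event. -/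
  zero_test : ∀ {X : Type} [Finite X] {A : E} (f : X → Out A) (C : E),
    D.IsTest f ↔ D.IsTest (Sum.elim f ![ev (D.zero A C)])
  ovee_zero : ∀ {A B : E} (f : A ⟶ B) (c : D.Compat f (D.zero A B)), D.ovee f (D.zero A B) c = f
  /-- Identity events are deterministic. -/
  id_det : ∀ A : E, D.IsDet (𝟙 A)
  /-- Every event belongs to some test. -/
  mem_test : ∀ {A B : E} (f : A ⟶ B), D.IsPartialTest ![ev f]
  /-- Complementary effects. -/
  compl : ∀ {A : E} (e : A ⟶ I), ∃! e' : A ⟶ I, D.IsTest ![ev e, ev e']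

namespace OTCData

variable {E : Type u} [Category.{v} E] {I : E} (D : OTCData E I)

open Classical in
/-- Coarse-graining, extended by the impossible event to pairs which are not compatible. -/
def add {A B : E} (f g : A ⟶ B) : A ⟶ B :=
  if c : D.Compat f g then D.ovee f g c else D.zero A B

/-- The coarse-graining `f₁ ⊻ (f₂ ⊻ (⋯ ⊻ fₙ))` of a list of events. -/
def lsum {A B : E} : List (A ⟶ B) → (A ⟶ B)
  | [] => D.zero A B
  | f :: l => D.add f (lsum l)

/-- A list of all elements of a finite type. -/
def enum (X : Type) [Finite X] : List X :=
  (@Finset.univ X (Fintype.ofFinite X)).toList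

/-- The coarse-graining of a finite compatible collection of events of the same type; it is the
impossible event for the empty collection. -/
def bigOvee {X : Type} [Finite X] {A B : E} (f : X → (A ⟶ B)) : A ⟶ B :=
  D.lsum ((enum X).map f)

theorem enum_nodup (X : Type) [Finite X] : (enum X).Nodup := Finset.nodup_toList _

theorem mem_enum {X : Type} [Finite X] (x : X) : x ∈ enum X := by
  simp [enum]

/-! ### Auxiliary facts on coarse-graining of lists -/

/-- The events of a list form a test. -/
def LTest {A : E} (l : List (Out A)) : Prop := D.IsTest l.get

/-- The events of a list form a partial test. -/
def LPart {A : E} (l : List (Out A)) : Prop := ∃ l', D.LTest (l ++ l')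

theorem exists_equiv_of_perm {S : Type*} {l l' : List S} (h : l.Perm l') :
    ∃ e : Fin l.length ≃ Fin l'.length, ∀ i, l.get i = l'.get (e i) := by
  induction h with
  | nil => exact ⟨Equiv.refl _, fun i => rfl⟩
  | cons x _ ih =>
    obtain ⟨e, he⟩ := ih
    refine ⟨(finSuccEquiv _).trans (e.optionCongr.trans (finSuccEquiv _).symm), ?_⟩
    intro i
    refine Fin.cases ?_ (fun i => ?_) i
    · rfl
    · have := he i
      simpa using this
  | swap x y l =>
    refine ⟨Equiv.swap 0 1, ?_⟩
    intro i
    refine Fin.cases ?_ (fun i => ?_) i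
    · simp
    · refine Fin.cases ?_ (fun i => ?_) i
      · simp
      · rw [Equiv.swap_apply_of_ne_of_ne]
        · rfl
        · exact Fin.succ_ne_zero _
        · intro hh
          have := congrArg Fin.val hh
          simp at this
  | trans _ _ ih₁ ih₂ =>
    obtain ⟨e, he⟩ := ih₁
    obtain ⟨e', he'⟩ := ih₂
    exact ⟨e.trans e', fun i => by rw [he, he']; rfl⟩

variable {D}

theorem lTest_perm (ax : D.Axioms) {A : E} {l l' : List (Out A)} (h : l.Perm l')
    (t : D.LTest l) : D.LTest l' := by
  obtain ⟨e, he⟩ := exists_equiv_of_perm h.symm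
  have : l'.get = l.get ∘ e := funext he
  unfold LTest
  rw [this]
  exact ax.reindex e _ t

theorem isTest_iff (ax : D.Axioms) {X : Type} [Finite X] {A : E} (f : X → Out A) (l : List X)
    (hl : l.Nodup) (hm : ∀ x, x ∈ l) : D.IsTest f ↔ D.LTest (l.map f) := by
  classical
  have key : ∀ (i : Fin (l.map f).length),
      (l.map f).get i = f ((finCongr (by simp)).trans (hl.getEquivOfForallMemList l hm) i) := by
    intro i
    simp
  have e1 : (l.map f).get =
      f ∘ ((finCongr (by simp)).trans (hl.getEquivOfForallMemList l hm)) := funext key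
  constructor
  · intro t
    unfold LTest
    rw [e1]
    exact ax.reindex _ _ t
  · intro t
    unfold LTest at t
    rw [e1] at t
    have := ax.reindex ((finCongr (by simp)).trans (hl.getEquivOfForallMemList l hm)).symm _ t
    rw [Function.comp_assoc, Equiv.self_comp_symm] at this
    exact this

theorem isTest_iff_enum (ax : D.Axioms) {X : Type} [Finite X] {A : E} (f : X → Out A) :
    D.IsTest f ↔ D.LTest ((enum X).map f) :=
  isTest_iff ax f _ (enum_nodup X) mem_enum

theorem isTest_sum_iff (ax : D.Axioms) {X Y : Type} [Finite X] [Finite Y] {A : E} (f : X → Out A)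
    (g : Y → Out A) (l : List X) (hl : l.Nodup) (hm : ∀ x, x ∈ l)
    (l' : List Y) (hl' : l'.Nodup) (hm' : ∀ x, x ∈ l') :
    D.IsTest (Sum.elim f g) ↔ D.LTest (l.map f ++ l'.map g) := by
  rw [isTest_iff ax (Sum.elim f g) (l.map Sum.inl ++ l'.map Sum.inr)]
  · simp [Function.comp_def]
  · rw [List.nodup_append]
    refine ⟨hl.map Sum.inl_injective, hl'.map Sum.inr_injective, ?_⟩
    simp
  · rintro (x | x) <;> simp [hm, hm']

theorem isTest_fin_iff (ax : D.Axioms) {A : E} {n : ℕ} (f : Fin n → Out A) :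
    D.IsTest f ↔ D.LTest (List.ofFn f) := by
  rw [isTest_iff ax f (List.finRange n) (List.nodup_finRange n) (List.mem_finRange),
    List.ofFn_eq_map]

theorem isTest_sum_fin_iff (ax : D.Axioms) {X : Type} [Finite X] {n : ℕ} {A : E} (f : X → Out A)
    (g : Fin n → Out A) :
    D.IsTest (Sum.elim f g) ↔ D.LTest ((enum X).map f ++ List.ofFn g) := by
  rw [isTest_sum_iff ax f g _ (enum_nodup X) mem_enum (List.finRange n) (List.nodup_finRange n)
    List.mem_finRange, List.ofFn_eq_map]

theorem enum_fin_map_perm {S : Type*} {n : ℕ} (g : Fin n → S) :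
    ((enum (Fin n)).map g).Perm (List.ofFn g) := by
  rw [List.ofFn_eq_map]
  refine List.Perm.map _ ((List.perm_ext_iff_of_nodup (enum_nodup _) (List.nodup_finRange n)).2 ?_)
  intro a
  simp [mem_enum]

theorem isPartialTest_iff (ax : D.Axioms) {X : Type} [Finite X] {A : E} (f : X → Out A) :
    D.IsPartialTest f ↔ D.LPart ((enum X).map f) := by
  constructor
  · rintro ⟨Y, _, g, t⟩
    exact ⟨(enum Y).map g,
      (isTest_sum_iff ax f g _ (enum_nodup X) mem_enum _ (enum_nodup Y) mem_enum).1 t⟩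
  · rintro ⟨l', t⟩
    refine ⟨Fin l'.length, inferInstance, l'.get, (isTest_sum_fin_iff ax f _).2 ?_⟩
    rw [List.ofFn_get]
    exact t

theorem lPart_perm (ax : D.Axioms) {A : E} {l l' : List (Out A)} (h : l.Perm l')
    (t : D.LPart l) : D.LPart l' := by
  obtain ⟨k, hk⟩ := t
  exact ⟨k, lTest_perm ax (h.append_right k) hk⟩

theorem isPartialTest_fin_iff (ax : D.Axioms) {A : E} {n : ℕ} (f : Fin n → Out A) :
    D.IsPartialTest f ↔ D.LPart (List.ofFn f) := by
  rw [isPartialTest_iff ax]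
  exact ⟨lPart_perm ax (enum_fin_map_perm f), lPart_perm ax (enum_fin_map_perm f).symm⟩

theorem compat_iff (ax : D.Axioms) {A B : E} (f g : A ⟶ B) :
    D.Compat f g ↔ D.LPart [ev f, ev g] := by
  unfold TestSpec.Compat
  rw [isPartialTest_fin_iff ax]
  simp [List.ofFn_succ]

theorem LPart.of_append (ax : D.Axioms) {A : E} {l l' : List (Out A)} (h : D.LPart (l ++ l')) :
    D.LPart l' := by
  obtain ⟨k, hk⟩ := h
  refine ⟨l ++ k, lTest_perm ax ?_ hk⟩
  rw [← List.append_assoc]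
  exact List.perm_append_comm.append_right k

theorem LPart.left {A : E} {l l' : List (Out A)} (h : D.LPart (l ++ l')) : D.LPart l := by
  obtain ⟨k, hk⟩ := h
  exact ⟨l' ++ k, by simpa using hk⟩

theorem compat_zero (ax : D.Axioms) {A B : E} (f : A ⟶ B) : D.Compat f (D.zero A B) := by
  rw [compat_iff ax]
  obtain ⟨k, hk⟩ := (isPartialTest_fin_iff ax _).1 (ax.mem_test f)
  refine ⟨k, ?_⟩
  have h := (ax.zero_test _ B).1 hk
  rw [isTest_sum_iff ax _ _ _ (List.nodup_finRange _) List.mem_finRange _ (List.nodup_finRange _)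
    List.mem_finRange, ← List.ofFn_eq_map, ← List.ofFn_eq_map, List.ofFn_get] at h
  refine lTest_perm ax ?_ h
  simp only [List.ofFn_succ, List.ofFn_zero, Matrix.cons_val_zero, List.cons_append,
    List.nil_append]
  refine List.Perm.cons _ ?_
  exact List.perm_append_comm

theorem lTest_zero_iff (ax : D.Axioms) {A : E} (C : E) (l : List (Out A)) :
    D.LTest l ↔ D.LTest (ev (D.zero A C) :: l) := by
  have h := ax.zero_test l.get C
  rw [isTest_sum_iff ax _ _ _ (List.nodup_finRange _) List.mem_finRange _ (List.nodup_finRange _)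
    List.mem_finRange, ← List.ofFn_eq_map, ← List.ofFn_eq_map, List.ofFn_get] at h
  simp only [List.ofFn_succ, List.ofFn_zero, Matrix.cons_val_zero] at h
  refine h.trans ⟨lTest_perm ax ?_, lTest_perm ax ?_⟩
  · exact List.perm_append_comm
  · exact List.perm_append_comm (l₁ := [_])

theorem add_zero (ax : D.Axioms) {A B : E} (f : A ⟶ B) : D.add f (D.zero A B) = f := by
  unfold add
  rw [dif_pos (compat_zero ax f), ax.ovee_zero]

theorem compat_symm (ax : D.Axioms) {A B : E} {f g : A ⟶ B} (h : D.Compat f g) :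
    D.Compat g f := by
  rw [compat_iff ax] at h ⊢
  exact lPart_perm ax (List.Perm.swap _ _ _) h

theorem add_comm (ax : D.Axioms) {A B : E} (f g : A ⟶ B) : D.add f g = D.add g f := by
  unfold add
  by_cases h : D.Compat f g
  · rw [dif_pos h, dif_pos (compat_symm ax h), ax.ovee_comm]
  · rw [dif_neg h, dif_neg (fun h' => h (compat_symm ax h'))]

theorem zero_add (ax : D.Axioms) {A B : E} (f : A ⟶ B) : D.add (D.zero A B) f = f := by
  rw [add_comm ax, add_zero ax]

theorem lTest_add (ax : D.Axioms) {A B : E} (f g : A ⟶ B) (l : List (Out A))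
    (t : D.LTest (ev f :: ev g :: l)) : D.LTest (ev (D.add f g) :: l) := by
  have c : D.Compat f g := (compat_iff ax f g).2 ⟨l, t⟩
  have h := ax.ovee_test l.get f g c ?_
  · rw [isTest_sum_iff ax _ _ _ (List.nodup_finRange _) List.mem_finRange _ (List.nodup_finRange _)
      List.mem_finRange, ← List.ofFn_eq_map, ← List.ofFn_eq_map, List.ofFn_get] at h
    refine lTest_perm ax ?_ h
    simp only [List.ofFn_succ, List.ofFn_zero, Matrix.cons_val_zero, add, dif_pos c]
    exact List.perm_append_comm
  · rw [isTest_sum_iff ax _ _ _ (List.nodup_finRange _) List.mem_finRange _ (List.nodup_finRange _)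
      List.mem_finRange, ← List.ofFn_eq_map, ← List.ofFn_eq_map, List.ofFn_get]
    refine lTest_perm ax ?_ t
    simp only [List.ofFn_succ, List.ofFn_zero, Matrix.cons_val_zero, Matrix.cons_val_succ]
    exact List.perm_append_comm (l₁ := [_, _])

theorem lTest_merge (ax : D.Axioms) {A B : E} (l₁ : List (A ⟶ B)) :
    ∀ l : List (Out A), D.LTest (l₁.map ev ++ l) → D.LTest (ev (D.lsum l₁) :: l) := by
  induction l₁ with
  | nil => exact fun l t => (lTest_zero_iff ax B l).1 t
  | cons a l₁ ih =>
    intro l t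
    refine lTest_add ax _ _ _ ?_
    refine lTest_perm ax (List.Perm.swap _ _ _) (ih (ev a :: l) (lTest_perm ax ?_ t))
    exact List.perm_middle.symm

theorem lPart_merge (ax : D.Axioms) {A B : E} (l₁ : List (A ⟶ B)) (l : List (Out A))
    (t : D.LPart (l₁.map ev ++ l)) : D.LPart (ev (D.lsum l₁) :: l) := by
  obtain ⟨k, hk⟩ := t
  exact ⟨k, lTest_merge ax l₁ (l ++ k) (by simpa using hk)⟩

theorem add_assoc (ax : D.Axioms) {A B : E} (f g h : A ⟶ B) (t : D.LPart [ev f, ev g, ev h]) :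
    D.add (D.add f g) h = D.add f (D.add g h) := by
  have c₁ : D.Compat f g := (compat_iff ax _ _).2 (LPart.left (l' := [ev h]) t)
  have c₃ : D.Compat g h := (compat_iff ax _ _).2 (LPart.of_append ax (l := [ev f]) t)
  have e₁ : D.add f g = D.ovee f g c₁ := dif_pos c₁
  have e₃ : D.add g h = D.ovee g h c₃ := dif_pos c₃
  have c₂ : D.Compat (D.add f g) h := by
    obtain ⟨k, hk⟩ := t
    exact (compat_iff ax _ _).2 ⟨k, lTest_add ax _ _ _ hk⟩
  have c₄ : D.Compat f (D.add g h) := by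
    obtain ⟨k, hk⟩ := t
    refine compat_symm ax ((compat_iff ax _ _).2 ⟨k, lTest_add ax _ _ _ (lTest_perm ax ?_ hk)⟩)
    exact ((List.Perm.swap _ _ _).trans (List.Perm.cons _ (List.Perm.swap _ _ _)))
  have e₂ : D.add (D.add f g) h = D.ovee (D.add f g) h c₂ := dif_pos c₂
  have e₄ : D.add f (D.add g h) = D.ovee f (D.add g h) c₄ := dif_pos c₄
  rw [e₂, e₄]
  revert c₂ c₄ e₂ e₄
  rw [e₁, e₃]
  intro c₂ c₄ _ _
  exact ax.ovee_assoc f g h ((isPartialTest_fin_iff ax _).2 (by simpa [List.ofFn_succ] using t))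
    c₁ c₂ c₃ c₄

theorem lsum_append (ax : D.Axioms) {A B : E} (l₁ l₂ : List (A ⟶ B))
    (t : D.LPart ((l₁ ++ l₂).map ev)) : D.lsum (l₁ ++ l₂) = D.add (D.lsum l₁) (D.lsum l₂) := by
  induction l₁ with
  | nil => simp [lsum, zero_add ax]
  | cons a l₁ ih =>
    simp only [List.cons_append, lsum]
    rw [ih (LPart.of_append ax (l := [ev a]) t), add_assoc ax]
    have h₁ : D.LPart (ev (D.lsum l₁) :: (l₂.map ev ++ [ev a])) := by
      refine lPart_merge ax l₁ _ (lPart_perm ax ?_ t)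
      simp only [List.cons_append, List.map_cons, List.map_append]
      rw [← List.append_assoc]
      exact (List.perm_append_comm (l₁ := [_]))
    have h₂ : D.LPart (ev (D.lsum l₂) :: [ev a, ev (D.lsum l₁)]) := by
      refine lPart_merge ax l₂ _ (lPart_perm ax ?_ h₁)
      have : (l₂.map ev ++ [ev a, ev (D.lsum l₁)]) = (l₂.map ev ++ [ev a]) ++ [ev (D.lsum l₁)] := by
        simp
      rw [this]
      exact (List.perm_append_comm (l₁ := [_]))
    refine lPart_perm ax ?_ h₂
    exact ((List.Perm.swap _ _ _).trans (List.Perm.cons _ (List.Perm.swap _ _ _)))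

theorem lsum_perm (ax : D.Axioms) {A B : E} {l₁ l₂ : List (A ⟶ B)} (p : l₁.Perm l₂)
    (t : D.LPart (l₁.map ev)) : D.lsum l₁ = D.lsum l₂ := by
  induction p with
  | nil => rfl
  | cons x _ ih =>
    simp only [lsum]
    rw [ih (LPart.of_append ax (l := [ev x]) t)]
  | swap x y l =>
    have h : D.LPart (ev (D.lsum l) :: [ev x, ev y]) := by
      refine lPart_merge ax l _ (lPart_perm ax ?_ t)
      refine (List.Perm.swap _ _ _).trans ?_
      exact (List.perm_append_comm (l₁ := [_, _]))
    have h' : D.LPart [ev x, ev y, ev (D.lsum l)] :=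
      lPart_perm ax (List.perm_append_comm (l₁ := [_])) h
    simp only [lsum]
    rw [← add_assoc ax _ _ _ h', ← add_assoc ax _ _ _ (lPart_perm ax (List.Perm.swap _ _ _) h'),
      add_comm ax x y]
  | trans p₁ _ ih₁ ih₂ => rw [ih₁ t, ih₂ (lPart_perm ax (p₁.map _) t)]

theorem lsum_flatMap (ax : D.Axioms) {A B : E} {Z : Type*} (g : Z → List (A ⟶ B)) (zs : List Z)
    (t : D.LPart ((zs.flatMap g).map ev)) :
    D.lsum (zs.flatMap g) = D.lsum (zs.map (fun z => D.lsum (g z))) := by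
  induction zs with
  | nil => rfl
  | cons z zs ih =>
    rw [List.flatMap_cons] at t ⊢
    rw [lsum_append ax _ _ t, ih (LPart.of_append ax (by simpa only [List.map_append] using t))]
    rfl

theorem lTest_flatMap (ax : D.Axioms) {A : E} {Z : Type*} {B : Z → E} (g : ∀ z, List (A ⟶ B z))
    (zs : List Z) : ∀ l : List (Out A), D.LTest (zs.flatMap (fun z => (g z).map ev) ++ l) →
      D.LTest (zs.map (fun z => ev (D.lsum (g z))) ++ l) := by
  induction zs with
  | nil => exact fun l t => t
  | cons z zs ih =>
    intro l t
    rw [List.flatMap_cons, List.append_assoc] at t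
    have h := lTest_merge ax _ _ t
    have h' := ih (ev (D.lsum (g z)) :: l) (lTest_perm ax List.perm_middle.symm h)
    exact lTest_perm ax List.perm_middle h'

theorem isPartialTest_of_isTest (ax : D.Axioms) {X : Type} [Finite X] {A : E} {f : X → Out A}
    (t : D.IsTest f) : D.IsPartialTest f :=
  (isPartialTest_iff ax f).2 ⟨[], by simpa using (isTest_iff_enum ax f).1 t⟩

theorem lPart_of_nodup (ax : D.Axioms) {X : Type} [Finite X] {A : E} {f : X → Out A}
    (t : D.IsPartialTest f) (l : List X) (hl : l.Nodup) : D.LPart (l.map f) := by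
  obtain ⟨k, hk⟩ := (isPartialTest_iff ax f).1 t
  have hs : l.Subperm (enum X) := List.subperm_of_subset hl (fun x _ => mem_enum x)
  obtain ⟨m, hm, hs⟩ := hs
  obtain ⟨l', hl'⟩ := hs.exists_perm_append
  replace hl' := hl'.trans (hm.append_right l')
  refine ⟨l'.map f ++ k, lTest_perm ax ?_ hk⟩
  rw [← List.append_assoc, ← List.map_append]
  exact (hl'.map f).append_right k

theorem isPartialTest_comp_inj (ax : D.Axioms) {X Z : Type} [Finite X] [Finite Z] {A : E}
    {f : X → Out A} (t : D.IsPartialTest f) (e : Z → X) (he : Function.Injective e) :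
    D.IsPartialTest (f ∘ e) := by
  rw [isPartialTest_iff ax, ← List.map_map]
  exact lPart_of_nodup ax t _ ((enum_nodup Z).map he)

theorem isPartialTest_control (ax : D.Axioms) {X : Type} [Finite X] {Y : X → Type}
    [∀ x, Finite (Y x)] {A : E} (f : X → Out A) (g : ∀ x, Y x → Out (f x).1)
    (tf : D.IsPartialTest f) (tg : ∀ x, D.IsPartialTest (g x)) :
    D.IsPartialTest (fun p : (Σ x, Y x) => ev ((f p.1).2 ≫ (g p.1 p.2).2)) := by
  obtain ⟨X', _, f', t'⟩ := tf
  choose Y' hY' g' tg' using tg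
  let Z : X ⊕ X' → Type := Sum.elim (fun x => Y x ⊕ Y' x) (fun _ => Fin 1)
  have : ∀ s, Finite (Z s) := by
    rintro (x | x')
    · exact inferInstanceAs (Finite (Y x ⊕ Y' x))
    · exact inferInstanceAs (Finite (Fin 1))
  let k : ∀ s, Z s → Out (Sum.elim f f' s).1 := fun s =>
    match s with
    | .inl x => Sum.elim (g x) (g' x)
    | .inr x' => ![ev (𝟙 _)]
  have h := ax.control (Sum.elim f f') k t' (by
    rintro (x | x')
    · exact tg' x
    · exact ax.id_det _)
  let e : (Σ x, Y x) → (Σ s, Z s) := fun p => ⟨.inl p.1, (Sum.inl p.2 : Y p.1 ⊕ Y' p.1)⟩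
  have he : Function.Injective e := by
    rintro ⟨x, y⟩ ⟨x', y'⟩ hh
    obtain rfl : x = x' := Sum.inl_injective (congrArg Sigma.fst hh)
    have := eq_of_heq (Sigma.mk.inj hh).2
    exact congrArg (Sigma.mk x) (Sum.inl_injective (α := Y x) (β := Y' x) this)
  exact isPartialTest_comp_inj ax (isPartialTest_of_isTest ax h) e he

theorem lPart_comp (ax : D.Axioms) {A B : E} (k : A ⟶ B) (l : List (Out B)) (t : D.LPart l) :
    D.LPart (l.map fun g => ev (k ≫ g.2)) := by
  have h₁ := ax.mem_test k
  have h₂ : D.IsPartialTest l.get := by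
    rw [isPartialTest_fin_iff ax, List.ofFn_get]
    exact t
  have h := isPartialTest_control ax ![ev k] (Y := fun _ => Fin l.length)
    (fun i => match i with | 0 => l.get) h₁ (by
      intro i
      match i with
      | 0 => exact h₂)
  have := lPart_of_nodup ax h ((List.finRange l.length).map (fun i => ⟨0, i⟩))
    ((List.nodup_finRange _).map (fun i j hij => by simpa using hij))
  rw [List.map_map] at this
  have e : l.map (fun g => ev (k ≫ g.2)) =
      (List.finRange l.length).map (fun i => ev (k ≫ (l.get i).2)) := by
    rw [← List.ofFn_eq_map]
    conv_lhs => rw [← List.ofFn_get l]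
    rw [List.map_ofFn]
    rfl
  rw [e]
  exact this

theorem lPart_map_comp (ax : D.Axioms) {A B C : E} (k : B ⟶ C) (l : List (A ⟶ B))
    (t : D.LPart (l.map ev)) : D.LPart ((l.map (· ≫ k)).map ev) := by
  have h₂ : D.IsPartialTest (fun i => ev (l.get i)) := by
    rw [isPartialTest_fin_iff ax]
    convert t using 1
    conv_rhs => rw [← List.ofFn_get l]
    rw [List.map_ofFn]
    rfl
  have h := isPartialTest_control ax (fun i => ev (l.get i)) (Y := fun _ => Fin 1)
    (fun i => ![ev k]) h₂ (fun i => ax.mem_test k)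
  have := lPart_of_nodup ax h ((List.finRange l.length).map (fun i => ⟨i, 0⟩))
    ((List.nodup_finRange _).map (fun i j hij => by simpa using hij))
  rw [List.map_map] at this
  have e : (l.map (· ≫ k)).map ev =
      (List.finRange l.length).map (fun i => ev (l.get i ≫ k)) := by
    rw [← List.ofFn_eq_map]
    conv_lhs => rw [← List.ofFn_get l]
    rw [List.map_ofFn, List.map_ofFn]
    rfl
  rw [e]
  exact this

theorem comp_add (ax : D.Axioms) {A B C : E} (k : A ⟶ B) (g h : B ⟶ C) (c : D.Compat g h) :
    k ≫ D.add g h = D.add (k ≫ g) (k ≫ h) := by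
  have c' : D.Compat (k ≫ g) (k ≫ h) :=
    (compat_iff ax _ _).2 (by simpa using lPart_comp ax k _ ((compat_iff ax _ _).1 c))
  rw [add, add, dif_pos c, dif_pos c', ax.comp_ovee]

theorem add_comp (ax : D.Axioms) {B C F : E} (g h : B ⟶ C) (c : D.Compat g h) (f : C ⟶ F) :
    D.add g h ≫ f = D.add (g ≫ f) (h ≫ f) := by
  have c' : D.Compat (g ≫ f) (h ≫ f) :=
    (compat_iff ax _ _).2 (by
      simpa using lPart_map_comp ax f [g, h] (by simpa using (compat_iff ax _ _).1 c))
  rw [add, add, dif_pos c, dif_pos c', ax.ovee_comp]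

theorem compat_cons (ax : D.Axioms) {A B : E} (a : A ⟶ B) (l : List (A ⟶ B))
    (t : D.LPart ((a :: l).map ev)) : D.Compat a (D.lsum l) := by
  refine compat_symm ax ((compat_iff ax _ _).2 (lPart_merge ax l _ (lPart_perm ax ?_ t)))
  exact List.perm_append_comm (l₁ := [_])

theorem comp_lsum (ax : D.Axioms) {A B C : E} (k : A ⟶ B) (l : List (B ⟶ C))
    (t : D.LPart (l.map ev)) : k ≫ D.lsum l = D.lsum (l.map (k ≫ ·)) := by
  induction l with
  | nil => exact ax.comp_zero k
  | cons a l ih =>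
    simp only [lsum, List.map_cons]
    rw [comp_add ax _ _ _ (compat_cons ax a l t), ih (LPart.of_append ax (l := [ev a]) t)]

theorem lsum_comp (ax : D.Axioms) {A B C : E} (k : B ⟶ C) (l : List (A ⟶ B))
    (t : D.LPart (l.map ev)) : D.lsum l ≫ k = D.lsum (l.map (· ≫ k)) := by
  induction l with
  | nil => exact ax.zero_comp k
  | cons a l ih =>
    simp only [lsum, List.map_cons]
    rw [add_comp ax _ _ (compat_cons ax a l t), ih (LPart.of_append ax (l := [ev a]) t)]

theorem lsum_eq_single (ax : D.Axioms) {X : Type} {A B : E} (f : X → (A ⟶ B)) (x₀ : X)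
    (h : ∀ x, x ≠ x₀ → f x = D.zero A B) (l : List X) (hl : l.Nodup) :
    (x₀ ∈ l → D.lsum (l.map f) = f x₀) ∧ (x₀ ∉ l → D.lsum (l.map f) = D.zero A B) := by
  induction l with
  | nil => exact ⟨fun h => by simp at h, fun _ => rfl⟩
  | cons a l ih =>
    rw [List.nodup_cons] at hl
    obtain ⟨i₁, i₂⟩ := ih hl.2
    simp only [List.map_cons, lsum]
    by_cases e : a = x₀
    · subst e
      refine ⟨fun _ => ?_, fun hh => by simp at hh⟩
      rw [i₂ hl.1, add_zero ax]
    · rw [h a e, zero_add ax]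
      refine ⟨fun hh => i₁ ?_, fun hh => i₂ ?_⟩
      · rcases List.mem_cons.1 hh with rfl | hh
        · exact absurd rfl e
        · exact hh
      · exact fun hh' => hh (List.mem_cons_of_mem _ hh')

/-! ### Coarse-graining of finite collections -/

theorem lPart_enum (ax : D.Axioms) {X : Type} [Finite X] {A B : E} (f : X → (A ⟶ B))
    (t : D.IsPartialTest (fun x => ev (f x))) : D.LPart (((enum X).map f).map ev) := by
  have := (isPartialTest_iff ax _).1 t
  rwa [List.map_map]

theorem bigOvee_eq_single (ax : D.Axioms) {X : Type} [Finite X] {A B : E} (f : X → (A ⟶ B))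
    (x₀ : X) (h : ∀ x, x ≠ x₀ → f x = D.zero A B) : D.bigOvee f = f x₀ :=
  (lsum_eq_single ax f x₀ h _ (enum_nodup X)).1 (mem_enum x₀)

theorem comp_bigOvee (ax : D.Axioms) {X : Type} [Finite X] {A B C : E} (k : A ⟶ B)
    (f : X → (B ⟶ C)) (t : D.IsPartialTest (fun x => ev (f x))) :
    k ≫ D.bigOvee f = D.bigOvee (fun x => k ≫ f x) := by
  unfold bigOvee
  rw [comp_lsum ax _ _ (lPart_enum ax f t), List.map_map]
  rfl

theorem bigOvee_comp (ax : D.Axioms) {X : Type} [Finite X] {A B C : E} (k : B ⟶ C)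
    (f : X → (A ⟶ B)) (t : D.IsPartialTest (fun x => ev (f x))) :
    D.bigOvee f ≫ k = D.bigOvee (fun x => f x ≫ k) := by
  unfold bigOvee
  rw [lsum_comp ax _ _ (lPart_enum ax f t), List.map_map]
  rfl

theorem bigOvee_bigOvee (ax : D.Axioms) {X Y : Type} [Finite X] [Finite Y] {A B : E}
    (f : X → Y → (A ⟶ B)) (t : D.IsPartialTest (fun p : X × Y => ev (f p.1 p.2))) :
    D.bigOvee (fun x => D.bigOvee (fun y => f x y)) =
      D.bigOvee (fun p : X × Y => f p.1 p.2) := by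
  have e : (enum X).flatMap (fun x => (enum Y).map (f x)) =
      ((enum X) ×ˢ (enum Y)).map (fun p : X × Y => f p.1 p.2) := by
    change _ = List.map _ (List.flatMap _ _)
    rw [List.map_flatMap]
    simp [List.map_map, Function.comp_def]
  have hn : ((enum X) ×ˢ (enum Y)).Nodup := (enum_nodup X).product (enum_nodup Y)
  have hp := lPart_of_nodup ax t _ hn
  unfold bigOvee
  rw [← lsum_flatMap ax (fun x => (enum Y).map (f x)), e]
  · refine lsum_perm ax (List.Perm.map _ ?_) (by rwa [List.map_map])
    refine (List.perm_ext_iff_of_nodup hn (enum_nodup _)).2 ?_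
    rintro ⟨x, y⟩
    simp [mem_enum, List.mem_product]
  · rw [e, List.map_map]
    exact hp

theorem bigOvee_comm (ax : D.Axioms) {X Y : Type} [Finite X] [Finite Y] {A B : E}
    (f : X → Y → (A ⟶ B)) (t : D.IsPartialTest (fun p : X × Y => ev (f p.1 p.2))) :
    D.bigOvee (fun x => D.bigOvee (fun y => f x y)) =
      D.bigOvee (fun y => D.bigOvee (fun x => f x y)) := by
  have t' : D.IsPartialTest (fun p : Y × X => ev (f p.2 p.1)) :=
    isPartialTest_comp_inj ax t Prod.swap Prod.swap_injective
  rw [bigOvee_bigOvee ax f t, bigOvee_bigOvee ax (fun y x => f x y) t']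
  unfold bigOvee
  have : ((enum (Y × X)).map (fun p : Y × X => f p.2 p.1)) =
      ((enum (Y × X)).map Prod.swap).map (fun p : X × Y => f p.1 p.2) := by
    rw [List.map_map]
    rfl
  rw [this]
  refine lsum_perm ax (List.Perm.map _ ?_) (lPart_enum ax _ t)
  refine (List.perm_ext_iff_of_nodup (enum_nodup _)
    ((enum_nodup _).map Prod.swap_injective)).2 ?_
  rintro ⟨x, y⟩
  simp [mem_enum]

/-- Coarse-graining several groups of outcomes of a test. -/
theorem isTest_bigOvee (ax : D.Axioms) {Y Z : Type} [Finite Y] [Finite Z] {A : E} {B : Z → E}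
    (f : ∀ z, Y → (A ⟶ B z)) (t : D.IsTest (fun p : Z × Y => ev (f p.1 p.2))) :
    D.IsTest (fun z => ev (D.bigOvee (f z))) := by
  rw [isTest_iff_enum ax]
  have h := (isTest_iff ax _ _ ((enum_nodup Z).product (enum_nodup Y))
    (fun p => List.mem_product.2 ⟨mem_enum p.1, mem_enum p.2⟩)).1 t
  have := lTest_flatMap ax (fun z => (enum Y).map (f z)) (enum Z) [] (by
    rw [List.append_nil]
    convert h using 1
    change _ = List.map _ (List.flatMap _ _)
    rw [List.map_flatMap]
    simp [List.map_map, Function.comp_def])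
  rwa [List.append_nil] at this

/-! ### Deterministic events, discarding and complements -/

theorem isDet_iff (ax : D.Axioms) {A B : E} (f : A ⟶ B) : D.IsDet f ↔ D.LTest [ev f] := by
  unfold TestSpec.IsDet
  rw [isTest_fin_iff ax]
  simp [List.ofFn_succ]

theorem isTest_pair_iff (ax : D.Axioms) {A B C : E} (f : A ⟶ B) (g : A ⟶ C) :
    D.IsTest ![ev f, ev g] ↔ D.LTest [ev f, ev g] := by
  rw [isTest_fin_iff ax]
  simp [List.ofFn_succ]

theorem isTest_comp_det (ax : D.Axioms) {X : Type} [Finite X] {A : E} {B C : X → E}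
    (f : ∀ x, A ⟶ B x) (g : ∀ x, B x ⟶ C x) (t : D.IsTest (fun x => ev (f x)))
    (d : ∀ x, D.IsDet (g x)) : D.IsTest (fun x => ev (f x ≫ g x)) := by
  have h := ax.control (fun x => ev (f x)) (Y := fun _ => Fin 1) (fun x => ![ev (g x)]) t d
  let e : X ≃ (Σ _ : X, Fin 1) :=
    { toFun := fun x => ⟨x, 0⟩
      invFun := fun p => p.1
      left_inv := fun x => rfl
      right_inv := by
        rintro ⟨x, i⟩
        rw [Subsingleton.elim i 0] }
  exact ax.reindex e _ h

theorem isDet_comp (ax : D.Axioms) {A B C : E} {f : A ⟶ B} {g : B ⟶ C} (hf : D.IsDet f)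
    (hg : D.IsDet g) : D.IsDet (f ≫ g) := by
  have h := isTest_comp_det ax (X := Fin 1) (fun _ => f) (fun _ => g) (by
    have e : (fun _ : Fin 1 => ev f) = ![ev f] := by
      funext i
      rw [Subsingleton.elim i 0]
      rfl
    rw [e]
    exact hf) (fun _ => hg)
  unfold TestSpec.IsDet
  convert h using 1
  funext i
  rw [Subsingleton.elim i 0]
  rfl

theorem existsUnique_det (ax : D.Axioms) (A : E) : ∃! e : A ⟶ I, D.IsDet e := by
  obtain ⟨e, he, hu⟩ := ax.compl (D.zero A I)
  have key : ∀ e' : A ⟶ I, D.IsTest ![ev (D.zero A I), ev e'] ↔ D.IsDet e' := by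
    intro e'
    rw [isTest_pair_iff ax, isDet_iff ax, ← lTest_zero_iff ax]
  exact ⟨e, (key e).1 he, fun e' h => hu e' ((key e').2 h)⟩

/-- Discarding: the unique deterministic effect on a system. -/
def disc (ax : D.Axioms) (A : E) : A ⟶ I := (existsUnique_det ax A).choose

theorem isDet_disc (ax : D.Axioms) (A : E) : D.IsDet (disc ax A) :=
  (existsUnique_det ax A).choose_spec.1

theorem eq_disc (ax : D.Axioms) {A : E} {e : A ⟶ I} (h : D.IsDet e) : e = disc ax A :=
  (existsUnique_det ax A).choose_spec.2 e h

/-- The complement `eᗮ` of an effect `e`. -/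
def perp (ax : D.Axioms) {A : E} (e : A ⟶ I) : A ⟶ I := (ax.compl e).choose

theorem isDet_of_comp_disc (ax : D.Axioms) {A B : E} {f : A ⟶ B}
    (h : D.IsDet (f ≫ disc ax B)) : D.IsDet f := by
  obtain ⟨Y, _, g, t⟩ := ax.mem_test f
  let C : Fin 1 ⊕ Y → E := Sum.elim (fun _ => B) (fun _ => I)
  let k : ∀ s : Fin 1 ⊕ Y, (Sum.elim ![ev f] g s).1 ⟶ C s := fun s =>
    match s with
    | .inl 0 => 𝟙 B
    | .inr y => disc ax (g y).1
  have h₁ := isTest_comp_det ax (fun s => (Sum.elim ![ev f] g s).2) k t (by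
    rintro (i | y)
    · match i with
      | 0 => exact ax.id_det B
    · exact isDet_disc ax _)
  have e₁ : (fun s => ev ((Sum.elim ![ev f] g s).2 ≫ k s)) =
      Sum.elim ![ev f] (fun y => ev ((g y).2 ≫ disc ax (g y).1)) := by
    funext s
    rcases s with i | y
    · match i with
      | 0 => simp [k, C]
    · rfl
  rw [e₁, isTest_sum_iff ax _ _ (List.finRange 1) (List.nodup_finRange 1) List.mem_finRange
    _ (enum_nodup Y) mem_enum, ← List.ofFn_eq_map] at h₁
  let e : A ⟶ I := D.bigOvee (fun y => (g y).2 ≫ disc ax (g y).1)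
  have h₂ : D.LTest (ev e :: [ev f]) := by
    refine lTest_merge ax _ _ (lTest_perm ax ?_ h₁)
    rw [List.map_map]
    simp only [List.ofFn_succ, List.ofFn_zero, Matrix.cons_val_zero]
    exact List.perm_append_comm (l₁ := [_])
  have h₃ : D.IsTest ![ev (f ≫ disc ax B), ev e] := by
    have h₄ := (isTest_pair_iff ax f e).2 (lTest_perm ax (List.Perm.swap _ _ _) h₂)
    let C' : Fin 2 → E := fun _ => I
    let k' : ∀ i : Fin 2, (![ev f, ev e] i).1 ⟶ C' i := fun i =>
      match i with
      | 0 => disc ax B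
      | 1 => 𝟙 I
    have h₅ := isTest_comp_det ax (fun i => (![ev f, ev e] i).2) k' h₄ (by
      intro i
      match i with
      | 0 => exact isDet_disc ax B
      | 1 => exact ax.id_det I)
    convert h₅ using 1
    funext i
    match i with
    | 0 => rfl
    | 1 => simp [k', C']
  have h₆ : D.IsTest ![ev (f ≫ disc ax B), ev (D.zero A I)] :=
    (isTest_pair_iff ax _ _).2 (lTest_perm ax (List.Perm.swap _ _ _)
      ((lTest_zero_iff ax I _).1 ((isDet_iff ax _).1 h)))
  have h₇ : e = D.zero A I := (ax.compl (f ≫ disc ax B)).unique h₃ h₆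
  rw [h₇, ← lTest_zero_iff ax] at h₂
  exact (isDet_iff ax f).2 h₂

/-! ### Positivity and combining -/

/-- Positivity: whenever `{f_x}` and `{f_x} ∪ {g_y}` both form tests, each `g_y` is impossible. -/
def IsPositive (D : OTCData E I) : Prop :=
  ∀ {X Y : Type} [Finite X] [Finite Y] {A : E} (f : X → Out A) (g : Y → Out A),
    D.IsTest f → D.IsTest (Sum.elim f g) → ∀ y, (g y).2 = D.zero A (g y).1

/-- Combining: any partial tests `{f_x}` and `{g_y}` on the same system for which the
coarse-grainings of the effects `disc ∘ f_x` and of the effects `disc ∘ g_y` are complementary form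
a test `{f_x} ∪ {g_y}`. -/
def IsCombining (ax : D.Axioms) : Prop :=
  ∀ {X Y : Type} [Finite X] [Finite Y] {A : E} (f : X → Out A) (g : Y → Out A),
    D.IsPartialTest f → D.IsPartialTest g →
    D.bigOvee (fun x => (f x).2 ≫ disc ax (f x).1) =
      perp ax (D.bigOvee (fun y => (g y).2 ≫ disc ax (g y).1)) →
    D.IsTest (Sum.elim f g)

/-! ### Morphisms of operational theories -/

/-- The conditions on a functor between categories of events to be a morphism of operational
theories: it preserves tests, coarse-graining and the trivial system. -/
structure IsMorphism {E : Type u} [Category.{v} E] {I : E}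
    {E' : Type u} [Category.{v} E'] {I' : E'} {D' : OTCData E' I'} (ax' : D'.Axioms)
    (D : OTCData E I) (F : E ⥤ E') : Prop where
  map_test : ∀ {X : Type} [Finite X] {A : E} (f : X → Out A), D.IsTest f →
    D'.IsTest (fun x => ev (F.map (f x).2))
  map_ovee : ∀ {A B : E} (f g : A ⟶ B) (c : D.Compat f g) (c' : D'.Compat (F.map f) (F.map g)),
    F.map (D.ovee f g c) = D'.ovee (F.map f) (F.map g) c'
  isIso_disc : IsIso (disc ax' (F.obj I))

section

variable {E₁ : Type u} [Category.{v} E₁] {I₁ : E₁} {D₁ : OTCData E₁ I₁}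
  {E₂ : Type u} [Category.{v} E₂] {I₂ : E₂} {D₂ : OTCData E₂ I₂}
  {E₃ : Type u} [Category.{v} E₃] {I₃ : E₃} {D₃ : OTCData E₃ I₃}

theorem IsMorphism.map_det {ax₂ : D₂.Axioms} {F : E₁ ⥤ E₂} (h : IsMorphism ax₂ D₁ F) {A B : E₁}
    {f : A ⟶ B} (hf : D₁.IsDet f) : D₂.IsDet (F.map f) := by
  have := h.map_test _ hf
  unfold TestSpec.IsDet
  convert this using 1
  funext i
  rw [Subsingleton.elim i 0]
  rfl

theorem IsMorphism.disc_obj {ax₂ : D₂.Axioms} {F : E₁ ⥤ E₂} (h : IsMorphism ax₂ D₁ F)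
    (ax₁ : D₁.Axioms) (A : E₁) :
    F.map (disc ax₁ A) ≫ disc ax₂ (F.obj I₁) = disc ax₂ (F.obj A) :=
  eq_disc ax₂ (isDet_comp ax₂ (h.map_det (isDet_disc ax₁ A)) (isDet_disc ax₂ _))

theorem disc_I (ax : D.Axioms) : disc ax I = 𝟙 I := (eq_disc ax (ax.id_det I)).symm

theorem IsMorphism.id (ax : D.Axioms) : IsMorphism ax D (𝟭 E) where
  map_test _ t := t
  map_ovee _ _ _ _ := rfl
  isIso_disc := by
    change IsIso (disc ax I)
    rw [disc_I]
    infer_instance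

theorem IsMorphism.map_compat {ax₂ : D₂.Axioms} {F : E₁ ⥤ E₂} (h : IsMorphism ax₂ D₁ F)
    {A B : E₁} {f g : A ⟶ B} (c : D₁.Compat f g) : D₂.Compat (F.map f) (F.map g) := by
  obtain ⟨Y, _, k, t⟩ := c
  refine ⟨Y, inferInstance, fun y => ev (F.map (k y).2), ?_⟩
  convert h.map_test _ t using 1
  funext s
  rcases s with i | y
  · match i with
    | 0 => rfl
    | 1 => rfl
  · rfl

theorem IsMorphism.comp {ax₂ : D₂.Axioms} {ax₃ : D₃.Axioms} {F : E₁ ⥤ E₂} {G : E₂ ⥤ E₃}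
    (h : IsMorphism ax₂ D₁ F) (h' : IsMorphism ax₃ D₂ G) : IsMorphism ax₃ D₁ (F ⋙ G) where
  map_test f t := h'.map_test _ (h.map_test f t)
  map_ovee f g c c' := by
    have c₂ := h.map_compat c
    change G.map (F.map _) = _
    rw [h.map_ovee f g c c₂, h'.map_ovee _ _ c₂ c']
    rfl
  isIso_disc := by
    have := h.isIso_disc
    have := h'.isIso_disc
    change IsIso (disc ax₃ (G.obj (F.obj I₁)))
    rw [← h'.disc_obj ax₂]
    infer_instance

theorem IsMorphism.map_zero {ax₂ : D₂.Axioms} {F : E₁ ⥤ E₂} (h : IsMorphism ax₂ D₁ F)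
    (ax₁ : D₁.Axioms) (A B : E₁) : F.map (D₁.zero A B) = D₂.zero (F.obj A) (F.obj B) := by
  have := h.isIso_disc
  have key : F.map (D₁.zero A I₁) = D₂.zero _ _ := by
    rw [← cancel_mono (disc ax₂ (F.obj I₁)), ax₂.zero_comp]
    have t₁ : D₁.IsTest ![ev (disc ax₁ A), ev (D₁.zero A I₁)] :=
      (isTest_pair_iff ax₁ _ _).2 (lTest_perm ax₁ (List.Perm.swap _ _ _)
        ((lTest_zero_iff ax₁ I₁ _).1 ((isDet_iff ax₁ _).1 (isDet_disc ax₁ A))))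
    have t₂ := isTest_comp_det ax₂ (fun i : Fin 2 => F.map (![ev (disc ax₁ A),
      ev (D₁.zero A I₁)] i).2) (C := fun _ => I₂) (fun i => disc ax₂ _) (h.map_test _ t₁)
      (fun i => isDet_disc ax₂ _)
    have t₃ : D₂.IsTest ![ev (disc ax₂ (F.obj A)), ev (F.map (D₁.zero A I₁) ≫ disc ax₂ _)] := by
      convert t₂ using 1
      funext i
      match i with
      | 0 =>
        simp only [Matrix.cons_val_zero]
        exact congrArg ev (h.disc_obj ax₁ A).symm
      | 1 => rfl
    have t₄ : D₂.IsTest ![ev (disc ax₂ (F.obj A)), ev (D₂.zero (F.obj A) I₂)] :=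
      (isTest_pair_iff ax₂ _ _).2 (lTest_perm ax₂ (List.Perm.swap _ _ _)
        ((lTest_zero_iff ax₂ I₂ _).1 ((isDet_iff ax₂ _).1 (isDet_disc ax₂ _))))
    exact (ax₂.compl _).unique t₃ t₄
  rw [← ax₁.zero_comp (D₁.zero I₁ B), F.map_comp, key, ax₂.zero_comp]

theorem IsMorphism.map_add {ax₂ : D₂.Axioms} {F : E₁ ⥤ E₂} (h : IsMorphism ax₂ D₁ F)
    {A B : E₁} (f g : A ⟶ B) (c : D₁.Compat f g) :
    F.map (D₁.add f g) = D₂.add (F.map f) (F.map g) := by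
  rw [add, add, dif_pos c, dif_pos (h.map_compat c), h.map_ovee]

theorem IsMorphism.map_bigOvee {ax₂ : D₂.Axioms} {F : E₁ ⥤ E₂} (h : IsMorphism ax₂ D₁ F)
    (ax₁ : D₁.Axioms) {X : Type} [Finite X] {A B : E₁} (f : X → (A ⟶ B))
    (t : D₁.IsPartialTest (fun x => ev (f x))) :
    F.map (D₁.bigOvee f) = D₂.bigOvee (fun x => F.map (f x)) := by
  have key : ∀ l : List (A ⟶ B), D₁.LPart (l.map ev) →
      F.map (D₁.lsum l) = D₂.lsum (l.map F.map) := by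
    intro l
    induction l with
    | nil => exact fun _ => h.map_zero ax₁ A B
    | cons a l ih =>
      intro t
      simp only [lsum, List.map_cons]
      rw [h.map_add _ _ (compat_cons ax₁ a l t), ih (LPart.of_append ax₁ (l := [ev a]) t)]
  unfold bigOvee
  rw [key _ (lPart_enum ax₁ f t), List.map_map]
  rfl

end

end OTCData

/-- An operational theory with control. -/
structure OTC where
  Sys : Type u
  [cat : Category.{v} Sys]
  I : Sys
  data : OTCData Sys I
  ax : data.Axioms

attribute [instance] OTC.cat

/-- A morphism of operational theories with control. -/
@[ext]
structure OTC.Hom (Θ Θ' : OTC.{v, u}) where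
  toFunctor : Θ.Sys ⥤ Θ'.Sys
  isMorphism : OTCData.IsMorphism Θ'.ax Θ.data toFunctor

instance : Category OTC.{v, u} where
  Hom := OTC.Hom
  id Θ := ⟨𝟭 _, OTCData.IsMorphism.id Θ.ax⟩
  comp F G := ⟨F.toFunctor ⋙ G.toFunctor, F.isMorphism.comp G.isMorphism⟩
  id_comp _ := rfl
  comp_id _ := rfl
  assoc _ _ _ := rfl

/-! ### Monoidal theories -/

open MonoidalCategory

/-- The further assumptions on a monoidal operational theory with control, whose trivial system is
the tensor unit. -/
structure OTCData.MonoidalAxioms {E : Type u} [Category.{v} E] [MonoidalCategory E]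
    (D : OTCData E (𝟙_ E)) : Prop where
  /-- Parallel tests. -/
  parallel : ∀ {X Y : Type} [Finite X] [Finite Y] {A C : E} (f : X → Out A) (g : Y → Out C),
    D.IsTest f → D.IsTest g → D.IsTest (fun p : X × Y => ev ((f p.1).2 ⊗ₘ (g p.2).2))
  tensor_ovee : ∀ {A B C F : E} (f : A ⟶ B) (g h : C ⟶ F) (c : D.Compat g h)
    (c' : D.Compat (f ⊗ₘ g) (f ⊗ₘ h)), f ⊗ₘ D.ovee g h c = D.ovee (f ⊗ₘ g) (f ⊗ₘ h) c'
  tensor_zero : ∀ {A B : E} (f : A ⟶ B) (C F : E), f ⊗ₘ D.zero C F = D.zero (A ⊗ C) (B ⊗ F)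
  unitor_det : D.IsDet (λ_ (𝟙_ E)).hom

/-- `F` is a strong symmetric monoidal functor with coherence morphisms `ε` and `μ`. -/
def IsSymmMonoidal {C D : Type u} [Category.{v} C] [MonoidalCategory C] [SymmetricCategory C]
    [Category.{v} D] [MonoidalCategory D] [SymmetricCategory D] (F : C ⥤ D)
    (ε : 𝟙_ D ⟶ F.obj (𝟙_ C)) (μ : ∀ X Y : C, F.obj X ⊗ F.obj Y ⟶ F.obj (X ⊗ Y)) : Prop :=
  ∃ b : F.Braided, b.ε = ε ∧ ∀ X Y, b.μ X Y = μ X Y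

/-- A monoidal operational theory with control. -/
structure MonOTC where
  Sys : Type u
  [cat : Category.{v} Sys]
  [mon : MonoidalCategory Sys]
  [symm : SymmetricCategory Sys]
  data : OTCData Sys (𝟙_ Sys)
  ax : data.Axioms
  monAx : data.MonoidalAxioms

attribute [instance] MonOTC.cat MonOTC.mon MonOTC.symm

/-- The underlying theory of a monoidal theory. -/
abbrev MonOTC.toOTC (Θ : MonOTC.{v, u}) : OTC.{v, u} := ⟨Θ.Sys, 𝟙_ Θ.Sys, Θ.data, Θ.ax⟩

/-- A morphism of monoidal operational theories with control: a strong symmetric monoidal functor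
which is a morphism of theories, and whose coherence isomorphism `I ⟶ F(I)` is the inverse of
discarding. -/
@[ext]
structure MonOTC.Hom (Θ Θ' : MonOTC.{v, u}) where
  toFunctor : Θ.Sys ⥤ Θ'.Sys
  μ : ∀ A B : Θ.Sys, toFunctor.obj A ⊗ toFunctor.obj B ⟶ toFunctor.obj (A ⊗ B)
  isMorphism : OTCData.IsMorphism Θ'.ax Θ.data toFunctor
  isSymmMonoidal : ∃ ε, IsSymmMonoidal toFunctor ε μ ∧
    ε ≫ OTCData.disc Θ'.ax (toFunctor.obj (𝟙_ Θ.Sys)) = 𝟙 (𝟙_ Θ'.Sys)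

theorem IsSymmMonoidal.id (C : Type u) [Category.{v} C] [MonoidalCategory C]
    [SymmetricCategory C] : IsSymmMonoidal (𝟭 C) (𝟙 _) (fun _ _ => 𝟙 _) :=
  ⟨inferInstance, rfl, fun _ _ => rfl⟩

theorem IsSymmMonoidal.comp {C D E : Type u} [Category.{v} C] [MonoidalCategory C]
    [SymmetricCategory C] [Category.{v} D] [MonoidalCategory D] [SymmetricCategory D]
    [Category.{v} E] [MonoidalCategory E] [SymmetricCategory E] {F : C ⥤ D} {G : D ⥤ E}
    {ε : 𝟙_ D ⟶ F.obj (𝟙_ C)} {μ : ∀ X Y : C, F.obj X ⊗ F.obj Y ⟶ F.obj (X ⊗ Y)}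
    {ε' : 𝟙_ E ⟶ G.obj (𝟙_ D)} {μ' : ∀ X Y : D, G.obj X ⊗ G.obj Y ⟶ G.obj (X ⊗ Y)}
    (h : IsSymmMonoidal F ε μ) (h' : IsSymmMonoidal G ε' μ') :
    IsSymmMonoidal (F ⋙ G) (ε' ≫ G.map ε) (fun X Y => μ' _ _ ≫ G.map (μ X Y)) := by
  obtain ⟨b, rfl, hμ⟩ := h
  obtain ⟨b', rfl, hμ'⟩ := h'
  refine ⟨inferInstance, rfl, fun X Y => ?_⟩
  change _ = μ' _ _ ≫ G.map (μ X Y)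
  rw [← hμ, ← hμ']
  rfl

instance : Category MonOTC.{v, u} where
  Hom := MonOTC.Hom
  id Θ := ⟨𝟭 _, fun _ _ => 𝟙 _, OTCData.IsMorphism.id Θ.ax, 𝟙 _, IsSymmMonoidal.id Θ.Sys, by
    rw [Category.id_comp]
    exact OTCData.disc_I Θ.ax⟩
  comp {Θ₁ Θ₂ Θ₃} F G := ⟨F.toFunctor ⋙ G.toFunctor,
    fun A B => G.μ _ _ ≫ G.toFunctor.map (F.μ A B), F.isMorphism.comp G.isMorphism, by
      obtain ⟨ε, h, e⟩ := F.isSymmMonoidal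
      obtain ⟨ε', h', e'⟩ := G.isSymmMonoidal
      refine ⟨_, h.comp h', ?_⟩
      simp only [Functor.comp_obj]
      rw [← G.isMorphism.disc_obj Θ₂.ax, Category.assoc, ← Functor.map_comp_assoc, e,
        CategoryTheory.Functor.map_id, Category.id_comp, e']⟩
  id_comp F := MonOTC.Hom.ext rfl (heq_of_eq (by funext A B; simp))
  comp_id F := MonOTC.Hom.ext rfl (heq_of_eq (by funext A B; simp))
  assoc F G H := MonOTC.Hom.ext rfl (heq_of_eq (by funext A B; simp))

/-! ## Operational categories -/

/-- Specified finite coproducts `(+, 0)` on a category. -/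
class SpecCoproducts (C : Type u) [Category.{v} C] where
  zero : C
  isInitial : IsInitial zero
  sum : C → C → C
  inl : ∀ A B : C, A ⟶ sum A B
  inr : ∀ A B : C, B ⟶ sum A B
  isColimit : ∀ A B : C, IsColimit (BinaryCofan.mk (inl A B) (inr A B))

namespace SpecCoproducts

variable {C : Type u} [Category.{v} C] [SpecCoproducts C]

/-- The copairing `[f, g]`. -/
def desc {A B X : C} (f : A ⟶ X) (g : B ⟶ X) : sum A B ⟶ X :=
  (isColimit A B).desc (BinaryCofan.mk f g)

@[simp]
theorem inl_desc {A B X : C} (f : A ⟶ X) (g : B ⟶ X) : inl A B ≫ desc f g = f :=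
  (isColimit A B).fac (BinaryCofan.mk f g) ⟨WalkingPair.left⟩

@[simp]
theorem inr_desc {A B X : C} (f : A ⟶ X) (g : B ⟶ X) : inr A B ≫ desc f g = g :=
  (isColimit A B).fac (BinaryCofan.mk f g) ⟨WalkingPair.right⟩

@[simp]
theorem inl_desc_assoc {A B X Y : C} (f : A ⟶ X) (g : B ⟶ X) (h : X ⟶ Y) :
    inl A B ≫ desc f g ≫ h = f ≫ h := by
  rw [← Category.assoc, inl_desc]

@[simp]
theorem inr_desc_assoc {A B X Y : C} (f : A ⟶ X) (g : B ⟶ X) (h : X ⟶ Y) :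
    inr A B ≫ desc f g ≫ h = g ≫ h := by
  rw [← Category.assoc, inr_desc]

theorem hom_ext {A B X : C} {f g : sum A B ⟶ X} (h₁ : inl A B ≫ f = inl A B ≫ g)
    (h₂ : inr A B ≫ f = inr A B ≫ g) : f = g :=
  BinaryCofan.IsColimit.hom_ext (isColimit A B) h₁ h₂

/-- The arrow `f + g`. -/
def sumMap {A B X Y : C} (f : A ⟶ X) (g : B ⟶ Y) : sum A B ⟶ sum X Y :=
  desc (f ≫ inl X Y) (g ≫ inr X Y)

end SpecCoproducts

open SpecCoproducts

section

variable {C : Type u} [Category.{v} C] [SpecCoproducts C] {one : C} (T : IsTerminal one)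

/-- The conditions on a category with specified finite coproducts and a terminal object `one` to be
an operational category. -/
structure IsOperational : Prop where
  /-- The arrows `[▷₁, κ₂]` and `[▷₂, κ₂]` from `(A + A) + 1` to `A + 1` are jointly monic, where
  `▷₁ = [κ₁, κ₂ ∘ !]` and `▷₂ = [κ₂ ∘ !, κ₁]`. -/
  jointly_monic : ∀ {A X : C} (f g : X ⟶ sum (sum A A) one),
    f ≫ desc (desc (inl A one) (T.from A ≫ inr A one)) (inr A one) =
      g ≫ desc (desc (inl A one) (T.from A ≫ inr A one)) (inr A one) →
    f ≫ desc (desc (T.from A ≫ inr A one) (inl A one)) (inr A one) =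
      g ≫ desc (desc (T.from A ≫ inr A one) (inl A one)) (inr A one) → f = g
  isPullback : ∀ A : C,
    IsPullback (T.from A) (inl A one) (inl one one) (sumMap (T.from A) (T.from one))

/-- The further conditions on an operational category to be an effectus: it is positive, and the
squares formed by `!` and identities are pullbacks. -/
structure IsEffectus : Prop where
  positive : ∀ A B : C,
    IsPullback (T.from A) (inl A B) (inl one one) (sumMap (T.from A) (T.from B))
  isPullback : ∀ A B : C,
    IsPullback (sumMap (T.from A) (𝟙 B)) (sumMap (𝟙 A) (T.from B))
      (sumMap (T.from one) (T.from B)) (sumMap (T.from A) (T.from one))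

end

/-- The conditions on a symmetric monoidal category with specified finite coproducts, whose tensor
unit is terminal, to be a monoidal operational category: it is operational, and the tensor
distributes over finite coproducts. -/
structure IsMonOperational {C : Type u} [Category.{v} C] [MonoidalCategory C] [SpecCoproducts C]
    (T : IsTerminal (𝟙_ C)) : Prop extends IsOperational T where
  isIso_distrib : ∀ A B B' : C, IsIso (desc (A ◁ inl B B') (A ◁ inr B B'))
  isIso_distrib_zero : ∀ A : C, IsIso (isInitial.to (A ⊗ (zero : C)))

/-- The functor `F` preserves the specified coproducts strictly, and the terminal object. -/
structure IsStrict {C D : Type u} [Category.{v} C] [Category.{v} D] [SpecCoproducts C]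
    [SpecCoproducts D] (one : C) (F : C ⥤ D) : Prop where
  obj_zero : F.obj zero = zero
  obj_sum : ∀ A B : C, F.obj (sum A B) = sum (F.obj A) (F.obj B)
  map_inl : ∀ A B : C, F.map (inl A B) ≫ eqToHom (obj_sum A B) = inl (F.obj A) (F.obj B)
  map_inr : ∀ A B : C, F.map (inr A B) ≫ eqToHom (obj_sum A B) = inr (F.obj A) (F.obj B)
  terminal : Nonempty (IsTerminal (F.obj one))

theorem IsStrict.id {C : Type u} [Category.{v} C] [SpecCoproducts C] {one : C}
    (T : IsTerminal one) : IsStrict one (𝟭 C) where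
  obj_zero := rfl
  obj_sum _ _ := rfl
  map_inl _ _ := Category.comp_id _
  map_inr _ _ := Category.comp_id _
  terminal := ⟨T⟩

theorem IsStrict.comp {C D E : Type u} [Category.{v} C] [Category.{v} D] [Category.{v} E]
    [SpecCoproducts C] [SpecCoproducts D] [SpecCoproducts E] {one : C} {one' : D}
    {F : C ⥤ D} {G : D ⥤ E} (T : IsTerminal one') (h : IsStrict one F) (h' : IsStrict one' G) :
    IsStrict one (F ⋙ G) where
  obj_zero := (congrArg G.obj h.obj_zero).trans h'.obj_zero
  obj_sum A B := (congrArg G.obj (h.obj_sum A B)).trans (h'.obj_sum _ _)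
  map_inl A B := by
    have e := h'.map_inl (F.obj A) (F.obj B)
    rw [← h.map_inl, G.map_comp, eqToHom_map, Category.assoc, eqToHom_trans] at e
    exact e
  map_inr A B := by
    have e := h'.map_inr (F.obj A) (F.obj B)
    rw [← h.map_inr, G.map_comp, eqToHom_map, Category.assoc, eqToHom_trans] at e
    exact e
  terminal := ⟨h'.terminal.some.ofIso (G.mapIso (T.uniqueUpToIso h.terminal.some))⟩

/-- An operational category with specified coproducts. -/
structure OpCatStrict where
  Obj : Type u
  [cat : Category.{v} Obj]
  [coprod : SpecCoproducts Obj]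
  one : Obj
  isTerminal : IsTerminal one
  isOperational : IsOperational isTerminal

attribute [instance] OpCatStrict.cat OpCatStrict.coprod

/-- A morphism of operational categories which preserves the specified coproducts strictly. -/
@[ext]
structure OpCatStrict.Hom (B B' : OpCatStrict.{v, u}) where
  toFunctor : B.Obj ⥤ B'.Obj
  isStrict : IsStrict B.one toFunctor

instance : Category OpCatStrict.{v, u} where
  Hom := OpCatStrict.Hom
  id B := ⟨𝟭 _, IsStrict.id B.isTerminal⟩
  comp {_ B' _} F G := ⟨F.toFunctor ⋙ G.toFunctor, F.isStrict.comp B'.isTerminal G.isStrict⟩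
  id_comp _ := rfl
  comp_id _ := rfl
  assoc _ _ _ := rfl

/-- A monoidal operational category with specified coproducts. -/
structure MonOpCatStrict where
  Obj : Type u
  [cat : Category.{v} Obj]
  [mon : MonoidalCategory Obj]
  [symm : SymmetricCategory Obj]
  [coprod : SpecCoproducts Obj]
  isTerminal : IsTerminal (𝟙_ Obj)
  isMonOperational : IsMonOperational isTerminal

attribute [instance] MonOpCatStrict.cat MonOpCatStrict.mon MonOpCatStrict.symm MonOpCatStrict.coprod

/-- The underlying operational category of a monoidal operational category. -/
abbrev MonOpCatStrict.toOpCatStrict (B : MonOpCatStrict.{v, u}) : OpCatStrict.{v, u} :=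
  ⟨B.Obj, 𝟙_ B.Obj, B.isTerminal, B.isMonOperational.toIsOperational⟩

/-- A morphism of monoidal operational categories which preserves the specified coproducts
strictly: a strong symmetric monoidal functor which preserves the terminal object, and strictly
preserves the specified coproducts. Its coherence isomorphism `I ⟶ F(I)` is the only arrow of this
type. -/
@[ext]
structure MonOpCatStrict.Hom (B B' : MonOpCatStrict.{v, u}) where
  toFunctor : B.Obj ⥤ B'.Obj
  μ : ∀ A A' : B.Obj, toFunctor.obj A ⊗ toFunctor.obj A' ⟶ toFunctor.obj (A ⊗ A')
  isStrict : IsStrict (𝟙_ B.Obj) toFunctor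
  isSymmMonoidal : ∃ ε, IsSymmMonoidal toFunctor ε μ

instance : Category MonOpCatStrict.{v, u} where
  Hom := MonOpCatStrict.Hom
  id B := ⟨𝟭 _, fun _ _ => 𝟙 _, IsStrict.id B.isTerminal, _, IsSymmMonoidal.id B.Obj⟩
  comp {_ B' _} F G := ⟨F.toFunctor ⋙ G.toFunctor,
    fun A A' => G.μ _ _ ≫ G.toFunctor.map (F.μ A A'),
    F.isStrict.comp B'.isTerminal G.isStrict, _,
    F.isSymmMonoidal.choose_spec.comp G.isSymmMonoidal.choose_spec⟩
  id_comp F := MonOpCatStrict.Hom.ext rfl (heq_of_eq (by funext A B; simp))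
  comp_id F := MonOpCatStrict.Hom.ext rfl (heq_of_eq (by funext A B; simp))
  assoc F G H := MonOpCatStrict.Hom.ext rfl (heq_of_eq (by funext A B; simp))

/-! ## Partial arrows -/

/-- The objects of the category of partial arrows of a category with specified finite coproducts
and a terminal object. -/
structure Par {C : Type u} [Category.{v} C] [SpecCoproducts C] {one : C} (T : IsTerminal one) where
  of : C

namespace Par

section

variable {C : Type u} [Category.{v} C] [SpecCoproducts C] {one : C} (T : IsTerminal one)

/-- A partial arrow from `A` to `B` is an arrow `A ⟶ B + 1`. -/
@[ext]
structure Hom (A B : Par T) where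
  arrow : A.of ⟶ sum B.of one

instance : Category (Par T) where
  Hom A B := Hom T A B
  id A := ⟨inl A.of one⟩
  comp {_ _ X} f g := ⟨f.arrow ≫ desc g.arrow (inr X.of one)⟩
  id_comp f := Hom.ext (inl_desc _ _)
  comp_id f := Hom.ext (by
    dsimp only
    rw [show desc (inl _ _) (inr _ _) = 𝟙 (sum _ one) from hom_ext (by simp) (by simp),
      Category.comp_id])
  assoc f g h := Hom.ext (by
    dsimp only
    rw [Category.assoc]
    congr 1
    exact hom_ext (by simp) (by simp))

variable {T}

@[simp]
theorem id_arrow (A : Par T) : (𝟙 A : A ⟶ A).arrow = inl A.of one := rfl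

@[simp]
theorem comp_arrow {A B X : Par T} (f : A ⟶ B) (g : B ⟶ X) :
    (f ≫ g).arrow = f.arrow ≫ desc g.arrow (inr X.of one) := rfl

@[ext]
theorem hom_ext {A B : Par T} {f g : A ⟶ B} (h : f.arrow = g.arrow) : f = g := Hom.ext h

variable (T)

/-- The zero arrow from `A` to `B` is `κ₂ ∘ !`. -/
instance : HasZeroMorphisms (Par T) where
  zero A B := ⟨⟨T.from A.of ≫ inr B.of one⟩⟩
  comp_zero {A B} f D := by
    apply hom_ext
    change f.arrow ≫ desc (T.from B.of ≫ inr D.of one) (inr D.of one) = T.from A.of ≫ inr D.of one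
    have : desc (T.from B.of ≫ inr D.of one) (inr D.of one) = T.from _ ≫ inr D.of one := by
      refine SpecCoproducts.hom_ext ?_ ?_
      · rw [inl_desc, ← Category.assoc]
        congr 1
        exact T.hom_ext _ _
      · rw [inr_desc, ← Category.assoc]
        conv_lhs => rw [← Category.id_comp (inr D.of one)]
        congr 1
        exact T.hom_ext _ _
    rw [this, ← Category.assoc]
    congr 1
    exact T.hom_ext _ _
  zero_comp A {B D} f := by
    apply hom_ext
    change (T.from A.of ≫ inr B.of one) ≫ desc f.arrow (inr D.of one) = T.from A.of ≫ inr D.of one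
    rw [Category.assoc, inr_desc]

/-- The partial arrow `⌈f⌉ = κ₁ ∘ f` defined by an arrow `f`. -/
def ofTotal {A B : C} (f : A ⟶ B) : (⟨A⟩ : Par T) ⟶ ⟨B⟩ := ⟨f ≫ inl B one⟩

@[simp]
theorem ofTotal_arrow {A B : C} (f : A ⟶ B) : (ofTotal T f).arrow = f ≫ inl B one := rfl

/-- The discarding maps `κ₁ ∘ !`. -/
def discard (A : Par T) : A ⟶ (⟨one⟩ : Par T) := ofTotal T (T.from A.of)

/-- The coproducts `A + B`, with coprojections `⌈κ₁⌉` and `⌈κ₂⌉`. -/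
instance : SpecCoproducts (Par T) where
  zero := ⟨zero⟩
  isInitial := IsInitial.ofUniqueHom (fun B => ⟨isInitial.to (sum B.of one)⟩)
    (fun B f => hom_ext (isInitial.hom_ext f.arrow _))
  sum A B := ⟨sum A.of B.of⟩
  inl A B := ofTotal T (inl A.of B.of)
  inr A B := ofTotal T (inr A.of B.of)
  isColimit A B := BinaryCofan.IsColimit.mk _
    (fun f g => ⟨desc f.arrow g.arrow⟩)
    (fun f g => hom_ext (by
      change (inl A.of B.of ≫ inl _ one) ≫ desc (desc f.arrow g.arrow) (inr _ one) = f.arrow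
      simp))
    (fun f g => hom_ext (by
      change (inr A.of B.of ≫ inl _ one) ≫ desc (desc f.arrow g.arrow) (inr _ one) = g.arrow
      simp))
    (fun f g m h₁ h₂ => hom_ext (by
      subst h₁ h₂
      refine SpecCoproducts.hom_ext ?_ ?_
      · change inl A.of B.of ≫ m.arrow = inl A.of B.of ≫
          desc ((inl A.of B.of ≫ inl _ one) ≫ desc m.arrow (inr _ one)) _
        rw [inl_desc]
        exact (congrArg (inl A.of B.of ≫ ·) (inl_desc m.arrow (inr _ one)).symm).trans
          (Category.assoc _ _ _).symm
      · change inr A.of B.of ≫ m.arrow = inr A.of B.of ≫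
          desc _ ((inr A.of B.of ≫ inl _ one) ≫ desc m.arrow (inr _ one))
        rw [inr_desc]
        exact (congrArg (inr A.of B.of ≫ ·) (inl_desc m.arrow (inr _ one)).symm).trans
          (Category.assoc _ _ _).symm))

end

section

variable {C : Type u} [Category.{v} C] [SpecCoproducts C] {one : C} (T : IsTerminal one)
  {D : Type u} [Category.{v} D] [SpecCoproducts D] {one' : D} (T' : IsTerminal one')

/-- The lifting of a functor which strictly preserves specified coproducts to partial arrows: it
sends `f : A ⟶ B + 1` to the arrow `F(A) ⟶ F(B + 1) = F(B) + F(1) ≅ F(B) + 1`. -/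
def functor {F : C ⥤ D} (h : IsStrict one F) : Par T ⥤ Par T' where
  obj A := ⟨F.obj A.of⟩
  map {A B} f :=
    ⟨F.map f.arrow ≫ eqToHom (h.obj_sum B.of one) ≫ sumMap (𝟙 _) (T'.from (F.obj one))⟩
  map_id A := hom_ext (by
    dsimp
    rw [← Category.assoc, h.map_inl, sumMap, inl_desc, Category.id_comp])
  map_comp {A B X} f g := hom_ext (by
    dsimp
    rw [F.map_comp]
    simp only [Category.assoc]
    congr 1
    rw [← cancel_epi (eqToHom (h.obj_sum B.of one).symm), eqToHom_trans_assoc, eqToHom_refl,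
      Category.id_comp]
    have e₁ : inl _ _ ≫ eqToHom (h.obj_sum B.of one).symm = F.map (inl B.of one) := by
      rw [← h.map_inl]
      simp
    have e₂ : inr _ _ ≫ eqToHom (h.obj_sum B.of one).symm = F.map (inr B.of one) := by
      rw [← h.map_inr]
      simp
    refine SpecCoproducts.hom_ext ?_ ?_
    · rw [← Category.assoc, e₁, ← Category.assoc, ← F.map_comp, inl_desc]
      simp [sumMap]
    · rw [← Category.assoc, e₂, ← Category.assoc, ← F.map_comp, inr_desc, ← Category.assoc,
        h.map_inr]
      simp [sumMap])

end

end Par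

open Classical in
/-- The projection `▷_x` of a coproduct in a category with zero arrows. -/
def proj {C : Type u} [Category.{v} C] [HasZeroMorphisms C] {X : Type} {B : X → C}
    {c : Cofan B} (hc : IsColimit c) (x : X) : c.pt ⟶ B x :=
  Cofan.IsColimit.desc hc (fun y => if e : y = x then eqToHom (congrArg B e) else 0)

/-- The theory defined by a category with coproducts, zero arrows, a distinguished object `I` and
discarding maps. A collection `{f_x : A ⟶ B_x}` is a test iff there is a total arrow
`f : A ⟶ ∐ B_x` with `▷_x ∘ f = f_x` for all `x`. Here `∐ B_x` may be any coproduct with total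
coprojections, i.e. for which discarding is the copairing of the discarding maps. The
coarse-graining of compatible `f`, `g` is `▽ ∘ h`, for the unique `h` with `▷₁ ∘ h = f` and
`▷₂ ∘ h = g`. -/
def otcFrom {C : Type u} [Category.{v} C] [HasZeroMorphisms C] [SpecCoproducts C] (I : C)
    (discard : ∀ A : C, A ⟶ I) : OTCData C I where
  IsTest {_} _ A f :=
    ∃ (c : Cofan fun x => (f x).1) (hc : IsColimit c),
      (∀ x, c.inj x ≫ discard c.pt = discard (f x).1) ∧
      ∃ h : A ⟶ c.pt, h ≫ discard c.pt = discard A ∧ ∀ x, h ≫ proj hc x = (f x).2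
  ovee {A B} f g _ := (@Classical.epsilon (A ⟶ sum B B) ⟨0⟩
    (fun h => h ≫ desc (𝟙 B) 0 = f ∧ h ≫ desc 0 (𝟙 B) = g)) ≫ desc (𝟙 B) (𝟙 B)
  zero _ _ := 0

/-- The theory of partial arrows of a category. -/
def otcPar {C : Type u} [Category.{v} C] [SpecCoproducts C] {one : C} (T : IsTerminal one) :
    OTCData (Par T) (Par.mk (T := T) one) :=
  otcFrom _ (Par.discard T)

/-! ## The category of tests of a theory -/

/-- Index sets of finite collections: the finite sets which are generated from the empty set and a
one-point set by disjoint unions. Up to bijection, these are all finite sets. -/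
inductive Shape : Type
  | empty
  | point
  | plus (s t : Shape)

/-- The elements of an index set. -/
def Shape.Idx : Shape → Type
  | empty => Empty
  | point => Unit
  | plus s t => s.Idx ⊕ t.Idx

theorem Shape.finite_idx : ∀ s : Shape, Finite s.Idx
  | empty => inferInstanceAs (Finite Empty)
  | point => inferInstanceAs (Finite Unit)
  | plus s t =>
    have := s.finite_idx
    have := t.finite_idx
    inferInstanceAs (Finite (s.Idx ⊕ t.Idx))

instance (s : Shape) : Finite s.Idx := s.finite_idx

namespace OTCData

variable {E : Type u} [Category.{v} E] {I : E} {D : OTCData E I}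

/-- The objects of the category of tests of a theory: finite indexed collections of systems. -/
structure Coll (ax : D.Axioms) where
  shape : Shape
  fam : shape.Idx → E

namespace Coll

variable {ax : D.Axioms}

/-- The elements of the index set of a collection of systems. -/
abbrev Idx (X : Coll ax) : Type := X.shape.Idx

/-- An arrow from `{A_x}_{x ∈ X}` to `{B_y}_{y ∈ Y}` in the category of tests: a matrix of events
`A_x ⟶ B_y` each of whose columns, given by a fixed `x`, is a test. -/
@[ext]
structure Hom (X Y : Coll ax) where
  entry : ∀ (x : X.Idx) (y : Y.Idx), X.fam x ⟶ Y.fam y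
  isTest : ∀ x, D.IsTest (fun y => ev (entry x y))

open Classical in
/-- The entries of the identity matrix: identity events on the diagonal, and impossible events
elsewhere. -/
def delta (X : Coll ax) (x x' : X.Idx) : X.fam x ⟶ X.fam x' :=
  if h : x = x' then eqToHom (congrArg X.fam h) else D.zero _ _

@[simp]
theorem delta_self (X : Coll ax) (x : X.Idx) : X.delta x x = 𝟙 _ := by simp [delta]

theorem delta_ne (X : Coll ax) {x x' : X.Idx} (h : x ≠ x') : X.delta x x' = D.zero _ _ := by
  simp [delta, h]

theorem isTest_unique_iff {X : Type} [Finite X] [Unique X] {A B : E} (f : A ⟶ B)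
    (ax : D.Axioms) : D.IsTest (fun _ : X => ev f) ↔ D.IsDet f := by
  have e : ![ev f] = fun _ => ev f := by
    funext i
    rw [Subsingleton.elim i 0]
    rfl
  unfold TestSpec.IsDet
  rw [e]
  exact ⟨ax.reindex (Equiv.ofUnique (Fin 1) X) _, ax.reindex (Equiv.ofUnique X (Fin 1)) _⟩

theorem isTest_sum_zero {X Y : Type} [Finite X] [Finite Y] {A : E} (B : X → E) (B' : Y → E)
    (f : ∀ x, A ⟶ B x) (t : D.IsTest (fun x => ev (f x))) (ax : D.Axioms) :
    D.IsTest (Sum.elim (fun x => ev (f x)) (fun y => ev (D.zero A (B' y)))) := by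
  rw [isTest_sum_iff ax _ _ _ (enum_nodup X) mem_enum _ (enum_nodup Y) mem_enum]
  have h := (isTest_iff_enum ax _).1 t
  generalize enum Y = l
  refine lTest_perm ax List.perm_append_comm ?_
  induction l with
  | nil => exact h
  | cons a l ih => exact (lTest_zero_iff ax _ _).1 ih

theorem isTest_delta (X : Coll ax) (x : X.Idx) : D.IsTest (fun x' => ev (X.delta x x')) := by
  classical
  have h := isTest_sum_zero (D := D) (X := Fin 1) (Y := {x' : X.Idx // x' ≠ x})
    (fun _ => X.fam x) (fun y => X.fam y.1) (fun _ => 𝟙 _)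
    ((isTest_unique_iff _ ax).2 (ax.id_det _)) ax
  let e : X.Idx ≃ Fin 1 ⊕ {x' : X.Idx // x' ≠ x} :=
    { toFun := fun x' => if h : x' = x then .inl 0 else .inr ⟨x', h⟩
      invFun := Sum.elim (fun _ => x) (fun y => y.1)
      left_inv := fun x' => by
        by_cases h : x' = x
        · simp [h]
        · simp [h]
      right_inv := by
        rintro (i | y)
        · simp [Subsingleton.elim i 0]
        · simp [y.2] }
  convert ax.reindex e _ h using 1
  funext x'
  by_cases hx : x' = x
  · subst hx
    simp [e]
  · simp only [Function.comp, e, Equiv.coe_fn_mk, dif_neg hx, Sum.elim_inr,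
      delta_ne X (Ne.symm hx)]

theorem isTest_comp {X Y Z : Coll ax} (M : Hom X Y) (N : Hom Y Z) (x : X.Idx) :
    D.IsTest (fun p : Z.Idx × Y.Idx => ev (M.entry x p.2 ≫ N.entry p.2 p.1)) := by
  have h := ax.control (fun y => ev (M.entry x y)) (fun y z => ev (N.entry y z)) (M.isTest x)
    (fun y => N.isTest y)
  exact ax.reindex (((Equiv.prodComm _ _).trans (Equiv.sigmaEquivProd _ _).symm)) _ h

theorem isTest_comp_comp {X Y Z W : Coll ax} (M : Hom X Y) (N : Hom Y Z) (P : Hom Z W)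
    (x : X.Idx) : D.IsTest (fun p : W.Idx × (Z.Idx × Y.Idx) =>
      ev ((M.entry x p.2.2 ≫ N.entry p.2.2 p.2.1) ≫ P.entry p.2.1 p.1)) := by
  have h := ax.control _ (fun p w => ev (P.entry p.1 w)) (isTest_comp M N x)
    (fun p => P.isTest p.1)
  exact ax.reindex (((Equiv.prodComm _ _).trans (Equiv.sigmaEquivProd _ _).symm)) _ h

theorem isPartialTest_comp {X Y Z : Coll ax} (M : Hom X Y) (N : Hom Y Z) (x : X.Idx)
    (z : Z.Idx) : D.IsPartialTest (fun y => ev (M.entry x y ≫ N.entry y z)) :=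
  isPartialTest_comp_inj ax (isPartialTest_of_isTest ax (isTest_comp M N x)) (fun y => (z, y))
    (fun _ _ h => (Prod.mk.inj h).2)

/-- The composite of matrices `M` and `N` has entries `⊻_y N(y, z) ∘ M(x, y)`. -/
instance : Category (Coll ax) where
  Hom := Hom
  id X := ⟨X.delta, X.isTest_delta⟩
  comp M N := ⟨fun x z => D.bigOvee (fun y => M.entry x y ≫ N.entry y z),
    fun x => isTest_bigOvee ax _ (isTest_comp M N x)⟩
  id_comp {X Y} M := Hom.ext (by
    funext x y
    dsimp only
    rw [bigOvee_eq_single ax _ x (fun x' h => by rw [delta_ne X (Ne.symm h), ax.zero_comp]),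
      delta_self, Category.id_comp])
  comp_id {X Y} M := Hom.ext (by
    funext x y
    dsimp only
    rw [bigOvee_eq_single ax _ y (fun y' h => by rw [delta_ne Y h, ax.comp_zero]),
      delta_self, Category.comp_id])
  assoc {X Y Z W} M N P := Hom.ext (by
    funext x w
    dsimp only
    have e₁ : ∀ z, D.bigOvee (fun y => M.entry x y ≫ N.entry y z) ≫ P.entry z w =
        D.bigOvee (fun y => (M.entry x y ≫ N.entry y z) ≫ P.entry z w) := fun z =>
      bigOvee_comp ax _ _ (isPartialTest_comp M N x z)
    have e₂ : ∀ y, M.entry x y ≫ D.bigOvee (fun z => N.entry y z ≫ P.entry z w) =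
        D.bigOvee (fun z => M.entry x y ≫ N.entry y z ≫ P.entry z w) := fun y =>
      comp_bigOvee ax _ _ (isPartialTest_comp N P y w)
    simp only [e₁, e₂, Category.assoc]
    refine bigOvee_comm ax _ ?_
    have h := isPartialTest_comp_inj ax (isPartialTest_of_isTest ax (isTest_comp_comp M N P x))
      (fun p => (w, p)) (fun _ _ h => (Prod.mk.inj h).2)
    simpa only [Function.comp_def, Category.assoc] using h)

@[ext]
theorem hom_ext {X Y : Coll ax} {M N : X ⟶ Y} (h : ∀ x y, M.entry x y = N.entry x y) : M = N :=
  Hom.ext (funext fun x => funext fun y => h x y)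

theorem id_entry (X : Coll ax) (x x' : X.Idx) : Hom.entry (𝟙 X) x x' = X.delta x x' := rfl

theorem comp_entry {X Y Z : Coll ax} (M : X ⟶ Y) (N : Y ⟶ Z) (x : X.Idx) (z : Z.Idx) :
    (M ≫ N).entry x z = D.bigOvee (fun y => M.entry x y ≫ N.entry y z) := rfl

variable (ax)

/-- A single system, as a collection. -/
def single (A : E) : Coll ax := ⟨.point, fun _ => A⟩

/-- The single trivial system is terminal. -/
def isTerminal : IsTerminal (single ax I) :=
  IsTerminal.ofUniqueHom
    (fun X => ⟨fun x _ => disc ax (X.fam x), fun x =>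
      (isTest_unique_iff (X := Unit) _ ax).2 (isDet_disc ax (X.fam x))⟩)
    (fun _ M => hom_ext (fun x _ => eq_disc ax
      ((isTest_unique_iff (X := Unit) _ ax).1 (M.isTest x))))

variable {ax}

/-- The disjoint union of two collections of systems. -/
def plus (X Y : Coll ax) : Coll ax := ⟨.plus X.shape Y.shape, Sum.elim X.fam Y.fam⟩

/-- The elements of the index set of a disjoint union which come from the first collection. -/
def inlIdx (X Y : Coll ax) (x : X.Idx) : (X.plus Y).Idx := Sum.inl x

/-- The elements of the index set of a disjoint union which come from the second collection. -/
def inrIdx (X Y : Coll ax) (y : Y.Idx) : (X.plus Y).Idx := Sum.inr y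

theorem bigOvee_delta {X Z : Coll ax} (M : Hom X Z) (x : X.Idx) (z : Z.Idx) :
    D.bigOvee (fun x' => X.delta x x' ≫ M.entry x' z) = M.entry x z := by
  rw [bigOvee_eq_single ax _ x (fun x' h => by rw [delta_ne X (Ne.symm h), ax.zero_comp]),
    delta_self, Category.id_comp]

/-- The matrix formed by matrices `f` and `g` with the same codomain. -/
def copair {X Y Z : Coll ax} (f : Hom X Z) (g : Hom Y Z) : Hom (X.plus Y) Z where
  entry s := match s with
    | .inl x => f.entry x
    | .inr y => g.entry y
  isTest s := match s with
    | .inl x => f.isTest x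
    | .inr y => g.isTest y

variable (ax)

/-- The coproducts of collections of systems, given by disjoint unions. -/
instance : SpecCoproducts (Coll ax) where
  zero := ⟨.empty, Empty.elim⟩
  isInitial := IsInitial.ofUniqueHom
    (fun Y => ⟨fun x => Empty.elim x, fun x => Empty.elim x⟩)
    (fun Y M => hom_ext (fun x => Empty.elim x))
  sum := plus
  inl X Y := ⟨fun x s => (X.plus Y).delta (inlIdx X Y x) s, fun x => isTest_delta _ _⟩
  inr X Y := ⟨fun y s => (X.plus Y).delta (inrIdx X Y y) s, fun y => isTest_delta _ _⟩
  isColimit X Y :=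
    BinaryCofan.IsColimit.mk _ copair
      (fun f g => hom_ext (fun x z => bigOvee_delta (copair f g) (inlIdx X Y x) z))
      (fun f g => hom_ext (fun y z => bigOvee_delta (copair f g) (inrIdx X Y y) z))
      (fun f g M h₁ h₂ => hom_ext (fun s z => by
        subst h₁ h₂
        match s with
        | .inl x => exact (bigOvee_delta (X := X.plus Y) M (inlIdx X Y x) z).symm
        | .inr y => exact (bigOvee_delta (X := X.plus Y) M (inrIdx X Y y) z).symm))

end Coll

end OTCData

/-- The functor between categories of tests given by a morphism of theories. It applies the
morphism to every system of a collection, and to every entry of a matrix. -/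
def OTC.Hom.tests {Θ Θ' : OTC.{v, u}} (F : OTC.Hom Θ Θ') :
    OTCData.Coll Θ.ax ⥤ OTCData.Coll Θ'.ax where
  obj X := ⟨X.shape, fun x => F.toFunctor.obj (X.fam x)⟩
  map M := ⟨fun x y => F.toFunctor.map (M.entry x y), fun x => F.isMorphism.map_test _ (M.isTest x)⟩
  map_id X := OTCData.Coll.hom_ext (fun x x' => by
    change F.toFunctor.map (X.delta x x') = OTCData.Coll.delta _ x x'
    unfold OTCData.Coll.delta
    split_ifs with h
    · rw [eqToHom_map]
    · exact F.isMorphism.map_zero Θ.ax _ _)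
  map_comp M N := OTCData.Coll.hom_ext (fun x z => by
    change F.toFunctor.map (Θ.data.bigOvee _) = Θ'.data.bigOvee _
    rw [F.isMorphism.map_bigOvee Θ.ax _ (OTCData.Coll.isPartialTest_comp M N x z)]
    simp only [Functor.map_comp])
/-! ## Symmetric monoidal structures from explicit data -/

/-- The data of a symmetric monoidal structure on a category. -/
structure SymmMonData (C : Type u) [Category.{v} C] where
  tensorObj : C → C → C
  tensorHom : ∀ {X₁ Y₁ X₂ Y₂ : C}, (X₁ ⟶ Y₁) → (X₂ ⟶ Y₂) → (tensorObj X₁ X₂ ⟶ tensorObj Y₁ Y₂)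
  tensorUnit : C
  associator : ∀ X Y Z : C, tensorObj (tensorObj X Y) Z ⟶ tensorObj X (tensorObj Y Z)
  leftUnitor : ∀ X : C, tensorObj tensorUnit X ⟶ X
  rightUnitor : ∀ X : C, tensorObj X tensorUnit ⟶ X
  braiding : ∀ X Y : C, tensorObj X Y ⟶ tensorObj Y X

namespace SymmMonData

variable {C : Type u} [Category.{v} C]

/-- The laws of a symmetric monoidal category. -/
structure Laws (S : SymmMonData C) : Prop where
  isIso_associator : ∀ X Y Z, IsIso (S.associator X Y Z)
  isIso_leftUnitor : ∀ X, IsIso (S.leftUnitor X)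
  isIso_rightUnitor : ∀ X, IsIso (S.rightUnitor X)
  id_tensorHom_id : ∀ X Y : C, S.tensorHom (𝟙 X) (𝟙 Y) = 𝟙 (S.tensorObj X Y)
  tensorHom_comp_tensorHom : ∀ {X₁ Y₁ Z₁ X₂ Y₂ Z₂ : C} (f₁ : X₁ ⟶ Y₁) (f₂ : X₂ ⟶ Y₂)
    (g₁ : Y₁ ⟶ Z₁) (g₂ : Y₂ ⟶ Z₂),
    S.tensorHom f₁ f₂ ≫ S.tensorHom g₁ g₂ = S.tensorHom (f₁ ≫ g₁) (f₂ ≫ g₂)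
  associator_naturality : ∀ {X₁ X₂ X₃ Y₁ Y₂ Y₃ : C} (f₁ : X₁ ⟶ Y₁) (f₂ : X₂ ⟶ Y₂)
    (f₃ : X₃ ⟶ Y₃), S.tensorHom (S.tensorHom f₁ f₂) f₃ ≫ S.associator Y₁ Y₂ Y₃ =
      S.associator X₁ X₂ X₃ ≫ S.tensorHom f₁ (S.tensorHom f₂ f₃)
  leftUnitor_naturality : ∀ {X Y : C} (f : X ⟶ Y),
    S.tensorHom (𝟙 S.tensorUnit) f ≫ S.leftUnitor Y = S.leftUnitor X ≫ f
  rightUnitor_naturality : ∀ {X Y : C} (f : X ⟶ Y),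
    S.tensorHom f (𝟙 S.tensorUnit) ≫ S.rightUnitor Y = S.rightUnitor X ≫ f
  braiding_naturality : ∀ {X₁ Y₁ X₂ Y₂ : C} (f₁ : X₁ ⟶ Y₁) (f₂ : X₂ ⟶ Y₂),
    S.tensorHom f₁ f₂ ≫ S.braiding Y₁ Y₂ = S.braiding X₁ X₂ ≫ S.tensorHom f₂ f₁
  pentagon : ∀ W X Y Z : C,
    S.tensorHom (S.associator W X Y) (𝟙 Z) ≫
        S.associator W (S.tensorObj X Y) Z ≫ S.tensorHom (𝟙 W) (S.associator X Y Z) =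
      S.associator (S.tensorObj W X) Y Z ≫ S.associator W X (S.tensorObj Y Z)
  triangle : ∀ X Y : C,
    S.associator X S.tensorUnit Y ≫ S.tensorHom (𝟙 X) (S.leftUnitor Y) =
      S.tensorHom (S.rightUnitor X) (𝟙 Y)
  hexagon : ∀ X Y Z : C,
    S.associator X Y Z ≫ S.braiding X (S.tensorObj Y Z) ≫ S.associator Y Z X =
      S.tensorHom (S.braiding X Y) (𝟙 Z) ≫ S.associator Y X Z ≫
        S.tensorHom (𝟙 Y) (S.braiding X Z)
  symmetry : ∀ X Y : C, S.braiding X Y ≫ S.braiding Y X = 𝟙 _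

variable {S : SymmMonData C} (h : S.Laws)

/-- The monoidal category given by the data. -/
abbrev Laws.monoidalCategory : MonoidalCategory C :=
  let _ : MonoidalCategoryStruct C :=
    { tensorObj := S.tensorObj
      tensorHom := S.tensorHom
      whiskerLeft := fun X _ _ f => S.tensorHom (𝟙 X) f
      whiskerRight := fun f Y => S.tensorHom f (𝟙 Y)
      tensorUnit := S.tensorUnit
      associator := fun X Y Z => @asIso _ _ _ _ _ (h.isIso_associator X Y Z)
      leftUnitor := fun X => @asIso _ _ _ _ _ (h.isIso_leftUnitor X)
      rightUnitor := fun X => @asIso _ _ _ _ _ (h.isIso_rightUnitor X) }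
  MonoidalCategory.ofTensorHom
    (id_tensorHom_id := h.id_tensorHom_id)
    (id_tensorHom := fun _ _ _ _ => rfl)
    (tensorHom_id := fun _ _ => rfl)
    (tensorHom_comp_tensorHom := h.tensorHom_comp_tensorHom)
    (associator_naturality := h.associator_naturality)
    (leftUnitor_naturality := h.leftUnitor_naturality)
    (rightUnitor_naturality := h.rightUnitor_naturality)
    (pentagon := h.pentagon)
    (triangle := h.triangle)

/-- The symmetric monoidal category given by the data. -/
abbrev Laws.symmetricCategory : @SymmetricCategory C _ h.monoidalCategory :=
  letI := h.monoidalCategory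
  have hf : ∀ X Y Z : C, (α_ X Y Z).hom ≫ S.braiding X (Y ⊗ Z) ≫ (α_ Y Z X).hom =
    (S.braiding X Y ▷ Z) ≫ (α_ Y X Z).hom ≫ (Y ◁ S.braiding X Z) := h.hexagon
  { braiding := fun X Y => ⟨S.braiding X Y, S.braiding Y X, h.symmetry X Y, h.symmetry Y X⟩
    braiding_naturality_right := fun X _ _ f => h.braiding_naturality (𝟙 X) f
    braiding_naturality_left := fun f Z => h.braiding_naturality f (𝟙 Z)
    hexagon_forward := hf
    hexagon_reverse := fun X Y Z => by
      have e₁ : ∀ X Y : C, S.braiding X Y ≫ S.braiding Y X = 𝟙 (X ⊗ Y) := h.symmetry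
      let b : ∀ X Y : C, X ⊗ Y ≅ Y ⊗ X := fun X Y => ⟨S.braiding X Y, S.braiding Y X, e₁ X Y, e₁ Y X⟩
      change (α_ X Y Z).inv ≫ (b (X ⊗ Y) Z).hom ≫ (α_ Z X Y).inv =
        (X ◁ (b Y Z).hom) ≫ (α_ X Z Y).inv ≫ ((b X Z).hom ▷ Y)
      have e₂ : (α_ Z X Y).hom ≫ (b Z (X ⊗ Y)).hom ≫ (α_ X Y Z).hom =
        ((b Z X).hom ▷ Y) ≫ (α_ X Z Y).hom ≫ (X ◁ (b Z Y).hom) := hf Z X Y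
      have e₃ : whiskerRightIso (b Z X) Y ≪≫ α_ X Z Y ≪≫ whiskerLeftIso X (b Z Y) =
          α_ Z X Y ≪≫ b Z (X ⊗ Y) ≪≫ α_ X Y Z := Iso.ext e₂.symm
      have e₄ := congrArg Iso.inv e₃
      simp only [Iso.trans_inv, whiskerLeftIso_inv, whiskerRightIso_inv, Category.assoc] at e₄
      exact e₄.symm
    symmetry := h.symmetry }

end SymmMonData
/-! ## Monoidal structure on tests -/

namespace OTCData

variable {E : Type u} [Category.{v} E] [MonoidalCategory E] {D : OTCData E (𝟙_ E)}

theorem MonoidalAxioms.isDet_tensor (m : D.MonoidalAxioms) (ax : D.Axioms) {A B A' B' : E}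
    {f : A ⟶ A'} {g : B ⟶ B'} (hf : D.IsDet f) (hg : D.IsDet g) : D.IsDet (f ⊗ₘ g) := by
  rw [← Coll.isTest_unique_iff (X := Unit) _ ax] at hf hg
  have : Unique (Unit × Unit) := ⟨⟨((), ())⟩, fun _ => rfl⟩
  exact (Coll.isTest_unique_iff (X := Unit × Unit) _ ax).1 (m.parallel _ _ hf hg)

theorem MonoidalAxioms.disc_tensor (m : D.MonoidalAxioms) (ax : D.Axioms) (A B : E) :
    disc ax (A ⊗ B) = (disc ax A ⊗ₘ disc ax B) ≫ (λ_ (𝟙_ E)).hom :=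
  (eq_disc ax (isDet_comp ax (m.isDet_tensor ax (isDet_disc ax A) (isDet_disc ax B))
    m.unitor_det)).symm

theorem MonoidalAxioms.isDet_leftUnitor (m : D.MonoidalAxioms) (ax : D.Axioms) (A : E) :
    D.IsDet (λ_ A).hom := by
  refine isDet_of_comp_disc ax ?_
  rw [← leftUnitor_naturality, ← id_tensorHom]
  exact isDet_comp ax (m.isDet_tensor ax (ax.id_det _) (isDet_disc ax A)) m.unitor_det

theorem MonoidalAxioms.isDet_rightUnitor (m : D.MonoidalAxioms) (ax : D.Axioms) (A : E) :
    D.IsDet (ρ_ A).hom := by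
  refine isDet_of_comp_disc ax ?_
  rw [← rightUnitor_naturality, ← tensorHom_id, ← unitors_equal]
  exact isDet_comp ax (m.isDet_tensor ax (isDet_disc ax A) (ax.id_det _)) m.unitor_det

theorem MonoidalAxioms.isDet_associator (m : D.MonoidalAxioms) (ax : D.Axioms) (A B C : E) :
    D.IsDet (α_ A B C).hom := by
  refine isDet_of_comp_disc ax ?_
  have e : (α_ A B C).hom ≫ disc ax (A ⊗ (B ⊗ C)) =
      (disc ax (A ⊗ B) ⊗ₘ disc ax C) ≫ (λ_ (𝟙_ E)).hom := by
    rw [m.disc_tensor ax, m.disc_tensor ax, m.disc_tensor ax A B]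
    have e₁ : (disc ax A ⊗ₘ ((disc ax B ⊗ₘ disc ax C) ≫ (λ_ (𝟙_ E)).hom)) =
        (disc ax A ⊗ₘ (disc ax B ⊗ₘ disc ax C)) ≫ (𝟙_ E ◁ (λ_ (𝟙_ E)).hom) := by
      rw [← id_tensorHom, tensorHom_comp_tensorHom, Category.comp_id]
    have e₂ : (((disc ax A ⊗ₘ disc ax B) ≫ (λ_ (𝟙_ E)).hom) ⊗ₘ disc ax C) =
        ((disc ax A ⊗ₘ disc ax B) ⊗ₘ disc ax C) ≫ ((λ_ (𝟙_ E)).hom ▷ 𝟙_ E) := by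
      rw [← tensorHom_id, tensorHom_comp_tensorHom, Category.comp_id]
    have e₃ : (α_ (𝟙_ E) (𝟙_ E) (𝟙_ E)).hom ≫ (𝟙_ E ◁ (λ_ (𝟙_ E)).hom) =
        (λ_ (𝟙_ E)).hom ▷ 𝟙_ E := by
      rw [triangle, unitors_equal]
    rw [e₁, e₂, Category.assoc, ← associator_naturality_assoc, ← e₃]
    simp only [Category.assoc]
  rw [e]
  exact isDet_comp ax (m.isDet_tensor ax (isDet_disc ax _) (isDet_disc ax _)) m.unitor_det

theorem MonoidalAxioms.isDet_braiding [SymmetricCategory E] (m : D.MonoidalAxioms)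
    (ax : D.Axioms) (A B : E) : D.IsDet (β_ A B).hom := by
  refine isDet_of_comp_disc ax ?_
  have e : (β_ A B).hom ≫ disc ax (B ⊗ A) = disc ax (A ⊗ B) := by
    rw [m.disc_tensor ax, m.disc_tensor ax, ← BraidedCategory.braiding_naturality_assoc,
      braiding_leftUnitor, unitors_equal]
  rw [e]
  exact isDet_disc ax _

theorem isTest_det_comp (ax : D.Axioms) {X : Type} [Finite X] {A B : E} {f : A ⟶ B}
    (hf : D.IsDet f) {C : X → E} (g : ∀ x, B ⟶ C x) (t : D.IsTest (fun x => ev (g x))) :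
    D.IsTest (fun x => ev (f ≫ g x)) := by
  have h := ax.control (X := Unit) (fun _ => ev f) (fun _ x => ev (g x))
    ((Coll.isTest_unique_iff _ ax).2 hf) (fun _ => t)
  exact ax.reindex (Equiv.uniqueSigma (fun _ : Unit => X)).symm _ h

end OTCData

/-- The product of two index sets. -/
def Shape.mul : Shape → Shape → Shape
  | .empty, _ => .empty
  | .point, t => t
  | .plus s s', t => .plus (s.mul t) (s'.mul t)

/-- The elements of a product of index sets are pairs. -/
def Shape.pair : ∀ s t : Shape, (s.mul t).Idx ≃ s.Idx × t.Idx
  | .empty, _ => (Equiv.emptyProd _).symm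
  | .point, _ => (Equiv.punitProd _).symm
  | .plus s s', t => (Equiv.sumCongr (s.pair t) (s'.pair t)).trans
      (Equiv.sumProdDistrib s.Idx s'.Idx t.Idx).symm

namespace OTCData.Coll

variable {E : Type u} [Category.{v} E] [MonoidalCategory E] {D : OTCData E (𝟙_ E)} {ax : D.Axioms}

/-- The tensor product of `{A_x}_{x ∈ X}` and `{B_y}_{y ∈ Y}` is
`{A_x ⊗ B_y}_{(x, y) ∈ X × Y}`. -/
def tensor (X Y : Coll ax) : Coll ax where
  shape := X.shape.mul Y.shape
  fam i := X.fam (X.shape.pair Y.shape i).1 ⊗ Y.fam (X.shape.pair Y.shape i).2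

/-- The first component of an index. -/
def fst {X Y : Coll ax} (i : (X.tensor Y).Idx) : X.Idx := (X.shape.pair Y.shape i).1

/-- The second component of an index. -/
def snd {X Y : Coll ax} (i : (X.tensor Y).Idx) : Y.Idx := (X.shape.pair Y.shape i).2

theorem isTest_tensor (m : D.MonoidalAxioms) {X Y : Coll ax} {A B : E} (f : ∀ x, A ⟶ X.fam x)
    (g : ∀ y, B ⟶ Y.fam y) (hf : D.IsTest (fun x => ev (f x))) (hg : D.IsTest (fun y => ev (g y))) :
    D.IsTest (fun j : (X.tensor Y).Idx =>
      (ev (f (fst j) ⊗ₘ g (snd j)) : Out (A ⊗ B))) :=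
  ax.reindex (X.shape.pair Y.shape) _ (m.parallel _ _ hf hg)

/-- The symmetric monoidal structure on the category of tests. The tensor product of matrices has
entries `M(x, x') ⊗ N(y, y')`, and the coherence isomorphisms consist of those of the category of
events. -/
def symmMonData [SymmetricCategory E] (ax : D.Axioms) (m : D.MonoidalAxioms) :
    SymmMonData (Coll ax) where
  tensorObj := tensor
  tensorHom M N := ⟨fun i j => M.entry (fst i) (fst j) ⊗ₘ N.entry (snd i) (snd j),
    fun i => isTest_tensor m _ _ (M.isTest (fst i)) (N.isTest (snd i))⟩
  tensorUnit := single ax (𝟙_ E)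
  associator X Y Z :=
    ⟨fun i j => (α_ (X.fam (fst (fst i))) (Y.fam (snd (fst i))) (Z.fam (snd i))).hom ≫
        (X.delta (fst (fst i)) (fst j) ⊗ₘ
          (Y.delta (snd (fst i)) (fst (snd j)) ⊗ₘ Z.delta (snd i) (snd (snd j)))),
      fun _ => isTest_det_comp ax (m.isDet_associator ax _ _ _) _
        (isTest_tensor m (X := X) (Y := Y.tensor Z) _ _ (X.isTest_delta _)
          (isTest_tensor m _ _ (Y.isTest_delta _) (Z.isTest_delta _)))⟩
  leftUnitor X := ⟨fun i x => (λ_ (X.fam (snd i))).hom ≫ X.delta (snd i) x,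
    fun _ => isTest_det_comp ax (m.isDet_leftUnitor ax _) _ (X.isTest_delta _)⟩
  rightUnitor X := ⟨fun i x => (ρ_ (X.fam (fst i))).hom ≫ X.delta (fst i) x,
    fun _ => isTest_det_comp ax (m.isDet_rightUnitor ax _) _ (X.isTest_delta _)⟩
  braiding X Y :=
    ⟨fun i j => (β_ (X.fam (fst i)) (Y.fam (snd i))).hom ≫
        (Y.delta (snd i) (fst j) ⊗ₘ X.delta (fst i) (snd j)),
      fun _ => isTest_det_comp ax (m.isDet_braiding ax _ _) _
        (isTest_tensor m _ _ (Y.isTest_delta _) (X.isTest_delta _))⟩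

end OTCData.Coll

/-- The underlying morphism of theories of a morphism of monoidal theories. -/
abbrev MonOTC.Hom.toOTCHom {Θ Θ' : MonOTC.{v, u}} (F : MonOTC.Hom Θ Θ') :
    OTC.Hom Θ.toOTC Θ'.toOTC := ⟨F.toFunctor, F.isMorphism⟩

theorem MonOTC.Hom.isDet_μ {Θ Θ' : MonOTC.{v, u}} (F : MonOTC.Hom Θ Θ') (A B : Θ.Sys) :
    Θ'.data.IsDet (F.μ A B) := by
  obtain ⟨ε, ⟨b, rfl, hμ⟩, hε⟩ := F.isSymmMonoidal
  rw [← hμ]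
  refine OTCData.isDet_of_comp_disc Θ'.ax ?_
  have e₀ : b.η = OTCData.disc Θ'.ax (F.toFunctor.obj (𝟙_ Θ.Sys)) := by
    rw [← cancel_epi b.ε, hε, b.ε_η]
  have e₁ : b.μ (𝟙_ Θ.Sys) (𝟙_ Θ.Sys) ≫ F.toFunctor.map (λ_ (𝟙_ Θ.Sys)).hom =
      (OTCData.disc Θ'.ax (F.toFunctor.obj (𝟙_ Θ.Sys)) ▷ _) ≫
        (λ_ (F.toFunctor.obj (𝟙_ Θ.Sys))).hom := by
    rw [← e₀, b.left_unitality, ← comp_whiskerRight_assoc, b.η_ε, id_whiskerRight,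
      Category.id_comp]
  rw [← F.isMorphism.disc_obj Θ.ax, Θ.monAx.disc_tensor Θ.ax, Functor.map_comp]
  have e₂ : b.μ A B ≫ F.toFunctor.map (OTCData.disc Θ.ax A ⊗ₘ OTCData.disc Θ.ax B) =
      (F.toFunctor.map (OTCData.disc Θ.ax A) ⊗ₘ F.toFunctor.map (OTCData.disc Θ.ax B)) ≫
        b.μ _ _ := (Functor.LaxMonoidal.μ_natural F.toFunctor _ _).symm
  have e₃ : b.μ A B ≫ (F.toFunctor.map (OTCData.disc Θ.ax A ⊗ₘ OTCData.disc Θ.ax B) ≫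
      F.toFunctor.map (λ_ (𝟙_ Θ.Sys)).hom) ≫ OTCData.disc Θ'.ax (F.toFunctor.obj (𝟙_ Θ.Sys)) =
      (F.toFunctor.map (OTCData.disc Θ.ax A) ⊗ₘ F.toFunctor.map (OTCData.disc Θ.ax B)) ≫
        ((OTCData.disc Θ'.ax (F.toFunctor.obj (𝟙_ Θ.Sys)) ▷ _) ≫
          (λ_ (F.toFunctor.obj (𝟙_ Θ.Sys))).hom) ≫ OTCData.disc Θ'.ax _ := by
    rw [← e₁]
    simp only [Category.assoc]
    rw [← Category.assoc, e₂, Category.assoc]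
  refine (congrArg Θ'.data.IsDet e₃).mpr ?_
  have d := OTCData.isDet_disc Θ'.ax
  refine OTCData.isDet_comp Θ'.ax (Θ'.monAx.isDet_tensor Θ'.ax
    (F.isMorphism.map_det (OTCData.isDet_disc Θ.ax A))
    (F.isMorphism.map_det (OTCData.isDet_disc Θ.ax B))) (OTCData.isDet_comp Θ'.ax ?_ (d _))
  rw [← tensorHom_id]
  exact OTCData.isDet_comp Θ'.ax (Θ'.monAx.isDet_tensor Θ'.ax (d _) (Θ'.ax.id_det _))
    (Θ'.monAx.isDet_leftUnitor Θ'.ax _)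

/-- The coherence morphisms of the functor between categories of tests given by a morphism of
monoidal theories. -/
def MonOTC.Hom.testsμ {Θ Θ' : MonOTC.{v, u}} (F : MonOTC.Hom Θ Θ')
    (X Y : OTCData.Coll Θ.ax) :
    (F.toOTCHom.tests.obj X).tensor (F.toOTCHom.tests.obj Y) ⟶ F.toOTCHom.tests.obj (X.tensor Y) :=
  ⟨fun i j => F.μ (X.fam (OTCData.Coll.fst (X := X) (Y := Y) i))
      (Y.fam (OTCData.Coll.snd (X := X) (Y := Y) i)) ≫
      F.toFunctor.map (X.delta (OTCData.Coll.fst (X := X) (Y := Y) i) (OTCData.Coll.fst j) ⊗ₘ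
        Y.delta (OTCData.Coll.snd (X := X) (Y := Y) i) (OTCData.Coll.snd j)),
    fun _ => OTCData.isTest_det_comp Θ'.ax (F.isDet_μ _ _) _ (F.isMorphism.map_test _
      (OTCData.Coll.isTest_tensor Θ.monAx _ _ (X.isTest_delta _) (Y.isTest_delta _)))⟩

/-! ## Monoidal structure on partial arrows -/

namespace Par

variable {C : Type u} [Category.{v} C] [MonoidalCategory C] [SpecCoproducts C]
  {T : IsTerminal (𝟙_ C)}

/-- The distributivity isomorphism `A ⊗ (B + B') ≅ A ⊗ B + A ⊗ B'`. -/
def distrib (h : IsMonOperational T) (A B B' : C) : A ⊗ sum B B' ⟶ sum (A ⊗ B) (A ⊗ B') :=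
  have := h.isIso_distrib A B B'
  inv (desc (A ◁ inl B B') (A ◁ inr B B'))

variable [SymmetricCategory C]

/-- The arrow `(A + 1) ⊗ (B + 1) ≅ A ⊗ B + 1 ⊗ B + (A + 1) ⊗ 1 ⟶ A ⊗ B + 1` given by distributivity
and the arrows to `1`. -/
def both (h : IsMonOperational T) (A B : C) :
    sum A (𝟙_ C) ⊗ sum B (𝟙_ C) ⟶ sum (A ⊗ B) (𝟙_ C) :=
  distrib h (sum A (𝟙_ C)) B (𝟙_ C) ≫
    desc ((β_ (sum A (𝟙_ C)) B).hom ≫ distrib h B A (𝟙_ C) ≫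
        desc ((β_ B A).hom ≫ inl _ _) (T.from _ ≫ inr _ _))
      (T.from _ ≫ inr _ _)

/-- The symmetric monoidal structure on partial arrows. -/
def symmMonData (h : IsMonOperational T) : SymmMonData (Par T) where
  tensorObj A B := ⟨A.of ⊗ B.of⟩
  tensorHom {_ Y₁ _ Y₂} f g := ⟨(f.arrow ⊗ₘ g.arrow) ≫ both h Y₁.of Y₂.of⟩
  tensorUnit := ⟨𝟙_ C⟩
  associator A B X := ofTotal T (α_ A.of B.of X.of).hom
  leftUnitor A := ofTotal T (λ_ A.of).hom
  rightUnitor A := ofTotal T (ρ_ A.of).hom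
  braiding A B := ofTotal T (β_ A.of B.of).hom

end Par
/-! ## The functors -/

/-- The categories of tests of theories are operational categories, and morphisms of theories
induce morphisms of operational categories. -/
structure TestsWellDefined : Prop where
  isOperational : ∀ Θ : OTC.{v, u}, IsOperational (OTCData.Coll.isTerminal Θ.ax)
  isStrict : ∀ {Θ Θ' : OTC.{v, u}} (F : OTC.Hom Θ Θ'),
    IsStrict (OTCData.Coll.single Θ.ax Θ.I) F.tests

/-- The functor `OpCat(-)` which sends a theory to its category of tests. -/
def opCat (h : TestsWellDefined.{v, u}) : OTC.{v, u} ⥤ OpCatStrict.{v, u} where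
  obj Θ := ⟨OTCData.Coll Θ.ax, _, OTCData.Coll.isTerminal Θ.ax, h.isOperational Θ⟩
  map F := ⟨OTC.Hom.tests F, h.isStrict F⟩

namespace Par

variable {C : Type u} [Category.{v} C] [SpecCoproducts C] {one : C} {T : IsTerminal one}
  {C' : Type u} [Category.{v} C'] [SpecCoproducts C'] {one' : C'} {T' : IsTerminal one'}
  {C'' : Type u} [Category.{v} C''] [SpecCoproducts C''] {one'' : C''} {T'' : IsTerminal one''}

theorem functor_id (h : IsStrict one (𝟭 C)) : functor T T h = 𝟭 (Par T) :=
  CategoryTheory.Functor.hext (fun _ => rfl) (fun A B f => heq_of_eq (hom_ext (by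
    change f.arrow ≫ 𝟙 _ ≫ sumMap (𝟙 _) (T.from one) = f.arrow
    have : sumMap (𝟙 B.of) (T.from one) = 𝟙 _ := by
      rw [T.hom_ext (T.from one) (𝟙 one)]
      refine SpecCoproducts.hom_ext ?_ ?_
      · simp [sumMap]
      · simp [sumMap]
    rw [this]
    simp)))

theorem functor_comp_aux {F : C ⥤ C'} {G : C' ⥤ C''} (hF : IsStrict one F)
    (hG : IsStrict one' G) (B : C) {A : C} (f : A ⟶ sum B one) :
    G.map (F.map f) ≫ eqToHom ((congrArg G.obj (hF.obj_sum B one)).trans (hG.obj_sum (F.obj B) (F.obj one))) ≫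
        sumMap (𝟙 (G.obj (F.obj B))) (T''.from (G.obj (F.obj one))) =
      G.map (F.map f ≫ eqToHom (hF.obj_sum B one) ≫ sumMap (𝟙 (F.obj B)) (T'.from (F.obj one))) ≫
        eqToHom (hG.obj_sum (F.obj B) one') ≫
        sumMap (𝟙 (G.obj (F.obj B))) (T''.from (G.obj one')) := by
  have e₁ : inl _ _ ≫ eqToHom (hG.obj_sum (F.obj B) (F.obj one)).symm = G.map (inl _ _) := by
    rw [← hG.map_inl]
    simp
  have e₂ : inr _ _ ≫ eqToHom (hG.obj_sum (F.obj B) (F.obj one)).symm = G.map (inr _ _) := by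
    rw [← hG.map_inr]
    simp
  rw [G.map_comp (F.map f), Category.assoc]
  congr 1
  rw [G.map_comp, eqToHom_map, ← cancel_epi (eqToHom ((congrArg G.obj (hF.obj_sum B one)).trans
    (hG.obj_sum (F.obj B) (F.obj one))).symm)]
  simp only [eqToHom_trans_assoc, eqToHom_refl, Category.id_comp, Category.assoc]
  refine SpecCoproducts.hom_ext ?_ ?_
  · rw [← Category.assoc (inl _ _), e₁, ← Category.assoc (G.map _), ← G.map_comp]
    simp only [sumMap, inl_desc, Category.id_comp]
    rw [← Category.assoc, hG.map_inl, inl_desc]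
  · rw [← Category.assoc (inr _ _), e₂, ← Category.assoc (G.map _), ← G.map_comp]
    simp only [sumMap, inr_desc, G.map_comp, Category.assoc]
    rw [← Category.assoc (G.map (inr _ _)), hG.map_inr, inr_desc, ← Category.assoc]
    congr 1
    exact T''.hom_ext _ _

theorem functor_comp {F : C ⥤ C'} {G : C' ⥤ C''} (hF : IsStrict one F) (hG : IsStrict one' G)
    (h : IsStrict one (F ⋙ G)) :
    functor T T'' h = functor T T' hF ⋙ functor T' T'' hG :=
  CategoryTheory.Functor.hext (fun _ => rfl) (fun A B f => heq_of_eq (hom_ext (by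
    exact functor_comp_aux (T' := T') (T'' := T'') hF hG B.of f.arrow)))

end Par

/-- Categories of partial arrows of operational categories define theories, and morphisms of
operational categories induce morphisms of theories. -/
structure ParWellDefined : Prop where
  axioms : ∀ B : OpCatStrict.{v, u}, (otcPar B.isTerminal).Axioms
  isMorphism : ∀ {B B' : OpCatStrict.{v, u}} (F : OpCatStrict.Hom B B'),
    OTCData.IsMorphism (axioms B') (otcPar B.isTerminal)
      (Par.functor B.isTerminal B'.isTerminal F.isStrict)

/-- The functor `OTC(Par(-))` which sends an operational category to the theory of its partial
arrows. -/
def otcOfPar (h : ParWellDefined.{v, u}) : OpCatStrict.{v, u} ⥤ OTC.{v, u} where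
  obj B := ⟨Par B.isTerminal, ⟨B.one⟩, otcPar B.isTerminal, h.axioms B⟩
  map {B B'} F := ⟨Par.functor B.isTerminal B'.isTerminal (OpCatStrict.Hom.isStrict F),
    h.isMorphism F⟩
  map_id B := OTC.Hom.ext (Par.functor_id (OpCatStrict.Hom.isStrict (𝟙 B)))
  map_comp F G := OTC.Hom.ext (Par.functor_comp F.isStrict G.isStrict (F ≫ G).isStrict)

/-! ### The monoidal case -/

/-- The categories of tests of monoidal theories are monoidal operational categories, and
morphisms of monoidal theories induce morphisms of monoidal operational categories. -/
structure MonTestsWellDefined : Prop where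
  laws : ∀ Θ : MonOTC.{v, u}, (OTCData.Coll.symmMonData Θ.ax Θ.monAx).Laws
  isMonOperational : ∀ Θ : MonOTC.{v, u},
    letI := (laws Θ).monoidalCategory
    IsMonOperational (OTCData.Coll.isTerminal Θ.ax)
  isStrict : ∀ {Θ Θ' : MonOTC.{v, u}} (F : MonOTC.Hom Θ Θ'),
    IsStrict (OTCData.Coll.single Θ.ax (𝟙_ Θ.Sys)) F.toOTCHom.tests
  isSymmMonoidal : ∀ {Θ Θ' : MonOTC.{v, u}} (F : MonOTC.Hom Θ Θ'),
    letI := (laws Θ).monoidalCategory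
    letI := (laws Θ).symmetricCategory
    letI := (laws Θ').monoidalCategory
    letI := (laws Θ').symmetricCategory
    ∃ ε, IsSymmMonoidal F.toOTCHom.tests ε F.testsμ

theorem OTCData.MonoidalAxioms.zero_tensor {E : Type u} [Category.{v} E] [MonoidalCategory E]
    [SymmetricCategory E] {D : OTCData E (𝟙_ E)} (m : D.MonoidalAxioms) (ax : D.Axioms)
    {A B : E} (f : A ⟶ B) (X Y : E) : D.zero X Y ⊗ₘ f = D.zero (X ⊗ A) (Y ⊗ B) := by
  rw [← cancel_mono (β_ Y B).hom, BraidedCategory.braiding_naturality, m.tensor_zero,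
    ax.zero_comp, ax.comp_zero]

theorem OTCData.Coll.delta_tensor {E : Type u} [Category.{v} E] [MonoidalCategory E]
    [SymmetricCategory E] {D : OTCData E (𝟙_ E)} (m : D.MonoidalAxioms) {ax : D.Axioms}
    (X Y : Coll ax) (i j : (X.tensor Y).Idx) :
    X.delta (fst i) (fst j) ⊗ₘ Y.delta (snd i) (snd j) = (X.tensor Y).delta i j := by
  by_cases h : i = j
  · subst h
    simp only [delta_self, id_tensorHom_id]
    rfl
  · rw [delta_ne _ h]
    by_cases h₁ : fst i = fst j
    · have h₂ : snd i ≠ snd j := fun h₂ =>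
        h ((X.shape.pair Y.shape).injective (Prod.ext h₁ h₂))
      rw [delta_ne Y h₂, m.tensor_zero]
      rfl
    · rw [delta_ne X h₁, m.zero_tensor ax]
      rfl

open OTCData.Coll in
theorem MonOTC.Hom.testsμ_entry {Θ Θ' : MonOTC.{v, u}} (F : MonOTC.Hom Θ Θ')
    (X Y : OTCData.Coll Θ.ax) (i j : (X.tensor Y).Idx) :
    (F.testsμ X Y).entry i j =
      F.μ (X.fam (fst i)) (Y.fam (snd i)) ≫ F.toFunctor.map ((X.tensor Y).delta i j) :=
  congrArg (fun k => F.μ (X.fam (fst i)) (Y.fam (snd i)) ≫ F.toFunctor.map k)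
    (delta_tensor Θ.monAx X Y i j)

theorem MonOTC.Hom.testsμ_id (Θ : MonOTC.{v, u}) (X Y : OTCData.Coll Θ.ax) :
    MonOTC.Hom.testsμ (𝟙 Θ) X Y = 𝟙 (X.tensor Y) :=
  OTCData.Coll.hom_ext (fun i j =>
    (MonOTC.Hom.testsμ_entry (𝟙 Θ) X Y i j).trans (Category.id_comp _))

open OTCData.Coll in
theorem MonOTC.Hom.testsμ_ne {Θ Θ' : MonOTC.{v, u}} (F : MonOTC.Hom Θ Θ')
    (X Y : OTCData.Coll Θ.ax) {i j : (X.tensor Y).Idx} (h : i ≠ j) :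
    (F.testsμ X Y).entry i j = Θ'.data.zero _ _ :=
  (F.testsμ_entry X Y i j).trans ((congrArg
    (fun t => F.μ (X.fam (fst i)) (Y.fam (snd i)) ≫ F.toFunctor.map t) (delta_ne _ h)).trans
    ((congrArg (F.μ (X.fam (fst i)) (Y.fam (snd i)) ≫ ·)
      (F.isMorphism.map_zero Θ.ax _ _)).trans (Θ'.ax.comp_zero _)))

open OTCData.Coll in
theorem MonOTC.Hom.testsμ_self {Θ Θ' : MonOTC.{v, u}} (F : MonOTC.Hom Θ Θ')
    (X Y : OTCData.Coll Θ.ax) (i : (X.tensor Y).Idx) :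
    (F.testsμ X Y).entry i i = F.μ (X.fam (fst i)) (Y.fam (snd i)) :=
  (F.testsμ_entry X Y i i).trans ((congrArg
    (fun t => F.μ (X.fam (fst i)) (Y.fam (snd i)) ≫ F.toFunctor.map t) (delta_self _ i)).trans
    ((congrArg (F.μ (X.fam (fst i)) (Y.fam (snd i)) ≫ ·)
      (CategoryTheory.Functor.map_id _ _)).trans (Category.comp_id _)))

open OTCData.Coll in
theorem MonOTC.Hom.testsμ_comp {Θ₁ Θ₂ Θ₃ : MonOTC.{v, u}} (F : Θ₁ ⟶ Θ₂) (G : Θ₂ ⟶ Θ₃)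
    (X Y : OTCData.Coll Θ₁.ax) :
    MonOTC.Hom.testsμ (F ≫ G) X Y =
      MonOTC.Hom.testsμ G _ _ ≫ (MonOTC.Hom.toOTCHom G).tests.map (MonOTC.Hom.testsμ F X Y) :=
  OTCData.Coll.hom_ext (fun i j => by
    let X' := (MonOTC.Hom.toOTCHom F).tests.obj X
    let Y' := (MonOTC.Hom.toOTCHom F).tests.obj Y
    have h := OTCData.bigOvee_eq_single Θ₃.ax (X := (X'.tensor Y').Idx)
      (fun k => (MonOTC.Hom.testsμ G X' Y').entry i k ≫
        G.toFunctor.map ((MonOTC.Hom.testsμ F X Y).entry k j)) i (fun k hk =>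
          (congrArg (· ≫ G.toFunctor.map ((MonOTC.Hom.testsμ F X Y).entry k j))
            (MonOTC.Hom.testsμ_ne G X' Y' (Ne.symm hk))).trans (Θ₃.ax.zero_comp _))
    refine Eq.trans ?_ h.symm
    refine (MonOTC.Hom.testsμ_entry (F ≫ G) X Y i j).trans ?_
    refine Eq.trans ?_ (congrArg (· ≫ G.toFunctor.map ((MonOTC.Hom.testsμ F X Y).entry i j))
      (MonOTC.Hom.testsμ_self G X' Y' i)).symm
    refine Eq.trans ?_ (congrArg (fun t => G.μ (X'.fam (fst (X := X') (Y := Y') i))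
      (Y'.fam (snd (X := X') (Y := Y') i)) ≫ G.toFunctor.map t)
      (MonOTC.Hom.testsμ_entry F X Y i j)).symm
    refine Eq.trans ?_ (congrArg (_ ≫ ·) (G.toFunctor.map_comp _ _).symm)
    exact Category.assoc _ _ _)

/-- The functor `OpCat(-)` which sends a monoidal theory to its category of tests. -/
def monOpCat (h : MonTestsWellDefined.{v, u}) : MonOTC.{v, u} ⥤ MonOpCatStrict.{v, u} where
  obj Θ :=
    letI := (h.laws Θ).monoidalCategory
    letI := (h.laws Θ).symmetricCategory
    ⟨OTCData.Coll Θ.ax, OTCData.Coll.isTerminal Θ.ax, h.isMonOperational Θ⟩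
  map {Θ Θ'} F :=
    letI := (h.laws Θ).monoidalCategory
    letI := (h.laws Θ).symmetricCategory
    letI := (h.laws Θ').monoidalCategory
    letI := (h.laws Θ').symmetricCategory
    ⟨(MonOTC.Hom.toOTCHom F).tests, MonOTC.Hom.testsμ F, h.isStrict F, h.isSymmMonoidal F⟩
  map_id Θ := MonOpCatStrict.Hom.ext rfl (heq_of_eq (by
    funext X Y
    exact MonOTC.Hom.testsμ_id Θ X Y))
  map_comp F G := MonOpCatStrict.Hom.ext rfl (heq_of_eq (by
    funext X Y
    exact MonOTC.Hom.testsμ_comp F G X Y))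

/-- Categories of partial arrows of monoidal operational categories define monoidal theories, and
morphisms of monoidal operational categories induce morphisms of monoidal theories. -/
structure MonParWellDefined : Prop where
  laws : ∀ B : MonOpCatStrict.{v, u}, (Par.symmMonData B.isMonOperational).Laws
  axioms : ∀ B : MonOpCatStrict.{v, u}, (otcPar B.isTerminal).Axioms
  monoidalAxioms : ∀ B : MonOpCatStrict.{v, u},
    letI := (laws B).monoidalCategory
    OTCData.MonoidalAxioms (otcPar B.isTerminal)
  isMorphism : ∀ {B B' : MonOpCatStrict.{v, u}} (F : MonOpCatStrict.Hom B B'),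
    OTCData.IsMorphism (axioms B') (otcPar B.isTerminal)
      (Par.functor B.isTerminal B'.isTerminal F.isStrict)
  isSymmMonoidal : ∀ {B B' : MonOpCatStrict.{v, u}} (F : MonOpCatStrict.Hom B B'),
    letI := (laws B).monoidalCategory
    letI := (laws B).symmetricCategory
    letI := (laws B').monoidalCategory
    letI := (laws B').symmetricCategory
    ∃ ε, IsSymmMonoidal (Par.functor B.isTerminal B'.isTerminal F.isStrict) ε
        (fun X Y => Par.ofTotal B'.isTerminal (F.μ X.of Y.of)) ∧
      ε ≫ OTCData.disc (axioms B') _ = 𝟙 (𝟙_ (Par B'.isTerminal))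

theorem Par.functor_map_ofTotal {C : Type u} [Category.{v} C] [SpecCoproducts C] {one : C}
    {T : IsTerminal one} {C' : Type u} [Category.{v} C'] [SpecCoproducts C'] {one' : C'}
    {T' : IsTerminal one'} {F : C ⥤ C'} (h : IsStrict one F) {A B : C} (f : A ⟶ B) :
    (functor T T' h).map (ofTotal T f) = ofTotal T' (F.map f) :=
  hom_ext (by
    change F.map (f ≫ inl B one) ≫ eqToHom _ ≫ sumMap (𝟙 _) (T'.from _) = F.map f ≫ inl _ _
    rw [F.map_comp, Category.assoc, ← Category.assoc (F.map (inl B one)), h.map_inl, sumMap,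
      inl_desc, Category.id_comp])

theorem Par.ofTotal_comp {C : Type u} [Category.{v} C] [SpecCoproducts C] {one : C}
    {T : IsTerminal one} {A B X : C} (f : A ⟶ B) (g : B ⟶ X) :
    ofTotal T (f ≫ g) = ofTotal T f ≫ ofTotal T g :=
  hom_ext (by simp)

theorem MonOTC.Hom.ext_of_heq {Θ Θ' : MonOTC.{v, u}} {F G : MonOTC.Hom Θ Θ'}
    (h : F.toFunctor = G.toFunctor) (h' : ∀ A B, F.μ A B ≍ G.μ A B) : F = G := by
  obtain ⟨F, μ, _, _⟩ := F
  obtain ⟨G, ν, _, _⟩ := G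
  obtain rfl : F = G := h
  obtain rfl : μ = ν := funext fun A => funext fun B => eq_of_heq (h' A B)
  rfl

/-- The functor `OTC(Par(-))` which sends a monoidal operational category to the theory of its
partial arrows. -/
def monOTCOfPar (h : MonParWellDefined.{v, u}) : MonOpCatStrict.{v, u} ⥤ MonOTC.{v, u} where
  obj B :=
    letI := (h.laws B).monoidalCategory
    letI := (h.laws B).symmetricCategory
    ⟨Par B.isTerminal, otcPar B.isTerminal, h.axioms B, h.monoidalAxioms B⟩
  map {B B'} F :=
    letI := (h.laws B).monoidalCategory
    letI := (h.laws B).symmetricCategory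
    letI := (h.laws B').monoidalCategory
    letI := (h.laws B').symmetricCategory
    ⟨Par.functor B.isTerminal B'.isTerminal (MonOpCatStrict.Hom.isStrict F),
      fun X Y => Par.ofTotal B'.isTerminal (MonOpCatStrict.Hom.μ F X.of Y.of), h.isMorphism F,
      h.isSymmMonoidal F⟩
  map_id B := MonOTC.Hom.ext_of_heq (Par.functor_id (MonOpCatStrict.Hom.isStrict (𝟙 B)))
    (fun X Y => heq_of_eq (by
      exact Par.hom_ext (Category.id_comp _)))
  map_comp {B₁ B₂ B₃} F G := MonOTC.Hom.ext_of_heq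
    (Par.functor_comp F.isStrict G.isStrict (F ≫ G).isStrict)
    (fun X Y => heq_of_eq (by
      refine (Par.ofTotal_comp (T := B₃.isTerminal) (G.μ _ _)
        (G.toFunctor.map (F.μ X.of Y.of))).trans ?_
      exact congrArg (_ ≫ ·) (Par.functor_map_ofTotal (T := B₂.isTerminal) (T' := B₃.isTerminal)
        G.isStrict (F.μ X.of Y.of)).symm))

/-! ### Restriction to full subcategories -/

/-- The positive theories which satisfy combining. -/
def OTC.positiveCombining : ObjectProperty OTC.{v, u} :=
  fun Θ => Θ.data.IsPositive ∧ OTCData.IsCombining Θ.ax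

/-- The effectuses, in total form. -/
def OpCatStrict.effectus : ObjectProperty OpCatStrict.{v, u} :=
  fun B => IsEffectus B.isTerminal

/-- The positive monoidal theories which satisfy combining. -/
def MonOTC.positiveCombining : ObjectProperty MonOTC.{v, u} :=
  fun Θ => Θ.data.IsPositive ∧ OTCData.IsCombining Θ.ax

/-- The monoidal effectuses, in total form. -/
def MonOpCatStrict.effectus : ObjectProperty MonOpCatStrict.{v, u} :=
  fun B => IsEffectus B.isTerminal

/-- An adjunction restricts to full subcategories: both functors restrict to functors between the
subcategories, and these are adjoint, with the same unit. -/
def RestrictsTo {C : Type*} [Category* C] {D : Type*} [Category* D] {L : C ⥤ D} {R : D ⥤ C}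
    (adj : L ⊣ R) (P : ObjectProperty C) (Q : ObjectProperty D) : Prop :=
  ∃ (hL : ∀ X, P X → Q (L.obj X)) (hR : ∀ Y, Q Y → P (R.obj Y))
    (adj' : Q.lift (P.ι ⋙ L) (fun X => hL X.obj X.property) ⊣
      P.lift (Q.ι ⋙ R) (fun Y => hR Y.obj Y.property)),
    ∀ X, (adj'.unit.app X).hom = adj.unit.app X.obj

end OpTheory

end

set_option linter.unusedSectionVars false

noncomputable section

namespace OpTheory

open SpecCoproducts

/-! Both constructions rest on one dictionary: a finite test on `A` with outcomes `B_x` is a total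
arrow from `A` to the coproduct of the `B_x`, recovered from its components along the projections
`▷_x`.

From operational categories to theories. `IsPartialForm` isolates what is needed of the category of
partial arrows. Joint monicity extends from `A + A` to all finite coproducts
(`IsPartialForm.sum_ext`, `IsPartialForm.coprod_ext`), so a test is coded by exactly one total arrow
into any chosen coproduct with total coprojections, and a partial test by an arbitrary arrow into it
(`isTest_iff`, `isPartialTest_iff`). Control, coarse-graining and complements then become statements
about composing with copairings (`IsPartialForm.axioms`). A strict functor preserves coproducts,
zero arrows and discarding, hence all of this data (`IsPartialFunctor.isMorphism`).

From theories to operational categories. A row of a matrix into `Y + 1` is a test whose last outcome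
is an effect, and by uniqueness of complements this effect is determined by the other entries
(`perp_row`). This gives the axioms of an operational category, and it identifies partial arrows
between collections with matrices whose rows are partial tests (`Par.entry_ext`,
`Par.exists_entry`).

The adjunction. The unit sends an event to the corresponding one-by-one matrix. The counit sends a
collection to its coproduct and a matrix to the total arrow which its rows define; that arrow comes
from the operational category because total partial arrows do (`Par.exists_ofTotal`). One triangle
identity (`Par.unit_comp_functor_counit`) makes transposition surjective. It is injective because a
strict functor on collections is determined by single systems: collections are iterated sums of
these, and a matrix is determined by its composites with coprojections and projections
(`Par.eq_of_unit_comp_eq`). With naturality of the unit this suffices (`exists_adjunction`).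

Restriction. Positivity and combining say precisely that certain effects vanish and that certain
partial tests glue, which is what the two pullback squares of an effectus express, in both
directions. The subcategories are full, so the adjunction restricts with the same unit.

Monoidal case. By distributivity, tensors of coprojections are coprojections of the tensor, and so
are jointly epic. Coherence laws for matrices therefore reduce to single systems, and laws for
partial arrows reduce to total arrows together with the arrows `A + 1 ⇀ A`, where they are checked
on summands. The comparison maps of the unit are identities, those of the counit are the canonical
isomorphisms of coproducts, and a natural comparison map is fixed by its values on single systems
(`OTCData.Coll.μ_eq_of_single`). -/

/-! ## Coproducts of families -/

/-- The arrows `ι x : B x ⟶ P` are the coprojections of a coproduct. -/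
structure IsCoprod {C : Type u} [Category.{v} C] {X : Type} {B : X → C} {P : C}
    (ι : ∀ x, B x ⟶ P) : Prop where
  exists_desc : ∀ {Z : C} (f : ∀ x, B x ⟶ Z), ∃ g : P ⟶ Z, ∀ x, ι x ≫ g = f x
  hom_ext : ∀ {Z : C} {f g : P ⟶ Z}, (∀ x, ι x ≫ f = ι x ≫ g) → f = g

namespace IsCoprod

variable {C : Type u} [Category.{v} C] {X : Type} {B : X → C} {P : C} {ι : ∀ x, B x ⟶ P}

/-- The copairing of a family of arrows. -/
def desc (h : IsCoprod ι) {Z : C} (f : ∀ x, B x ⟶ Z) : P ⟶ Z := (h.exists_desc f).choose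

@[simp]
theorem ι_desc (h : IsCoprod ι) {Z : C} (f : ∀ x, B x ⟶ Z) (x : X) : ι x ≫ h.desc f = f x :=
  (h.exists_desc f).choose_spec x

@[simp]
theorem ι_desc_assoc (h : IsCoprod ι) {Z W : C} (f : ∀ x, B x ⟶ Z) (x : X) (k : Z ⟶ W) :
    ι x ≫ h.desc f ≫ k = f x ≫ k := by
  rw [← Category.assoc, ι_desc]

theorem ofCofan {c : Cofan B} (hc : IsColimit c) : IsCoprod c.inj where
  exists_desc f := ⟨Cofan.IsColimit.desc hc f, Cofan.IsColimit.fac hc f⟩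
  hom_ext h := Cofan.IsColimit.hom_ext hc _ _ h

/-- The colimit cofan given by the coprojections of a coproduct. -/
def isColimit (h : IsCoprod ι) : IsColimit (Cofan.mk P ι) :=
  Cofan.IsColimit.mk _ (fun s => h.desc s.inj) (fun s x => h.ι_desc s.inj x)
    (fun _ _ hm => h.hom_ext (fun x => (hm x).trans (h.ι_desc _ x).symm))

theorem reindex (h : IsCoprod ι) {Y : Type} (e : Y ≃ X) :
    IsCoprod (B := fun y => B (e y)) (fun y => ι (e y)) where
  exists_desc {Z} f := by
    -- The target index `x` is kept free so that `e y = x` can be eliminated; `e (e.symm x) = x` is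
    -- not definitional, and a direct definition of the family would carry transports.
    have key : ∀ x y (hy : e y = x), ∃ g : B x ⟶ Z, ∀ y' (hy' : e y' = x),
        g = eqToHom (by rw [hy']) ≫ f y' := by
      rintro _ y rfl
      refine ⟨f y, fun y' hy' => ?_⟩
      obtain rfl := e.injective hy'
      simp
    choose g hg using fun x => key x (e.symm x) (e.apply_symm_apply x)
    refine ⟨h.desc g, fun y => ?_⟩
    rw [ι_desc, hg (e y) y rfl, eqToHom_refl, Category.id_comp]
  hom_ext hh := h.hom_ext (fun x => by
    obtain ⟨y, rfl⟩ := e.surjective x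
    exact hh y)

theorem of_isIso (h : IsCoprod ι) {Q : C} (φ : P ⟶ Q) [IsIso φ] {κ : ∀ x, B x ⟶ Q}
    (hκ : ∀ x, ι x ≫ φ = κ x) : IsCoprod κ where
  exists_desc f := ⟨inv φ ≫ h.desc f, fun x => by simp [← hκ]⟩
  hom_ext hh := by
    rw [← cancel_epi φ]
    exact h.hom_ext (fun x => by simpa [← hκ] using hh x)

theorem isIso_desc (h : IsCoprod ι) {Q : C} {κ : ∀ x, B x ⟶ Q} (hκ : IsCoprod κ) :
    IsIso (h.desc κ) :=
  ⟨hκ.desc ι, h.hom_ext (by simp), hκ.hom_ext (by simp)⟩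

theorem of_unique (X : Type) [Unique X] (B : X → C) {P : C} (φ : ∀ x, B x ⟶ P)
    [∀ x, IsIso (φ x)] : IsCoprod φ where
  exists_desc f := ⟨inv (φ default) ≫ f default, fun x => by
    obtain rfl := Subsingleton.elim x default
    simp⟩
  hom_ext hh := (cancel_epi (φ default)).1 (hh default)

theorem fin_two {B : Fin 2 → C} (ι : ∀ i, B i ⟶ P)
    (h₁ : ∀ {Z : C} (a : B 0 ⟶ Z) (b : B 1 ⟶ Z), ∃ g : P ⟶ Z, ι 0 ≫ g = a ∧ ι 1 ≫ g = b)
    (h₂ : ∀ {Z : C} {f g : P ⟶ Z}, ι 0 ≫ f = ι 0 ≫ g → ι 1 ≫ f = ι 1 ≫ g → f = g) :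
    IsCoprod ι where
  exists_desc f := by
    obtain ⟨g, hg, hg'⟩ := h₁ (f 0) (f 1)
    exact ⟨g, fun i => match i with
      | 0 => hg
      | 1 => hg'⟩
  hom_ext hh := h₂ (hh 0) (hh 1)

/-- Copairing can be done in two stages. This underlies both control, where outcomes are indexed by
dependent pairs, and the coproducts formed by tensoring two families. -/
theorem sigma {X : Type} {Y : X → Type} {B : (Σ x, Y x) → C} {Q : X → C} {P : C}
    {ι : ∀ x, Q x ⟶ P} {κ : ∀ x y, B ⟨x, y⟩ ⟶ Q x} (h : IsCoprod ι) (h' : ∀ x, IsCoprod (κ x)) :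
    IsCoprod (B := B) (fun p => κ p.1 p.2 ≫ ι p.1) where
  exists_desc f := ⟨h.desc (fun x => (h' x).desc (fun y => f ⟨x, y⟩)), fun p => by simp⟩
  hom_ext hh := h.hom_ext (fun x => (h' x).hom_ext (fun y => by simpa using hh ⟨x, y⟩))

variable [SpecCoproducts C]

/-- The coprojections of a binary coproduct of coproducts. -/
def sumι {X Y : Type} {B : X ⊕ Y → C} {P Q : C} (ι : ∀ x, B (.inl x) ⟶ P)
    (κ : ∀ y, B (.inr y) ⟶ Q) : ∀ s, B s ⟶ sum P Q
  | .inl x => ι x ≫ inl P Q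
  | .inr y => κ y ≫ inr P Q

theorem sum {X Y : Type} {B : X ⊕ Y → C} {P Q : C} {ι : ∀ x, B (.inl x) ⟶ P}
    {κ : ∀ y, B (.inr y) ⟶ Q} (h : IsCoprod ι) (h' : IsCoprod κ) : IsCoprod (sumι ι κ) where
  exists_desc f := ⟨SpecCoproducts.desc (h.desc fun x => f (.inl x)) (h'.desc fun y => f (.inr y)),
    fun s => match s with
      | .inl x => by simp [sumι]
      | .inr y => by simp [sumι]⟩
  hom_ext hh := SpecCoproducts.hom_ext
    (h.hom_ext (fun x => by simpa [sumι] using hh (.inl x)))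
    (h'.hom_ext (fun y => by simpa [sumι] using hh (.inr y)))

end IsCoprod

/-! ### Coproducts over inductively generated index sets -/

section

variable {C : Type u} [Category.{v} C] [SpecCoproducts C]

/-- The coproduct of a family which is indexed by a shape. -/
def Shape.coprod : (s : Shape) → (s.Idx → C) → C
  | .empty, _ => zero
  | .point, B => B ()
  | .plus s t, B => sum (s.coprod fun x => B (.inl x)) (t.coprod fun y => B (.inr y))

/-- The coprojections of the coproduct of a family which is indexed by a shape. -/
def Shape.ι : (s : Shape) → (B : s.Idx → C) → (x : s.Idx) → (B x ⟶ s.coprod B)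
  | .empty, _, x => Empty.elim x
  | .point, B, _ => 𝟙 (B ())
  | .plus s t, _, x => IsCoprod.sumι (s.ι _) (t.ι _) x

theorem Shape.isCoprod : ∀ (s : Shape) (B : s.Idx → C), IsCoprod (s.ι B)
  | .empty, _ =>
    { exists_desc := fun _ => ⟨isInitial.to _, fun x => Empty.elim x⟩
      hom_ext := fun _ => isInitial.hom_ext _ _ }
  | .point, _ =>
    { exists_desc := fun f => ⟨f (), fun _ => Category.id_comp (f ())⟩
      hom_ext := fun {_} {f} {g} hh =>
        (Category.id_comp f).symm.trans ((hh ()).trans (Category.id_comp g)) }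
  | .plus s t, B => (s.isCoprod fun x => B (.inl x)).sum (t.isCoprod fun y => B (.inr y))

/-- Reduces statements on arbitrary finite families to induction on shapes, where coproducts are
computed from the specified binary sums and the initial object. -/
theorem Shape.exists_equiv (X : Type) [Finite X] : ∃ s : Shape, Nonempty (s.Idx ≃ X) := by
  induction X using Finite.induction_empty_option with
  | of_equiv e h =>
    obtain ⟨s, ⟨e'⟩⟩ := h
    exact ⟨s, ⟨e'.trans e⟩⟩
  | h_empty => exact ⟨.empty, ⟨Equiv.equivPEmpty Empty⟩⟩
  | h_option h =>
    obtain ⟨s, ⟨e⟩⟩ := h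
    exact ⟨.plus s .point, ⟨((Equiv.sumCongr e (Equiv.refl Unit)).trans
      (Equiv.optionEquivSumPUnit.{0} _).symm)⟩⟩

end

/-! ### Projections -/

section

variable {C : Type u} [Category.{v} C] [HasZeroMorphisms C]

namespace IsCoprod

variable {X : Type} {B : X → C} {P : C} {ι : ∀ x, B x ⟶ P}

open Classical in
/-- The projection of a coproduct onto one of its summands. -/
def proj (h : IsCoprod ι) (x : X) : P ⟶ B x :=
  h.desc (fun y => if e : y = x then eqToHom (congrArg B e) else 0)

@[simp]
theorem ι_proj_self (h : IsCoprod ι) (x : X) : ι x ≫ h.proj x = 𝟙 (B x) := by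
  simp [proj]

theorem ι_proj_ne (h : IsCoprod ι) {x y : X} (n : x ≠ y) : ι x ≫ h.proj y = 0 := by
  simp [proj, n]

@[simp]
theorem ι_proj_self_assoc (h : IsCoprod ι) (x : X) {Z : C} (k : B x ⟶ Z) :
    ι x ≫ h.proj x ≫ k = k := by
  rw [← Category.assoc, ι_proj_self, Category.id_comp]

theorem ι_proj_ne_assoc (h : IsCoprod ι) {x y : X} (n : x ≠ y) {Z : C} (k : B y ⟶ Z) :
    ι x ≫ h.proj y ≫ k = 0 := by
  rw [← Category.assoc, ι_proj_ne h n, zero_comp]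

/-- The criterion behind all later identifications of projections: it suffices to know the
composites with the coprojections. -/
theorem eq_proj (h : IsCoprod ι) {x : X} {p : P ⟶ B x} (h₁ : ι x ≫ p = 𝟙 (B x))
    (h₀ : ∀ y, y ≠ x → ι y ≫ p = 0) : p = h.proj x :=
  h.hom_ext (fun y => by
    by_cases e : y = x
    · subst e
      rw [h₁, ι_proj_self]
    · rw [h₀ y e, ι_proj_ne h e])

/-- Tests are defined through colimit cofans, the arguments below through `IsCoprod`; this lemma and
the next translate the projections in the two directions. -/
theorem proj_eq_proj {c : Cofan B} (hc : IsColimit c) (x : X) :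
    OpTheory.proj hc x = (ofCofan hc).proj x :=
  eq_proj _ ((Cofan.IsColimit.fac hc _ x).trans (by simp))
    (fun y e => (Cofan.IsColimit.fac hc _ y).trans (by simp [e]))

theorem proj_eq_proj_isColimit (h : IsCoprod ι) (x : X) :
    OpTheory.proj h.isColimit x = h.proj x :=
  eq_proj h ((Cofan.IsColimit.fac h.isColimit _ x).trans (by simp))
    (fun y e => (Cofan.IsColimit.fac h.isColimit _ y).trans (by simp [e]))

theorem desc_proj (h : IsCoprod ι) {Q : C} {κ : ∀ x, B x ⟶ Q} (hκ : IsCoprod κ) (x : X) :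
    h.desc κ ≫ hκ.proj x = h.proj x :=
  eq_proj h (by simp) (fun y e => by simp [ι_proj_ne hκ e])

theorem reindex_proj (h : IsCoprod ι) {Y : Type} (e : Y ≃ X) (y : Y) :
    (h.reindex e).proj y = h.proj (e y) :=
  (eq_proj (h.reindex e) (h.ι_proj_self (e y))
    (fun _ n => h.ι_proj_ne (fun n' => n (e.injective n')))).symm

theorem sigma_proj {X : Type} {Y : X → Type} {B : (Σ x, Y x) → C} {Q : X → C} {P : C}
    {ι : ∀ x, Q x ⟶ P} {κ : ∀ x y, B ⟨x, y⟩ ⟶ Q x} (h : IsCoprod ι) (h' : ∀ x, IsCoprod (κ x))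
    (p : Σ x, Y x) : (h.sigma h').proj p = h.proj p.1 ≫ (h' p.1).proj p.2 := by
  refine (eq_proj _ (by simp) ?_).symm
  rintro ⟨x, y⟩ n
  obtain ⟨x', y'⟩ := p
  by_cases e : x = x'
  · subst e
    simp only [Category.assoc, ι_proj_self_assoc]
    exact ι_proj_ne (h' x) (fun e => n (congrArg (Sigma.mk x) e))
  · simp [ι_proj_ne_assoc h e]

variable [SpecCoproducts C]

theorem sum_proj_inl {X Y : Type} {B : X ⊕ Y → C} {P Q : C} {ι : ∀ x, B (.inl x) ⟶ P}
    {κ : ∀ y, B (.inr y) ⟶ Q} (h : IsCoprod ι) (h' : IsCoprod κ) (x : X) :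
    (h.sum h').proj (.inl x) = SpecCoproducts.desc (𝟙 P) 0 ≫ h.proj x := by
  refine (eq_proj _ (by simp [sumι]) (fun s n => ?_)).symm
  rcases s with y | y
  · simp only [sumι, Category.assoc, inl_desc_assoc, Category.id_comp]
    exact ι_proj_ne h (fun e => n (congrArg Sum.inl e))
  · simp [sumι]

theorem sum_proj_inr {X Y : Type} {B : X ⊕ Y → C} {P Q : C} {ι : ∀ x, B (.inl x) ⟶ P}
    {κ : ∀ y, B (.inr y) ⟶ Q} (h : IsCoprod ι) (h' : IsCoprod κ) (y : Y) :
    (h.sum h').proj (.inr y) = SpecCoproducts.desc 0 (𝟙 Q) ≫ h'.proj y := by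
  refine (eq_proj _ (by simp [sumι]) (fun s n => ?_)).symm
  rcases s with x | x
  · simp [sumι]
  · simp only [sumι, Category.assoc, inr_desc_assoc, Category.id_comp]
    exact ι_proj_ne h' (fun e => n (congrArg Sum.inr e))

end IsCoprod

end

/-! ## Categories of partial arrows, abstractly -/

/-- Totality can be tested on the summands, provided that the coprojections are total themselves. In
particular comparison arrows between coproducts with total coprojections are total. -/
theorem IsCoprod.desc_total {C : Type u} [Category.{v} C] {I : C} {d : ∀ A : C, A ⟶ I}
    {X : Type} {B : X → C} {P Q : C} {ι : ∀ x, B x ⟶ P}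
    (h : IsCoprod ι)
    (t : ∀ x, ι x ≫ d P = d (B x)) {κ : ∀ x, B x ⟶ Q} (t' : ∀ x, κ x ≫ d Q = d (B x)) :
    h.desc κ ≫ d Q = d P :=
  h.hom_ext (fun x => by rw [IsCoprod.ι_desc_assoc, t, t'])

section

variable {C : Type u} [Category.{v} C]

/-- The coprojection of a coproduct with one summand, as a family which is indexed by `Fin 1`. -/
def oneι (B : Fin 1 → C) : ∀ i, B i ⟶ B 0
  | 0 => 𝟙 _

theorem isCoprod_oneι (B : Fin 1 → C) : IsCoprod (oneι B) :=
  have : ∀ i, IsIso (oneι B i) := fun i => match i with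
    | 0 => inferInstanceAs (IsIso (𝟙 (B 0)))
  IsCoprod.of_unique _ _ _

variable [SpecCoproducts C]

/-- The coprojections of a binary coproduct, as a family which is indexed by `Fin 2`. -/
def pairι (B : Fin 2 → C) : ∀ i, B i ⟶ sum (B 0) (B 1)
  | 0 => inl _ _
  | 1 => inr _ _

theorem isCoprod_pairι (B : Fin 2 → C) : IsCoprod (pairι B) :=
  IsCoprod.fin_two _ (fun a b => ⟨desc a b, inl_desc _ _, inr_desc _ _⟩)
    (fun h₁ h₂ => SpecCoproducts.hom_ext h₁ h₂)

/-- The coprojections of a ternary coproduct, as a family which is indexed by `Fin 3`. -/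
def tripleι (B : Fin 3 → C) : ∀ i, B i ⟶ sum (sum (B 0) (B 1)) (B 2)
  | 0 => inl _ _ ≫ inl _ _
  | 1 => inr _ _ ≫ inl _ _
  | 2 => inr _ _

theorem isCoprod_tripleι (B : Fin 3 → C) : IsCoprod (tripleι B) where
  exists_desc f := ⟨desc (desc (f 0) (f 1)) (f 2), fun i => match i with
    | 0 => by simp [tripleι]
    | 1 => by simp [tripleι]
    | 2 => by simp [tripleι]⟩
  hom_ext hh := SpecCoproducts.hom_ext (SpecCoproducts.hom_ext
    (by simpa [tripleι] using hh 0) (by simpa [tripleι] using hh 1)) (hh 2)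

end

/-! ### Tests and partial tests as arrows into coproducts -/

section

variable {C : Type u} [Category.{v} C] [HasZeroMorphisms C] [SpecCoproducts C]

/-- The properties of the category of partial arrows of an operational category, with its zero
arrows, coproducts and discarding maps `d`. -/
structure IsPartialForm {I : C} (d : ∀ A : C, A ⟶ I) : Prop where
  jointly_monic : ∀ {A X : C} (f g : X ⟶ sum A A), f ≫ desc (𝟙 A) 0 = g ≫ desc (𝟙 A) 0 →
    f ≫ desc 0 (𝟙 A) = g ≫ desc 0 (𝟙 A) → f = g
  inl_d : ∀ A B : C, inl A B ≫ d _ = d A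
  inr_d : ∀ A B : C, inr A B ≫ d _ = d B
  d_I : d I = 𝟙 I
  exists_total : ∀ {A B : C} (f : A ⟶ B), ∃ h : A ⟶ sum B I,
    h ≫ d _ = d A ∧ h ≫ desc (𝟙 B) 0 = f
  total_ext : ∀ {A : C} (h h' : A ⟶ sum I I), h ≫ d _ = d A → h' ≫ d _ = d A →
    h ≫ desc (𝟙 I) 0 = h' ≫ desc (𝟙 I) 0 → h = h'

namespace IsPartialForm

variable {I : C} {d : ∀ A : C, A ⟶ I}

/-- The axiom speaks of `A + A` only. The arrow `κ₁ + κ₂` embeds `A + B` in `(A + B) + (A + B)`,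
with the codiagonal as retraction, and its composites with the two projections there factor through
the projections of `A + B`. -/
theorem sum_ext (p : IsPartialForm d) {A B X : C} {f g : X ⟶ sum A B} (h₁ : f ≫ desc (𝟙 A) 0 = g ≫ desc (𝟙 A) 0)
    (h₂ : f ≫ desc 0 (𝟙 B) = g ≫ desc 0 (𝟙 B)) : f = g := by
  let k : sum A B ⟶ sum (sum A B) (sum A B) := desc (inl A B ≫ inl _ _) (inr A B ≫ inr _ _)
  have hk : k ≫ desc (𝟙 _) (𝟙 _) = 𝟙 (sum A B) :=
    SpecCoproducts.hom_ext (by simp [k]) (by simp [k])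
  have k₁ : k ≫ desc (𝟙 _) 0 = desc (𝟙 A) 0 ≫ inl A B :=
    SpecCoproducts.hom_ext (by simp [k]) (by simp [k])
  have k₂ : k ≫ desc 0 (𝟙 _) = desc 0 (𝟙 B) ≫ inr A B :=
    SpecCoproducts.hom_ext (by simp [k]) (by simp [k])
  have e : f ≫ k = g ≫ k := p.jointly_monic _ _
    (by simp only [Category.assoc, k₁]; rw [← Category.assoc, h₁, Category.assoc])
    (by simp only [Category.assoc, k₂]; rw [← Category.assoc, h₂, Category.assoc])
  calc f = (f ≫ k) ≫ desc (𝟙 _) (𝟙 _) := by rw [Category.assoc, hk, Category.comp_id]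
    _ = (g ≫ k) ≫ desc (𝟙 _) (𝟙 _) := by rw [e]
    _ = g := by rw [Category.assoc, hk, Category.comp_id]

theorem shape_ext (p : IsPartialForm d) : ∀ (s : Shape) (B : s.Idx → C) {A : C}
    {f g : A ⟶ s.coprod B},
    (∀ x, f ≫ (s.isCoprod B).proj x = g ≫ (s.isCoprod B).proj x) → f = g
  | .empty, B, A, f, g, _ => by
    -- The empty coproduct is initial, so its identity is zero and any arrow into it is zero.
    have e : 𝟙 (Shape.coprod .empty B) = 0 := isInitial.hom_ext _ _
    rw [← Category.comp_id f, ← Category.comp_id g, e, comp_zero, comp_zero]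
  | .point, B, A, f, g, hh => by
    have e : (Shape.isCoprod .point B).proj () = 𝟙 (B ()) :=
      (IsCoprod.eq_proj (ι := Shape.ι .point B) (x := ()) _ (Category.id_comp _)
        (fun y n => absurd rfl n)).symm
    have hh' := hh ()
    rw [e] at hh'
    exact (Category.comp_id f).symm.trans (hh'.trans (Category.comp_id g))
  | .plus s t, B, A, f, g, hh => by
    refine p.sum_ext (shape_ext p s _ fun x => ?_) (shape_ext p t _ fun y => ?_)
    · have e : (Shape.isCoprod (.plus s t) B).proj (.inl x) = _ :=
        IsCoprod.sum_proj_inl (s.isCoprod _) (t.isCoprod _) x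
      have := hh (.inl x)
      rw [e] at this
      exact (Category.assoc _ _ _).trans (this.trans (Category.assoc _ _ _).symm)
    · have e : (Shape.isCoprod (.plus s t) B).proj (.inr y) = _ :=
        IsCoprod.sum_proj_inr (s.isCoprod _) (t.isCoprod _) y
      have := hh (.inr y)
      rw [e] at this
      exact (Category.assoc _ _ _).trans (this.trans (Category.assoc _ _ _).symm)

theorem shape_total (p : IsPartialForm d) : ∀ (s : Shape) (B : s.Idx → C) (x : s.Idx),
    s.ι B x ≫ d _ = d (B x)
  | .empty, _, x => Empty.elim x
  | .point, _, _ => Category.id_comp (d _)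
  | .plus s _, _, .inl x =>
    (Category.assoc _ _ _).trans ((congrArg (_ ≫ ·) (p.inl_d _ _)).trans (shape_total p s _ x))
  | .plus _ t, _, .inr y =>
    (Category.assoc _ _ _).trans ((congrArg (_ ≫ ·) (p.inr_d _ _)).trans (shape_total p t _ y))

/-- Every finite family has a coproduct with total coprojections. -/
theorem exists_coprod (p : IsPartialForm d) {X : Type} [Finite X] (B : X → C) :
    ∃ (P : C) (ι : ∀ x, B x ⟶ P), IsCoprod ι ∧ ∀ x, ι x ≫ d P = d (B x) := by
  obtain ⟨s, ⟨e⟩⟩ := Shape.exists_equiv X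
  have h := (s.isCoprod fun i => B (e i)).reindex e.symm
  have t := fun x => p.shape_total s (fun i => B (e i)) (e.symm x)
  -- Reindexing back and forth gives a family that equals `B` only propositionally; with `B'` as a
  -- variable the equality can be substituted.
  have key : ∃ (B' : X → C) (_ : B' = B) (P : C) (ι : ∀ x, B' x ⟶ P), IsCoprod ι ∧
      ∀ x, ι x ≫ d P = d (B' x) :=
    ⟨_, funext fun x => by rw [e.apply_symm_apply], _, _, h, t⟩
  obtain ⟨_, rfl, hh⟩ := key
  exact hh

/-- Any finite coproduct is isomorphic to one over a shape by a comparison arrow that commutes with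
the projections, so `shape_ext` carries over. -/
theorem coprod_ext (p : IsPartialForm d) {X : Type} [Finite X] {B : X → C} {P : C}
    {ι : ∀ x, B x ⟶ P} (h : IsCoprod ι) {A : C} {f g : A ⟶ P}
    (hh : ∀ x, f ≫ h.proj x = g ≫ h.proj x) : f = g := by
  obtain ⟨s, ⟨e⟩⟩ := Shape.exists_equiv X
  let k := (h.reindex e).desc (s.ι fun i => B (e i))
  have := (h.reindex e).isIso_desc (s.isCoprod fun i => B (e i))
  rw [← cancel_mono k]
  refine p.shape_ext s _ fun x => ?_
  rw [Category.assoc, Category.assoc, IsCoprod.desc_proj, IsCoprod.reindex_proj]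
  exact hh _

/-- The definition asks for some coproduct with total coprojections. The comparison arrow to another
such coproduct is total and commutes with the projections, so the choice does not matter. -/
theorem isTest_iff {X : Type} [Finite X] {A : C} (f : X → Out A) {P : C}
    {ι : ∀ x, (f x).1 ⟶ P} (h : IsCoprod ι) (t : ∀ x, ι x ≫ d P = d (f x).1) :
    (otcFrom I d).IsTest f ↔ ∃ k : A ⟶ P, k ≫ d P = d A ∧ ∀ x, k ≫ h.proj x = (f x).2 := by
  constructor
  · rintro ⟨c, hc, tc, k, tk, hk⟩
    refine ⟨k ≫ (IsCoprod.ofCofan hc).desc ι, ?_, fun x => ?_⟩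
    · rw [Category.assoc, IsCoprod.desc_total _ tc t, tk]
    · rw [Category.assoc, IsCoprod.desc_proj, ← IsCoprod.proj_eq_proj, hk]
  · rintro ⟨k, tk, hk⟩
    refine ⟨_, h.isColimit, t, k, tk, fun x => ?_⟩
    rw [IsCoprod.proj_eq_proj_isColimit]
    exact hk x

theorem sumι_total (p : IsPartialForm d) {X Y : Type} {B : X ⊕ Y → C} {P Q : C}
    {ι : ∀ x, B (.inl x) ⟶ P} {κ : ∀ y, B (.inr y) ⟶ Q} (t : ∀ x, ι x ≫ d P = d (B (.inl x)))
    (t' : ∀ y, κ y ≫ d Q = d (B (.inr y))) : ∀ s, IsCoprod.sumι ι κ s ≫ d _ = d (B s)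
  | .inl x => by
    rw [IsCoprod.sumι, Category.assoc, p.inl_d, t]
  | .inr y => by
    rw [IsCoprod.sumι, Category.assoc, p.inr_d, t']

theorem isTest_sum_iff (p : IsPartialForm d) {X Y : Type} [Finite X] [Finite Y] {A : C}
    (f : X → Out A) (g : Y → Out A) {P Q : C} {ι : ∀ x, (f x).1 ⟶ P} {κ : ∀ y, (g y).1 ⟶ Q}
    (h : IsCoprod ι) (h' : IsCoprod κ) (t : ∀ x, ι x ≫ d P = d (f x).1)
    (t' : ∀ y, κ y ≫ d Q = d (g y).1) :
    (otcFrom I d).IsTest (Sum.elim f g) ↔ ∃ k : A ⟶ sum P Q, k ≫ d _ = d A ∧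
      (∀ x, k ≫ desc (𝟙 P) 0 ≫ h.proj x = (f x).2) ∧
      (∀ y, k ≫ desc 0 (𝟙 Q) ≫ h'.proj y = (g y).2) := by
  rw [isTest_iff (Sum.elim f g) (IsCoprod.sum (B := fun s => (Sum.elim f g s).1) h h')
    (p.sumι_total (B := fun s => (Sum.elim f g s).1) t t')]
  refine exists_congr fun k => and_congr_right fun _ => ⟨fun hh => ⟨fun x => ?_, fun y => ?_⟩,
    fun hh s => ?_⟩
  · have := hh (.inl x)
    rwa [IsCoprod.sum_proj_inl (B := fun s => (Sum.elim f g s).1) h h' x] at this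
  · have := hh (.inr y)
    rwa [IsCoprod.sum_proj_inr (B := fun s => (Sum.elim f g s).1) h h' y] at this
  · rcases s with x | y
    · rw [IsCoprod.sum_proj_inl (B := fun s => (Sum.elim f g s).1) h h' x]
      exact hh.1 x
    · rw [IsCoprod.sum_proj_inr (B := fun s => (Sum.elim f g s).1) h h' y]
      exact hh.2 y

/-- An arrow into the coproduct need not be total: `exists_total` completes it by one extra outcome
with values in `I`, which records that it is undefined. Conversely a test restricts along `▷₁`. -/
theorem isPartialTest_iff (p : IsPartialForm d) {X : Type} [Finite X] {A : C} (f : X → Out A)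
    {P : C} {ι : ∀ x, (f x).1 ⟶ P} (h : IsCoprod ι) (t : ∀ x, ι x ≫ d P = d (f x).1) :
    (otcFrom I d).IsPartialTest f ↔ ∃ k : A ⟶ P, ∀ x, k ≫ h.proj x = (f x).2 := by
  constructor
  · rintro ⟨Y, _, g, tg⟩
    obtain ⟨Q, κ, h', t'⟩ := p.exists_coprod (fun y => (g y).1)
    obtain ⟨k, -, hk, -⟩ := (p.isTest_sum_iff f g h h' t t').1 tg
    exact ⟨k ≫ desc (𝟙 P) 0, fun x => (Category.assoc _ _ _).trans (hk x)⟩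
  · rintro ⟨k, hk⟩
    obtain ⟨m, tm, hm⟩ := p.exists_total k
    refine ⟨Unit, inferInstance, fun _ => ev (m ≫ desc 0 (𝟙 I)), ?_⟩
    refine (p.isTest_sum_iff f (fun _ : Unit => ev (m ≫ desc 0 (𝟙 I))) h
      (IsCoprod.of_unique Unit (fun _ => I) (fun _ => 𝟙 I)) t (fun _ => Category.id_comp _)).2
      ⟨m, tm, fun x => ?_, fun _ => ?_⟩
    · rw [← Category.assoc, hm, hk]
    · rw [← IsCoprod.eq_proj (x := ()) (IsCoprod.of_unique Unit (fun _ => I) (fun _ => 𝟙 I))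
        (p := 𝟙 I) (Category.id_comp _) (fun y n => absurd rfl n), Category.comp_id]

theorem pairι_proj_zero (B : Fin 2 → C) : (isCoprod_pairι B).proj 0 = desc (𝟙 _) 0 :=
  (IsCoprod.eq_proj _ (inl_desc _ _) (fun y n => match y with
    | 0 => absurd rfl n
    | 1 => inr_desc _ _)).symm

theorem pairι_proj_one (B : Fin 2 → C) : (isCoprod_pairι B).proj 1 = desc 0 (𝟙 _) :=
  (IsCoprod.eq_proj _ (inr_desc _ _) (fun y n => match y with
    | 1 => absurd rfl n
    | 0 => inl_desc _ _)).symm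

theorem pairι_total (p : IsPartialForm d) (B : Fin 2 → C) :
    ∀ i, pairι B i ≫ d _ = d (B i)
  | 0 => p.inl_d _ _
  | 1 => p.inr_d _ _

theorem isTest_pair_iff (p : IsPartialForm d) {A B B' : C} (f : A ⟶ B) (g : A ⟶ B') :
    (otcFrom I d).IsTest ![ev f, ev g] ↔ ∃ k : A ⟶ sum B B', k ≫ d _ = d A ∧
      k ≫ desc (𝟙 B) 0 = f ∧ k ≫ desc 0 (𝟙 B') = g := by
  rw [isTest_iff ![ev f, ev g] (isCoprod_pairι fun i => (![ev f, ev g] i).1)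
    (p.pairι_total fun i => (![ev f, ev g] i).1), ]
  refine exists_congr fun k => and_congr_right fun _ => ?_
  rw [Fin.forall_fin_two, pairι_proj_zero, pairι_proj_one]
  rfl

theorem compat_iff (p : IsPartialForm d) {A B : C} (f g : A ⟶ B) :
    (otcFrom I d).Compat f g ↔ ∃ k : A ⟶ sum B B, k ≫ desc (𝟙 B) 0 = f ∧
      k ≫ desc 0 (𝟙 B) = g := by
  unfold TestSpec.Compat
  rw [isPartialTest_iff p ![ev f, ev g] (isCoprod_pairι fun i => (![ev f, ev g] i).1)
    (p.pairι_total fun i => (![ev f, ev g] i).1), ]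
  refine exists_congr fun k => ?_
  rw [Fin.forall_fin_two, pairι_proj_zero, pairι_proj_one]
  rfl

/-- The arrow picked by `Classical.epsilon` is unique by joint monicity, so coarse-graining can be
computed from any witness `k` at hand. -/
theorem ovee_eq (p : IsPartialForm d) {A B : C} {f g : A ⟶ B} (c : (otcFrom I d).Compat f g)
    (k : A ⟶ sum B B) (h₁ : k ≫ desc (𝟙 B) 0 = f) (h₂ : k ≫ desc 0 (𝟙 B) = g) :
    (otcFrom I d).ovee f g c = k ≫ desc (𝟙 B) (𝟙 B) := by
  have e := @Classical.epsilon_spec _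
    (fun h : A ⟶ sum B B => h ≫ desc (𝟙 B) 0 = f ∧ h ≫ desc 0 (𝟙 B) = g) ⟨k, h₁, h₂⟩
  refine congrArg (· ≫ desc (𝟙 B) (𝟙 B)) (p.jointly_monic _ _ ?_ ?_)
  · rw [h₁]
    exact e.1
  · rw [h₂]
    exact e.2

theorem oneι_proj (B : Fin 1 → C) : (isCoprod_oneι B).proj 0 = 𝟙 (B 0) :=
  (IsCoprod.eq_proj _ (Category.id_comp _) (fun _ n => absurd (Subsingleton.elim _ _) n)).symm

theorem oneι_total (B : Fin 1 → C) : ∀ i, oneι B i ≫ d _ = d (B i)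
  | 0 => Category.id_comp _

/-- A coproduct with one summand is the summand itself, so deterministic events are the total
arrows. -/
theorem isDet_iff {A B : C} (f : A ⟶ B) : (otcFrom I d).IsDet f ↔ f ≫ d B = d A := by
  unfold TestSpec.IsDet
  rw [isTest_iff ![ev f] (isCoprod_oneι fun i => (![ev f] i).1)
    (oneι_total fun i => (![ev f] i).1)]
  simp only [Fin.forall_fin_one, oneι_proj]
  constructor
  · rintro ⟨k, tk, hk⟩
    have e : k = f := (Category.comp_id k).symm.trans hk
    rw [← e]
    exact tk
  · exact fun t => ⟨f, t, Category.comp_id f⟩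

end IsPartialForm

end

/-! ### Partial arrows satisfy the axioms of a theory -/

namespace IsPartialForm

variable {C : Type u} [Category.{v} C] [HasZeroMorphisms C] [SpecCoproducts C]
  {I : C} {d : ∀ A : C, A ⟶ I}

theorem tripleι_proj_zero (B : Fin 3 → C) :
    (isCoprod_tripleι B).proj 0 = desc (desc (𝟙 _) 0) 0 :=
  (IsCoprod.eq_proj _ (by simp [tripleι]) (fun y n => match y with
    | 0 => absurd rfl n
    | 1 => by simp [tripleι]
    | 2 => by simp [tripleι])).symm

theorem tripleι_proj_one (B : Fin 3 → C) :
    (isCoprod_tripleι B).proj 1 = desc (desc 0 (𝟙 _)) 0 :=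
  (IsCoprod.eq_proj _ (by simp [tripleι]) (fun y n => match y with
    | 0 => by simp [tripleι]
    | 1 => absurd rfl n
    | 2 => by simp [tripleι])).symm

theorem tripleι_proj_two (B : Fin 3 → C) : (isCoprod_tripleι B).proj 2 = desc 0 (𝟙 _) :=
  (IsCoprod.eq_proj _ (by simp [tripleι]) (fun y n => match y with
    | 0 => by simp [tripleι]
    | 1 => by simp [tripleι]
    | 2 => absurd rfl n)).symm

theorem tripleι_total (p : IsPartialForm d) (B : Fin 3 → C) :
    ∀ i, tripleι B i ≫ d _ = d (B i)
  | 0 => by simp [tripleι, p.inl_d]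
  | 1 => by simp [tripleι, p.inl_d, p.inr_d]
  | 2 => by simp [tripleι, p.inr_d]

/-- If `k` codes the first test and `m x` the tests performed after it, then `k` followed by the
copairing of the `m x ≫ ι' x` is a total arrow into the iterated coproduct and codes the composite
test. -/
theorem isTest_control (p : IsPartialForm d) {X : Type} [Finite X] {Y : X → Type}
    [∀ x, Finite (Y x)] {A : C} (f : X → Out A) (g : ∀ x, Y x → Out (f x).1)
    (tf : (otcFrom I d).IsTest f) (tg : ∀ x, (otcFrom I d).IsTest (g x)) :
    (otcFrom I d).IsTest (fun q : (Σ x, Y x) => ev ((f q.1).2 ≫ (g q.1 q.2).2)) := by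
  obtain ⟨P, ι, h, t⟩ := p.exists_coprod (fun x => (f x).1)
  choose Q κ h' t' using fun x => p.exists_coprod (fun y => (g x y).1)
  obtain ⟨P', ι', h'', t''⟩ := p.exists_coprod Q
  obtain ⟨k, tk, hk⟩ := (isTest_iff f h t).1 tf
  choose m tm hm using fun x => (isTest_iff (g x) (h' x) (t' x)).1 (tg x)
  refine (isTest_iff (fun q : (Σ x, Y x) => ev ((f q.1).2 ≫ (g q.1 q.2).2))
    (IsCoprod.sigma (B := fun q : (Σ x, Y x) => (g q.1 q.2).1) h'' h') (fun q => ?_)).2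
    ⟨k ≫ h.desc (fun x => m x ≫ ι' x), ?_, fun q => ?_⟩
  · rw [Category.assoc, t'', t']
  · have : h.desc (fun x => m x ≫ ι' x) ≫ d _ = d _ := h.hom_ext (fun x => by
      rw [IsCoprod.ι_desc_assoc, Category.assoc, t'', tm, t])
    rw [Category.assoc, this, tk]
  -- Projecting to the group of outcomes `q.1` leaves only the summand `q.1` of the copairing.
  · have e : h.desc (fun x => m x ≫ ι' x) ≫ h''.proj q.1 = h.proj q.1 ≫ m q.1 :=
      h.hom_ext (fun x => by
        by_cases hx : x = q.1
        · subst hx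
          simp
        · simp [IsCoprod.ι_proj_ne h'' hx, IsCoprod.ι_proj_ne_assoc h hx])
    rw [IsCoprod.sigma_proj (B := fun q : (Σ x, Y x) => (g q.1 q.2).1) h'' h']
    rw [Category.assoc, reassoc_of% e, ← Category.assoc k, hk]
    exact congrArg ((f q.1).2 ≫ ·) (hm q.1 q.2)

theorem isTest_sum_one_iff (p : IsPartialForm d) {X : Type} [Finite X] {A B : C}
    (f : X → Out A) (g : A ⟶ B) {P : C} {ι : ∀ x, (f x).1 ⟶ P} (h : IsCoprod ι)
    (t : ∀ x, ι x ≫ d P = d (f x).1) :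
    (otcFrom I d).IsTest (Sum.elim f ![ev g]) ↔ ∃ k : A ⟶ sum P B, k ≫ d _ = d A ∧
      (∀ x, k ≫ desc (𝟙 P) 0 ≫ h.proj x = (f x).2) ∧ k ≫ desc 0 (𝟙 B) = g := by
  rw [p.isTest_sum_iff f _ h (isCoprod_oneι _) t (oneι_total _)]
  simp only [Fin.forall_fin_one, oneι_proj]
  refine exists_congr fun k => and_congr_right fun _ => and_congr_right fun _ => ?_
  exact ⟨fun e => (congrArg (k ≫ ·) (Category.comp_id _).symm).trans e,
    fun e => (congrArg (k ≫ ·) (Category.comp_id _)).trans e⟩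

theorem isTest_sum_pair_iff (p : IsPartialForm d) {X : Type} [Finite X] {A B B' : C}
    (f : X → Out A) (g : A ⟶ B) (g' : A ⟶ B') {P : C} {ι : ∀ x, (f x).1 ⟶ P} (h : IsCoprod ι)
    (t : ∀ x, ι x ≫ d P = d (f x).1) :
    (otcFrom I d).IsTest (Sum.elim f ![ev g, ev g']) ↔
      ∃ k : A ⟶ sum P (sum B B'), k ≫ d _ = d A ∧
      (∀ x, k ≫ desc (𝟙 P) 0 ≫ h.proj x = (f x).2) ∧
      k ≫ desc 0 (𝟙 _) ≫ desc (𝟙 B) 0 = g ∧ k ≫ desc 0 (𝟙 _) ≫ desc 0 (𝟙 B') = g' := by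
  rw [p.isTest_sum_iff f _ h (isCoprod_pairι _) t (p.pairι_total _)]
  simp only [Fin.forall_fin_two, pairι_proj_zero, pairι_proj_one]
  rfl

/-- The test is an arrow into `P + (B + B)`; applying the codiagonal to the second summand gives a
total arrow into `P + B` which codes the coarser test. -/
theorem isTest_ovee (p : IsPartialForm d) {X : Type} [Finite X] {A B : C} (f : X → Out A)
    (g h : A ⟶ B) (c : (otcFrom I d).Compat g h)
    (t : (otcFrom I d).IsTest (Sum.elim f ![ev g, ev h])) :
    (otcFrom I d).IsTest (Sum.elim f ![ev ((otcFrom I d).ovee g h c)]) := by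
  obtain ⟨P, ι, hι, tι⟩ := p.exists_coprod (fun x => (f x).1)
  obtain ⟨k, tk, h₁, h₂, h₃⟩ := (p.isTest_sum_pair_iff f g h hι tι).1 t
  refine (p.isTest_sum_one_iff f _ hι tι).2
    ⟨k ≫ desc (inl P B) (desc (𝟙 B) (𝟙 B) ≫ inr P B), ?_, fun x => ?_, ?_⟩
  · have e : desc (inl P B) (desc (𝟙 B) (𝟙 B) ≫ inr P B) ≫ d _ = d _ :=
      SpecCoproducts.hom_ext (by simp [p.inl_d])
        (SpecCoproducts.hom_ext (by simp [p.inl_d, p.inr_d]) (by simp [p.inr_d]))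
    rw [Category.assoc, e, tk]
  · rw [← h₁ x, Category.assoc]
    congr 1
    exact SpecCoproducts.hom_ext (by simp) (SpecCoproducts.hom_ext (by simp) (by simp))
  · rw [p.ovee_eq c (k ≫ desc 0 (𝟙 (sum B B))) ((Category.assoc _ _ _).trans h₂)
      ((Category.assoc _ _ _).trans h₃), Category.assoc, Category.assoc]
    congr 1
    exact SpecCoproducts.hom_ext (by simp) (SpecCoproducts.hom_ext (by simp) (by simp))

/-- One arrow `k` into `(B + B) + B` codes the triple. Each of the four coarse-grainings is
witnessed by `k` followed by an arrow that merges or drops summands, and both sides become `k`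
followed by the threefold codiagonal. -/
theorem ovee_assoc (p : IsPartialForm d) {A B : C} (f g h : A ⟶ B)
    (t : (otcFrom I d).IsPartialTest ![ev f, ev g, ev h])
    (c₁ : (otcFrom I d).Compat f g) (c₂ : (otcFrom I d).Compat ((otcFrom I d).ovee f g c₁) h)
    (c₃ : (otcFrom I d).Compat g h) (c₄ : (otcFrom I d).Compat f ((otcFrom I d).ovee g h c₃)) :
    (otcFrom I d).ovee ((otcFrom I d).ovee f g c₁) h c₂ =
      (otcFrom I d).ovee f ((otcFrom I d).ovee g h c₃) c₄ := by
  obtain ⟨k, hk⟩ := (p.isPartialTest_iff ![ev f, ev g, ev h] (isCoprod_tripleι _)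
    (p.tripleι_total _)).1 t
  have a₀ := hk 0
  have a₁ := hk 1
  have a₂ := hk 2
  rw [tripleι_proj_zero] at a₀
  rw [tripleι_proj_one] at a₁
  rw [tripleι_proj_two] at a₂
  change A ⟶ sum (sum B B) B at k
  change k ≫ desc (desc (𝟙 B) 0) 0 = f at a₀
  change k ≫ desc (desc 0 (𝟙 B)) 0 = g at a₁
  change k ≫ desc 0 (𝟙 B) = h at a₂
  have ext₃ : ∀ {Z : C} {a b : sum (sum B B) B ⟶ Z}, inl _ _ ≫ inl _ _ ≫ a = inl _ _ ≫ inl _ _ ≫ b →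
      inr _ _ ≫ inl _ _ ≫ a = inr _ _ ≫ inl _ _ ≫ b → inr _ _ ≫ a = inr _ _ ≫ b → a = b :=
    fun h₁ h₂ h₃ => SpecCoproducts.hom_ext (SpecCoproducts.hom_ext h₁ h₂) h₃
  have e₁ := p.ovee_eq c₁ (k ≫ desc (𝟙 (sum B B)) 0)
    (by rw [← a₀, Category.assoc]; congr 1; exact ext₃ (by simp) (by simp) (by simp))
    (by rw [← a₁, Category.assoc]; congr 1; exact ext₃ (by simp) (by simp) (by simp))
  have e₃ := p.ovee_eq c₃ (k ≫ desc (desc 0 (inl B B)) (inr B B))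
    (by rw [← a₁, Category.assoc]; congr 1; exact ext₃ (by simp) (by simp) (by simp))
    (by rw [← a₂, Category.assoc]; congr 1; exact ext₃ (by simp) (by simp) (by simp))
  -- Witnesses for the outer sums: on the left the first two summands share a slot, on the right the
  -- last two do.
  rw [p.ovee_eq c₂ (k ≫ desc (desc (inl B B) (inl B B)) (inr B B))
    (by rw [e₁, Category.assoc, Category.assoc]; congr 1; exact ext₃ (by simp) (by simp) (by simp))
    (by rw [← a₂, Category.assoc]; congr 1; exact ext₃ (by simp) (by simp) (by simp)),
    p.ovee_eq c₄ (k ≫ desc (desc (inl B B) (inr B B)) (inr B B))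
    (by rw [← a₀, Category.assoc]; congr 1; exact ext₃ (by simp) (by simp) (by simp))
    (by rw [e₃, Category.assoc, Category.assoc]; congr 1; exact ext₃ (by simp) (by simp) (by simp)),
    Category.assoc, Category.assoc]
  congr 1
  exact ext₃ (by simp) (by simp) (by simp)

/-- The theory of a category of partial arrows. -/
theorem axioms (p : IsPartialForm d) : (otcFrom I d).Axioms where
  reindex {X Y} _ _ A e f tf := by
    obtain ⟨P, ι, h, t⟩ := p.exists_coprod (fun y => (f y).1)
    obtain ⟨k, tk, hk⟩ := (isTest_iff f h t).1 tf
    refine (isTest_iff (f ∘ e) (h.reindex e) (fun x => t (e x))).2 ⟨k, tk, fun x => ?_⟩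
    exact (congrArg (k ≫ ·) (h.reindex_proj e x)).trans (hk (e x))
  control := p.isTest_control
  ovee_test := p.isTest_ovee
  ovee_assoc := p.ovee_assoc
  ovee_comm {A B} g h c c' := by
    obtain ⟨k, h₁, h₂⟩ := (p.compat_iff g h).1 c
    -- The swap of the two summands witnesses the reversed pair and is absorbed by the codiagonal.
    rw [p.ovee_eq c k h₁ h₂, p.ovee_eq c' (k ≫ desc (inr B B) (inl B B))
      (by rw [← h₂, Category.assoc]; congr 1; exact SpecCoproducts.hom_ext (by simp) (by simp))
      (by rw [← h₁, Category.assoc]; congr 1; exact SpecCoproducts.hom_ext (by simp) (by simp)),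
      Category.assoc]
    congr 1
    exact SpecCoproducts.hom_ext (by simp) (by simp)
  ovee_comp {B C F} g h c f c' := by
    obtain ⟨k, h₁, h₂⟩ := (p.compat_iff g h).1 c
    rw [p.ovee_eq c k h₁ h₂, p.ovee_eq c' (k ≫ desc (f ≫ inl F F) (f ≫ inr F F))
      (by rw [← h₁, Category.assoc, Category.assoc]; congr 1
          exact SpecCoproducts.hom_ext (by simp) (by simp))
      (by rw [← h₂, Category.assoc, Category.assoc]; congr 1
          exact SpecCoproducts.hom_ext (by simp) (by simp)), Category.assoc, Category.assoc]
    congr 1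
    exact SpecCoproducts.hom_ext (by simp) (by simp)
  comp_ovee l g h c c' := by
    obtain ⟨k, h₁, h₂⟩ := (p.compat_iff g h).1 c
    rw [p.ovee_eq c k h₁ h₂, p.ovee_eq c' (l ≫ k) (by rw [Category.assoc, h₁])
      (by rw [Category.assoc, h₂]), Category.assoc]
  zero_comp _ := zero_comp
  comp_zero _ := comp_zero
  zero_test {X} _ A f B := by
    obtain ⟨P, ι, h, t⟩ := p.exists_coprod (fun x => (f x).1)
    rw [isTest_iff f h t, p.isTest_sum_one_iff f _ h t]
    constructor
    · rintro ⟨k, tk, hk⟩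
      exact ⟨k ≫ inl P B, by rw [Category.assoc, p.inl_d, tk],
        fun x => by rw [Category.assoc, inl_desc_assoc, Category.id_comp, hk], by simp; rfl⟩
    · rintro ⟨k, tk, hk, hk'⟩
      replace hk' : k ≫ desc 0 (𝟙 B) = 0 := hk'
      -- The component at `B` is zero, so by joint monicity `k` factors through `P`; this removes
      -- the impossible outcome.
      have e : k = (k ≫ desc (𝟙 P) 0) ≫ inl P B := p.sum_ext (by simp) (by simpa using hk')
      refine ⟨k ≫ desc (𝟙 P) 0, ?_, fun x => (Category.assoc _ _ _).trans (hk x)⟩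
      rw [← tk]
      conv_rhs => rw [e]
      rw [Category.assoc _ (inl P B), p.inl_d]
  ovee_zero {A B} f c := by
    rw [p.ovee_eq c (f ≫ inl B B) (by simp) (by simp; rfl)]
    simp
  id_det A := (isDet_iff _).2 (Category.id_comp _)
  mem_test {A B} f := by
    refine (p.isPartialTest_iff ![ev f] (isCoprod_oneι _) (oneι_total _)).2 ⟨f, ?_⟩
    rw [Fin.forall_fin_one, oneι_proj]
    exact Category.comp_id f
  compl {A} e := by
    -- The complement is the second component of the total arrow completing `e`; `total_ext` says
    -- that this total arrow is determined by its first component.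
    obtain ⟨k, tk, hk⟩ := p.exists_total e
    refine ⟨k ≫ desc 0 (𝟙 I), (p.isTest_pair_iff _ _).2 ⟨k, tk, hk, rfl⟩, fun e' he' => ?_⟩
    obtain ⟨k', tk', hk₁, rfl⟩ := (p.isTest_pair_iff _ _).1 he'
    rw [p.total_ext k k' tk tk' (hk.trans hk₁.symm)]

end IsPartialForm

/-! ### Coarse-graining, positivity and combining for partial arrows -/

namespace IsPartialForm

variable {C : Type u} [Category.{v} C] [HasZeroMorphisms C] [SpecCoproducts C]
  {I : C} {d : ∀ A : C, A ⟶ I}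

theorem disc_eq (ax : (otcFrom I d).Axioms) (A : C) (hI : d I = 𝟙 I) :
    OTCData.disc ax A = d A :=
  (OTCData.eq_disc ax ((isDet_iff (d A)).2 (by rw [hI, Category.comp_id]))).symm

/-- A copairing is the sum of its legs precomposed with the projections: after a coprojection, all
terms but one vanish. -/
theorem bigOvee_proj_comp (p : IsPartialForm d) (ax : (otcFrom I d).Axioms) {X : Type} [Finite X]
    {B : X → C} {P Z : C} {ι : ∀ x, B x ⟶ P} (h : IsCoprod ι) (k : ∀ x, B x ⟶ Z) :
    (otcFrom I d).bigOvee (fun x => h.proj x ≫ k x) = h.desc k := by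
  refine h.hom_ext fun y => ?_
  rw [OTCData.comp_bigOvee ax, OTCData.bigOvee_eq_single ax _ y, IsCoprod.ι_proj_self_assoc,
    IsCoprod.ι_desc]
  · intro x n
    exact IsCoprod.ι_proj_ne_assoc h n.symm (k x)
  · obtain ⟨P', ι', h', t'⟩ := p.exists_coprod (fun _ : X => Z)
    -- The summands are compatible because the copairing of the `k x ≫ ι' x`, into the copower of
    -- `Z`, has them as components.
    refine (p.isPartialTest_iff (fun x => ev (h.proj x ≫ k x)) h' t').2
      ⟨h.desc (fun x => k x ≫ ι' x), fun x => h.hom_ext fun z => ?_⟩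
    by_cases e : z = x
    · subst e
      simp
    · simp [IsCoprod.ι_proj_ne h' e, IsCoprod.ι_proj_ne_assoc h e]

theorem bigOvee_comp_desc (p : IsPartialForm d) (ax : (otcFrom I d).Axioms) {X : Type} [Finite X]
    {A : C} {B : X → C} {P Z : C} {ι : ∀ x, B x ⟶ P} (h : IsCoprod ι) (m : A ⟶ P)
    (k : ∀ x, B x ⟶ Z) :
    (otcFrom I d).bigOvee (fun x => (m ≫ h.proj x) ≫ k x) = m ≫ h.desc k := by
  rw [← p.bigOvee_proj_comp ax h k, OTCData.comp_bigOvee ax]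
  · simp only [Category.assoc]
  · obtain ⟨P', ι', h', t'⟩ := p.exists_coprod (fun _ : X => Z)
    refine (p.isPartialTest_iff (fun x => ev (h.proj x ≫ k x)) h' t').2
      ⟨h.desc (fun x => k x ≫ ι' x), fun x => h.hom_ext fun z => ?_⟩
    by_cases e : z = x
    · subst e
      simp
    · simp [IsCoprod.ι_proj_ne h' e, IsCoprod.ι_proj_ne_assoc h e]

/-- It is enough to treat two outcomes. The arrow coding the larger test has as `P`-component the
arrow coding `f`, which is total, so `pos` makes the `Q`-component zero and with it all the `g y`.
-/
theorem isPositive (p : IsPartialForm d)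
    (pos : ∀ {A P Q : C} (k : A ⟶ sum P Q), k ≫ d _ = d A → k ≫ desc (𝟙 P) 0 ≫ d P = d A →
      k ≫ desc 0 (𝟙 Q) = 0) : (otcFrom I d).IsPositive := by
  intro X Y _ _ A f g tf tg y
  obtain ⟨P, ι, h, t⟩ := p.exists_coprod (fun x => (f x).1)
  obtain ⟨Q, κ, h', t'⟩ := p.exists_coprod (fun y => (g y).1)
  obtain ⟨k, tk, hk⟩ := (isTest_iff f h t).1 tf
  obtain ⟨m, tm, h₁, h₂⟩ := (p.isTest_sum_iff f g h h' t t').1 tg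
  have e : m ≫ desc (𝟙 P) 0 = k := p.coprod_ext h (fun x => by rw [Category.assoc, h₁, hk])
  rw [← h₂ y, ← Category.assoc, pos m tm (by rw [← Category.assoc, e, tk])]
  exact zero_comp

/-- Partial tests are arrows `k : A ⟶ P` and `m : A ⟶ Q`, and coarse-graining their discarded
outcomes gives `k ≫ d P` and `m ≫ d Q`. Combining is thus reduced to gluing two partial arrows with
complementary domains. -/
theorem isCombining (p : IsPartialForm d) (ax : (otcFrom I d).Axioms)
    (comb : ∀ {A P Q : C} (f : A ⟶ P) (g : A ⟶ Q),
      (∃ k : A ⟶ sum I I, k ≫ d _ = d A ∧ k ≫ desc (𝟙 I) 0 = f ≫ d P ∧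
        k ≫ desc 0 (𝟙 I) = g ≫ d Q) →
      ∃ k : A ⟶ sum P Q, k ≫ d _ = d A ∧ k ≫ desc (𝟙 P) 0 = f ∧ k ≫ desc 0 (𝟙 Q) = g) :
    OTCData.IsCombining ax := by
  have key : ∀ {X : Type} [Finite X] {A : C} (f : X → Out A), (otcFrom I d).IsPartialTest f →
      ∀ {P : C} {ι : ∀ x, (f x).1 ⟶ P} (h : IsCoprod ι) (_ : ∀ x, ι x ≫ d P = d (f x).1),
      ∃ k : A ⟶ P, (∀ x, k ≫ h.proj x = (f x).2) ∧
      (otcFrom I d).bigOvee (fun x => (f x).2 ≫ OTCData.disc ax (f x).1) = k ≫ d P := by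
    intro X _ A f tf P ι h t
    obtain ⟨k, hk⟩ := (p.isPartialTest_iff f h t).1 tf
    refine ⟨k, hk, ?_⟩
    have e : d P = h.desc (fun x => d (f x).1) := h.hom_ext (fun x => by rw [t, IsCoprod.ι_desc])
    rw [e, ← p.bigOvee_comp_desc ax h k]
    simp only [hk, disc_eq ax _ p.d_I]
  intro X Y _ _ A f g tf tg hfg
  obtain ⟨P, ι, h, t⟩ := p.exists_coprod (fun x => (f x).1)
  obtain ⟨Q, κ, h', t'⟩ := p.exists_coprod (fun y => (g y).1)
  obtain ⟨k, hk, ek⟩ := key f tf h t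
  obtain ⟨m, hm, em⟩ := key g tg h' t'
  rw [ek, em] at hfg
  have hp : (otcFrom I d).IsTest ![ev (m ≫ d Q), ev (OTCData.perp ax (m ≫ d Q))] :=
    (ax.compl (m ≫ d Q)).choose_spec.1
  rw [← hfg] at hp
  obtain ⟨q, tq, q₁, q₂⟩ := (p.isTest_pair_iff _ _).1 hp
  -- The arrow `q` has the effect of `m` first and its complement, the effect of `k`, second; `comb`
  -- expects the other order, so the summands are swapped.
  have e : q ≫ desc (inr I I) (inl I I) ≫ d _ = q ≫ d _ := by
    congr 1
    exact SpecCoproducts.hom_ext (by simp [p.inl_d, p.inr_d]) (by simp [p.inl_d, p.inr_d])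
  have e₁ : q ≫ desc (inr I I) (inl I I) ≫ desc (𝟙 I) 0 = q ≫ desc 0 (𝟙 I) := by
    congr 1
    exact SpecCoproducts.hom_ext (by simp) (by simp)
  have e₂ : q ≫ desc (inr I I) (inl I I) ≫ desc 0 (𝟙 I) = q ≫ desc (𝟙 I) 0 := by
    congr 1
    exact SpecCoproducts.hom_ext (by simp) (by simp)
  obtain ⟨r, tr, r₁, r₂⟩ := comb k m ⟨q ≫ desc (inr I I) (inl I I), by rw [Category.assoc, e, tq],
    by rw [Category.assoc, e₁, q₂], by rw [Category.assoc, e₂, q₁]⟩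
  refine (p.isTest_sum_iff f g h h' t t').2 ⟨r, tr, fun x => ?_, fun y => ?_⟩
  · rw [← Category.assoc, r₁, hk]
  · rw [← Category.assoc, r₂, hm]

/-! ### The coproduct of a collection -/

section

variable {ax : (otcFrom I d).Axioms}

/-- The coproduct of the members of a collection. -/
abbrev total (X : OTCData.Coll ax) : C := X.shape.coprod X.fam

/-- The coprojections of the coproduct of the members of a collection. -/
abbrev totalι (X : OTCData.Coll ax) (x : X.Idx) : X.fam x ⟶ total X := X.shape.ι X.fam x

theorem isCoprod_total (X : OTCData.Coll ax) : IsCoprod (totalι X) := X.shape.isCoprod X.fam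

theorem totalι_d (p : IsPartialForm d) (X : OTCData.Coll ax) (x : X.Idx) :
    totalι X x ≫ d _ = d _ := p.shape_total _ _ _

theorem exists_row (p : IsPartialForm d) {X Y : OTCData.Coll ax} (M : X ⟶ Y) (x : X.Idx) :
    ∃ k : X.fam x ⟶ total Y, k ≫ d _ = d _ ∧
      ∀ y, k ≫ (isCoprod_total Y).proj y = M.entry x y :=
  (isTest_iff _ (isCoprod_total Y) (p.totalι_d Y)).1 (M.isTest x)

/-- The arrow between coproducts which is given by a matrix. -/
def totalMap (p : IsPartialForm d) {X Y : OTCData.Coll ax} (M : X ⟶ Y) : total X ⟶ total Y :=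
  (isCoprod_total X).desc (fun x => (p.exists_row M x).choose)

theorem totalMap_d (p : IsPartialForm d) {X Y : OTCData.Coll ax} (M : X ⟶ Y) :
    p.totalMap M ≫ d _ = d _ :=
  IsCoprod.desc_total _ (p.totalι_d X) (fun x => (p.exists_row M x).choose_spec.1)

theorem ι_totalMap_proj (p : IsPartialForm d) {X Y : OTCData.Coll ax} (M : X ⟶ Y) (x : X.Idx)
    (y : Y.Idx) : totalι X x ≫ p.totalMap M ≫ (isCoprod_total Y).proj y = M.entry x y := by
  rw [totalMap, IsCoprod.ι_desc_assoc]
  exact (p.exists_row M x).choose_spec.2 y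

/-- Coprojections are jointly epic and projections jointly monic, so an arrow between finite
coproducts is determined by its matrix. -/
theorem eq_totalMap (p : IsPartialForm d) {X Y : OTCData.Coll ax} (M : X ⟶ Y)
    {f : total X ⟶ total Y}
    (h : ∀ x y, totalι X x ≫ f ≫ (isCoprod_total Y).proj y = M.entry x y) : f = p.totalMap M :=
  (isCoprod_total X).hom_ext fun x => p.coprod_ext (isCoprod_total Y) fun y => by
    rw [Category.assoc, Category.assoc, h, p.ι_totalMap_proj]

theorem totalMap_id (p : IsPartialForm d) (X : OTCData.Coll ax) :
    p.totalMap (𝟙 X) = 𝟙 (total X) := by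
  refine (p.eq_totalMap _ fun x y => ?_).symm
  rw [Category.id_comp, OTCData.Coll.id_entry]
  by_cases e : x = y
  · subst e
    rw [OTCData.Coll.delta_self, IsCoprod.ι_proj_self]
  · rw [OTCData.Coll.delta_ne X e, IsCoprod.ι_proj_ne _ e]
    rfl

/-- Composition in the category of tests is defined as matrix multiplication, and
`bigOvee_comp_desc` identifies the sum over the middle index with composition through the middle
coproduct. -/
theorem totalMap_comp (p : IsPartialForm d) {X Y Z : OTCData.Coll ax} (M : X ⟶ Y) (N : Y ⟶ Z) :
    p.totalMap (M ≫ N) = p.totalMap M ≫ p.totalMap N := by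
  refine (p.eq_totalMap _ fun x z => ?_).symm
  rw [OTCData.Coll.comp_entry]
  have e : p.totalMap N ≫ (isCoprod_total Z).proj z =
      (isCoprod_total Y).desc (fun y => N.entry y z) :=
    (isCoprod_total Y).hom_ext fun y => by rw [p.ι_totalMap_proj, IsCoprod.ι_desc]
  rw [Category.assoc, e, ← Category.assoc, ← p.bigOvee_comp_desc ax (isCoprod_total Y)]
  simp only [Category.assoc, p.ι_totalMap_proj]

end

end IsPartialForm

/-! ## Functors which preserve sums -/

/-- The functor `K` preserves finite coproducts. -/
structure PreservesSums {C : Type u} [Category.{v} C] [SpecCoproducts C] {D : Type u}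
    [Category.{v} D] [SpecCoproducts D] (K : C ⥤ D) : Prop where
  isIso : ∀ A B : C, IsIso (desc (K.map (inl A B)) (K.map (inr A B)))
  isInitial : Nonempty (IsInitial (K.obj zero))

namespace PreservesSums

variable {C : Type u} [Category.{v} C] [SpecCoproducts C] {D : Type u} [Category.{v} D]
  [SpecCoproducts D] {K : C ⥤ D}

theorem sum_ext (hK : PreservesSums K) {A B : C} {Z : D} {f g : K.obj (sum A B) ⟶ Z}
    (h₁ : K.map (inl A B) ≫ f = K.map (inl A B) ≫ g)
    (h₂ : K.map (inr A B) ≫ f = K.map (inr A B) ≫ g) : f = g := by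
  have := hK.isIso A B
  rw [← cancel_epi (desc (K.map (inl A B)) (K.map (inr A B)))]
  exact hom_ext (by simpa using h₁) (by simpa using h₂)

theorem isCoprod_shape (hK : PreservesSums K) : ∀ (s : Shape) (B : s.Idx → C),
    IsCoprod (fun x => K.map (s.ι B x))
  | .empty, _ =>
    { exists_desc := fun _ => ⟨hK.isInitial.some.to _, fun x => Empty.elim x⟩
      hom_ext := fun _ => hK.isInitial.some.hom_ext _ _ }
  | .point, B =>
    { exists_desc := fun f => ⟨f (), fun _ => by
        change K.map (𝟙 (B ())) ≫ f () = f ()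
        rw [K.map_id, Category.id_comp]⟩
      hom_ext := fun {_} {f} {g} hh => by
        exact (cancel_epi (K.map (𝟙 (B ())))).1 (hh ()) }
  | .plus s t, B =>
    have := hK.isIso (s.coprod fun x => B (.inl x)) (t.coprod fun y => B (.inr y))
    ((hK.isCoprod_shape s _).sum (B := fun x => K.obj (B x)) (hK.isCoprod_shape t _)).of_isIso
      (desc (K.map (inl _ _)) (K.map (inr _ _))) (fun x => match x with
        | .inl x => ((Category.assoc _ _ _).trans (congrArg (_ ≫ ·) (inl_desc _ _))).trans (K.map_comp _ _).symm
        | .inr y => ((Category.assoc _ _ _).trans (congrArg (_ ≫ ·) (inr_desc _ _))).trans (K.map_comp _ _).symm)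

/-- The hypotheses cover the initial object and binary sums; a general finite coproduct is
isomorphic to one over a shape, where induction applies. -/
theorem isCoprod (hK : PreservesSums K) {X : Type} [Finite X] {B : X → C} {P : C}
    {ι : ∀ x, B x ⟶ P} (h : IsCoprod ι) : IsCoprod (fun x => K.map (ι x)) := by
  obtain ⟨s, ⟨e⟩⟩ := Shape.exists_equiv X
  have h' := s.isCoprod fun i => B (e i)
  let k := h'.desc (fun i => ι (e i))
  have := h'.isIso_desc (h.reindex e)
  have h'' := (hK.isCoprod_shape s fun i => B (e i)).of_isIso (K.map k)
    (κ := fun i => K.map (ι (e i))) (fun x => by rw [← K.map_comp, IsCoprod.ι_desc])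
  have key : ∀ {B' : X → D} {P' : D} (ι' : ∀ x, B' x ⟶ P'), IsCoprod (fun i => ι' (e i)) →
      IsCoprod ι' := fun ι' h =>
    { exists_desc := fun f => ⟨h.desc (fun i => f (e i)), fun x => by
        obtain ⟨i, rfl⟩ := e.surjective x
        exact h.ι_desc (fun i => f (e i)) i⟩
      hom_ext := fun hh => h.hom_ext (fun i => hh (e i)) }
  exact key _ h''

end PreservesSums

theorem IsStrict.map_inl_eq {C D : Type u} [Category.{v} C] [Category.{v} D] [SpecCoproducts C]
    [SpecCoproducts D] {one : C} {F : C ⥤ D} (h : IsStrict one F) (A B : C) :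
    F.map (inl A B) = inl (F.obj A) (F.obj B) ≫ eqToHom (h.obj_sum A B).symm := by
  rw [← h.map_inl]
  simp

theorem IsStrict.map_inr_eq {C D : Type u} [Category.{v} C] [Category.{v} D] [SpecCoproducts C]
    [SpecCoproducts D] {one : C} {F : C ⥤ D} (h : IsStrict one F) (A B : C) :
    F.map (inr A B) = inr (F.obj A) (F.obj B) ≫ eqToHom (h.obj_sum A B).symm := by
  rw [← h.map_inr]
  simp

/-- The properties of a functor between categories of partial arrows which ensure that it defines a
morphism of theories. -/
structure IsPartialFunctor {C : Type u} [Category.{v} C] [SpecCoproducts C]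
    [HasZeroMorphisms C] {D : Type u} [Category.{v} D] [SpecCoproducts D] [HasZeroMorphisms D]
    {I : C} (d : ∀ A : C, A ⟶ I) {I' : D} (d' : ∀ A : D, A ⟶ I') (K : C ⥤ D) : Prop extends
    PreservesSums K where
  map_zero : ∀ A B : C, K.map (0 : A ⟶ B) = 0
  map_d : ∀ A : C, K.map (d A) ≫ d' _ = d' _
  isIso_d : IsIso (d' (K.obj I))

namespace IsPartialFunctor

variable {C : Type u} [Category.{v} C] [SpecCoproducts C]
    [HasZeroMorphisms C] {D : Type u} [Category.{v} D] [SpecCoproducts D] [HasZeroMorphisms D]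
    {I : C} {d : ∀ A : C, A ⟶ I} {I' : D} {d' : ∀ A : D, A ⟶ I'} {K : C ⥤ D}

theorem map_total (hK : IsPartialFunctor d d' K) {A B : C} {f : A ⟶ B} (h : f ≫ d B = d A) :
    K.map f ≫ d' _ = d' _ := by
  rw [← hK.map_d, ← Category.assoc, ← K.map_comp, h, hK.map_d]

theorem map_proj (hK : IsPartialFunctor d d' K) {X : Type} [Finite X] {B : X → C} {P : C}
    {ι : ∀ x, B x ⟶ P} (h : IsCoprod ι) (x : X) :
    K.map (h.proj x) = (hK.isCoprod h).proj x :=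
  IsCoprod.eq_proj (hK.isCoprod h) (by rw [← K.map_comp, IsCoprod.ι_proj_self, K.map_id])
    (fun y n => by rw [← K.map_comp, IsCoprod.ι_proj_ne h n, hK.map_zero])

/-- Tests and compatible pairs are coded by arrows into coproducts with their projections. Such a
`K` preserves coproducts, total arrows and zero arrows, hence projections, so it carries each coding
arrow to a coding arrow. -/
theorem isMorphism (hK : IsPartialFunctor d d' K) (p : IsPartialForm d) (p' : IsPartialForm d')
    (ax' : (otcFrom I' d').Axioms) : OTCData.IsMorphism ax' (otcFrom I d) K where
  map_test {X} _ A f tf := by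
    obtain ⟨P, ι, h, t⟩ := p.exists_coprod (fun x => (f x).1)
    obtain ⟨k, tk, hk⟩ := (IsPartialForm.isTest_iff f h t).1 tf
    refine (IsPartialForm.isTest_iff (fun x => ev (K.map (f x).2)) (hK.isCoprod h)
      (fun x => hK.map_total (t x))).2 ⟨K.map k, hK.map_total tk, fun x => ?_⟩
    rw [← hK.map_proj h, ← K.map_comp, hk]
  map_ovee {A B} f g c c' := by
    obtain ⟨k, h₁, h₂⟩ := (p.compat_iff f g).1 c
    have := hK.isIso B B
    let φ := desc (K.map (inl B B)) (K.map (inr B B))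
    -- Up to the comparison isomorphism `φ`, the functor preserves copairings; the cases used are
    -- the two projections and the codiagonal.
    have key : ∀ {Z : C} (a b : B ⟶ Z), inv φ ≫ desc (K.map a) (K.map b) = K.map (desc a b) := by
      intro Z a b
      rw [← cancel_epi φ, IsIso.hom_inv_id_assoc]
      refine hom_ext ?_ ?_
      · rw [inl_desc, inl_desc_assoc, ← K.map_comp, inl_desc]
      · rw [inr_desc, inr_desc_assoc, ← K.map_comp, inr_desc]
    have k₁ := key (𝟙 B) 0
    have k₂ := key 0 (𝟙 B)
    have k₃ := key (𝟙 B) (𝟙 B)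
    rw [K.map_id] at k₁ k₂ k₃
    rw [hK.map_zero] at k₁ k₂
    rw [p.ovee_eq c k h₁ h₂, p'.ovee_eq c' (K.map k ≫ inv φ)
      (by rw [Category.assoc, k₁, ← K.map_comp, h₁])
      (by rw [Category.assoc, k₂, ← K.map_comp, h₂]), Category.assoc, k₃, ← K.map_comp]
  isIso_disc := by
    rw [IsPartialForm.disc_eq ax' _ p'.d_I]
    exact hK.isIso_d

end IsPartialFunctor

/-! ## Partial arrows of operational categories -/

namespace Par

section

variable {C : Type u} [Category.{v} C] [SpecCoproducts C] {one : C} {T : IsTerminal one}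

@[simp]
theorem zero_arrow (A B : Par T) : (0 : A ⟶ B).arrow = T.from A.of ≫ inr B.of one := rfl

@[simp]
theorem desc_arrow {A B X : Par T} (f : A ⟶ X) (g : B ⟶ X) :
    (desc f g).arrow = desc f.arrow g.arrow := rfl

@[simp]
theorem discard_arrow (A : Par T) : (discard T A).arrow = T.from A.of ≫ inl one one := rfl

theorem desc_inl_inr (A B : C) : desc (inl A B) (inr A B) = 𝟙 (sum A B) :=
  SpecCoproducts.hom_ext (by simp) (by simp)

theorem from_one (T : IsTerminal one) : T.from one = 𝟙 one := T.hom_ext _ _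

theorem ofTotal_comp_arrow {A B : C} {X : Par T} (f : A ⟶ B) (g : (⟨B⟩ : Par T) ⟶ X) :
    (ofTotal T f ≫ g).arrow = f ≫ g.arrow := by
  simp

theorem ofTotal_id (A : C) : ofTotal T (𝟙 A) = 𝟙 _ := hom_ext (by simp)

theorem ofTotal_discard {A B : C} (f : A ⟶ B) : ofTotal T f ≫ discard T ⟨B⟩ = discard T ⟨A⟩ :=
  hom_ext (by
    rw [ofTotal_comp_arrow, discard_arrow, discard_arrow, ← Category.assoc]
    congr 1
    exact T.hom_ext _ _)

theorem isIso_ofTotal {A B : C} (f : A ⟶ B) [IsIso f] : IsIso (ofTotal T f) :=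
  ⟨ofTotal T (inv f), by rw [← ofTotal_comp, IsIso.hom_inv_id, ofTotal_id],
    by rw [← ofTotal_comp, IsIso.inv_hom_id, ofTotal_id]⟩

/-- In the defining pullback square the other projection goes to a terminal object, so `κ₁` alone is
monic. -/
theorem mono_inl (op : IsOperational T) {A X : C} {f g : X ⟶ A} (h : f ≫ inl A one = g ≫ inl A one) :
    f = g :=
  (op.isPullback A).hom_ext (T.hom_ext _ _) h

theorem ofTotal_injective (op : IsOperational T) {A B : C} {f g : A ⟶ B}
    (h : ofTotal T f = ofTotal T g) : f = g :=
  mono_inl op (congrArg Hom.arrow h)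

/-- A partial arrow which preserves discarding is total. -/
theorem exists_ofTotal (op : IsOperational T) {A B : Par T} (f : A ⟶ B)
    (h : f ≫ discard T B = discard T A) : ∃ g : A.of ⟶ B.of, ofTotal T g = f := by
  have e : T.from A.of ≫ inl one one = f.arrow ≫ sumMap (T.from B.of) (T.from one) := by
    have := congrArg Hom.arrow h
    rw [sumMap, from_one, Category.id_comp]
    exact this.symm
  exact ⟨(op.isPullback B.of).lift _ _ e, hom_ext ((op.isPullback B.of).lift_snd _ _ e)⟩

/-- Joint monicity is the first axiom of an operational category, read in partial arrows. A partial
arrow `f` is completed by the arrow `A ⟶ B + 1` that it is, regarded as a total one. -/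
theorem isPartialForm (op : IsOperational T) : IsPartialForm (discard T) where
  jointly_monic f g h₁ h₂ := hom_ext (op.jointly_monic f.arrow g.arrow
    (congrArg Hom.arrow h₁) (congrArg Hom.arrow h₂))
  inl_d A B := ofTotal_discard _
  inr_d A B := ofTotal_discard _
  d_I := hom_ext (by simp)
  exists_total {A B} f := ⟨ofTotal T f.arrow, ofTotal_discard _, hom_ext (by
    rw [ofTotal_comp_arrow]
    simp [desc_inl_inr])⟩
  -- Total partial arrows to `1 + 1` come from arrows `A ⟶ 1 + 1`, and `▷₁` of such an arrow is the
  -- same arrow regarded as a partial one to `1`; nothing is lost.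
  total_ext {A} h h' t t' e := by
    obtain ⟨k, rfl⟩ := exists_ofTotal op h t
    obtain ⟨k', rfl⟩ := exists_ofTotal op h' t'
    have := congrArg Hom.arrow e
    rw [ofTotal_comp_arrow, ofTotal_comp_arrow] at this
    simp only [desc_arrow, id_arrow, zero_arrow, from_one, Category.id_comp, desc_inl_inr] at this
    rw [show k = k' from (Category.comp_id k).symm.trans (this.trans (Category.comp_id k'))]

variable {C' : Type u} [Category.{v} C'] [SpecCoproducts C'] {one' : C'} {T' : IsTerminal one'}

/-- Strictness makes the comparison map of sums an equality of objects. For discarding, only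
terminality of `F.obj one` is needed. -/
theorem isPartialFunctor {F : C ⥤ C'} (h : IsStrict one F) :
    IsPartialFunctor (discard T) (discard T') (functor T T' h) where
  isIso A B := by
    have e : desc ((functor T T' h).map (inl A B)) ((functor T T' h).map (inr A B)) =
        ofTotal T' (eqToHom (h.obj_sum A.of B.of).symm) := by
      refine SpecCoproducts.hom_ext ?_ ?_
      · rw [inl_desc]
        exact (functor_map_ofTotal h (inl A.of B.of)).trans ((congrArg (ofTotal T')
          (h.map_inl_eq A.of B.of)).trans (ofTotal_comp _ _))
      · rw [inr_desc]
        exact (functor_map_ofTotal h (inr A.of B.of)).trans ((congrArg (ofTotal T')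
          (h.map_inr_eq A.of B.of)).trans (ofTotal_comp _ _))
    rw [e]
    exact isIso_ofTotal _
  isInitial := ⟨SpecCoproducts.isInitial.ofIso
    (eqToIso (congrArg (Par.mk (T := T')) h.obj_zero.symm))⟩
  map_zero A B := hom_ext (by
    change F.map (T.from A.of ≫ inr B.of one) ≫ eqToHom _ ≫ sumMap _ _ = T'.from _ ≫ inr _ _
    rw [F.map_comp, Category.assoc, ← Category.assoc (F.map (inr B.of one)), h.map_inr, sumMap,
      inr_desc, ← Category.assoc]
    congr 1
    exact T'.hom_ext _ _)
  map_d A := by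
    rw [discard, functor_map_ofTotal]
    exact ofTotal_discard _
  isIso_d := by
    have : IsIso (T'.from (F.obj one)) := isIso_of_isTerminal h.terminal.some T' _
    exact isIso_ofTotal (T'.from (F.obj one))

end

end Par

theorem parWellDefined : ParWellDefined.{v, u} where
  axioms B := (Par.isPartialForm B.isOperational).axioms
  isMorphism {B B'} F := (Par.isPartialFunctor F.isStrict).isMorphism
    (Par.isPartialForm B.isOperational) (Par.isPartialForm B'.isOperational) _

/-! ### Partial arrows of effectuses -/

namespace Par

variable {C : Type u} [Category.{v} C] [SpecCoproducts C] {one : C} {T : IsTerminal one}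

/-- A total `k` is an arrow `g : A ⟶ P + Q`. Totality of its first component says that `g` followed
by `! + !` is the constant `κ₁`, so the positivity pullback factors `g` through `κ₁`, and the second
component vanishes. -/
theorem isPositive (op : IsOperational T) (h : IsEffectus T) : (otcPar T).IsPositive := by
  refine (isPartialForm op).isPositive fun {A P Q} k t t' => ?_
  obtain ⟨g, rfl⟩ := exists_ofTotal op k t
  have e : T.from A.of ≫ inl one one = g ≫ sumMap (T.from P.of) (T.from Q.of) := by
    have e' := congrArg Hom.arrow t'
    rw [ofTotal_comp_arrow] at e'
    rw [sumMap]
    refine (Eq.trans ?_ e').symm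
    congr 1
    refine SpecCoproducts.hom_ext ?_ ?_
    · simp
    · simp
  obtain ⟨l, -, hl⟩ := (h.positive P.of Q.of).exists_lift _ _ e
  subst hl
  refine hom_ext ?_
  rw [ofTotal_comp_arrow, desc_arrow, Category.assoc, inl_desc, zero_arrow, zero_arrow,
    ← Category.assoc]
  congr 1
  exact T.hom_ext _ _

/-- Read `f` as an arrow to `P + 1` and `g`, with its summands swapped, as one to `1 + Q`.
Complementary domains mean that both induce the same arrow to `1 + 1`, so the pullback square
produces an arrow to `P + Q`. -/
theorem isCombining (op : IsOperational T) (h : IsEffectus T) (ax : (otcPar T).Axioms) :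
    OTCData.IsCombining ax := by
  refine (isPartialForm op).isCombining ax fun {A P Q} f g => ?_
  rintro ⟨k, tk, k₁, k₂⟩
  obtain ⟨l, rfl⟩ := exists_ofTotal op k tk
  change A.of ⟶ sum one one at l
  -- The arrow `l` decides whether `f` is defined; the next equation says that with its values
  -- exchanged it decides whether `g` is.
  have e₁ : l = f.arrow ≫ desc (T.from P.of ≫ inl one one) (inr one one) := by
    have := congrArg Hom.arrow k₁
    rw [ofTotal_comp_arrow] at this
    refine Eq.trans ?_ this
    simp only [desc_arrow, id_arrow, zero_arrow, from_one, Category.id_comp, desc_inl_inr]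
    exact (Category.comp_id l).symm
  have e₂ : l ≫ desc (inr one one) (inl one one) =
      g.arrow ≫ desc (T.from Q.of ≫ inl one one) (inr one one) := by
    have := congrArg Hom.arrow k₂
    rw [ofTotal_comp_arrow] at this
    refine Eq.trans ?_ this
    simp
  have e : (g.arrow ≫ desc (inr one Q.of) (inl one Q.of)) ≫ sumMap (T.from one) (T.from Q.of) =
      f.arrow ≫ sumMap (T.from P.of) (T.from one) := by
    have e₃ : sumMap (T.from P.of) (T.from one) =
        desc (T.from P.of ≫ inl one one) (inr one one) := by
      rw [sumMap, from_one, Category.id_comp]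
    have e₄ : desc (inr one Q.of) (inl one Q.of) ≫ sumMap (T.from one) (T.from Q.of) =
        desc (T.from Q.of ≫ inl one one) (inr one one) ≫ desc (inr one one) (inl one one) :=
      SpecCoproducts.hom_ext (by simp [sumMap]) (by simp [sumMap])
    have e₅ : desc (inr one one) (inl one one) ≫ desc (inr one one) (inl one one) =
        𝟙 (sum one one) := SpecCoproducts.hom_ext (by simp) (by simp)
    rw [Category.assoc, e₄, ← Category.assoc, ← e₂, Category.assoc, e₅, Category.comp_id, e₃, ← e₁]
  obtain ⟨r, hr₁, hr₂⟩ := (h.isPullback P.of Q.of).exists_lift _ _ e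
  refine ⟨ofTotal T (B := sum P.of Q.of) r, ofTotal_discard _, hom_ext ?_, hom_ext ?_⟩
  · rw [ofTotal_comp_arrow, ← hr₂]
    congr 1
    exact SpecCoproducts.hom_ext (by simp [sumMap]) (by simp [sumMap])
  · rw [ofTotal_comp_arrow]
    have e₆ : g.arrow = r ≫ sumMap (T.from P.of) (𝟙 Q.of) ≫ desc (inr Q.of one) (inl Q.of one) := by
      rw [← Category.assoc, hr₁, Category.assoc]
      have : desc (inr one Q.of) (inl one Q.of) ≫ desc (inr Q.of one) (inl Q.of one) = 𝟙 _ :=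
        SpecCoproducts.hom_ext (by simp) (by simp)
      rw [this, Category.comp_id]
    rw [e₆]
    congr 1
    exact SpecCoproducts.hom_ext (by simp [sumMap]) (by simp [sumMap])

end Par

/-! ## Coarse-graining over disjoint unions -/

namespace OTCData

variable {E : Type u} [Category.{v} E] {I : E} {D : OTCData E I}

theorem bigOvee_eq_zero (ax : D.Axioms) {X : Type} [Finite X] {A B : E} (f : X → (A ⟶ B))
    (h : ∀ x, f x = D.zero A B) : D.bigOvee f = D.zero A B := by
  have : ∀ l : List X, D.lsum (l.map f) = D.zero A B := by
    intro l
    induction l with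
    | nil => rfl
    | cons a l ih => rw [List.map_cons, lsum, ih, h, add_zero ax]
  exact this _

theorem bigOvee_unique (ax : D.Axioms) {X : Type} [Finite X] [Unique X] {A B : E}
    (f : X → (A ⟶ B)) : D.bigOvee f = f default :=
  bigOvee_eq_single ax f default (fun _ h => absurd (Subsingleton.elim _ _) h)

theorem bigOvee_sum (ax : D.Axioms) {X Y : Type} [Finite X] [Finite Y] {A B : E}
    (f : X ⊕ Y → (A ⟶ B)) (t : D.IsPartialTest (fun s => ev (f s))) :
    D.bigOvee f = D.add (D.bigOvee fun x => f (.inl x)) (D.bigOvee fun y => f (.inr y)) := by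
  have hn : ((enum X).map Sum.inl ++ (enum Y).map (Sum.inr : Y → X ⊕ Y)).Nodup := by
    rw [List.nodup_append]
    refine ⟨(enum_nodup X).map Sum.inl_injective, (enum_nodup Y).map Sum.inr_injective, ?_⟩
    simp
  have hp : (enum (X ⊕ Y)).Perm ((enum X).map Sum.inl ++ (enum Y).map Sum.inr) := by
    refine (List.perm_ext_iff_of_nodup (enum_nodup _) hn).2 ?_
    rintro (x | y) <;> simp [mem_enum]
  have h := lPart_enum ax f t
  unfold bigOvee
  rw [lsum_perm ax (hp.map f) h, List.map_append, lsum_append ax, List.map_map, List.map_map]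
  · rfl
  · rw [← List.map_append]
    exact lPart_perm ax ((hp.map f).map ev) h

theorem bigOvee_equiv (ax : D.Axioms) {X Y : Type} [Finite X] [Finite Y] {A B : E} (e : X ≃ Y)
    (f : Y → (A ⟶ B)) (t : D.IsPartialTest (fun y => ev (f y))) :
    D.bigOvee (fun x => f (e x)) = D.bigOvee f := by
  have hp : (enum Y).Perm ((enum X).map e) := by
    refine (List.perm_ext_iff_of_nodup (enum_nodup _) ((enum_nodup _).map e.injective)).2 ?_
    intro y
    simp only [mem_enum, List.mem_map, true_and, true_iff]
    exact e.surjective y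
  unfold bigOvee
  rw [lsum_perm ax (hp.map f) (lPart_enum ax f t), List.map_map]
  rfl

theorem bigOvee_sum_inl (ax : D.Axioms) {X Y : Type} [Finite X] [Finite Y] {A B : E}
    (f : X ⊕ Y → (A ⟶ B)) (t : D.IsPartialTest (fun s => ev (f s)))
    (h : ∀ y, f (.inr y) = D.zero A B) : D.bigOvee f = D.bigOvee fun x => f (.inl x) := by
  rw [bigOvee_sum ax f t, bigOvee_eq_zero ax _ h, add_zero ax]

theorem bigOvee_sum_inr (ax : D.Axioms) {X Y : Type} [Finite X] [Finite Y] {A B : E}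
    (f : X ⊕ Y → (A ⟶ B)) (t : D.IsPartialTest (fun s => ev (f s)))
    (h : ∀ x, f (.inl x) = D.zero A B) : D.bigOvee f = D.bigOvee fun y => f (.inr y) := by
  rw [bigOvee_sum ax f t, bigOvee_eq_zero ax _ h, zero_add ax]

theorem isTest_sum_zero_iff (ax : D.Axioms) {X Y : Type} [Finite X] [Finite Y] {A : E}
    (f : X → Out A) (g : Y → Out A) (h : ∀ y, (g y).2 = D.zero A (g y).1) :
    D.IsTest (Sum.elim f g) ↔ D.IsTest f := by
  rw [OTCData.isTest_sum_iff ax _ _ _ (enum_nodup X) mem_enum _ (enum_nodup Y) mem_enum,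
    isTest_iff_enum ax f]
  have key : ∀ l : List Y, D.LTest ((enum X).map f ++ l.map g) ↔ D.LTest ((enum X).map f) := by
    intro l
    induction l with
    | nil => simp
    | cons y l ih =>
      rw [← ih, lTest_zero_iff ax (g y).1 ((enum X).map f ++ l.map g), List.map_cons]
      have e : g y = ev (D.zero A (g y).1) := Sigma.ext rfl (heq_of_eq (h y))
      rw [← e]
      exact ⟨lTest_perm ax List.perm_middle, lTest_perm ax List.perm_middle.symm⟩
  exact key _

/-- Outcomes in `Y` are first discarded, by control with deterministic events, and the resulting
effects are then merged into one. -/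
theorem isTest_elim_map_disc (ax : D.Axioms) {X Y : Type} [Finite X] [Finite Y] {A : E}
    (f : X → Out A) (g : Y → Out A) (t : D.IsTest (Sum.elim f g)) :
    D.IsTest (Sum.elim f (fun _ : Unit => ev (D.bigOvee fun y => (g y).2 ≫ disc ax (g y).1))) := by
  let B' : X ⊕ Y → E := Sum.elim (fun x => (f x).1) (fun _ => I)
  let k : ∀ s : X ⊕ Y, (Sum.elim f g s).1 ⟶ B' s := fun s => match s with
    | .inl x => 𝟙 (f x).1
    | .inr y => disc ax (g y).1
  have h := isTest_comp_det ax (fun s => (Sum.elim f g s).2) k t (fun s => match s with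
    | .inl x => ax.id_det _
    | .inr y => isDet_disc ax _)
  have e : (fun s => ev ((Sum.elim f g s).2 ≫ k s)) =
      Sum.elim f (fun y => ev ((g y).2 ≫ disc ax (g y).1)) := by
    funext s
    rcases s with x | y
    · exact Sigma.ext rfl (heq_of_eq (Category.comp_id _))
    · rfl
  rw [e, OTCData.isTest_sum_iff ax _ _ _ (enum_nodup X) mem_enum _ (enum_nodup Y) mem_enum] at h
  rw [OTCData.isTest_sum_iff ax _ _ _ (enum_nodup X) mem_enum [()] (List.nodup_singleton _)
    (fun _ => List.mem_singleton.2 rfl)]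
  have h' : D.LTest (((enum Y).map (fun y => (g y).2 ≫ disc ax (g y).1)).map ev ++
      (enum X).map f) := by
    rw [List.map_map]
    exact lTest_perm ax List.perm_append_comm h
  exact lTest_perm ax List.perm_append_comm (l := [_] ++ _) (lTest_merge ax _ _ h')

theorem isTest_unit_sum_iff (ax : D.Axioms) {A : E} (e e' : Out A) :
    D.IsTest (Sum.elim (fun _ : Unit => e) (fun _ : Unit => e')) ↔ D.IsTest ![e, e'] := by
  rw [OTCData.isTest_sum_iff ax _ _ [()] (List.nodup_singleton _)
    (fun _ => List.mem_singleton.2 rfl) [()] (List.nodup_singleton _)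
    (fun _ => List.mem_singleton.2 rfl), isTest_fin_iff ax]
  simp [List.ofFn_succ]

theorem isTest_sum_comm (ax : D.Axioms) {X Y : Type} [Finite X] [Finite Y] {A : E}
    (f : X → Out A) (g : Y → Out A) (t : D.IsTest (Sum.elim f g)) : D.IsTest (Sum.elim g f) := by
  have := ax.reindex (Equiv.sumComm Y X) _ t
  convert this using 1
  funext s
  rcases s with y | x <;> rfl

theorem isTest_discs_unit (ax : D.Axioms) {X : Type} [Finite X] {A : E}
    (f : X → Out A) (e : A ⟶ I) (t : D.IsTest (Sum.elim f (fun _ : Unit => ev e))) :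
    D.IsTest ![ev (D.bigOvee fun x => (f x).2 ≫ disc ax (f x).1), ev e] :=
  (isTest_unit_sum_iff ax _ _).1 (isTest_sum_comm ax _ _ (isTest_elim_map_disc ax _ _
    (isTest_sum_comm ax _ _ t)))

theorem eq_perp (ax : D.Axioms) {A : E} {e e' : A ⟶ I} (h : D.IsTest ![ev e, ev e']) :
    e' = perp ax e :=
  (ax.compl e).choose_spec.2 e' h

theorem isTest_pair_comm (ax : D.Axioms) {A : E} {e e' : A ⟶ I} (h : D.IsTest ![ev e, ev e']) :
    D.IsTest ![ev e', ev e] := by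
  rw [← isTest_unit_sum_iff ax] at h ⊢
  exact isTest_sum_comm ax _ _ h

/-- Whatever completes a partial test can be compressed into a single effect. This is how a partial
test becomes a row of a matrix into `Y + 1`. -/
theorem exists_isTest_unit (ax : D.Axioms) {X : Type} [Finite X] {A : E} (f : X → Out A)
    (t : D.IsPartialTest f) : ∃ e : A ⟶ I, D.IsTest (Sum.elim f (fun _ : Unit => ev e)) := by
  obtain ⟨Y, _, g, t⟩ := t
  exact ⟨_, isTest_elim_map_disc ax f g t⟩

end OTCData

/-! ## The category of tests as an operational category -/

namespace OTCData.Coll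

variable {E : Type u} [Category.{v} E] {I : E} {D : OTCData E I} {ax : D.Axioms}

theorem comp_entry_single {X Y Z : Coll ax} (M : X ⟶ Y) (N : Y ⟶ Z) (x : X.Idx) (z : Z.Idx)
    (y : Y.Idx) (h : ∀ y', y' ≠ y → M.entry x y' ≫ N.entry y' z = D.zero _ _) :
    (M ≫ N).entry x z = M.entry x y ≫ N.entry y z :=
  bigOvee_eq_single ax _ y h

theorem comp_entry_of_right {X Y Z : Coll ax} (M : X ⟶ Y) (N : Y ⟶ Z) (x : X.Idx) (z : Z.Idx)
    (y : Y.Idx) (h : ∀ y', y' ≠ y → N.entry y' z = D.zero _ _) :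
    (M ≫ N).entry x z = M.entry x y ≫ N.entry y z :=
  comp_entry_single M N x z y (fun y' n => by rw [h y' n, ax.comp_zero])

theorem comp_entry_of_left {X Y Z : Coll ax} (M : X ⟶ Y) (N : Y ⟶ Z) (x : X.Idx) (z : Z.Idx)
    (y : Y.Idx) (h : ∀ y', y' ≠ y → M.entry x y' = D.zero _ _) :
    (M ≫ N).entry x z = M.entry x y ≫ N.entry y z :=
  comp_entry_single M N x z y (fun y' n => by rw [h y' n, ax.zero_comp])

theorem delta_inl_inl (X Y : Coll ax) (x x' : X.Idx) :
    (plus X Y).delta (inlIdx X Y x) (inlIdx X Y x') = X.delta x x' := by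
  by_cases h : x = x'
  · subst h
    rw [delta_self, delta_self]
    rfl
  · rw [delta_ne _ h, delta_ne _ (fun e => h (Sum.inl_injective e))]
    rfl

theorem delta_inr_inr (X Y : Coll ax) (y y' : Y.Idx) :
    (plus X Y).delta (inrIdx X Y y) (inrIdx X Y y') = Y.delta y y' := by
  by_cases h : y = y'
  · subst h
    rw [delta_self, delta_self]
    rfl
  · rw [delta_ne _ h, delta_ne _ (fun e => h (Sum.inr_injective e))]
    rfl

theorem delta_inl_inr (X Y : Coll ax) (x : X.Idx) (y : Y.Idx) :
    (plus X Y).delta (inlIdx X Y x) (inrIdx X Y y) = D.zero _ _ :=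
  delta_ne _ (fun e => by cases e)

theorem delta_inr_inl (X Y : Coll ax) (x : X.Idx) (y : Y.Idx) :
    (plus X Y).delta (inrIdx X Y y) (inlIdx X Y x) = D.zero _ _ :=
  delta_ne _ (fun e => by cases e)

theorem comp_inl_entry_inl {X Y Z : Coll ax} (M : X ⟶ Y) (x : X.Idx) (y : Y.Idx) :
    (M ≫ inl Y Z).entry x (inlIdx Y Z y) = M.entry x y := by
  refine (comp_entry_of_right M (inl Y Z) x (inlIdx Y Z y) y (fun y' n =>
    (delta_inl_inl Y Z y' y).trans (delta_ne _ n))).trans ?_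
  refine (congrArg (M.entry x y ≫ ·) ((delta_inl_inl Y Z y y).trans (delta_self _ _))).trans ?_
  exact Category.comp_id _

theorem comp_inl_entry_inr {X Y Z : Coll ax} (M : X ⟶ Y) (x : X.Idx) (z : Z.Idx) :
    (M ≫ inl Y Z).entry x (inrIdx Y Z z) = D.zero _ _ :=
  bigOvee_eq_zero ax _ (fun y =>
    (congrArg (M.entry x y ≫ ·) (delta_inl_inr Y Z y z)).trans (ax.comp_zero _))

theorem comp_inr_entry_inr {X Y Z : Coll ax} (M : X ⟶ Z) (x : X.Idx) (z : Z.Idx) :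
    (M ≫ inr Y Z).entry x (inrIdx Y Z z) = M.entry x z := by
  refine (comp_entry_of_right M (inr Y Z) x (inrIdx Y Z z) z (fun y' n =>
    (delta_inr_inr Y Z y' z).trans (delta_ne _ n))).trans ?_
  refine (congrArg (M.entry x z ≫ ·) ((delta_inr_inr Y Z z z).trans (delta_self _ _))).trans ?_
  exact Category.comp_id _

theorem comp_inr_entry_inl {X Y Z : Coll ax} (M : X ⟶ Z) (x : X.Idx) (y : Y.Idx) :
    (M ≫ inr Y Z).entry x (inlIdx Y Z y) = D.zero _ _ :=
  bigOvee_eq_zero ax _ (fun z =>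
    (congrArg (M.entry x z ≫ ·) (delta_inr_inl Y Z y z)).trans (ax.comp_zero _))

theorem plus_hom_ext {X Y Z : Coll ax} {M N : X ⟶ plus Y Z}
    (h₁ : ∀ x y, M.entry x (inlIdx Y Z y) = N.entry x (inlIdx Y Z y))
    (h₂ : ∀ x z, M.entry x (inrIdx Y Z z) = N.entry x (inrIdx Y Z z)) : M = N :=
  hom_ext (fun x s => match s with
    | .inl y => h₁ x y
    | .inr z => h₂ x z)

theorem row_eq {X Y Z : Coll ax} (M : X ⟶ plus Y Z) (x : X.Idx) :
    (fun s => ev (M.entry x s)) = Sum.elim (fun y => ev (M.entry x (inlIdx Y Z y)))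
      (fun z => ev (M.entry x (inrIdx Y Z z))) := by
  funext s
  rcases s with y | z <;> rfl

theorem isTest_row {X Y Z : Coll ax} (M : X ⟶ plus Y Z) (x : X.Idx) :
    D.IsTest (Sum.elim (fun y => ev (M.entry x (inlIdx Y Z y)))
      (fun z => ev (M.entry x (inrIdx Y Z z)))) := by
  rw [← row_eq]
  exact M.isTest x

/-- The matrix with the given blocks. -/
theorem exists_plus {X Y Z : Coll ax} (M : ∀ x y, X.fam x ⟶ Y.fam y)
    (N : ∀ x z, X.fam x ⟶ Z.fam z)
    (t : ∀ x, D.IsTest (Sum.elim (fun y => ev (M x y)) (fun z => ev (N x z)))) :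
    ∃ K : X ⟶ plus Y Z, (∀ x y, K.entry x (inlIdx Y Z y) = M x y) ∧
      ∀ x z, K.entry x (inrIdx Y Z z) = N x z := by
  let K : ∀ x (s : (plus Y Z).Idx), X.fam x ⟶ (plus Y Z).fam s := fun x s => match s with
    | .inl y => M x y
    | .inr z => N x z
  have e : ∀ x, (fun s => ev (K x s)) =
      Sum.elim (fun y => ev (M x y)) (fun z => ev (N x z)) := fun x => by
    funext s
    rcases s with y | z <;> rfl
  exact ⟨⟨K, fun x => by rw [e x]; exact t x⟩, fun _ _ => rfl, fun _ _ => rfl⟩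

/-- Discarding and merging the outcomes in `Y` leaves a two-outcome test of effects, and complements
are unique. Hence an arrow into `Y + 1` is determined by its entries in `Y`. -/
theorem perp_row {X Y : Coll ax} (M : X ⟶ plus Y (single ax I)) (x : X.Idx) :
    M.entry x (inrIdx Y (single ax I) ()) =
      perp ax (D.bigOvee fun y => M.entry x (inlIdx Y (single ax I) y) ≫ disc ax (Y.fam y)) :=
  eq_perp ax (isTest_discs_unit ax (fun y => ev (M.entry x (inlIdx Y (single ax I) y)))
    (M.entry x (inrIdx Y (single ax I) ())) (isTest_row M x))

theorem plus_single_hom_ext {X Y : Coll ax} {M N : X ⟶ plus Y (single ax I)}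
    (h : ∀ x y, M.entry x (inlIdx Y _ y) = N.entry x (inlIdx Y _ y)) : M = N :=
  plus_hom_ext h (fun x _ => by
    refine (perp_row M x).trans (Eq.trans ?_ (perp_row N x).symm)
    exact congrArg (fun F => perp ax (D.bigOvee F))
      (funext fun y => congrArg (· ≫ disc ax (Y.fam y)) (h x y)))

theorem comp_entry_inl {X Y Z W : Coll ax} (M : X ⟶ plus Y Z) (N : plus Y Z ⟶ W) (x : X.Idx)
    (w : W.Idx) (h : ∀ z, N.entry (inrIdx Y Z z) w = D.zero _ _) :
    (M ≫ N).entry x w =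
      D.bigOvee fun y => M.entry x (inlIdx Y Z y) ≫ N.entry (inlIdx Y Z y) w :=
  bigOvee_sum_inl ax (X := Y.Idx) (Y := Z.Idx) _ (isPartialTest_comp M N x w) (fun z =>
    (congrArg (M.entry x (inrIdx Y Z z) ≫ ·) (h z)).trans (ax.comp_zero _))

theorem comp_entry_inr {X Y Z W : Coll ax} (M : X ⟶ plus Y Z) (N : plus Y Z ⟶ W) (x : X.Idx)
    (w : W.Idx) (h : ∀ y, N.entry (inlIdx Y Z y) w = D.zero _ _) :
    (M ≫ N).entry x w =
      D.bigOvee fun z => M.entry x (inrIdx Y Z z) ≫ N.entry (inrIdx Y Z z) w :=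
  bigOvee_sum_inr ax (X := Y.Idx) (Y := Z.Idx) _ (isPartialTest_comp M N x w) (fun y =>
    (congrArg (M.entry x (inlIdx Y Z y) ≫ ·) (h y)).trans (ax.comp_zero _))

theorem sumMap_entry_inl_inl {X Y Z W : Coll ax} (f : X ⟶ Z) (g : Y ⟶ W) (x : X.Idx) (z : Z.Idx) :
    (sumMap f g).entry (inlIdx X Y x) (inlIdx Z W z) = f.entry x z :=
  comp_inl_entry_inl f x z

theorem sumMap_entry_inr_inr {X Y Z W : Coll ax} (f : X ⟶ Z) (g : Y ⟶ W) (y : Y.Idx) (w : W.Idx) :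
    (sumMap f g).entry (inrIdx X Y y) (inrIdx Z W w) = g.entry y w :=
  comp_inr_entry_inr g y w

theorem comp_sumMap_entry_inl {V X Y Z W : Coll ax} (M : V ⟶ plus X Y) (f : X ⟶ Z) (g : Y ⟶ W)
    (v : V.Idx) (z : Z.Idx) : (M ≫ sumMap f g).entry v (inlIdx Z W z) =
      D.bigOvee fun x => M.entry v (inlIdx X Y x) ≫ f.entry x z := by
  refine (comp_entry_inl M (sumMap f g) v _ (fun y => comp_inr_entry_inl g y z)).trans ?_
  exact congrArg D.bigOvee (funext fun x => congrArg (M.entry v (inlIdx X Y x) ≫ ·)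
    (sumMap_entry_inl_inl f g x z))

theorem comp_sumMap_entry_inr {V X Y Z W : Coll ax} (M : V ⟶ plus X Y) (f : X ⟶ Z) (g : Y ⟶ W)
    (v : V.Idx) (w : W.Idx) : (M ≫ sumMap f g).entry v (inrIdx Z W w) =
      D.bigOvee fun y => M.entry v (inrIdx X Y y) ≫ g.entry y w := by
  refine (comp_entry_inr M (sumMap f g) v _ (fun x => comp_inl_entry_inr f x w)).trans ?_
  exact congrArg D.bigOvee (funext fun y => congrArg (M.entry v (inrIdx X Y y) ≫ ·)
    (sumMap_entry_inr_inr f g y w))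

/-- Impossible outcomes can be deleted from a test, so the remaining block is again a matrix of
tests. -/
theorem exists_comp_inl {X Y Z : Coll ax} (M : X ⟶ plus Y Z)
    (h : ∀ x z, M.entry x (inrIdx Y Z z) = D.zero _ _) : ∃ N : X ⟶ Y, N ≫ inl Y Z = M := by
  refine ⟨⟨fun x y => M.entry x (inlIdx Y Z y), fun x => ?_⟩, ?_⟩
  · exact (isTest_sum_zero_iff ax _ _ (fun z => h x z)).1 (isTest_row M x)
  · refine plus_hom_ext (fun x y => comp_inl_entry_inl _ x y) (fun x z => ?_)
    rw [h]
    exact comp_inl_entry_inr _ x z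

theorem comp_inl_injective {X Y Z : Coll ax} {M N : X ⟶ Y} (h : M ≫ inl Y Z = N ≫ inl Y Z) :
    M = N :=
  hom_ext (fun x y => by rw [← comp_inl_entry_inl (Z := Z) M, h, comp_inl_entry_inl])

end OTCData.Coll

theorem isPullback_of_exists {C : Type u} [Category.{v} C] {P X Y Z : C} {fst : P ⟶ X}
    {snd : P ⟶ Y} {f : X ⟶ Z} {g : Y ⟶ Z} (w : fst ≫ f = snd ≫ g)
    (h : ∀ {W : C} (a : W ⟶ X) (b : W ⟶ Y), a ≫ f = b ≫ g → ∃ l : W ⟶ P, l ≫ fst = a ∧ l ≫ snd = b)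
    (h' : ∀ {W : C} (l l' : W ⟶ P), l ≫ fst = l' ≫ fst → l ≫ snd = l' ≫ snd → l = l') :
    IsPullback fst snd f g :=
  ⟨⟨w⟩, ⟨PullbackCone.IsLimit.mk w (fun s => (h s.fst s.snd s.condition).choose)
    (fun s => (h s.fst s.snd s.condition).choose_spec.1)
    (fun s => (h s.fst s.snd s.condition).choose_spec.2)
    (fun s _ e₁ e₂ => h' _ _ (e₁.trans (h s.fst s.snd s.condition).choose_spec.1.symm)
      (e₂.trans (h s.fst s.snd s.condition).choose_spec.2.symm))⟩⟩

/-! ### Operational categories and effectuses of tests -/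

namespace OTCData.Coll

variable {E : Type u} [Category.{v} E] {I : E} {D : OTCData E I} {ax : D.Axioms}

/-- The two maps of the first axiom read off the two blocks of a matrix into `(A + A) + 1`, whose
last column is then forced by complements. For the pullback, commutativity says that the last column
is impossible. -/
theorem isOperational (ax : D.Axioms) : IsOperational (isTerminal ax) where
  jointly_monic {A X} f g h₁ h₂ := by
    let T := isTerminal ax
    -- Among the indices of `(A + A) + 1`, only the first copy of `a` has a nonzero entry at `a`;
    -- `k₂` does the same for the second copy.
    have k₁ : ∀ (f : X ⟶ sum (sum A A) (single ax I)) (x : X.Idx) (a : A.Idx),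
        (f ≫ desc (desc (inl A (single ax I)) (T.from A ≫ inr A (single ax I)))
          (inr A (single ax I))).entry x (inlIdx A _ a) =
        f.entry x (inlIdx (plus A A) (single ax I) (inlIdx A A a)) := fun f x a => by
      refine (comp_entry_of_right f _ x _ (inlIdx (plus A A) (single ax I) (inlIdx A A a))
        (fun s n => ?_)).trans ?_
      · match s with
        | .inl (.inl a') =>
          refine (delta_inl_inl A (single ax I) a' a).trans (delta_ne _ (fun e => n ?_))
          rw [e]
          rfl
        | .inl (.inr a') => exact comp_inr_entry_inl (T.from A) a' a
        | .inr u => exact delta_inr_inl A (single ax I) a u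
      · exact (congrArg (f.entry x (inlIdx (plus A A) (single ax I) (inlIdx A A a)) ≫ ·)
          ((delta_inl_inl A (single ax I) a a).trans (delta_self _ _))).trans (Category.comp_id _)
    have k₂ : ∀ (f : X ⟶ sum (sum A A) (single ax I)) (x : X.Idx) (a : A.Idx),
        (f ≫ desc (desc (T.from A ≫ inr A (single ax I)) (inl A (single ax I)))
          (inr A (single ax I))).entry x (inlIdx A _ a) =
        f.entry x (inlIdx (plus A A) (single ax I) (inrIdx A A a)) := fun f x a => by
      refine (comp_entry_of_right f _ x _ (inlIdx (plus A A) (single ax I) (inrIdx A A a))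
        (fun s n => ?_)).trans ?_
      · match s with
        | .inl (.inl a') => exact comp_inr_entry_inl (T.from A) a' a
        | .inl (.inr a') =>
          refine (delta_inl_inl A (single ax I) a' a).trans (delta_ne _ (fun e => n ?_))
          rw [e]
          rfl
        | .inr u => exact delta_inr_inl A (single ax I) a u
      · exact (congrArg (f.entry x (inlIdx (plus A A) (single ax I) (inrIdx A A a)) ≫ ·)
          ((delta_inl_inl A (single ax I) a a).trans (delta_self _ _))).trans (Category.comp_id _)
    refine plus_single_hom_ext (fun x s => ?_)
    match s with
    | .inl a => exact (k₁ f x a).symm.trans ((congrArg (fun M => Hom.entry M x _) h₁).trans (k₁ g x a))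
    | .inr a => exact (k₂ f x a).symm.trans ((congrArg (fun M => Hom.entry M x _) h₂).trans (k₂ g x a))
  isPullback A := by
    refine isPullback_of_exists ?_ (fun {W} a b e => ?_) (fun l l' _ h => comp_inl_injective h)
    · exact (inl_desc _ _).symm
    · obtain ⟨l, hl⟩ := exists_comp_inl b (fun x _ => by
        -- Comparing the second entries in `1 + 1`: it is zero on one side, and on the other the
        -- last entry of `b` followed by discarding on the trivial system, an identity.
        have h₁ := congrArg (fun M => Hom.entry M x (inrIdx (single ax I) (single ax I) ())) e
        have h₂ := (comp_inl_entry_inr (Z := single ax I) a x ()).symm.trans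
          (h₁.trans (comp_sumMap_entry_inr b _ ((isTerminal ax).from (single ax I)) x ()))
        refine Eq.trans ?_ h₂.symm
        refine Eq.trans ?_ (bigOvee_unique ax (X := Unit) _).symm
        refine Eq.trans (Category.comp_id _).symm (congrArg (b.entry x (inrIdx A _ ()) ≫ ·) ?_)
        exact (disc_I ax).symm)
      exact ⟨l, (isTerminal ax).hom_ext _ _, hl⟩

theorem comp_sumMap_from_entry_inl {X A B Z : Coll ax} (M : X ⟶ plus A B) (g : B ⟶ Z) (x : X.Idx) :
    (M ≫ sumMap ((isTerminal ax).from A) g).entry x (inlIdx (single ax I) Z ()) =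
      D.bigOvee fun a => M.entry x (inlIdx A B a) ≫ disc ax (A.fam a) :=
  comp_sumMap_entry_inl M ((isTerminal ax).from A) g x ()

theorem comp_sumMap_from_entry_inr {X A B Z : Coll ax} (M : X ⟶ plus A B) (f : A ⟶ Z) (x : X.Idx) :
    (M ≫ sumMap f ((isTerminal ax).from B)).entry x (inrIdx Z (single ax I) ()) =
      D.bigOvee fun b => M.entry x (inrIdx A B b) ≫ disc ax (B.fam b) :=
  comp_sumMap_entry_inr M f ((isTerminal ax).from B) x ()

theorem bigOvee_point_disc {A : E} (e : (single ax I).Idx → (A ⟶ I)) :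
    D.bigOvee (fun a : (single ax I).Idx => e a ≫ disc ax ((single ax I).fam a)) = e () :=
  (bigOvee_unique ax (X := Unit) _).trans
    ((congrArg (e () ≫ ·) (disc_I ax)).trans (Category.comp_id _))

theorem isTest_empty_elim (ax : D.Axioms) {X : Type} [Finite X] {A : E} (f : X → Out A)
    (t : D.IsTest (Sum.elim f (fun e : Empty => e.elim))) : D.IsTest f := by
  have := ax.reindex (Equiv.sumEmpty X Empty).symm _ t
  convert this using 1
  funext x
  rfl

/-- Discarding is complementary to the zero effect, so combining with the empty partial test shows
that `f` alone is already a test; positivity then makes the outcomes added to it impossible. -/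
theorem eq_zero_of_positive (pos : D.IsPositive) (comb : IsCombining ax) {X Y : Type} [Finite X]
    [Finite Y] {A : E} (f : X → Out A) (g : Y → Out A) (t : D.IsTest (Sum.elim f g))
    (h : D.bigOvee (fun x => (f x).2 ≫ disc ax (f x).1) = disc ax A) (y : Y) :
    (g y).2 = D.zero A (g y).1 := by
  have tp := isPartialTest_of_isTest ax t
  refine pos f g (isTest_empty_elim ax f (comb f (fun e : Empty => e.elim)
    (isPartialTest_comp_inj ax tp Sum.inl Sum.inl_injective) ?_ ?_)) t y
  · convert isPartialTest_comp_inj ax tp (Empty.elim : Empty → X ⊕ Y) (fun e => e.elim) using 1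
  · rw [h]
    have e : D.bigOvee (fun y : Empty => ((fun e : Empty => e.elim : Empty → Out A) y).2 ≫
        disc ax ((fun e : Empty => e.elim : Empty → Out A) y).1) = D.zero A I :=
      bigOvee_eq_zero ax _ (fun e => e.elim)
    rw [e]
    refine eq_perp ax ?_
    rw [isTest_pair_iff ax, ← lTest_zero_iff ax, ← isDet_iff ax]
    exact isDet_disc ax A

/-- Commutativity of the first square says that the effects of the first block add up to discarding,
so the second block vanishes. For the second square, the two given arrows supply the two blocks of a
matrix into `A + B`, and combining makes its rows tests. -/
theorem isEffectus (pos : D.IsPositive) (comb : IsCombining ax) : IsEffectus (isTerminal ax) where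
  positive A B := by
    refine isPullback_of_exists ?_ (fun {W} a b e => ?_) (fun l l' _ h => comp_inl_injective h)
    · exact (inl_desc _ _).symm
    · obtain ⟨l, hl⟩ := exists_comp_inl b (fun x z => by
        have h₁ := congrArg (fun M => Hom.entry M x (inlIdx (single ax I) (single ax I) ())) e
        have h₂ := (comp_inl_entry_inl (Z := single ax I) a x ()).symm.trans
          (h₁.trans (comp_sumMap_from_entry_inl b _ x))
        have h₃ : a = (isTerminal ax).from W := (isTerminal ax).hom_ext _ _
        rw [h₃] at h₂
        exact eq_zero_of_positive pos comb _ _ (isTest_row b x) h₂.symm z)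
      exact ⟨l, (isTerminal ax).hom_ext _ _, hl⟩
  isPullback A B := by
    refine isPullback_of_exists ?_ (fun {W} P Q e => ?_) (fun l l' h₁ h₂ => plus_hom_ext ?_ ?_)
    · refine SpecCoproducts.hom_ext ?_ ?_
      · simp only [sumMap, inl_desc_assoc, inl_desc, Category.assoc, Category.id_comp]
        rw [← Category.assoc]
        congr 1
        exact (isTerminal ax).hom_ext _ _
      · simp only [sumMap, inr_desc_assoc, inr_desc, Category.assoc, Category.id_comp]
        rw [← Category.assoc]
        congr 1
        exact (isTerminal ax).hom_ext _ _
    -- Agreement over `1 + 1` says that the effect entry of each arrow is the coarse-grained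
    -- discarding of the proper block of the other.
    · have e₁ : ∀ x, P.entry x (inlIdx (single ax I) B ()) =
          D.bigOvee fun a => Q.entry x (inlIdx A (single ax I) a) ≫ disc ax (A.fam a) := fun x => by
        have h₁ := congrArg (fun M => Hom.entry M x (inlIdx (single ax I) (single ax I) ())) e
        exact (bigOvee_point_disc (fun a => P.entry x (inlIdx (single ax I) B a))).symm.trans
          ((comp_sumMap_from_entry_inl P _ x).symm.trans
            (h₁.trans (comp_sumMap_from_entry_inl Q _ x)))
      have e₂ : ∀ x, Q.entry x (inrIdx A (single ax I) ()) =
          D.bigOvee fun b => P.entry x (inrIdx (single ax I) B b) ≫ disc ax (B.fam b) := fun x => by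
        have h₁ := congrArg (fun M => Hom.entry M x (inrIdx (single ax I) (single ax I) ())) e
        exact (bigOvee_point_disc (fun a => Q.entry x (inrIdx A (single ax I) a))).symm.trans
          ((comp_sumMap_from_entry_inr Q _ x).symm.trans
            (h₁.symm.trans (comp_sumMap_from_entry_inr P _ x)))
      obtain ⟨K, hK₁, hK₂⟩ := exists_plus (X := W) (Y := A) (Z := B)
        (fun x a => Q.entry x (inlIdx A (single ax I) a))
        (fun x b => P.entry x (inrIdx (single ax I) B b)) (fun x => by
          refine comb _ _ ?_ ?_ ?_
          · exact isPartialTest_comp_inj ax (isPartialTest_of_isTest ax (isTest_row Q x)) Sum.inl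
              Sum.inl_injective
          · exact isPartialTest_comp_inj ax (isPartialTest_of_isTest ax (isTest_row P x)) Sum.inr
              Sum.inr_injective
          -- The row of `Q` is a test, so its discarded `A`-block is complementary to its effect
          -- entry, which `e₂` rewrites as the discarded `B`-block of `P`.
          · refine eq_perp ax (isTest_pair_comm ax ?_)
            have := isTest_discs_unit ax (fun a => ev (Q.entry x (inlIdx A (single ax I) a)))
              (Q.entry x (inrIdx A (single ax I) ())) (isTest_row Q x)
            rw [e₂ x] at this
            exact this)
      refine ⟨K, ?_, ?_⟩
      · refine plus_hom_ext (fun x _ => ?_) (fun x b => ?_)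
        · refine (comp_sumMap_from_entry_inl K _ x).trans (Eq.trans ?_ (e₁ x).symm)
          exact congrArg D.bigOvee (funext fun a => congrArg (· ≫ disc ax (A.fam a)) (hK₁ x a))
        · refine (comp_sumMap_entry_inr K _ (𝟙 B) x b).trans ?_
          refine (bigOvee_eq_single ax _ b (fun b' n => ?_)).trans ?_
          · exact (congrArg (_ ≫ ·) (delta_ne B n)).trans (ax.comp_zero _)
          · refine (congrArg (_ ≫ ·) (delta_self B b)).trans ((Category.comp_id _).trans (hK₂ x b))
      · refine plus_hom_ext (fun x a => ?_) (fun x _ => ?_)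
        · refine (comp_sumMap_entry_inl K (𝟙 A) _ x a).trans ?_
          refine (bigOvee_eq_single ax _ a (fun a' n => ?_)).trans ?_
          · exact (congrArg (_ ≫ ·) (delta_ne A n)).trans (ax.comp_zero _)
          · refine (congrArg (_ ≫ ·) (delta_self A a)).trans ((Category.comp_id _).trans (hK₁ x a))
        · refine (comp_sumMap_from_entry_inr K _ x).trans (Eq.trans ?_ (e₂ x).symm)
          exact congrArg D.bigOvee (funext fun b => congrArg (· ≫ disc ax (B.fam b)) (hK₂ x b))
    · intro x a
      have key : ∀ l : _ ⟶ plus A B, (l ≫ sumMap (𝟙 A) ((isTerminal ax).from B)).entry x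
          (inlIdx A (single ax I) a) = l.entry x (inlIdx A B a) := fun l => by
        refine (comp_sumMap_entry_inl l (𝟙 A) _ x a).trans ?_
        refine (bigOvee_eq_single ax _ a (fun a' n => ?_)).trans ?_
        · exact (congrArg (_ ≫ ·) (delta_ne A n)).trans (ax.comp_zero _)
        · exact (congrArg (_ ≫ ·) (delta_self A a)).trans (Category.comp_id _)
      exact (key l).symm.trans ((congrArg (fun M => Hom.entry M x _) h₂).trans (key l'))
    · intro x b
      have key : ∀ l : _ ⟶ plus A B, (l ≫ sumMap ((isTerminal ax).from A) (𝟙 B)).entry x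
          (inrIdx (single ax I) B b) = l.entry x (inrIdx A B b) := fun l => by
        refine (comp_sumMap_entry_inr l _ (𝟙 B) x b).trans ?_
        refine (bigOvee_eq_single ax _ b (fun b' n => ?_)).trans ?_
        · exact (congrArg (_ ≫ ·) (delta_ne B n)).trans (ax.comp_zero _)
        · exact (congrArg (_ ≫ ·) (delta_self B b)).trans (Category.comp_id _)
      exact (key l).symm.trans ((congrArg (fun M => Hom.entry M x _) h₁).trans (key l'))

theorem comp_eqToHom_entry {s : Shape} {f g : s.Idx → E} (h : f = g) {X : Coll ax}
    (M : X ⟶ ⟨s, f⟩) (x : X.Idx) (y : s.Idx) :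
    (M ≫ eqToHom (congrArg (Coll.mk s) h)).entry x y = M.entry x y ≫ eqToHom (congrFun h y) := by
  subst h
  simp

/-- A single system is terminal when discarding is an isomorphism. -/
def isTerminalSingle (A : E) (i : IsIso (disc ax A)) : IsTerminal (single ax A) :=
  let j : I ⟶ A := inv (disc ax A)
  have hd : D.IsDet j := isDet_of_comp_disc ax (by
    rw [IsIso.inv_hom_id]
    exact ax.id_det I)
  IsTerminal.ofUniqueHom
    (fun X => ⟨fun x _ => disc ax (X.fam x) ≫ j, fun x =>
      (isTest_unique_iff (X := Unit) _ ax).2 (isDet_comp ax (isDet_disc ax (X.fam x)) hd)⟩)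
    (fun X M => hom_ext (fun x _ => by
      have h₁ : D.IsDet (M.entry x ()) := (isTest_unique_iff (X := Unit) _ ax).1 (M.isTest x)
      have h₂ := eq_disc ax (isDet_comp ax h₁ (isDet_disc ax A))
      exact (IsIso.eq_comp_inv (disc ax A)).2 h₂))

end OTCData.Coll

/-! ### Strictness of the functors between categories of tests -/

theorem OTC.Hom.map_delta {Θ Θ' : OTC.{v, u}} (F : OTC.Hom Θ Θ') (X : OTCData.Coll Θ.ax)
    (x x' : X.Idx) : F.toFunctor.map (X.delta x x') = (F.tests.obj X).delta x x' :=
  congrArg (fun M : F.tests.obj X ⟶ F.tests.obj X => OTCData.Coll.Hom.entry M x x')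
    (F.tests.map_id X)

open OTCData.Coll in
theorem testsWellDefined : TestsWellDefined.{v, u} where
  isOperational Θ := isOperational Θ.ax
  isStrict {Θ Θ'} F := by
    have e₀ : (fun x : Shape.empty.Idx => F.toFunctor.obj (Empty.elim x)) = Empty.elim :=
      funext fun x => Empty.elim x
    -- Applying `F` to a disjoint union of families agrees with the disjoint union of the images
    -- only after case analysis, so `obj_sum` is a propositional equality.
    have e : ∀ X Y : OTCData.Coll Θ.ax, (fun s => F.toFunctor.obj (Sum.elim X.fam Y.fam s)) =
        Sum.elim (fun x => F.toFunctor.obj (X.fam x)) (fun y => F.toFunctor.obj (Y.fam y)) :=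
      fun X Y => funext fun s => match s with
        | .inl x => rfl
        | .inr y => rfl
    -- Identity matrices are compatible with replacing a family by an equal one; this absorbs the
    -- transports in `map_inl` and `map_inr`.
    have key : ∀ {s : Shape} {f g : s.Idx → Θ'.Sys} (h : f = g) (x y : s.Idx),
        OTCData.Coll.delta (ax := Θ'.ax) ⟨s, f⟩ x y ≫ eqToHom (congrFun h y) =
          eqToHom (congrFun h x) ≫ OTCData.Coll.delta (ax := Θ'.ax) ⟨s, g⟩ x y := by
      rintro s f _ rfl x y
      simp
    have := F.isMorphism.isIso_disc
    refine ⟨congrArg (OTCData.Coll.mk .empty) e₀, fun X Y => congrArg (OTCData.Coll.mk _) (e X Y),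
      fun X Y => OTCData.Coll.hom_ext fun x s => ?_, fun X Y => OTCData.Coll.hom_ext fun y s => ?_,
      ⟨isTerminalSingle (ax := Θ'.ax) (F.toFunctor.obj Θ.I) this⟩⟩
    · refine (comp_eqToHom_entry (ax := Θ'.ax) (e X Y) (F.tests.map (inl X Y)) x s).trans ?_
      refine (congrArg (· ≫ eqToHom (congrFun (e X Y) s))
        (OTC.Hom.map_delta F (plus X Y) (inlIdx X Y x) s)).trans ?_
      exact (key (e X Y) (inlIdx X Y x) s).trans (Category.id_comp _)
    · refine (comp_eqToHom_entry (ax := Θ'.ax) (e X Y) (F.tests.map (inr X Y)) y s).trans ?_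
      refine (congrArg (· ≫ eqToHom (congrFun (e X Y) s))
        (OTC.Hom.map_delta F (plus X Y) (inrIdx X Y y) s)).trans ?_
      exact (key (e X Y) (inrIdx X Y y) s).trans (Category.id_comp _)

theorem OTCData.isPartialTest_unique {E : Type u} [Category.{v} E] {I : E} {D : OTCData E I}
    (ax : D.Axioms) {A B : E} (f : A ⟶ B) : D.IsPartialTest (fun _ : Unit => ev f) :=
  isPartialTest_comp_inj ax (ax.mem_test f) (fun _ : Unit => 0) (fun _ _ _ => rfl)

/-! ## Partial arrows between collections -/

/-- A cocone of partial arrows with vertex `Z` is a cocone of arrows with vertex `Z + 1`, so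
coproducts remain coproducts among partial arrows. -/
theorem IsCoprod.ofTotal {C : Type u} [Category.{v} C] [SpecCoproducts C] {one : C}
    (T : IsTerminal one) {X : Type} {B : X → C} {P : C} {ι : ∀ x, B x ⟶ P} (h : IsCoprod ι) :
    IsCoprod (B := fun x => Par.mk (T := T) (B x)) (P := ⟨P⟩) (fun x => Par.ofTotal T (ι x)) where
  exists_desc f := ⟨⟨h.desc fun x => (f x).arrow⟩, fun x => Par.hom_ext
    ((Par.ofTotal_comp_arrow _ _).trans (h.ι_desc (fun x => (f x).arrow) x))⟩
  hom_ext hh := Par.hom_ext (h.hom_ext fun x =>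
    (Par.ofTotal_comp_arrow _ _).symm.trans
      ((congrArg Par.Hom.arrow (hh x)).trans (Par.ofTotal_comp_arrow _ _)))

namespace OTCData.Coll

variable {E : Type u} [Category.{v} E] {I : E} {D : OTCData E I} {ax : D.Axioms}

/-- The only index of a single system. -/
abbrev pt (ax : D.Axioms) (A : E) : (single ax A).Idx := ()

/-- The coprojections of a collection, as the coproduct of its members. -/
def singleι (X : Coll ax) (x : X.Idx) : single ax (X.fam x) ⟶ X :=
  ⟨fun _ x' => X.delta x x', fun _ => X.isTest_delta x⟩

theorem singleι_comp_entry {X Z : Coll ax} (x : X.Idx) (M : X ⟶ Z) (z : Z.Idx) :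
    (X.singleι x ≫ M).entry () z = M.entry x z :=
  bigOvee_delta M x z

theorem isCoprod_singleι (X : Coll ax) : IsCoprod X.singleι where
  exists_desc f := ⟨⟨fun x z => (f x).entry () z, fun x => (f x).isTest ()⟩, fun x =>
    hom_ext fun _ z => singleι_comp_entry (X := X) x _ z⟩
  hom_ext {_ f g} hh := hom_ext fun x z => (singleι_comp_entry x f z).symm.trans
    ((congrArg (fun M => Hom.entry M (pt ax (X.fam x)) z) (hh x)).trans (singleι_comp_entry x g z))

end OTCData.Coll

namespace Par

open OTCData.Coll

variable {E : Type u} [Category.{v} E] {I : E} {D : OTCData E I} {ax : D.Axioms}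

/-- The entries of a partial arrow between collections. -/
def entry {X Y : Par (isTerminal ax)} (f : X ⟶ Y) (x : X.of.Idx) (y : Y.of.Idx) :
    X.of.fam x ⟶ Y.of.fam y :=
  f.arrow.entry x (inlIdx Y.of (single ax I) y)

/-- The column of effects is a complement of the rest, so partial arrows between collections are
matrices without it. -/
theorem entry_ext {X Y : Par (isTerminal ax)} {f g : X ⟶ Y}
    (h : ∀ x y, entry f x y = entry g x y) : f = g :=
  hom_ext (plus_single_hom_ext h)

theorem ofTotal_entry {X Y : OTCData.Coll ax} (M : X ⟶ Y) (x : X.Idx) (y : Y.Idx) :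
    entry (ofTotal (isTerminal ax) M) x y = M.entry x y :=
  comp_inl_entry_inl M x y

theorem zero_entry {X Y : Par (isTerminal ax)} (x : X.of.Idx) (y : Y.of.Idx) :
    entry (0 : X ⟶ Y) x y = D.zero _ _ :=
  comp_inr_entry_inl ((isTerminal ax).from X.of) x y

theorem id_entry {X : Par (isTerminal ax)} (x x' : X.of.Idx) :
    entry (𝟙 X) x x' = X.of.delta x x' :=
  delta_inl_inl X.of (single ax I) x x'

/-- The summand `1` of the middle object, where the first arrow is undefined, contributes nothing to
entries in `Z`; what remains is matrix multiplication. -/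
theorem comp_entry {X Y Z : Par (isTerminal ax)} (f : X ⟶ Y) (g : Y ⟶ Z) (x : X.of.Idx)
    (z : Z.of.Idx) : entry (f ≫ g) x z = D.bigOvee fun y => entry f x y ≫ entry g y z :=
  comp_entry_inl f.arrow (desc g.arrow (inr Z.of (single ax I))) x _
    (fun u => delta_inr_inl Z.of (single ax I) z u)

theorem comp_entry_single {X : Par (isTerminal ax)} {A : E} {Z : Par (isTerminal ax)}
    (f : X ⟶ ⟨single ax A⟩) (g : ⟨single ax A⟩ ⟶ Z) (x : X.of.Idx) (z : Z.of.Idx) :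
    entry (f ≫ g) x z = entry f x (pt ax A) ≫ entry g (pt ax A) z :=
  (comp_entry f g x z).trans (OTCData.bigOvee_unique ax (X := Unit) _)

/-- Each row is completed by one effect, which becomes the column at `1`. With `isPartialTest_entry`
this characterises the matrices that occur. -/
theorem exists_entry {X Y : Par (isTerminal ax)} (M : ∀ x y, X.of.fam x ⟶ Y.of.fam y)
    (t : ∀ x, D.IsPartialTest fun y => ev (M x y)) : ∃ f : X ⟶ Y, ∀ x y, entry f x y = M x y := by
  choose e he using fun x => OTCData.exists_isTest_unit ax _ (t x)
  obtain ⟨K, hK, -⟩ := exists_plus (X := X.of) (Y := Y.of) (Z := single ax I) M (fun x _ => e x) he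
  exact ⟨⟨K⟩, hK⟩

theorem isPartialTest_entry {X Y : Par (isTerminal ax)} (f : X ⟶ Y) (x : X.of.Idx) :
    D.IsPartialTest fun y => ev (entry f x y) :=
  OTCData.isPartialTest_comp_inj ax (OTCData.isPartialTest_of_isTest ax (isTest_row f.arrow x))
    Sum.inl Sum.inl_injective

/-- The functor which sends a system to the corresponding collection. -/
def unit (ax : D.Axioms) : E ⥤ Par (isTerminal ax) where
  obj A := ⟨single ax A⟩
  map {A B} f := (exists_entry (X := ⟨single ax A⟩) (Y := ⟨single ax B⟩) (fun _ _ => f)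
    (fun _ => OTCData.isPartialTest_unique ax f)).choose
  map_id A := entry_ext fun _ _ => ((exists_entry (X := ⟨single ax A⟩) (Y := ⟨single ax A⟩)
    (fun _ _ => 𝟙 A) (fun _ => OTCData.isPartialTest_unique ax (𝟙 A))).choose_spec () ()).trans
      ((id_entry (X := ⟨single ax A⟩) () ()).trans (delta_self _ _)).symm
  map_comp {A B F} f g := entry_ext fun _ _ =>
    ((exists_entry (X := ⟨single ax A⟩) (Y := ⟨single ax F⟩) (fun _ _ => f ≫ g)
      (fun _ => OTCData.isPartialTest_unique ax (f ≫ g))).choose_spec () ()).trans (by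
        refine Eq.trans ?_ (comp_entry_single (A := B) _ _ (pt ax A) (pt ax F)).symm
        refine (congrArg₂ (· ≫ ·) ?_ ?_).symm
        · exact (exists_entry (X := ⟨single ax A⟩) (Y := ⟨single ax B⟩)
            (fun _ _ => f) (fun _ => OTCData.isPartialTest_unique ax f)).choose_spec () ()
        · exact (exists_entry (X := ⟨single ax B⟩) (Y := ⟨single ax F⟩)
            (fun _ _ => g) (fun _ => OTCData.isPartialTest_unique ax g)).choose_spec () ())

theorem unit_map_entry {A B : E} (f : A ⟶ B) : entry ((unit ax).map f) () () = f :=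
  (exists_entry (X := ⟨single ax A⟩) (Y := ⟨single ax B⟩) (fun _ _ => f)
    (fun _ => OTCData.isPartialTest_unique ax f)).choose_spec () ()

/-- Every partial arrow between single systems is a one-by-one matrix, so the unit is full;
`unit_map_entry` makes it faithful. -/
theorem unit_map_entry_self {A : E} {B : E} (f : (unit ax).obj A ⟶ (unit ax).obj B) :
    (unit ax).map (X := A) (Y := B) (entry f () ()) = f :=
  entry_ext fun _ _ => unit_map_entry (ax := ax) (entry f () ())

/-- The coprojections of a collection, as partial arrows. -/
def collι (X : OTCData.Coll ax) (x : X.Idx) : (unit ax).obj (X.fam x) ⟶ ⟨X⟩ :=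
  ofTotal (isTerminal ax) (X.singleι x)

theorem collι_comp_entry {X : OTCData.Coll ax} {Z : Par (isTerminal ax)} (x : X.Idx)
    (f : ⟨X⟩ ⟶ Z) (z : Z.of.Idx) : entry (collι X x ≫ f) () z = entry f x z := by
  refine (congrArg (fun M => Hom.entry M (pt ax (X.fam x)) _)
    (ofTotal_comp_arrow (X.singleι x) f)).trans ?_
  exact singleι_comp_entry x f.arrow _

theorem isCoprod_collι (X : OTCData.Coll ax) : IsCoprod (collι X) :=
  X.isCoprod_singleι.ofTotal (isTerminal ax)

theorem proj_entry (X : OTCData.Coll ax) (x x' : X.Idx) :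
    entry ((isCoprod_collι X).proj x) x' () = X.delta x' x := by
  refine (collι_comp_entry x' ((isCoprod_collι X).proj x) ()).symm.trans ?_
  by_cases e : x' = x
  · subst e
    refine (congrArg (fun k => entry k (pt ax (X.fam x')) (pt ax (X.fam x')))
      ((isCoprod_collι X).ι_proj_self x')).trans ?_
    exact (id_entry (pt ax (X.fam x')) _).trans ((delta_self _ _).trans (delta_self X _).symm)
  · refine (congrArg (fun k => entry k (pt ax (X.fam x')) (pt ax (X.fam x)))
      ((isCoprod_collι X).ι_proj_ne e)).trans ?_
    exact (zero_entry (pt ax (X.fam x')) (pt ax (X.fam x))).trans (delta_ne _ e).symm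

theorem comp_proj_entry {X : Par (isTerminal ax)} {Y : OTCData.Coll ax} (f : X ⟶ ⟨Y⟩)
    (x : X.of.Idx) (y : Y.Idx) :
    entry (f ≫ (isCoprod_collι Y).proj y) x () = entry f x y := by
  refine (comp_entry f _ x (pt ax (Y.fam y))).trans ?_
  refine (OTCData.bigOvee_eq_single ax _ y fun y' n => ?_).trans ?_
  · exact (congrArg (entry f x y' ≫ ·) ((proj_entry Y y y').trans (delta_ne _ n))).trans
      (ax.comp_zero _)
  · exact (congrArg (entry f x y ≫ ·) ((proj_entry Y y y).trans (delta_self _ _))).trans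
      (Category.comp_id _)

/-- A test on `A` is a single row, that is, a total arrow from `{A}` to a collection, and its
components along the projections are the images of the events. For coarse-graining, a compatible
pair is a row with two entries. -/
theorem isMorphism_unit (p : IsPartialForm (discard (isTerminal ax)))
    (ax' : (otcPar (isTerminal ax)).Axioms) : OTCData.IsMorphism ax' D (unit ax) where
  map_test {X} _ A f tf := by
    obtain ⟨s, ⟨e⟩⟩ := Shape.exists_equiv X
    -- Collections are indexed by shapes, so the test is first transported along `e`.
    let B : OTCData.Coll ax := ⟨s, fun i => (f (e i)).1⟩
    let k : single ax A ⟶ B := ⟨fun _ i => (f (e i)).2, fun _ => ax.reindex e _ tf⟩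
    have t : (otcPar (isTerminal ax)).IsTest
        (fun i : s.Idx => (ev ((unit ax).map (f (e i)).2) : Out ((unit ax).obj A))) := by
      refine (IsPartialForm.isTest_iff _ (isCoprod_collι B) (fun i => ofTotal_discard _)).2
        ⟨ofTotal _ k, ofTotal_discard _, fun i => entry_ext fun _ _ => ?_⟩
      refine (comp_proj_entry (ofTotal (isTerminal ax) k) () i).trans ?_
      exact (ofTotal_entry k () i).trans (unit_map_entry (f (e i)).2).symm
    have t' := ax'.reindex e.symm _ t
    convert t' using 1
    funext x
    exact congrArg (fun x => (ev ((unit ax).map (f x).2) : Out ((unit ax).obj A)))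
      (e.apply_symm_apply x).symm
  map_ovee {A B} f g c c' := by
    have hp : D.IsPartialTest
        (fun s => Sum.elim (fun _ : Unit => (ev f : Out A)) (fun _ : Unit => ev g) s) := by
      have := OTCData.isPartialTest_comp_inj ax c
        (Sum.elim (fun _ => 0) (fun _ => 1) : Unit ⊕ Unit → Fin 2) (by
          rintro (_ | _) (_ | _) h
          · rfl
          · exact absurd h (Fin.zero_ne_one)
          · exact absurd h (Fin.zero_ne_one.symm)
          · rfl)
      convert this using 1
      funext s
      rcases s with _ | _ <;> rfl
    obtain ⟨k, hk⟩ := exists_entry (X := ⟨single ax A⟩) (Y := ⟨plus (single ax B) (single ax B)⟩)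
      (fun _ s => match s with
        | .inl _ => f
        | .inr _ => g) (fun _ => by
          refine Eq.mp (congrArg (fun h : Unit ⊕ Unit → Out A => D.IsPartialTest h)
            (funext fun s => ?_)) hp
          rcases s with _ | _ <;> rfl)
    -- The pairs `(𝟙, 𝟙)`, `(𝟙, 0)` and `(0, 𝟙)` for `(m, n)` give the coarse-graining and the two
    -- components, so `k` is the witness for the pair.
    have key : ∀ m n : (unit ax).obj B ⟶ (unit ax).obj B, entry (k ≫ desc m n) () () =
        D.add (f ≫ entry m () ()) (g ≫ entry n () ()) := fun m n => by
      refine (comp_entry k (desc m n) () ()).trans ?_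
      have hq : D.IsPartialTest (fun s => ev (entry k () s ≫ entry (desc m n) s ())) := by
        have h := isPartialTest_entry k ()
        have h' := isPartialTest_entry (k ≫ desc m n) ()
        have h₂ := OTCData.isPartialTest_control ax _ (Y := fun _ => Unit)
          (fun s _ => ev (entry (desc m n) s ())) h
          (fun s => OTCData.isPartialTest_unique ax (entry (desc m n) s ()))
        exact OTCData.isPartialTest_comp_inj ax h₂ (fun s => ⟨s, ()⟩)
          (fun _ _ h => congrArg Sigma.fst h)
      refine (OTCData.bigOvee_sum ax (X := Unit) (Y := Unit) _ hq).trans ?_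
      refine congrArg₂ D.add ?_ ?_
      · exact (OTCData.bigOvee_unique ax (X := Unit) _).trans
          (congrArg (· ≫ entry m () ()) (hk () (.inl ())))
      · exact (OTCData.bigOvee_unique ax (X := Unit) _).trans
          (congrArg (· ≫ entry n () ()) (hk () (.inr ())))
    have i : entry (𝟙 ((unit ax).obj B)) () () = 𝟙 B := (id_entry _ _).trans (delta_self _ _)
    have z : entry (0 : (unit ax).obj B ⟶ (unit ax).obj B) () () = D.zero B B := zero_entry _ _
    refine Eq.trans ?_ (p.ovee_eq c' k (entry_ext fun _ _ => ?_) (entry_ext fun _ _ => ?_)).symm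
    · have e : D.add (f ≫ 𝟙 B) (g ≫ 𝟙 B) = D.ovee f g c := by
        rw [Category.comp_id, Category.comp_id, OTCData.add, dif_pos c]
      exact entry_ext fun _ _ => (unit_map_entry _).trans ((key _ _).trans
        ((congrArg₂ (fun a b => D.add (f ≫ a) (g ≫ b)) i i).trans e)).symm
    · have e : D.add (f ≫ 𝟙 B) (g ≫ D.zero B B) = f := by
        rw [Category.comp_id, ax.comp_zero, OTCData.add_zero ax]
      exact ((key _ _).trans ((congrArg₂ (fun a b => D.add (f ≫ a) (g ≫ b)) i z).trans e)).trans
        (unit_map_entry f).symm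
    · have e : D.add (f ≫ D.zero B B) (g ≫ 𝟙 B) = g := by
        rw [Category.comp_id, ax.comp_zero, OTCData.zero_add ax]
      exact ((key _ _).trans ((congrArg₂ (fun a b => D.add (f ≫ a) (g ≫ b)) z i).trans e)).trans
        (unit_map_entry g).symm
  isIso_disc := by
    refine (congrArg (fun k => IsIso k) (IsPartialForm.disc_eq ax' _ p.d_I)).mpr ?_
    have : IsIso ((isTerminal ax).from (single ax I)) :=
      isIso_of_isTerminal (isTerminal ax) (isTerminal ax) _
    exact isIso_ofTotal (T := isTerminal ax) ((isTerminal ax).from (single ax I))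

end Par

/-! ## The adjunction -/

namespace Par

open OTCData.Coll IsPartialForm

/-! ### The counit and a triangle identity -/

section

variable {C : Type u} [Category.{v} C] [SpecCoproducts C] {one : C} {T : IsTerminal one}
  {ax : (otcPar T).Axioms}

/-- The arrow between coproducts which is given by a matrix of partial arrows. -/
def counitMap (op : IsOperational T) {X Y : OTCData.Coll ax} (M : X ⟶ Y) :
    (total X).of ⟶ (total Y).of :=
  (exists_ofTotal op _ ((isPartialForm op).totalMap_d M)).choose

theorem ofTotal_counitMap (op : IsOperational T) {X Y : OTCData.Coll ax} (M : X ⟶ Y) :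
    ofTotal T (counitMap op M) = (isPartialForm op).totalMap M :=
  (exists_ofTotal op _ ((isPartialForm op).totalMap_d M)).choose_spec

/-- The functor which sends a collection of objects to its coproduct. -/
def counit (op : IsOperational T) (ax : (otcPar T).Axioms) : OTCData.Coll ax ⥤ C where
  obj X := (total X).of
  map M := counitMap op M
  map_id X := ofTotal_injective op ((ofTotal_counitMap op _).trans
    (((isPartialForm op).totalMap_id X).trans (ofTotal_id _).symm))
  map_comp M N := ofTotal_injective op ((ofTotal_counitMap op _).trans
    (((isPartialForm op).totalMap_comp M N).trans ((ofTotal_comp _ _).trans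
      (congrArg₂ (· ≫ ·) (ofTotal_counitMap op M) (ofTotal_counitMap op N))).symm))

theorem ofTotal_counit_map (op : IsOperational T) {X Y : OTCData.Coll ax} (M : X ⟶ Y) :
    ofTotal T ((counit op ax).map M) = (isPartialForm op).totalMap M :=
  ofTotal_counitMap op M

theorem totalι_proj_entry {X : OTCData.Coll ax} (x x' : X.Idx) :
    totalι X x ≫ (isCoprod_total X).proj x' = X.delta x x' := by
  by_cases e : x = x'
  · subst e
    rw [IsCoprod.ι_proj_self, delta_self]
  · rw [IsCoprod.ι_proj_ne _ e, delta_ne _ e]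
    rfl

/-- Coproducts of collections are built by recursion on the shape, so sums and the empty collection
are preserved by definition. This is what index sets generated by disjoint unions are for. -/
theorem isStrict_counit (op : IsOperational T) (ax : (otcPar T).Axioms) :
    IsStrict (single ax (⟨one⟩ : Par T)) (counit op ax) where
  obj_zero := rfl
  obj_sum _ _ := rfl
  map_inl X Y := (Category.comp_id _).trans (ofTotal_injective op
    ((ofTotal_counit_map op (inl X Y)).trans ((isPartialForm op).eq_totalMap (inl X Y)
      (fun x s => (Category.assoc _ _ _).symm.trans
        (totalι_proj_entry (X := plus X Y) (inlIdx X Y x) s))).symm))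
  map_inr X Y := (Category.comp_id _).trans (ofTotal_injective op
    ((ofTotal_counit_map op (inr X Y)).trans ((isPartialForm op).eq_totalMap (inr X Y)
      (fun y s => (Category.assoc _ _ _).symm.trans
        (totalι_proj_entry (X := plus X Y) (inrIdx X Y y) s))).symm))
  terminal := ⟨T⟩

theorem eq_ofTotal_comp {A B : Par T} (f : A ⟶ B) :
    f = ofTotal T f.arrow ≫ (desc (𝟙 B) 0 : sum B ⟨one⟩ ⟶ B) :=
  hom_ext (by
    rw [ofTotal_comp_arrow]
    simp [desc_inl_inr])

/-- A partial arrow is a total one followed by `▷₁`. The lifted counit acts on the total part by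
`totalMap`, which has the expected entries, and sends `▷₁` to `▷₁`. -/
theorem ι_functor_counit_map_proj (op : IsOperational T) {X Y : Par (isTerminal ax)}
    (f : X ⟶ Y) (x : X.of.Idx) (y : Y.of.Idx) :
    totalι X.of x ≫ (functor (isTerminal ax) T (isStrict_counit op ax)).map f ≫
      (isCoprod_total Y.of).proj y = entry f x y := by
  let K := functor (isTerminal ax) T (isStrict_counit op ax)
  let Y' : Par (isTerminal ax) := sum Y ⟨single ax ⟨one⟩⟩
  have hK := isPartialFunctor (T := isTerminal ax) (T' := T) (isStrict_counit op ax)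
  have e₁ : K.map f = (isPartialForm op).totalMap f.arrow ≫
      K.map (desc (𝟙 Y) 0 : sum Y ⟨single ax ⟨one⟩⟩ ⟶ Y) := by
    refine (congrArg K.map (eq_ofTotal_comp f)).trans ((K.map_comp _ _).trans ?_)
    refine congrArg (· ≫ K.map (desc (𝟙 Y) 0 : sum Y ⟨single ax ⟨one⟩⟩ ⟶ Y)) ?_
    exact (functor_map_ofTotal (T := isTerminal ax) (T' := T) (isStrict_counit op ax)
      f.arrow).trans (ofTotal_counit_map op f.arrow)
  -- Checked on the two summands: the lifted functor preserves the coprojections, the identity and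
  -- the zero arrow.
  have e₂ : K.map (desc (𝟙 Y) 0 : sum Y ⟨single ax ⟨one⟩⟩ ⟶ Y) =
      desc (𝟙 (total Y.of)) (0 : (⟨one⟩ : Par T) ⟶ total Y.of) := by
    refine hK.sum_ext ?_ ?_
    · refine ((K.map_comp _ _).symm.trans ((congrArg K.map (inl_desc _ _)).trans
        (K.map_id _))).trans ?_
      refine (inl_desc (𝟙 (total Y.of)) (0 : (⟨one⟩ : Par T) ⟶ total Y.of)).symm.trans ?_
      refine congrArg (· ≫ _) ?_
      refine Eq.symm ((functor_map_ofTotal (T := isTerminal ax) (T' := T) (isStrict_counit op ax)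
        (inl Y.of (single ax ⟨one⟩))).trans (congrArg (ofTotal T) ?_))
      exact (Category.comp_id _).symm.trans ((isStrict_counit op ax).map_inl _ _)
    · refine ((K.map_comp _ _).symm.trans ((congrArg K.map (inr_desc _ _)).trans
        (hK.map_zero _ _))).trans ?_
      refine (inr_desc (𝟙 (total Y.of)) (0 : (⟨one⟩ : Par T) ⟶ total Y.of)).symm.trans ?_
      refine congrArg (· ≫ _) ?_
      refine Eq.symm ((functor_map_ofTotal (T := isTerminal ax) (T' := T) (isStrict_counit op ax)
        (inr Y.of (single ax ⟨one⟩))).trans (congrArg (ofTotal T) ?_))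
      exact (Category.comp_id _).symm.trans ((isStrict_counit op ax).map_inr _ _)
  refine (congrArg (fun k => totalι X.of x ≫ k ≫ (isCoprod_total Y.of).proj y)
    (e₁.trans (congrArg (_ ≫ ·) e₂))).trans ?_
  refine (congrArg (totalι X.of x ≫ ·) (Category.assoc _ _ _)).trans ?_
  refine Eq.trans ?_ ((isPartialForm op).ι_totalMap_proj f.arrow x
    (inlIdx Y.of (single ax ⟨one⟩) y))
  refine congrArg (fun k => totalι X.of x ≫ (isPartialForm op).totalMap f.arrow ≫ k) ?_
  exact (IsCoprod.sum_proj_inl (B := (plus Y.of (single ax (⟨one⟩ : Par T))).fam)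
    (ι := totalι Y.of) (κ := totalι (single ax (⟨one⟩ : Par T))) (isCoprod_total Y.of)
    (isCoprod_total (single ax (⟨one⟩ : Par T))) y).symm

/-- For single systems the coproduct is the system itself with identity coprojection and projection,
so the entry formula says that the composite fixes every arrow. -/
theorem unit_comp_functor_counit (op : IsOperational T) (ax : (otcPar T).Axioms) :
    unit ax ⋙ functor (isTerminal ax) T (isStrict_counit op ax) = 𝟭 (Par T) :=
  CategoryTheory.Functor.hext (fun _ => rfl) (fun A B f => heq_of_eq (by
    have h := (ι_functor_counit_map_proj op ((unit ax).map f) (pt ax A) (pt ax B)).trans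
      (unit_map_entry f)
    have e : (isCoprod_total (single ax B)).proj (pt ax B) = 𝟙 B :=
      (IsCoprod.eq_proj (isCoprod_total (single ax B)) (Category.id_comp (𝟙 B))
        (fun y n => absurd rfl n)).symm
    exact ((Category.id_comp _).trans ((congrArg (_ ≫ ·) e).trans (Category.comp_id _))).symm.trans h))

end

/-! ### Uniqueness of strict functors out of a category of tests -/

section

variable {E : Type u} [Category.{v} E] {I : E} {D : OTCData E I} {ax : D.Axioms}
  {C : Type u} [Category.{v} C] [SpecCoproducts C] {one : C} {T : IsTerminal one}

/-- Collections are generated from single systems by the specified coproducts, and strictness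
determines the values on these; hence induction on the shape. -/
theorem obj_eq_of_unit_comp_eq {H₁ H₂ : OTCData.Coll ax ⥤ C}
    (h₁ : IsStrict (single ax I) H₁) (h₂ : IsStrict (single ax I) H₂)
    (e : ∀ A : E, H₁.obj (single ax A) = H₂.obj (single ax A)) :
    ∀ (s : Shape) (f : s.Idx → E), H₁.obj ⟨s, f⟩ = H₂.obj ⟨s, f⟩
  | .empty, f => by
    have : (⟨.empty, f⟩ : OTCData.Coll ax) = zero :=
      congrArg (OTCData.Coll.mk .empty) (funext fun x => Empty.elim x)
    rw [this, h₁.obj_zero, h₂.obj_zero]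
  | .point, f => e (f ())
  | .plus s t, f => by
    have : (⟨.plus s t, f⟩ : OTCData.Coll ax) =
        sum ⟨s, fun x => f (.inl x)⟩ ⟨t, fun y => f (.inr y)⟩ :=
      congrArg (OTCData.Coll.mk (.plus s t)) (funext fun i => by rcases i with x | y <;> rfl)
    rw [this, h₁.obj_sum, h₂.obj_sum, obj_eq_of_unit_comp_eq h₁ h₂ e s,
      obj_eq_of_unit_comp_eq h₁ h₂ e t]

theorem singleι_plus_inl (X Y : OTCData.Coll ax) (x : X.Idx) :
    singleι (plus X Y) (inlIdx X Y x) = singleι X x ≫ inl X Y :=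
  OTCData.Coll.hom_ext fun _ s =>
    (OTCData.Coll.singleι_comp_entry (X := X) x (inl X Y) s).symm

theorem singleι_plus_inr (X Y : OTCData.Coll ax) (y : Y.Idx) :
    singleι (plus X Y) (inrIdx X Y y) = singleι Y y ≫ inr X Y :=
  OTCData.Coll.hom_ext fun _ s =>
    (OTCData.Coll.singleι_comp_entry (X := Y) y (inr X Y) s).symm

theorem inl_eqToHom {A A' B B' : C} (hA : A = A') (hB : B = B') (h : sum A B = sum A' B') :
    inl A B ≫ eqToHom h = eqToHom hA ≫ inl A' B' := by
  subst hA hB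
  simp

theorem inr_eqToHom {A A' B B' : C} (hA : A = A') (hB : B = B') (h : sum A B = sum A' B') :
    inr A B ≫ eqToHom h = eqToHom hB ≫ inr A' B' := by
  subst hA hB
  simp

/-- Functors which agree on objects agree on an arrow, up to the equalities of the objects. -/
def MapEq {K : Type u} [Category.{v} K] {C : Type u} [Category.{v} C] {H₁ H₂ : K ⥤ C}
    (e : ∀ X, H₁.obj X = H₂.obj X) {X Y : K} (f : X ⟶ Y) : Prop :=
  H₁.map f ≫ eqToHom (e Y) = eqToHom (e X) ≫ H₂.map f

theorem MapEq.comp {K : Type u} [Category.{v} K] {C : Type u} [Category.{v} C] {H₁ H₂ : K ⥤ C}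
    {e : ∀ X, H₁.obj X = H₂.obj X} {X Y Z : K} {f : X ⟶ Y} {g : Y ⟶ Z} (h : MapEq e f)
    (h' : MapEq e g) : MapEq e (f ≫ g) := by
  unfold MapEq at h h' ⊢
  rw [Functor.map_comp, Functor.map_comp, Category.assoc, h', ← Category.assoc, h, Category.assoc]

theorem MapEq.id {K : Type u} [Category.{v} K] {C : Type u} [Category.{v} C] {H₁ H₂ : K ⥤ C}
    {e : ∀ X, H₁.obj X = H₂.obj X} (X : K) : MapEq e (𝟙 X) := by
  simp [MapEq]

/-- Agreement on an arrow out of a coproduct can be tested on the summands when `H₁` sends the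
coprojections to coprojections. The next lemma is the version for arrows into an object on which the
family `H₂.map (π y)` is jointly monic. -/
theorem MapEq.of_ι_comp {K : Type u} [Category.{v} K] {C : Type u} [Category.{v} C] {H₁ H₂ : K ⥤ C}
    {e : ∀ X, H₁.obj X = H₂.obj X} {X : Type} {B : X → K} {P : K} {ι : ∀ x, B x ⟶ P}
    (h : IsCoprod (fun x => H₁.map (ι x))) (hι : ∀ x, MapEq e (ι x)) {Z : K} {f : P ⟶ Z}
    (hf : ∀ x, MapEq e (ι x ≫ f)) : MapEq e f := by
  refine h.hom_ext fun x => ?_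
  have h₁ := hι x
  have h₂ := hf x
  unfold MapEq at h₁ h₂
  rw [Functor.map_comp, Functor.map_comp, Category.assoc] at h₂
  rw [h₂, ← Category.assoc, ← h₁, Category.assoc]

theorem MapEq.of_comp {K : Type u} [Category.{v} K] {C : Type u} [Category.{v} C] {H₁ H₂ : K ⥤ C}
    {e : ∀ X, H₁.obj X = H₂.obj X} {Y : Type} {B : Y → K} {A P : K} {π : ∀ y, P ⟶ B y}
    (h : ∀ {Z : C} {f g : Z ⟶ H₂.obj P}, (∀ y, f ≫ H₂.map (π y) = g ≫ H₂.map (π y)) → f = g)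
    (hπ : ∀ y, MapEq e (π y)) {f : A ⟶ P} (hf : ∀ y, MapEq e (f ≫ π y)) : MapEq e f := by
  refine h fun y => ?_
  have h₁ := hπ y
  have h₂ := hf y
  unfold MapEq at h₁ h₂
  rw [Functor.map_comp, Functor.map_comp, Category.assoc, h₁] at h₂
  rw [Category.assoc, h₂, Category.assoc]

theorem mapEq_inl {K : Type u} [Category.{v} K] [SpecCoproducts K] {one' : K} {H₁ H₂ : K ⥤ C}
    (h₁ : IsStrict one' H₁) (h₂ : IsStrict one' H₂) (e : ∀ X, H₁.obj X = H₂.obj X) (A B : K) :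
    MapEq e (inl A B) := by
  unfold MapEq
  rw [h₁.map_inl_eq, h₂.map_inl_eq, Category.assoc, eqToHom_trans, ← Category.assoc,
    ← inl_eqToHom (e A) (e B) (by rw [e, e]), Category.assoc, eqToHom_trans]

theorem mapEq_inr {K : Type u} [Category.{v} K] [SpecCoproducts K] {one' : K} {H₁ H₂ : K ⥤ C}
    (h₁ : IsStrict one' H₁) (h₂ : IsStrict one' H₂) (e : ∀ X, H₁.obj X = H₂.obj X) (A B : K) :
    MapEq e (inr A B) := by
  unfold MapEq
  rw [h₁.map_inr_eq, h₂.map_inr_eq, Category.assoc, eqToHom_trans, ← Category.assoc,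
    ← inr_eqToHom (e A) (e B) (by rw [e, e]), Category.assoc, eqToHom_trans]

theorem mapEq_singleι {H₁ H₂ : OTCData.Coll ax ⥤ C}
    (h₁ : IsStrict (single ax I) H₁) (h₂ : IsStrict (single ax I) H₂)
    (e : ∀ X, H₁.obj X = H₂.obj X) :
    ∀ (s : Shape) (f : s.Idx → E) (x : s.Idx), MapEq e (singleι ⟨s, f⟩ x)
  | .empty, _, x => Empty.elim x
  | .point, f, _ => MapEq.id (single ax (f ()))
  | .plus s t, f, x => by
    obtain ⟨f₁, f₂, rfl⟩ : ∃ (f₁ : s.Idx → E) (f₂ : t.Idx → E), f = Sum.elim f₁ f₂ :=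
      ⟨fun x => f (.inl x), fun y => f (.inr y), by funext i; rcases i with x | y <;> rfl⟩
    rcases x with x | y
    · have h := (mapEq_singleι h₁ h₂ e s f₁ x).comp (mapEq_inl h₁ h₂ e _ ⟨t, f₂⟩)
      rw [← singleι_plus_inl ⟨s, f₁⟩ ⟨t, f₂⟩ x] at h
      exact h
    · have h := (mapEq_singleι h₁ h₂ e t f₂ y).comp (mapEq_inr h₁ h₂ e ⟨s, f₁⟩ _)
      rw [← singleι_plus_inr ⟨s, f₁⟩ ⟨t, f₂⟩ y] at h
      exact h

/-- Cut a matrix, as a partial arrow, by a coprojection before and a projection after. The result is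
a one-by-one matrix, which lies in the image of the unit, where the lifted functors agree. They also
agree on coprojections and projections, which are jointly epic and jointly monic, so they agree
everywhere. -/
theorem eq_of_unit_comp_eq (op : IsOperational T) {H₁ H₂ : OTCData.Coll ax ⥤ C}
    (h₁ : IsStrict (single ax I) H₁) (h₂ : IsStrict (single ax I) H₂)
    (h : unit ax ⋙ functor (isTerminal ax) T h₁ = unit ax ⋙ functor (isTerminal ax) T h₂) :
    H₁ = H₂ := by
  let K₁ := functor (isTerminal ax) T h₁
  let K₂ := functor (isTerminal ax) T h₂
  have k₁ := isPartialFunctor (T := isTerminal ax) (T' := T) h₁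
  have k₂ := isPartialFunctor (T := isTerminal ax) (T' := T) h₂
  have e : ∀ X, H₁.obj X = H₂.obj X := fun X =>
    obj_eq_of_unit_comp_eq h₁ h₂ (fun A => congrArg Par.of (Functor.congr_obj h A)) X.shape X.fam
  have e' : ∀ X, K₁.obj X = K₂.obj X := fun X => congrArg (Par.mk (T := T)) (e X.of)
  have ofT : ∀ {A B : C} (h : A = B), ofTotal T (eqToHom h) =
      eqToHom (congrArg (Par.mk (T := T)) h) := by
    rintro A _ rfl
    exact ofTotal_id A
  -- Passing to partial arrows is faithful, so agreement can be proved there, where projections are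
  -- available, and brought back.
  have mapEq_ofTotal : ∀ {X Y : OTCData.Coll ax} (M : X ⟶ Y),
      MapEq e' (ofTotal (isTerminal ax) M) ↔ MapEq e M := by
    intro X Y M
    have a₁ : K₁.map (ofTotal (isTerminal ax) M) ≫ eqToHom (e' ⟨Y⟩) =
        ofTotal T (H₁.map M ≫ eqToHom (e Y)) := by
      rw [ofTotal_comp, ofT]
      exact congrArg (· ≫ eqToHom (e' ⟨Y⟩)) (functor_map_ofTotal h₁ M)
    have a₂ : eqToHom (e' ⟨X⟩) ≫ K₂.map (ofTotal (isTerminal ax) M) =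
        ofTotal T (eqToHom (e X) ≫ H₂.map M) := by
      rw [ofTotal_comp, ofT]
      exact congrArg (eqToHom (e' ⟨X⟩) ≫ ·) (functor_map_ofTotal h₂ M)
    exact ⟨fun hh => ofTotal_injective op (a₁.symm.trans (hh.trans a₂)),
      fun hh => a₁.trans ((congrArg (ofTotal T) hh).trans a₂.symm)⟩
  have hι : ∀ (X : OTCData.Coll ax) (x : X.Idx), MapEq e' (collι X x) := fun X x =>
    (mapEq_ofTotal _).2 (mapEq_singleι h₁ h₂ e X.shape X.fam x)
  have hη : ∀ {A B : E} (f : A ⟶ B), MapEq e' ((unit ax).map f) := fun {A B} f => by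
    have := Functor.congr_hom h f
    have h' : K₁.map ((unit ax).map f) = eqToHom (e' ((unit ax).obj A)) ≫
      K₂.map ((unit ax).map f) ≫ eqToHom (e' ((unit ax).obj B)).symm := this
    unfold MapEq
    rw [h']
    simp
  have hz : ∀ X Y : Par (isTerminal ax), MapEq e' (0 : X ⟶ Y) := fun X Y => by
    unfold MapEq
    rw [k₁.map_zero, k₂.map_zero, zero_comp, comp_zero]
  -- On each summand a projection is an identity or a zero arrow, and both lifted functors preserve
  -- zero arrows.
  have hπ : ∀ (Y : OTCData.Coll ax) (y : Y.Idx), MapEq e' ((isCoprod_collι Y).proj y) := by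
    intro Y y
    refine MapEq.of_ι_comp (k₁.isCoprod (isCoprod_collι Y)) (hι Y) fun y' => ?_
    by_cases n : y' = y
    · subst n
      rw [IsCoprod.ι_proj_self]
      exact MapEq.id _
    · rw [IsCoprod.ι_proj_ne _ n]
      exact hz _ _
  have hM : ∀ {X Y : OTCData.Coll ax} (M : X ⟶ Y), MapEq e M := by
    intro X Y M
    refine (mapEq_ofTotal M).1 (MapEq.of_ι_comp (k₁.isCoprod (isCoprod_collι X)) (hι X)
      fun x => MapEq.of_comp (π := (isCoprod_collι Y).proj) (fun {Z f g} hfg => ?_) (hπ Y)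
        fun y => ?_)
    · refine (isPartialForm op).coprod_ext (k₂.isCoprod (isCoprod_collι Y)) fun y => ?_
      rw [← k₂.map_proj (isCoprod_collι Y)]
      exact hfg y
    · rw [← unit_map_entry_self ((collι X x ≫ ofTotal (isTerminal ax) M) ≫
        (isCoprod_collι Y).proj y)]
      exact hη _
  refine CategoryTheory.Functor.ext e fun X Y M => ?_
  have := hM M
  unfold MapEq at this
  rw [← Category.assoc, ← this]
  simp

end

end Par

/-- Transposition is `f ↦ η ≫ R.map f`. A preimage of `g` is `L.map g ≫ k` by naturality of `η` and
one triangle identity, and `hi` is injectivity; naturality of the `k` and the other triangle are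
then automatic. -/
theorem exists_adjunction {C : Type*} [Category* C] {D : Type*} [Category* D] {L : C ⥤ D}
    {R : D ⥤ C} (η : ∀ X, X ⟶ R.obj (L.obj X))
    (hη : ∀ {X Y : C} (f : X ⟶ Y), η X ≫ R.map (L.map f) = f ≫ η Y)
    (ε : ∀ Y, ∃ k : L.obj (R.obj Y) ⟶ Y, η (R.obj Y) ≫ R.map k = 𝟙 _)
    (hi : ∀ {X Y} {f g : L.obj X ⟶ Y}, η X ≫ R.map f = η X ≫ R.map g → f = g) :
    Nonempty (L ⊣ R) := by
  have hb : ∀ X Y, Function.Bijective (fun f : L.obj X ⟶ Y => η X ≫ R.map f) := fun X Y =>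
    ⟨fun _ _ h => hi h, fun g => by
      obtain ⟨k, hk⟩ := ε Y
      refine ⟨L.map g ≫ k, ?_⟩
      simp only [Functor.map_comp]
      rw [← Category.assoc, hη, Category.assoc, hk, Category.comp_id]⟩
  exact ⟨Adjunction.mkOfHomEquiv
    { homEquiv := fun X Y => Equiv.ofBijective _ (hb X Y)
      homEquiv_naturality_left_symm := fun {X' X Y} f g => by
        obtain ⟨g, rfl⟩ := (hb X Y).2 g
        have h₁ := (Equiv.ofBijective _ (hb X Y)).symm_apply_apply g
        rw [Equiv.symm_apply_eq]
        refine Eq.trans ?_ (congrArg (fun k => η X' ≫ R.map (L.map f ≫ k)) h₁.symm)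
        simp only [Functor.map_comp]
        rw [← Category.assoc, ← Category.assoc, hη]
      homEquiv_naturality_right := fun f g => by
        simp [Functor.map_comp] }⟩

/-- Inclusions of full subcategories are fully faithful, so once both functors restrict, the
bijections of hom-sets and the unit do as well. -/
theorem restrictsTo_of {C : Type*} [Category* C] {D : Type*} [Category* D] {L : C ⥤ D} {R : D ⥤ C}
    (adj : L ⊣ R) (P : ObjectProperty C) (Q : ObjectProperty D) (hL : ∀ X, P X → Q (L.obj X))
    (hR : ∀ Y, Q Y → P (R.obj Y)) : RestrictsTo adj P Q := by
  refine ⟨hL, hR, adj.restrictFullyFaithful P.fullyFaithfulι Q.fullyFaithfulι (Iso.refl _)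
    (Iso.refl _), fun X => ?_⟩
  have := Adjunction.map_restrictFullyFaithful_unit_app adj P.fullyFaithfulι
    Q.fullyFaithfulι
    (L := Q.lift (P.ι ⋙ L) (fun X => hL X.obj X.property))
    (R := P.lift (Q.ι ⋙ R) (fun Y => hR Y.obj Y.property)) (Iso.refl _) (Iso.refl _) X
  refine Eq.trans this ?_
  simp

/-- The unit of the adjunction between theories and operational categories. -/
def unitHom (Θ : OTC.{v, u}) :
    Θ ⟶ (otcOfPar parWellDefined).obj ((opCat testsWellDefined).obj Θ) :=
  ⟨Par.unit Θ.ax, Par.isMorphism_unit (Par.isPartialForm (OTCData.Coll.isOperational Θ.ax)) _⟩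

theorem OTCData.Coll.comp_sumMap_id_entry_inl {E : Type u} [Category.{v} E] {I : E}
    {D : OTCData E I} {ax : D.Axioms} {X Y Z W : Coll ax} (M : X ⟶ plus Y Z) (g : Z ⟶ W)
    (x : X.Idx) (y : Y.Idx) :
    (M ≫ sumMap (𝟙 Y) g).entry x (inlIdx Y W y) = M.entry x (inlIdx Y Z y) := by
  refine (comp_sumMap_entry_inl M (𝟙 Y) g x y).trans ?_
  refine (bigOvee_eq_single ax _ y fun y' n => ?_).trans ?_
  · exact (congrArg (_ ≫ ·) (delta_ne Y n)).trans (ax.comp_zero _)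
  · exact (congrArg (_ ≫ ·) (delta_self Y y)).trans (Category.comp_id _)

open OTCData.Coll in
-- The lifted functor corrects `F(Y + 1)` to `F(Y) + 1` by a change of family and a map on the
-- second summand; neither affects the entries in `Y`.
theorem Par.functor_tests_map_entry {Θ Θ' : OTC.{v, u}} (F : OTC.Hom Θ Θ')
    (h : IsStrict (single Θ.ax Θ.I) F.tests) {X Y : Par (isTerminal Θ.ax)} (f : X ⟶ Y)
    (x : X.of.Idx) (y : Y.of.Idx) :
    entry ((functor (isTerminal Θ.ax) (isTerminal Θ'.ax) h).map f) x y =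
      F.toFunctor.map (entry f x y) := by
  have e : (fun s => F.toFunctor.obj (Sum.elim Y.of.fam (single Θ.ax Θ.I).fam s)) =
      Sum.elim (F.tests.obj Y.of).fam (F.tests.obj (single Θ.ax Θ.I)).fam := by
    funext s
    rcases s with y | u <;> rfl
  let M := F.tests.map f.arrow ≫ eqToHom (congrArg (OTCData.Coll.mk (ax := Θ'.ax) _) e)
  have hM : M.entry x (inlIdx (F.tests.obj Y.of) (F.tests.obj (single Θ.ax Θ.I)) y) =
      F.toFunctor.map (entry f x y) :=
    (comp_eqToHom_entry (ax := Θ'.ax) e (F.tests.map f.arrow) x (.inl y)).trans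
      (Category.comp_id _)
  refine Eq.trans ?_ hM
  refine Eq.trans (congrArg (fun N : F.tests.obj X.of ⟶ plus (F.tests.obj Y.of)
    (single Θ'.ax Θ'.I) => Hom.entry N x (inlIdx (F.tests.obj Y.of) (single Θ'.ax Θ'.I) y))
    (Category.assoc (F.tests.map f.arrow) _ _).symm) ?_
  exact comp_sumMap_id_entry_inl (Y := F.tests.obj Y.of) (Z := F.tests.obj (single Θ.ax Θ.I)) M
    ((isTerminal Θ'.ax).from _) x y

theorem unit_comp_functor_tests {Θ Θ' : OTC.{v, u}} (F : OTC.Hom Θ Θ')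
    (h : IsStrict (OTCData.Coll.single Θ.ax Θ.I) F.tests) :
    Par.unit Θ.ax ⋙ Par.functor (OTCData.Coll.isTerminal Θ.ax) (OTCData.Coll.isTerminal Θ'.ax) h =
      F.toFunctor ⋙ Par.unit Θ'.ax :=
  CategoryTheory.Functor.hext (fun _ => rfl) fun A B f => heq_of_eq (by
    exact Par.entry_ext fun _ _ => ((Par.functor_tests_map_entry F h _ _ _).trans
      (congrArg F.toFunctor.map (Par.unit_map_entry f))).trans
        (Par.unit_map_entry (ax := Θ'.ax) (F.toFunctor.map f)).symm)

theorem exists_adjunction_opCat :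
    Nonempty (opCat testsWellDefined.{v, u} ⊣ otcOfPar parWellDefined.{v, u}) :=
  exists_adjunction unitHom
    (fun F => OTC.Hom.ext (unit_comp_functor_tests F (testsWellDefined.isStrict F)))
    (fun B => ⟨⟨Par.counit B.isOperational (parWellDefined.axioms B),
      Par.isStrict_counit B.isOperational _⟩,
      OTC.Hom.ext (Par.unit_comp_functor_counit B.isOperational (parWellDefined.axioms B))⟩)
    (fun {_ B H₁ H₂} h => OpCatStrict.Hom.ext (Par.eq_of_unit_comp_eq B.isOperational H₁.isStrict
      H₂.isStrict (congrArg OTC.Hom.toFunctor h)))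

theorem adjunction_opCat :
    ∃ (hL : TestsWellDefined.{v, u}) (hR : ParWellDefined.{v, u}) (adj : opCat hL ⊣ otcOfPar hR),
      RestrictsTo adj OTC.positiveCombining OpCatStrict.effectus :=
  ⟨testsWellDefined, parWellDefined, exists_adjunction_opCat.some, restrictsTo_of _ _ _
    (fun _ h => OTCData.Coll.isEffectus h.1 h.2)
    (fun B h => ⟨Par.isPositive B.isOperational h, Par.isCombining B.isOperational h _⟩)⟩

/-! ## Tensor products and coarse-graining -/

open MonoidalCategory

namespace OTCData

variable {E : Type u} [Category.{v} E] [MonoidalCategory E] {D : OTCData E (𝟙_ E)}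

theorem MonoidalAxioms.isPartialTest_tensor (m : D.MonoidalAxioms) (ax : D.Axioms) {X Y : Type}
    [Finite X] [Finite Y] {A C : E} (f : X → Out A) (g : Y → Out C) (tf : D.IsPartialTest f)
    (tg : D.IsPartialTest g) :
    D.IsPartialTest (fun p : X × Y => ev ((f p.1).2 ⊗ₘ (g p.2).2)) := by
  obtain ⟨X', _, f', tf⟩ := tf
  obtain ⟨Y', _, g', tg⟩ := tg
  exact isPartialTest_comp_inj ax (isPartialTest_of_isTest ax (m.parallel _ _ tf tg))
    (fun p : X × Y => ((Sum.inl p.1 : X ⊕ X'), (Sum.inl p.2 : Y ⊕ Y'))) (by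
      rintro ⟨x, y⟩ ⟨x', y'⟩ h
      simpa using h)

theorem MonoidalAxioms.tensor_add (m : D.MonoidalAxioms) (ax : D.Axioms) {A B C F : E}
    (f : A ⟶ B) (g h : C ⟶ F) (c : D.Compat g h) :
    f ⊗ₘ D.add g h = D.add (f ⊗ₘ g) (f ⊗ₘ h) := by
  have c' : D.Compat (f ⊗ₘ g) (f ⊗ₘ h) := by
    have := isPartialTest_comp_inj ax
      (m.isPartialTest_tensor ax _ _ (isPartialTest_unique ax f) c)
      (fun i : Fin 2 => ((), i)) (fun _ _ h => (Prod.mk.inj h).2)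
    unfold TestSpec.Compat
    convert this using 1
    funext i
    match i with
    | 0 => rfl
    | 1 => rfl
  rw [add, add, dif_pos c, dif_pos c', m.tensor_ovee]

theorem MonoidalAxioms.tensor_bigOvee (m : D.MonoidalAxioms) (ax : D.Axioms) {X : Type} [Finite X]
    {A B C F : E} (f : A ⟶ B) (g : X → (C ⟶ F)) (t : D.IsPartialTest (fun x => ev (g x))) :
    f ⊗ₘ D.bigOvee g = D.bigOvee (fun x => f ⊗ₘ g x) := by
  have key : ∀ l : List (C ⟶ F), D.LPart (l.map ev) →
      f ⊗ₘ D.lsum l = D.lsum (l.map (f ⊗ₘ ·)) := by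
    intro l
    induction l with
    | nil => exact fun _ => m.tensor_zero f C F
    | cons a l ih =>
      intro t
      simp only [lsum, List.map_cons]
      rw [m.tensor_add ax _ _ _ (compat_cons ax a l t), ih (LPart.of_append ax (l := [ev a]) t)]
  unfold bigOvee
  rw [key _ (lPart_enum ax g t), List.map_map]
  rfl

/-- The axioms give distributivity only in the second variable; the braiding moves it to the first.
-/
theorem MonoidalAxioms.bigOvee_tensor [SymmetricCategory E] (m : D.MonoidalAxioms) (ax : D.Axioms)
    {X : Type} [Finite X] {A B C F : E} (f : X → (A ⟶ B)) (g : C ⟶ F)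
    (t : D.IsPartialTest (fun x => ev (f x))) :
    D.bigOvee f ⊗ₘ g = D.bigOvee (fun x => f x ⊗ₘ g) := by
  have t' : D.IsPartialTest (fun x => ev (f x ⊗ₘ g)) :=
    isPartialTest_comp_inj ax
      (m.isPartialTest_tensor ax _ _ t (isPartialTest_unique ax g))
      (fun x => (x, ())) (fun _ _ h => (Prod.mk.inj h).1)
  rw [← cancel_mono (β_ B F).hom, BraidedCategory.braiding_naturality, m.tensor_bigOvee ax g f t,
    bigOvee_comp ax _ _ t', comp_bigOvee ax]
  · simp only [BraidedCategory.braiding_naturality]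
  · exact isPartialTest_comp_inj ax
      (m.isPartialTest_tensor ax _ _ (isPartialTest_unique ax g) t)
      (fun x => ((), x)) (fun _ _ h => (Prod.mk.inj h).2)

/-- Bilinearity of the tensor over coarse-graining is what makes the tensor of matrices functorial.
-/
theorem MonoidalAxioms.bigOvee_tensor_bigOvee [SymmetricCategory E] (m : D.MonoidalAxioms)
    (ax : D.Axioms) {X Y : Type} [Finite X] [Finite Y] {A B C F : E} (f : X → (A ⟶ B))
    (g : Y → (C ⟶ F)) (tf : D.IsPartialTest (fun x => ev (f x)))
    (tg : D.IsPartialTest (fun y => ev (g y))) :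
    D.bigOvee f ⊗ₘ D.bigOvee g = D.bigOvee (fun p : X × Y => f p.1 ⊗ₘ g p.2) := by
  rw [m.bigOvee_tensor ax _ _ tf]
  simp only [m.tensor_bigOvee ax _ g tg]
  exact bigOvee_bigOvee ax (fun x y => f x ⊗ₘ g y)
    (m.isPartialTest_tensor ax (fun x => ev (f x)) (fun y => ev (g y)) tf tg)

end OTCData

/-! ## The symmetric monoidal category of tests -/

namespace OTCData.Coll

section

variable {E : Type u} [Category.{v} E] {I : E} {D : OTCData E I} {ax : D.Axioms}

theorem isIso_delta (X : Coll ax) {x x' : X.Idx} (h : x = x') : IsIso (X.delta x x') := by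
  subst h
  rw [delta_self]
  infer_instance

theorem isDet_delta (X : Coll ax) {x x' : X.Idx} (h : x = x') : D.IsDet (X.delta x x') := by
  subst h
  rw [delta_self]
  exact ax.id_det _

/-- Discarding is the only deterministic effect, so `f` followed by discarding is discarding; hence
so is `inv f` followed by discarding. -/
theorem isDet_inv (ax : D.Axioms) {A B : E} (f : A ⟶ B) [IsIso f] (h : D.IsDet f) : D.IsDet (inv f) :=
  isDet_of_comp_disc ax (by
    rw [← eq_disc ax (isDet_comp ax h (isDet_disc ax B)), IsIso.inv_hom_id_assoc]
    exact isDet_disc ax B)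

theorem comp_delta {X : Coll ax} {A : E} (f : ∀ x, A ⟶ X.fam x) {x x' : X.Idx} (h : x = x') :
    f x ≫ X.delta x x' = f x' := by
  subst h
  rw [delta_self, Category.comp_id]

theorem delta_comp {X : Coll ax} {A : E} (f : ∀ x, X.fam x ⟶ A) {x x' : X.Idx} (h : x = x') :
    X.delta x x' ≫ f x' = f x := by
  subst h
  rw [delta_self, Category.id_comp]

/-- A matrix of isomorphisms along a bijection is an isomorphism. -/
theorem isIso_of_bijective {X Y : Coll ax} (M : X ⟶ Y) (σ : X.Idx → Y.Idx)
    (hσ : Function.Bijective σ) (h₀ : ∀ x y, y ≠ σ x → M.entry x y = D.zero _ _)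
    (h₁ : ∀ x, IsIso (M.entry x (σ x))) (h₂ : ∀ x, D.IsDet (M.entry x (σ x))) : IsIso M := by
  let e := Equiv.ofBijective σ hσ
  -- The inverse matrix is supported on the inverse bijection. Its rows are tests since they are
  -- rows of an identity matrix, reindexed by `σ` and followed by deterministic inverses.
  let N : Y ⟶ X := ⟨fun y x => Y.delta y (σ x) ≫ inv (M.entry x (σ x)), fun y =>
    isTest_comp_det ax (fun x => Y.delta y (σ x)) (fun x => inv (M.entry x (σ x)))
      (ax.reindex e _ (Y.isTest_delta y)) (fun x => isDet_inv ax _ (h₂ x))⟩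
  refine ⟨N, hom_ext fun x x' => ?_, hom_ext fun y y' => ?_⟩
  · refine (comp_entry_of_left M N x x' (σ x) (h₀ x)).trans ?_
    by_cases h : x = x'
    · subst h
      refine (congrArg (M.entry x (σ x) ≫ ·) ((congrArg (· ≫ inv (M.entry x (σ x)))
        (delta_self Y (σ x))).trans (Category.id_comp _))).trans ?_
      exact (IsIso.hom_inv_id _).trans (delta_self X x).symm
    · refine (congrArg (M.entry x (σ x) ≫ ·) ((congrArg (· ≫ inv (M.entry x' (σ x')))
        (delta_ne Y (fun e => h (hσ.1 e)))).trans (ax.zero_comp _))).trans ?_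
      exact (ax.comp_zero _).trans (delta_ne X h).symm
  · obtain ⟨x, rfl⟩ := hσ.2 y
    refine (comp_entry_of_left N M (σ x) y' x (fun x' h => ?_)).trans ?_
    · exact (congrArg (· ≫ inv (M.entry x' (σ x'))) (delta_ne Y (fun e => h (hσ.1 e).symm))).trans
        (ax.zero_comp _)
    · refine (congrArg (· ≫ M.entry x y') ((congrArg (· ≫ inv (M.entry x (σ x)))
        (delta_self Y (σ x))).trans (Category.id_comp _))).trans ?_
      by_cases h : y' = σ x
      · subst h
        exact (IsIso.inv_hom_id _).trans (delta_self Y _).symm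
      · rw [h₀ x y' h, ax.comp_zero]
        exact (delta_ne Y (Ne.symm h)).symm

theorem isIso_hom_comp {A B C : E} (e : A ≅ B) {f : B ⟶ C} (h : IsIso f) : IsIso (e.hom ≫ f) :=
  inferInstance

end

variable {E : Type u} [Category.{v} E] [MonoidalCategory E] {D : OTCData E (𝟙_ E)} {ax : D.Axioms}

theorem pair_ext {X Y : Coll ax} {i j : (X.tensor Y).Idx} (h₁ : fst i = fst j)
    (h₂ : snd i = snd j) : i = j :=
  (X.shape.pair Y.shape).injective (Prod.ext h₁ h₂)

theorem exists_pair (X Y : Coll ax) (x : X.Idx) (y : Y.Idx) :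
    ∃ i : (X.tensor Y).Idx, fst i = x ∧ snd i = y :=
  ⟨(X.shape.pair Y.shape).symm (x, y), by simp [fst], by simp [snd]⟩

theorem isIso_tensorHom {A B A' B' : E} {f : A ⟶ B} {g : A' ⟶ B'} (hf : IsIso f) (hg : IsIso g) :
    IsIso (f ⊗ₘ g) :=
  inferInstance

variable [SymmetricCategory E]

theorem delta_tensor_ne (m : D.MonoidalAxioms) (X Y : Coll ax) {x x' : X.Idx} {y y' : Y.Idx}
    (h : ¬(x = x' ∧ y = y')) : X.delta x x' ⊗ₘ Y.delta y y' = D.zero _ _ := by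
  by_cases h₁ : x = x'
  · rw [delta_ne Y (fun h₂ => h ⟨h₁, h₂⟩), m.tensor_zero]
  · rw [delta_ne X h₁, m.zero_tensor ax]

theorem delta_tensor_tensor_ne (m : D.MonoidalAxioms) (X Y Z : Coll ax) {x x' : X.Idx}
    {y y' : Y.Idx} {z z' : Z.Idx} (h : ¬(x = x' ∧ y = y' ∧ z = z')) :
    X.delta x x' ⊗ₘ (Y.delta y y' ⊗ₘ Z.delta z z') = D.zero _ _ := by
  by_cases h₁ : x = x'
  · rw [delta_tensor_ne m Y Z (fun h₂ => h ⟨h₁, h₂⟩), m.tensor_zero]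
  · rw [delta_ne X h₁, m.zero_tensor ax]

variable (ax)

/-- The matrix is supported on the reassociation of index triples, with isomorphisms there as
entries. -/
theorem isIso_associator (m : D.MonoidalAxioms) (X Y Z : Coll ax) :
    IsIso ((symmMonData ax m).associator X Y Z) := by
  -- The bijection is described by its components only, so the recursive definition of `Shape.pair`
  -- is never unfolded.
  have : ∀ i : ((X.tensor Y).tensor Z).Idx, ∃ j : (X.tensor (Y.tensor Z)).Idx,
      fst (fst i) = fst j ∧ snd (fst i) = fst (snd j) ∧ snd i = snd (snd j) := fun i => by
    obtain ⟨k, h₁, h₂⟩ := exists_pair Y Z (snd (fst i)) (snd i)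
    obtain ⟨j, h₃, rfl⟩ := exists_pair X (Y.tensor Z) (fst (fst i)) k
    exact ⟨j, h₃.symm, h₁.symm, h₂.symm⟩
  choose σ h₁ h₂ h₃ using this
  refine isIso_of_bijective _ σ ⟨fun i i' h => ?_, fun j => ?_⟩ (fun i j h => ?_) (fun i => ?_)
    (fun i => ?_)
  · refine pair_ext (pair_ext ?_ ?_) ?_
    · exact (h₁ i).trans ((congrArg fst h).trans (h₁ i').symm)
    · exact (h₂ i).trans ((congrArg (fun j => fst (snd j)) h).trans (h₂ i').symm)
    · exact (h₃ i).trans ((congrArg (fun j => snd (snd j)) h).trans (h₃ i').symm)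
  · obtain ⟨k, e₁, e₂⟩ := exists_pair X Y (fst j) (fst (snd j))
    obtain ⟨i, rfl, e₃⟩ := exists_pair (X.tensor Y) Z k (snd (snd j))
    exact ⟨i, pair_ext ((h₁ i).symm.trans e₁) (pair_ext ((h₂ i).symm.trans e₂)
      ((h₃ i).symm.trans e₃))⟩
  · refine (congrArg (_ ≫ ·) (delta_tensor_tensor_ne m X Y Z ?_)).trans (ax.comp_zero _)
    rintro ⟨e₁, e₂, e₃⟩
    exact h (pair_ext (e₁.symm.trans (h₁ i)) (pair_ext (e₂.symm.trans (h₂ i))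
      (e₃.symm.trans (h₃ i))))
  · exact isIso_hom_comp (α_ _ _ _) (isIso_tensorHom (isIso_delta X (h₁ i))
      (isIso_tensorHom (isIso_delta Y (h₂ i)) (isIso_delta Z (h₃ i))))
  · exact isDet_comp ax (m.isDet_associator ax _ _ _) (m.isDet_tensor ax (isDet_delta X (h₁ i))
      (m.isDet_tensor ax (isDet_delta Y (h₂ i)) (isDet_delta Z (h₃ i))))

theorem isIso_leftUnitor (m : D.MonoidalAxioms) (X : Coll ax) :
    IsIso ((symmMonData ax m).leftUnitor X) := by
  refine isIso_of_bijective _ (fun i => snd i) ⟨fun i i' h => pair_ext rfl h, fun x => ?_⟩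
    (fun i x h => ?_) (fun i => ?_) (fun i => ?_)
  · obtain ⟨i, -, h⟩ := exists_pair (single ax (𝟙_ E)) X () x
    exact ⟨i, h⟩
  · exact (congrArg (_ ≫ ·) (delta_ne X (Ne.symm h))).trans (ax.comp_zero _)
  · exact isIso_hom_comp (λ_ _) (isIso_delta X rfl)
  · exact isDet_comp ax (m.isDet_leftUnitor ax _) (isDet_delta X rfl)

theorem isIso_rightUnitor (m : D.MonoidalAxioms) (X : Coll ax) :
    IsIso ((symmMonData ax m).rightUnitor X) := by
  refine isIso_of_bijective _ (fun i => fst i) ⟨fun i i' h => pair_ext h rfl, fun x => ?_⟩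
    (fun i x h => ?_) (fun i => ?_) (fun i => ?_)
  · obtain ⟨i, h, -⟩ := exists_pair X (single ax (𝟙_ E)) x ()
    exact ⟨i, h⟩
  · exact (congrArg (_ ≫ ·) (delta_ne X (Ne.symm h))).trans (ax.comp_zero _)
  · exact isIso_hom_comp (ρ_ _) (isIso_delta X rfl)
  · exact isDet_comp ax (m.isDet_rightUnitor ax _) (isDet_delta X rfl)

theorem tensorHom_comp_tensorHom (m : D.MonoidalAxioms) {X₁ Y₁ Z₁ X₂ Y₂ Z₂ : Coll ax}
    (f₁ : X₁ ⟶ Y₁) (f₂ : X₂ ⟶ Y₂) (g₁ : Y₁ ⟶ Z₁) (g₂ : Y₂ ⟶ Z₂) :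
    (symmMonData ax m).tensorHom f₁ f₂ ≫ (symmMonData ax m).tensorHom g₁ g₂ =
      (symmMonData ax m).tensorHom (f₁ ≫ g₁) (f₂ ≫ g₂) :=
  hom_ext fun i k => by
    have t₁ := isPartialTest_comp f₁ g₁ (fst i) (fst k)
    have t₂ := isPartialTest_comp f₂ g₂ (snd i) (snd k)
    refine Eq.trans ?_ (m.bigOvee_tensor_bigOvee ax _ _ t₁ t₂).symm
    refine Eq.trans ?_ (bigOvee_equiv ax (Y₁.shape.pair Y₂.shape) _
      (m.isPartialTest_tensor ax _ _ t₁ t₂))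
    exact congrArg D.bigOvee (funext fun j => MonoidalCategory.tensorHom_comp_tensorHom _ _ _ _)

theorem associator_naturality (m : D.MonoidalAxioms) {X₁ X₂ X₃ Y₁ Y₂ Y₃ : Coll ax}
    (f₁ : X₁ ⟶ Y₁) (f₂ : X₂ ⟶ Y₂) (f₃ : X₃ ⟶ Y₃) :
    (symmMonData ax m).tensorHom ((symmMonData ax m).tensorHom f₁ f₂) f₃ ≫
        (symmMonData ax m).associator Y₁ Y₂ Y₃ =
      (symmMonData ax m).associator X₁ X₂ X₃ ≫
        (symmMonData ax m).tensorHom f₁ ((symmMonData ax m).tensorHom f₂ f₃) :=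
  hom_ext fun i j => by
    -- The associators are supported on a bijection, so each side has a single nonzero term: `k` is
    -- the reassociation of `j`, and `l` that of `i`.
    obtain ⟨k', h₁, h₂⟩ := exists_pair Y₁ Y₂ (fst j) (fst (snd j))
    obtain ⟨k, rfl, h₃⟩ := exists_pair (Y₁.tensor Y₂) Y₃ k' (snd (snd j))
    obtain ⟨l', h₅, h₆⟩ := exists_pair X₂ X₃ (snd (fst i)) (snd i)
    obtain ⟨l, h₄, rfl⟩ := exists_pair X₁ (X₂.tensor X₃) (fst (fst i)) l'
    refine (comp_entry_of_right _ ((symmMonData ax m).associator Y₁ Y₂ Y₃) i j k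
      fun k' n => ?_).trans (Eq.trans ?_ (comp_entry_of_left
        ((symmMonData ax m).associator X₁ X₂ X₃) _ i j l fun l' n => ?_).symm)
    · refine (congrArg (_ ≫ ·) (delta_tensor_tensor_ne m _ _ _ ?_)).trans (ax.comp_zero _)
      rintro ⟨e₁, e₂, e₃⟩
      exact n (pair_ext (pair_ext (e₁.trans h₁.symm) (e₂.trans h₂.symm)) (e₃.trans h₃.symm))
    · refine Eq.trans (b := (α_ _ _ _).hom ≫ (f₁.entry (fst (fst i)) (fst j) ⊗ₘ
        (f₂.entry (snd (fst i)) (fst (snd j)) ⊗ₘ f₃.entry (snd i) (snd (snd j))))) ?_ ?_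
      · rw [← comp_delta (f₁.entry (fst (fst i))) h₁, ← comp_delta (f₂.entry (snd (fst i))) h₂,
          ← comp_delta (f₃.entry (snd i)) h₃, ← MonoidalCategory.tensorHom_comp_tensorHom,
          ← MonoidalCategory.tensorHom_comp_tensorHom]
        exact (MonoidalCategory.associator_naturality_assoc _ _ _ _).trans rfl
      · refine Eq.trans ?_ (Category.assoc _ _ _).symm
        refine congrArg (_ ≫ ·) ?_
        refine Eq.trans ?_ (MonoidalCategory.tensorHom_comp_tensorHom _ _ _ _).symm
        refine congrArg₂ (· ⊗ₘ ·) (delta_comp (fun x => f₁.entry x (fst j)) h₄.symm).symm ?_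
        refine Eq.trans ?_ (MonoidalCategory.tensorHom_comp_tensorHom _ _ _ _).symm
        exact congrArg₂ (· ⊗ₘ ·) (delta_comp (fun x => f₂.entry x (fst (snd j))) h₅.symm).symm
          (delta_comp (fun x => f₃.entry x (snd (snd j))) h₆.symm).symm
    · refine (congrArg (_ ≫ ·) (delta_tensor_tensor_ne m _ _ _ ?_)).trans (ax.comp_zero _)
      rintro ⟨e₁, e₂, e₃⟩
      exact n (pair_ext (e₁.symm.trans h₄.symm) (pair_ext (e₂.symm.trans h₅.symm)
        (e₃.symm.trans h₆.symm)))

end OTCData.Coll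

open MonoidalCategory

/-! ## Naturality of the coherence diagrams -/

namespace SymmMonData

variable {C : Type u} [Category.{v} C]

/-- The functoriality and naturality laws of a symmetric monoidal category. -/
structure NaturalityLaws (S : SymmMonData C) : Prop where
  id_tensorHom_id : ∀ X Y : C, S.tensorHom (𝟙 X) (𝟙 Y) = 𝟙 (S.tensorObj X Y)
  tensorHom_comp_tensorHom : ∀ {X₁ Y₁ Z₁ X₂ Y₂ Z₂ : C} (f₁ : X₁ ⟶ Y₁) (f₂ : X₂ ⟶ Y₂)
    (g₁ : Y₁ ⟶ Z₁) (g₂ : Y₂ ⟶ Z₂),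
    S.tensorHom f₁ f₂ ≫ S.tensorHom g₁ g₂ = S.tensorHom (f₁ ≫ g₁) (f₂ ≫ g₂)
  associator_naturality : ∀ {X₁ X₂ X₃ Y₁ Y₂ Y₃ : C} (f₁ : X₁ ⟶ Y₁) (f₂ : X₂ ⟶ Y₂)
    (f₃ : X₃ ⟶ Y₃), S.tensorHom (S.tensorHom f₁ f₂) f₃ ≫ S.associator Y₁ Y₂ Y₃ =
      S.associator X₁ X₂ X₃ ≫ S.tensorHom f₁ (S.tensorHom f₂ f₃)
  leftUnitor_naturality : ∀ {X Y : C} (f : X ⟶ Y),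
    S.tensorHom (𝟙 S.tensorUnit) f ≫ S.leftUnitor Y = S.leftUnitor X ≫ f
  rightUnitor_naturality : ∀ {X Y : C} (f : X ⟶ Y),
    S.tensorHom f (𝟙 S.tensorUnit) ≫ S.rightUnitor Y = S.rightUnitor X ≫ f
  braiding_naturality : ∀ {X₁ Y₁ X₂ Y₂ : C} (f₁ : X₁ ⟶ Y₁) (f₂ : X₂ ⟶ Y₂),
    S.tensorHom f₁ f₂ ≫ S.braiding Y₁ Y₂ = S.braiding X₁ X₂ ≫ S.tensorHom f₂ f₁

namespace NaturalityLaws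

variable {S : SymmMonData C} (h : S.NaturalityLaws) {W X Y Z W' X' Y' Z' : C}
  (w : W ⟶ W') (x : X ⟶ X') (y : Y ⟶ Y') (z : Z ⟶ Z')

include h in
-- This and the lemmas following it say that each side of a coherence law is natural. A law known on
-- some objects then holds on others after precomposition with tensors of arrows between them.
theorem pentagon_left :
    S.tensorHom (S.tensorHom (S.tensorHom w x) y) z ≫ S.tensorHom (S.associator W' X' Y') (𝟙 Z') ≫
        S.associator W' (S.tensorObj X' Y') Z' ≫ S.tensorHom (𝟙 W') (S.associator X' Y' Z') =
      (S.tensorHom (S.associator W X Y) (𝟙 Z) ≫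
        S.associator W (S.tensorObj X Y) Z ≫ S.tensorHom (𝟙 W) (S.associator X Y Z)) ≫
        S.tensorHom w (S.tensorHom x (S.tensorHom y z)) := by
  rw [← Category.assoc, h.tensorHom_comp_tensorHom, h.associator_naturality, Category.comp_id]
  simp only [Category.assoc]
  rw [h.tensorHom_comp_tensorHom, Category.id_comp]
  have e : S.tensorHom (S.associator W X Y ≫ S.tensorHom w (S.tensorHom x y)) z =
      S.tensorHom (S.associator W X Y) (𝟙 Z) ≫ S.tensorHom (S.tensorHom w (S.tensorHom x y)) z := by
    rw [h.tensorHom_comp_tensorHom, Category.id_comp]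
  rw [e, Category.assoc]
  refine congrArg (_ ≫ ·) ?_
  rw [← Category.assoc, h.associator_naturality, Category.assoc, h.tensorHom_comp_tensorHom,
    Category.comp_id, h.associator_naturality]

include h in
theorem pentagon_right :
    S.tensorHom (S.tensorHom (S.tensorHom w x) y) z ≫
        S.associator (S.tensorObj W' X') Y' Z' ≫ S.associator W' X' (S.tensorObj Y' Z') =
      (S.associator (S.tensorObj W X) Y Z ≫ S.associator W X (S.tensorObj Y Z)) ≫
        S.tensorHom w (S.tensorHom x (S.tensorHom y z)) := by
  rw [← Category.assoc, h.associator_naturality, Category.assoc, h.associator_naturality,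
    Category.assoc]

include h in
theorem triangle_left :
    S.tensorHom (S.tensorHom x (𝟙 _)) y ≫ S.associator X' S.tensorUnit Y' ≫
        S.tensorHom (𝟙 X') (S.leftUnitor Y') =
      (S.associator X S.tensorUnit Y ≫ S.tensorHom (𝟙 X) (S.leftUnitor Y)) ≫ S.tensorHom x y := by
  rw [← Category.assoc, h.associator_naturality, Category.assoc, h.tensorHom_comp_tensorHom,
    h.leftUnitor_naturality, Category.assoc, h.tensorHom_comp_tensorHom, Category.comp_id,
    Category.id_comp]

include h in
theorem triangle_right :
    S.tensorHom (S.tensorHom x (𝟙 _)) y ≫ S.tensorHom (S.rightUnitor X') (𝟙 Y') =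
      S.tensorHom (S.rightUnitor X) (𝟙 Y) ≫ S.tensorHom x y := by
  rw [h.tensorHom_comp_tensorHom, h.tensorHom_comp_tensorHom, h.rightUnitor_naturality,
    Category.comp_id, Category.id_comp]

include h in
theorem hexagon_left :
    S.tensorHom (S.tensorHom x y) z ≫ S.associator X' Y' Z' ≫
        S.braiding X' (S.tensorObj Y' Z') ≫ S.associator Y' Z' X' =
      (S.associator X Y Z ≫ S.braiding X (S.tensorObj Y Z) ≫ S.associator Y Z X) ≫
        S.tensorHom y (S.tensorHom z x) := by
  rw [← Category.assoc, h.associator_naturality]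
  simp only [Category.assoc]
  rw [← Category.assoc (S.tensorHom _ _), h.braiding_naturality, Category.assoc,
    h.associator_naturality]

include h in
theorem hexagon_right :
    S.tensorHom (S.tensorHom x y) z ≫ S.tensorHom (S.braiding X' Y') (𝟙 Z') ≫
        S.associator Y' X' Z' ≫ S.tensorHom (𝟙 Y') (S.braiding X' Z') =
      (S.tensorHom (S.braiding X Y) (𝟙 Z) ≫ S.associator Y X Z ≫
        S.tensorHom (𝟙 Y) (S.braiding X Z)) ≫ S.tensorHom y (S.tensorHom z x) := by
  rw [← Category.assoc, h.tensorHom_comp_tensorHom, h.braiding_naturality, Category.comp_id]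
  simp only [Category.assoc]
  rw [h.tensorHom_comp_tensorHom, Category.id_comp]
  have e : S.tensorHom (S.braiding X Y ≫ S.tensorHom y x) z =
      S.tensorHom (S.braiding X Y) (𝟙 Z) ≫ S.tensorHom (S.tensorHom y x) z := by
    rw [h.tensorHom_comp_tensorHom, Category.id_comp]
  rw [e, Category.assoc]
  refine congrArg (_ ≫ ·) ?_
  rw [← Category.assoc, h.associator_naturality, Category.assoc, h.tensorHom_comp_tensorHom,
    Category.comp_id, h.braiding_naturality]

include h in
theorem symmetry_left :
    S.tensorHom x y ≫ S.braiding X' Y' ≫ S.braiding Y' X' =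
      (S.braiding X Y ≫ S.braiding Y X) ≫ S.tensorHom x y := by
  rw [← Category.assoc, h.braiding_naturality, Category.assoc, h.braiding_naturality,
    Category.assoc]

end NaturalityLaws

end SymmMonData

/-! ### Coherence laws for tests, by reduction to single systems -/

namespace OTCData.Coll

variable {E : Type u} [Category.{v} E] [MonoidalCategory E] [SymmetricCategory E]
  {D : OTCData E (𝟙_ E)} (ax : D.Axioms)

theorem leftUnitor_naturality (m : D.MonoidalAxioms) {X Y : Coll ax} (f : X ⟶ Y) :
    (symmMonData ax m).tensorHom (𝟙 (single ax (𝟙_ E))) f ≫ (symmMonData ax m).leftUnitor Y =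
      (symmMonData ax m).leftUnitor X ≫ f :=
  hom_ext fun i y => by
    obtain ⟨k, h₁, h₂⟩ := exists_pair (single ax (𝟙_ E)) Y () y
    refine (comp_entry_of_right _ ((symmMonData ax m).leftUnitor Y) i y k fun k' n => ?_).trans
      (Eq.trans ?_ (comp_entry_of_left ((symmMonData ax m).leftUnitor X) f i y (snd i)
        fun x n => ?_).symm)
    · exact (congrArg (_ ≫ ·) (delta_ne Y (fun e => n (pair_ext rfl (e.trans h₂.symm))))).trans
        (ax.comp_zero _)
    · refine Eq.trans (b := (λ_ _).hom ≫ f.entry (snd i) y) ?_ ?_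
      · rw [← comp_delta (f.entry (snd i)) h₂]
        refine Eq.trans ?_ (leftUnitor_naturality_assoc _ _)
        refine congrArg (· ≫ (λ_ _).hom ≫ Y.delta (snd k) y) ?_
        refine Eq.trans ?_ (id_tensorHom _ _)
        exact congrArg (· ⊗ₘ f.entry (snd i) (snd k)) (delta_self (single ax (𝟙_ E)) ())
      · refine congrArg (· ≫ f.entry (snd i) y) ?_
        exact ((congrArg (_ ≫ ·) (delta_self X (snd i))).trans (Category.comp_id _)).symm
    · exact (congrArg (_ ≫ ·) (delta_ne X (Ne.symm n))).trans (ax.comp_zero _)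

theorem rightUnitor_naturality (m : D.MonoidalAxioms) {X Y : Coll ax} (f : X ⟶ Y) :
    (symmMonData ax m).tensorHom f (𝟙 (single ax (𝟙_ E))) ≫ (symmMonData ax m).rightUnitor Y =
      (symmMonData ax m).rightUnitor X ≫ f :=
  hom_ext fun i y => by
    obtain ⟨k, h₂, h₁⟩ := exists_pair Y (single ax (𝟙_ E)) y ()
    refine (comp_entry_of_right _ ((symmMonData ax m).rightUnitor Y) i y k fun k' n => ?_).trans
      (Eq.trans ?_ (comp_entry_of_left ((symmMonData ax m).rightUnitor X) f i y (fst i)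
        fun x n => ?_).symm)
    · exact (congrArg (_ ≫ ·) (delta_ne Y (fun e => n (pair_ext (e.trans h₂.symm) rfl)))).trans
        (ax.comp_zero _)
    · refine Eq.trans (b := (ρ_ _).hom ≫ f.entry (fst i) y) ?_ ?_
      · rw [← comp_delta (f.entry (fst i)) h₂]
        refine Eq.trans ?_ (rightUnitor_naturality_assoc _ _)
        refine congrArg (· ≫ (ρ_ _).hom ≫ Y.delta (fst k) y) ?_
        refine Eq.trans ?_ (tensorHom_id _ _)
        exact congrArg (f.entry (fst i) (fst k) ⊗ₘ ·) (delta_self (single ax (𝟙_ E)) ())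
      · refine congrArg (· ≫ f.entry (fst i) y) ?_
        exact ((congrArg (_ ≫ ·) (delta_self X (fst i))).trans (Category.comp_id _)).symm
    · exact (congrArg (_ ≫ ·) (delta_ne X (Ne.symm n))).trans (ax.comp_zero _)

theorem braiding_naturality (m : D.MonoidalAxioms) {X₁ X₂ Y₁ Y₂ : Coll ax}
    (f₁ : X₁ ⟶ Y₁) (f₂ : X₂ ⟶ Y₂) :
    (symmMonData ax m).tensorHom f₁ f₂ ≫ (symmMonData ax m).braiding Y₁ Y₂ =
      (symmMonData ax m).braiding X₁ X₂ ≫ (symmMonData ax m).tensorHom f₂ f₁ :=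
  hom_ext fun i j => by
    obtain ⟨k, h₁, h₂⟩ := exists_pair Y₁ Y₂ (snd j) (fst j)
    obtain ⟨l, h₄, h₅⟩ := exists_pair X₂ X₁ (snd i) (fst i)
    refine (comp_entry_of_right _ ((symmMonData ax m).braiding Y₁ Y₂) i j k
      fun k' n => ?_).trans (Eq.trans ?_ (comp_entry_of_left
        ((symmMonData ax m).braiding X₁ X₂) _ i j l fun l' n => ?_).symm)
    · refine (congrArg (_ ≫ ·) (delta_tensor_ne m _ _ ?_)).trans (ax.comp_zero _)
      rintro ⟨e₁, e₂⟩
      exact n (pair_ext (e₂.trans h₁.symm) (e₁.trans h₂.symm))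
    · refine Eq.trans (b := (β_ _ _).hom ≫ (f₂.entry (snd i) (fst j) ⊗ₘ
        f₁.entry (fst i) (snd j))) ?_ ?_
      · rw [← comp_delta (f₁.entry (fst i)) h₁, ← comp_delta (f₂.entry (snd i)) h₂,
          ← MonoidalCategory.tensorHom_comp_tensorHom]
        exact BraidedCategory.braiding_naturality_assoc _ _ _
      · refine Eq.trans ?_ (Category.assoc _ _ _).symm
        refine congrArg (_ ≫ ·) ?_
        refine Eq.trans ?_ (MonoidalCategory.tensorHom_comp_tensorHom _ _ _ _).symm
        exact congrArg₂ (· ⊗ₘ ·) (delta_comp (fun x => f₂.entry x (fst j)) h₄.symm).symm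
          (delta_comp (fun x => f₁.entry x (snd j)) h₅.symm).symm
    · refine (congrArg (_ ≫ ·) (delta_tensor_ne m _ _ ?_)).trans (ax.comp_zero _)
      rintro ⟨e₁, e₂⟩
      exact n (pair_ext (e₁.symm.trans h₄.symm) (e₂.symm.trans h₅.symm))

theorem id_tensorHom_id (m : D.MonoidalAxioms) (X Y : Coll ax) :
    (symmMonData ax m).tensorHom (𝟙 X) (𝟙 Y) = 𝟙 (X.tensor Y) :=
  hom_ext fun i j => delta_tensor m X Y i j

theorem naturalityLaws (m : D.MonoidalAxioms) : (symmMonData ax m).NaturalityLaws where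
  id_tensorHom_id := id_tensorHom_id ax m
  tensorHom_comp_tensorHom := tensorHom_comp_tensorHom ax m
  associator_naturality := associator_naturality ax m
  leftUnitor_naturality := leftUnitor_naturality ax m
  rightUnitor_naturality := rightUnitor_naturality ax m
  braiding_naturality := braiding_naturality ax m

/-- Tensors of coprojections are the coprojections of the tensor, hence jointly epic. This is what
allows coherence to be checked on single systems. -/
theorem tensorHom_singleι (m : D.MonoidalAxioms) (X Y : Coll ax) (i : (X.tensor Y).Idx) :
    (symmMonData ax m).tensorHom (X.singleι (fst i)) (Y.singleι (snd i)) = (X.tensor Y).singleι i :=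
  hom_ext fun _ j => delta_tensor m X Y i j

theorem hom_ext_singleι {X Z : Coll ax} {f g : X ⟶ Z}
    (h : ∀ x, X.singleι x ≫ f = X.singleι x ≫ g) : f = g :=
  (isCoprod_singleι X).hom_ext h

theorem tensor_hom_ext (m : D.MonoidalAxioms) {X Y Z : Coll ax} {f g : X.tensor Y ⟶ Z}
    (h : ∀ x y, (symmMonData ax m).tensorHom (X.singleι x) (Y.singleι y) ≫ f =
      (symmMonData ax m).tensorHom (X.singleι x) (Y.singleι y) ≫ g) : f = g :=
  hom_ext_singleι ax fun i => (congrArg (· ≫ f) (tensorHom_singleι ax m X Y i)).symm.trans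
    ((h (fst i) (snd i)).trans (congrArg (· ≫ g) (tensorHom_singleι ax m X Y i)))

theorem tensor_tensor_hom_ext (m : D.MonoidalAxioms) {X Y Z W : Coll ax}
    {f g : (X.tensor Y).tensor Z ⟶ W}
    (h : ∀ x y z, (symmMonData ax m).tensorHom ((symmMonData ax m).tensorHom (X.singleι x)
        (Y.singleι y)) (Z.singleι z) ≫ f =
      (symmMonData ax m).tensorHom ((symmMonData ax m).tensorHom (X.singleι x)
        (Y.singleι y)) (Z.singleι z) ≫ g) : f = g :=
  tensor_hom_ext ax m fun i z =>
    (congrArg (fun t => (symmMonData ax m).tensorHom t (Z.singleι z) ≫ f)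
      (tensorHom_singleι ax m X Y i)).symm.trans ((h (fst i) (snd i) z).trans
    (congrArg (fun t => (symmMonData ax m).tensorHom t (Z.singleι z) ≫ g)
      (tensorHom_singleι ax m X Y i)))

theorem tensor_tensor_tensor_hom_ext (m : D.MonoidalAxioms) {X Y Z W V : Coll ax}
    {f g : ((X.tensor Y).tensor Z).tensor W ⟶ V}
    (h : ∀ x y z w, (symmMonData ax m).tensorHom ((symmMonData ax m).tensorHom
        ((symmMonData ax m).tensorHom (X.singleι x) (Y.singleι y)) (Z.singleι z)) (W.singleι w) ≫ f =
      (symmMonData ax m).tensorHom ((symmMonData ax m).tensorHom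
        ((symmMonData ax m).tensorHom (X.singleι x) (Y.singleι y)) (Z.singleι z)) (W.singleι w) ≫ g) :
    f = g :=
  tensor_tensor_hom_ext ax m fun i z w =>
    (congrArg (fun t => (symmMonData ax m).tensorHom ((symmMonData ax m).tensorHom t
      (Z.singleι z)) (W.singleι w) ≫ f) (tensorHom_singleι ax m X Y i)).symm.trans
    ((h (fst i) (snd i) z w).trans
    (congrArg (fun t => (symmMonData ax m).tensorHom ((symmMonData ax m).tensorHom t
      (Z.singleι z)) (W.singleι w) ≫ g) (tensorHom_singleι ax m X Y i)))

theorem comp_entry_of_forall_eq {X Y Z : Coll ax} (M : X ⟶ Y) (N : Y ⟶ Z) (x : X.Idx) (z : Z.Idx)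
    (y : Y.Idx) (h : ∀ y', y' = y) : (M ≫ N).entry x z = M.entry x y ≫ N.entry y z :=
  comp_entry_of_left M N x z y fun y' n => (n (h y')).elim

theorem associator_single_entry (m : D.MonoidalAxioms) (A B C : E) :
    ((symmMonData ax m).associator (single ax A) (single ax B) (single ax C)).entry
      (pt ax ((A ⊗ B) ⊗ C)) (pt ax (A ⊗ B ⊗ C)) = (α_ A B C).hom := by
  refine Eq.trans (congrArg ((α_ A B C).hom ≫ ·) ?_) (Category.comp_id _)
  refine (congrArg₂ (· ⊗ₘ ·) (delta_self (single ax A) ()) (congrArg₂ (· ⊗ₘ ·)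
    (delta_self (single ax B) ()) (delta_self (single ax C) ()))).trans ?_
  exact (congrArg (_ ⊗ₘ ·) (MonoidalCategory.id_tensorHom_id _ _)).trans
    (MonoidalCategory.id_tensorHom_id _ _)

theorem leftUnitor_single_entry (m : D.MonoidalAxioms) (A : E) :
    ((symmMonData ax m).leftUnitor (single ax A)).entry (pt ax (𝟙_ E ⊗ A)) (pt ax A) =
      (λ_ A).hom :=
  (congrArg ((λ_ A).hom ≫ ·) (delta_self (single ax A) ())).trans (Category.comp_id _)

theorem rightUnitor_single_entry (m : D.MonoidalAxioms) (A : E) :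
    ((symmMonData ax m).rightUnitor (single ax A)).entry (pt ax (A ⊗ 𝟙_ E)) (pt ax A) =
      (ρ_ A).hom :=
  (congrArg ((ρ_ A).hom ≫ ·) (delta_self (single ax A) ())).trans (Category.comp_id _)

theorem braiding_single_entry (m : D.MonoidalAxioms) (A B : E) :
    ((symmMonData ax m).braiding (single ax A) (single ax B)).entry (pt ax (A ⊗ B))
      (pt ax (B ⊗ A)) = (β_ A B).hom := by
  refine Eq.trans (congrArg ((β_ A B).hom ≫ ·) ?_) (Category.comp_id _)
  exact (congrArg₂ (· ⊗ₘ ·) (delta_self (single ax B) ()) (delta_self (single ax A) ())).trans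
    (MonoidalCategory.id_tensorHom_id _ _)

/-- All index sets have one element, so sums over intermediate indices have one term and the
identity is the pentagon of the category of events. The lemmas for the other diagrams work alike. -/
theorem pentagon_single (m : D.MonoidalAxioms) (A B C F : E) :
    (symmMonData ax m).tensorHom
          ((symmMonData ax m).associator (single ax A) (single ax B) (single ax C))
          (𝟙 (single ax F)) ≫
        (symmMonData ax m).associator (single ax A) (single ax (B ⊗ C)) (single ax F) ≫
        (symmMonData ax m).tensorHom (𝟙 (single ax A))
          ((symmMonData ax m).associator (single ax B) (single ax C) (single ax F)) =
      (symmMonData ax m).associator (single ax (A ⊗ B)) (single ax C) (single ax F) ≫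
        (symmMonData ax m).associator (single ax A) (single ax B) (single ax (C ⊗ F)) :=
  hom_ext fun i j => by
    refine (comp_entry_of_forall_eq ax _ _ i j (pt ax ((A ⊗ (B ⊗ C)) ⊗ F)) fun _ => rfl).trans
      (Eq.trans ?_ (comp_entry_of_forall_eq ax _ _ i j (pt ax ((A ⊗ B) ⊗ (C ⊗ F))) fun _ => rfl).symm)
    refine (congrArg (_ ≫ ·)
      (comp_entry_of_forall_eq ax _ _ (pt ax ((A ⊗ (B ⊗ C)) ⊗ F)) j (pt ax (A ⊗ ((B ⊗ C) ⊗ F))) fun _ => rfl)).trans ?_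
    refine (congrArg₂ (· ≫ ·) (congrArg₂ (· ⊗ₘ ·) (associator_single_entry ax m A B C)
      (delta_self (single ax F) ())) (congrArg₂ (· ≫ ·) (associator_single_entry ax m A (B ⊗ C) F)
      (congrArg₂ (· ⊗ₘ ·) (delta_self (single ax A) ())
        (associator_single_entry ax m B C F)))).trans (Eq.trans ?_ (congrArg₂ (· ≫ ·)
        (associator_single_entry ax m (A ⊗ B) C F)
        (associator_single_entry ax m A B (C ⊗ F))).symm)
    exact (congrArg₂ (· ≫ ·) (tensorHom_id _ _)
      (congrArg (_ ≫ ·) (id_tensorHom _ _))).trans (MonoidalCategory.pentagon A B C F)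

theorem triangle_single (m : D.MonoidalAxioms) (A B : E) :
    (symmMonData ax m).associator (single ax A) (single ax (𝟙_ E)) (single ax B) ≫
        (symmMonData ax m).tensorHom (𝟙 (single ax A)) ((symmMonData ax m).leftUnitor (single ax B)) =
      (symmMonData ax m).tensorHom ((symmMonData ax m).rightUnitor (single ax A))
        (𝟙 (single ax B)) :=
  hom_ext fun i j => by
    refine (comp_entry_of_forall_eq ax _ _ i j (pt ax (A ⊗ (𝟙_ E ⊗ B))) fun _ => rfl).trans ?_
    refine (congrArg₂ (· ≫ ·) (associator_single_entry ax m A (𝟙_ E) B) (congrArg₂ (· ⊗ₘ ·)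
      (delta_self (single ax A) ()) (leftUnitor_single_entry ax m B))).trans (Eq.trans ?_
      (congrArg₂ (· ⊗ₘ ·) (rightUnitor_single_entry ax m A) (delta_self (single ax B) ())).symm)
    exact (congrArg (_ ≫ ·) (id_tensorHom _ _)).trans
      ((MonoidalCategory.triangle A B).trans (tensorHom_id _ _).symm)

theorem hexagon_single (m : D.MonoidalAxioms) (A B C : E) :
    (symmMonData ax m).associator (single ax A) (single ax B) (single ax C) ≫
        (symmMonData ax m).braiding (single ax A) (single ax (B ⊗ C)) ≫
        (symmMonData ax m).associator (single ax B) (single ax C) (single ax A) =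
      (symmMonData ax m).tensorHom ((symmMonData ax m).braiding (single ax A) (single ax B))
          (𝟙 (single ax C)) ≫
        (symmMonData ax m).associator (single ax B) (single ax A) (single ax C) ≫
        (symmMonData ax m).tensorHom (𝟙 (single ax B))
          ((symmMonData ax m).braiding (single ax A) (single ax C)) :=
  hom_ext fun i j => by
    refine (comp_entry_of_forall_eq ax _ _ i j (pt ax (A ⊗ (B ⊗ C))) fun _ => rfl).trans
      (Eq.trans ?_ (comp_entry_of_forall_eq ax _ _ i j (pt ax ((B ⊗ A) ⊗ C)) fun _ => rfl).symm)
    refine (congrArg (_ ≫ ·)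
      (comp_entry_of_forall_eq ax _ _ (pt ax (A ⊗ (B ⊗ C))) j (pt ax ((B ⊗ C) ⊗ A)) fun _ => rfl)).trans
      (Eq.trans ?_ (congrArg (_ ≫ ·)
      (comp_entry_of_forall_eq ax _ _ (pt ax ((B ⊗ A) ⊗ C)) j (pt ax (B ⊗ (A ⊗ C))) fun _ => rfl)).symm)
    refine (congrArg₂ (· ≫ ·) (associator_single_entry ax m A B C) (congrArg₂ (· ≫ ·)
      (braiding_single_entry ax m A (B ⊗ C)) (associator_single_entry ax m B C A))).trans
      (Eq.trans ?_ (congrArg₂ (· ≫ ·) (congrArg₂ (· ⊗ₘ ·) (braiding_single_entry ax m A B)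
        (delta_self (single ax C) ())) (congrArg₂ (· ≫ ·) (associator_single_entry ax m B A C)
        (congrArg₂ (· ⊗ₘ ·) (delta_self (single ax B) ())
          (braiding_single_entry ax m A C)))).symm)
    exact (BraidedCategory.hexagon_forward A B C).trans (congrArg₂ (· ≫ ·) (tensorHom_id _ _)
      (congrArg (_ ≫ ·) (id_tensorHom _ _))).symm

theorem symmetry_single (m : D.MonoidalAxioms) (A B : E) :
    (symmMonData ax m).braiding (single ax A) (single ax B) ≫
      (symmMonData ax m).braiding (single ax B) (single ax A) = 𝟙 (single ax (A ⊗ B)) :=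
  hom_ext fun i j => by
    refine (comp_entry_of_forall_eq ax _ _ i j (pt ax (B ⊗ A)) fun _ => rfl).trans ?_
    exact (congrArg₂ (· ≫ ·) (braiding_single_entry ax m A B)
      (braiding_single_entry ax m B A)).trans ((SymmetricCategory.symmetry A B).trans
      (delta_self (single ax (A ⊗ B)) ()).symm)

/-- For each coherence diagram, precompose with coprojections of single systems and use naturality
of both sides to move to single systems, where the diagram is that of events. -/
theorem laws (m : D.MonoidalAxioms) : (symmMonData ax m).Laws where
  isIso_associator := isIso_associator ax m
  isIso_leftUnitor := isIso_leftUnitor ax m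
  isIso_rightUnitor := isIso_rightUnitor ax m
  id_tensorHom_id := id_tensorHom_id ax m
  tensorHom_comp_tensorHom := tensorHom_comp_tensorHom ax m
  associator_naturality := associator_naturality ax m
  leftUnitor_naturality := leftUnitor_naturality ax m
  rightUnitor_naturality := rightUnitor_naturality ax m
  braiding_naturality := braiding_naturality ax m
  pentagon W X Y Z := tensor_tensor_tensor_hom_ext ax m fun w x y z =>
    ((naturalityLaws ax m).pentagon_left _ _ _ _).trans
      ((congrArg (· ≫ (symmMonData ax m).tensorHom (W.singleι w)
        ((symmMonData ax m).tensorHom (X.singleι x) ((symmMonData ax m).tensorHom (Y.singleι y)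
        (Z.singleι z)))) (pentagon_single ax m _ _ _ _)).trans
        ((naturalityLaws ax m).pentagon_right _ _ _ _).symm)
  triangle X Y := tensor_tensor_hom_ext ax m fun x _ y =>
    ((naturalityLaws ax m).triangle_left (X.singleι x) (Y.singleι y)).trans
      ((congrArg (· ≫ (symmMonData ax m).tensorHom (X.singleι x) (Y.singleι y))
        (triangle_single ax m _ _)).trans
        ((naturalityLaws ax m).triangle_right (X.singleι x) (Y.singleι y)).symm)
  hexagon X Y Z := tensor_tensor_hom_ext ax m fun x y z =>
    ((naturalityLaws ax m).hexagon_left _ _ _).trans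
      ((congrArg (· ≫ (symmMonData ax m).tensorHom (Y.singleι y)
        ((symmMonData ax m).tensorHom (Z.singleι z) (X.singleι x)))
        (hexagon_single ax m _ _ _)).trans ((naturalityLaws ax m).hexagon_right _ _ _).symm)
  symmetry X Y := tensor_hom_ext ax m fun x y =>
    ((naturalityLaws ax m).symmetry_left _ _).trans
      ((congrArg (· ≫ (symmMonData ax m).tensorHom (X.singleι x) (Y.singleι y))
        (symmetry_single ax m _ _)).trans
        ((Category.id_comp _).trans (Category.comp_id _).symm))

end OTCData.Coll

open MonoidalCategory

/-! ## Symmetric monoidal functors from explicit data -/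

section

variable {C D : Type u} [Category.{v} C] [MonoidalCategory C] [SymmetricCategory C]
  [Category.{v} D] [MonoidalCategory D] [SymmetricCategory D] {F : C ⥤ D}
  {ε : 𝟙_ D ⟶ F.obj (𝟙_ C)} {μ : ∀ X Y : C, F.obj X ⊗ F.obj Y ⟶ F.obj (X ⊗ Y)}

theorem IsSymmMonoidal.of_laws (hε : IsIso ε) (hμ : ∀ X Y, IsIso (μ X Y))
    (nat : ∀ {X Y X' Y' : C} (f : X ⟶ Y) (g : X' ⟶ Y'),
      (F.map f ⊗ₘ F.map g) ≫ μ Y Y' = μ X X' ≫ F.map (f ⊗ₘ g))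
    (assoc : ∀ X Y Z : C, (μ X Y ⊗ₘ 𝟙 (F.obj Z)) ≫ μ (X ⊗ Y) Z ≫ F.map (α_ X Y Z).hom =
      (α_ (F.obj X) (F.obj Y) (F.obj Z)).hom ≫ (𝟙 (F.obj X) ⊗ₘ μ Y Z) ≫ μ X (Y ⊗ Z))
    (unit : ∀ X : C, (ε ⊗ₘ 𝟙 (F.obj X)) ≫ μ (𝟙_ C) X ≫ F.map (λ_ X).hom = (λ_ (F.obj X)).hom)
    (braid : ∀ X Y : C, μ X Y ≫ F.map (β_ X Y).hom = (β_ (F.obj X) (F.obj Y)).hom ≫ μ Y X) :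
    IsSymmMonoidal F ε μ := by
  let c : F.CoreMonoidal :=
    { εIso := asIso ε
      μIso X Y := asIso (μ X Y)
      μIso_hom_natural_left f X' := by
        simpa using nat f (𝟙 X')
      μIso_hom_natural_right X' f := by
        simpa using nat (𝟙 X') f
      associativity X Y Z := by
        simpa using assoc X Y Z
      left_unitality X := by
        simpa using (unit X).symm
      -- The right unit law follows from the left one, as the braiding exchanges the unitors and is
      -- respected by `μ`.
      right_unitality X := by
        have e := unit X
        rw [tensorHom_id] at e
        simp only [asIso_hom]
        rw [← braiding_leftUnitor, ← e, ← BraidedCategory.braiding_naturality_right_assoc,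
          ← reassoc_of% braid, ← F.map_comp, braiding_leftUnitor] }
  exact ⟨{ c.toMonoidal with braided := braid }, rfl, fun _ _ => rfl⟩

theorem IsSymmMonoidal.isIso_μ (h : IsSymmMonoidal F ε μ) (X Y : C) : IsIso (μ X Y) := by
  obtain ⟨b, -, h⟩ := h
  rw [← h]
  infer_instance

theorem IsSymmMonoidal.isIso_ε (h : IsSymmMonoidal F ε μ) : IsIso ε := by
  obtain ⟨b, rfl, -⟩ := h
  infer_instance

theorem IsSymmMonoidal.natural (h : IsSymmMonoidal F ε μ) {X Y X' Y' : C} (f : X ⟶ Y)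
    (g : X' ⟶ Y') : (F.map f ⊗ₘ F.map g) ≫ μ Y Y' = μ X X' ≫ F.map (f ⊗ₘ g) := by
  obtain ⟨b, -, h⟩ := h
  rw [← h, ← h]
  exact Functor.LaxMonoidal.μ_natural F f g

theorem IsSymmMonoidal.associativity (h : IsSymmMonoidal F ε μ) (X Y Z : C) :
    (μ X Y ⊗ₘ 𝟙 (F.obj Z)) ≫ μ (X ⊗ Y) Z ≫ F.map (α_ X Y Z).hom =
      (α_ (F.obj X) (F.obj Y) (F.obj Z)).hom ≫ (𝟙 (F.obj X) ⊗ₘ μ Y Z) ≫ μ X (Y ⊗ Z) := by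
  obtain ⟨b, -, h⟩ := h
  simp only [← h, tensorHom_id, id_tensorHom]
  exact Functor.LaxMonoidal.associativity F X Y Z

theorem IsSymmMonoidal.left_unitality (h : IsSymmMonoidal F ε μ) (X : C) :
    (ε ⊗ₘ 𝟙 (F.obj X)) ≫ μ (𝟙_ C) X ≫ F.map (λ_ X).hom = (λ_ (F.obj X)).hom := by
  obtain ⟨b, rfl, h⟩ := h
  simp only [← h, tensorHom_id]
  exact (Functor.LaxMonoidal.left_unitality F X).symm

theorem IsSymmMonoidal.braided (h : IsSymmMonoidal F ε μ) (X Y : C) :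
    μ X Y ≫ F.map (β_ X Y).hom = (β_ (F.obj X) (F.obj Y)).hom ≫ μ Y X := by
  obtain ⟨b, -, h⟩ := h
  simp only [← h]
  exact Functor.LaxBraided.braided X Y

/-- By naturality of `μ`, the law at `X, Y, Z` implies the law at `X', Y', Z'` after precomposition.
With jointly epic families this reduces the law to generating objects; the next two lemmas serve the
same purpose. -/
theorem associativity_comp
    (nat : ∀ {X Y X' Y' : C} (f : X ⟶ Y) (g : X' ⟶ Y'),
      (F.map f ⊗ₘ F.map g) ≫ μ Y Y' = μ X X' ≫ F.map (f ⊗ₘ g)) {X Y Z X' Y' Z' : C}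
    (x : X ⟶ X') (y : Y ⟶ Y') (z : Z ⟶ Z')
    (h : (μ X Y ⊗ₘ 𝟙 (F.obj Z)) ≫ μ (X ⊗ Y) Z ≫ F.map (α_ X Y Z).hom =
      (α_ (F.obj X) (F.obj Y) (F.obj Z)).hom ≫ (𝟙 (F.obj X) ⊗ₘ μ Y Z) ≫ μ X (Y ⊗ Z)) :
    ((F.map x ⊗ₘ F.map y) ⊗ₘ F.map z) ≫
        (μ X' Y' ⊗ₘ 𝟙 (F.obj Z')) ≫ μ (X' ⊗ Y') Z' ≫ F.map (α_ X' Y' Z').hom =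
      ((F.map x ⊗ₘ F.map y) ⊗ₘ F.map z) ≫
        (α_ (F.obj X') (F.obj Y') (F.obj Z')).hom ≫ (𝟙 (F.obj X') ⊗ₘ μ Y' Z') ≫
          μ X' (Y' ⊗ Z') := by
  have e₁ : ((F.map x ⊗ₘ F.map y) ⊗ₘ F.map z) ≫ (μ X' Y' ⊗ₘ 𝟙 (F.obj Z')) =
      (μ X Y ⊗ₘ 𝟙 (F.obj Z)) ≫ (F.map (x ⊗ₘ y) ⊗ₘ F.map z) := by
    rw [MonoidalCategory.tensorHom_comp_tensorHom, nat, MonoidalCategory.tensorHom_comp_tensorHom,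
      Category.comp_id, Category.id_comp]
  have e₂ : (F.map x ⊗ₘ (F.map y ⊗ₘ F.map z)) ≫ (𝟙 (F.obj X') ⊗ₘ μ Y' Z') =
      (𝟙 (F.obj X) ⊗ₘ μ Y Z) ≫ (F.map x ⊗ₘ F.map (y ⊗ₘ z)) := by
    rw [MonoidalCategory.tensorHom_comp_tensorHom, nat, MonoidalCategory.tensorHom_comp_tensorHom,
      Category.comp_id, Category.id_comp]
  rw [reassoc_of% e₁, reassoc_of% nat, ← F.map_comp, MonoidalCategory.associator_naturality,
    F.map_comp, reassoc_of% h, MonoidalCategory.associator_naturality_assoc, reassoc_of% e₂, nat]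

theorem left_unitality_comp
    (nat : ∀ {X Y X' Y' : C} (f : X ⟶ Y) (g : X' ⟶ Y'),
      (F.map f ⊗ₘ F.map g) ≫ μ Y Y' = μ X X' ≫ F.map (f ⊗ₘ g)) {X X' : C} (x : X ⟶ X')
    (h : (ε ⊗ₘ 𝟙 (F.obj X)) ≫ μ (𝟙_ C) X ≫ F.map (λ_ X).hom = (λ_ (F.obj X)).hom) :
    (𝟙 (𝟙_ D) ⊗ₘ F.map x) ≫ (ε ⊗ₘ 𝟙 (F.obj X')) ≫ μ (𝟙_ C) X' ≫ F.map (λ_ X').hom =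
      (𝟙 (𝟙_ D) ⊗ₘ F.map x) ≫ (λ_ (F.obj X')).hom := by
  have e₁ : (𝟙 (𝟙_ D) ⊗ₘ F.map x) ≫ (ε ⊗ₘ 𝟙 (F.obj X')) =
      (ε ⊗ₘ 𝟙 (F.obj X)) ≫ (F.map (𝟙 _) ⊗ₘ F.map x) := by
    rw [MonoidalCategory.tensorHom_comp_tensorHom, MonoidalCategory.tensorHom_comp_tensorHom,
      F.map_id, Category.comp_id, Category.id_comp, Category.id_comp, Category.comp_id]
  rw [reassoc_of% e₁, reassoc_of% nat, ← F.map_comp, id_tensorHom,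
    MonoidalCategory.leftUnitor_naturality, F.map_comp, reassoc_of% h, id_tensorHom,
    MonoidalCategory.leftUnitor_naturality]

theorem braided_comp
    (nat : ∀ {X Y X' Y' : C} (f : X ⟶ Y) (g : X' ⟶ Y'),
      (F.map f ⊗ₘ F.map g) ≫ μ Y Y' = μ X X' ≫ F.map (f ⊗ₘ g)) {X Y X' Y' : C}
    (x : X ⟶ X') (y : Y ⟶ Y')
    (h : μ X Y ≫ F.map (β_ X Y).hom = (β_ (F.obj X) (F.obj Y)).hom ≫ μ Y X) :
    (F.map x ⊗ₘ F.map y) ≫ μ X' Y' ≫ F.map (β_ X' Y').hom =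
      (F.map x ⊗ₘ F.map y) ≫ (β_ (F.obj X') (F.obj Y')).hom ≫ μ Y' X' := by
  rw [reassoc_of% nat, ← F.map_comp, BraidedCategory.braiding_naturality, F.map_comp,
    reassoc_of% h, BraidedCategory.braiding_naturality_assoc, nat]

end

/-! ## The category of tests as a monoidal operational category -/

namespace OTCData.Coll

variable {E : Type u} [Category.{v} E] [MonoidalCategory E] [SymmetricCategory E]
  {D : OTCData E (𝟙_ E)} (ax : D.Axioms)

/-- The matrix is supported on the bijection `X × Y + X × Z ≅ X × (Y + Z)` and has identities there,
so it is invertible by `isIso_of_bijective`. -/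
theorem isIso_desc_tensorHom (m : D.MonoidalAxioms) (X Y Z : Coll ax) :
    IsIso (desc ((symmMonData ax m).tensorHom (𝟙 X) (inl Y Z))
      ((symmMonData ax m).tensorHom (𝟙 X) (inr Y Z))) := by
  have : ∀ i : (plus (X.tensor Y) (X.tensor Z)).Idx, ∃ j : (X.tensor (plus Y Z)).Idx,
      Sum.elim (fun i : (X.tensor Y).Idx => fst i = fst j ∧ inlIdx Y Z (snd i) = snd j)
        (fun i : (X.tensor Z).Idx => fst i = fst j ∧ inrIdx Y Z (snd i) = snd j) i := by
    rintro (i | i)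
    · obtain ⟨j, h₁, h₂⟩ := exists_pair X (plus Y Z) (fst i) (inlIdx Y Z (snd i))
      exact ⟨j, h₁.symm, h₂.symm⟩
    · obtain ⟨j, h₁, h₂⟩ := exists_pair X (plus Y Z) (fst i) (inrIdx Y Z (snd i))
      exact ⟨j, h₁.symm, h₂.symm⟩
  choose σ hσ using this
  have l : ∀ i : (X.tensor Y).Idx, fst i = fst (σ (Sum.inl i)) ∧
      inlIdx Y Z (snd i) = snd (σ (Sum.inl i)) := fun i => hσ (Sum.inl i)
  have r : ∀ i : (X.tensor Z).Idx, fst i = fst (σ (Sum.inr i)) ∧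
      inrIdx Y Z (snd i) = snd (σ (Sum.inr i)) := fun i => hσ (Sum.inr i)
  refine isIso_of_bijective (X := plus (X.tensor Y) (X.tensor Z)) (Y := X.tensor (plus Y Z)) _ σ
    ⟨?_, fun j => ?_⟩ ?_ ?_ ?_
  · rintro (i | i) (i' | i') h
    · exact congrArg Sum.inl (pair_ext ((l i).1.trans ((congrArg fst h).trans (l i').1.symm))
        (Sum.inl_injective ((l i).2.trans ((congrArg snd h).trans (l i').2.symm))))
    · exact (Sum.inl_ne_inr ((l i).2.trans ((congrArg snd h).trans (r i').2.symm))).elim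
    · exact (Sum.inr_ne_inl ((r i).2.trans ((congrArg snd h).trans (l i').2.symm))).elim
    · exact congrArg Sum.inr (pair_ext ((r i).1.trans ((congrArg fst h).trans (r i').1.symm))
        (Sum.inr_injective ((r i).2.trans ((congrArg snd h).trans (r i').2.symm))))
  · rcases e : (snd j : (plus Y Z).Idx) with y | z
    · obtain ⟨i, h₁, h₂⟩ := exists_pair X Y (fst j) y
      exact ⟨Sum.inl i, pair_ext ((l i).1.symm.trans h₁)
        ((l i).2.symm.trans ((congrArg Sum.inl h₂).trans e.symm))⟩
    · obtain ⟨i, h₁, h₂⟩ := exists_pair X Z (fst j) z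
      exact ⟨Sum.inr i, pair_ext ((r i).1.symm.trans h₁)
        ((r i).2.symm.trans ((congrArg Sum.inr h₂).trans e.symm))⟩
  · rintro (i | i) j n
    · exact delta_tensor_ne m X (plus Y Z) fun e => n (pair_ext (e.1.symm.trans (l i).1)
        (e.2.symm.trans (l i).2))
    · exact delta_tensor_ne m X (plus Y Z) fun e => n (pair_ext (e.1.symm.trans (r i).1)
        (e.2.symm.trans (r i).2))
  · rintro (i | i)
    · exact isIso_tensorHom (isIso_delta X (l i).1) (isIso_delta (plus Y Z) (l i).2)
    · exact isIso_tensorHom (isIso_delta X (r i).1) (isIso_delta (plus Y Z) (r i).2)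
  · rintro (i | i)
    · exact m.isDet_tensor ax (isDet_delta X (l i).1) (isDet_delta (plus Y Z) (l i).2)
    · exact m.isDet_tensor ax (isDet_delta X (r i).1) (isDet_delta (plus Y Z) (r i).2)

theorem isIso_initial_tensor (X : Coll ax) :
    IsIso (isInitial.to (X.tensor (SpecCoproducts.zero : Coll ax))) :=
  isIso_of_bijective _ (fun x : (SpecCoproducts.zero : Coll ax).Idx => Empty.elim x)
    ⟨fun x => Empty.elim x, fun i => Empty.elim (snd i)⟩ (fun x => Empty.elim x)
    (fun x => Empty.elim x) (fun x => Empty.elim x)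

theorem isMonOperational (m : D.MonoidalAxioms) :
    letI := (laws ax m).monoidalCategory
    IsMonOperational (isTerminal ax) :=
  let _ := (laws ax m).monoidalCategory
  { toIsOperational := isOperational ax
    isIso_distrib := isIso_desc_tensorHom ax m
    isIso_distrib_zero := isIso_initial_tensor ax }

end OTCData.Coll

open OTCData.Coll

/-! ### Monoidality of functors between categories of tests -/

namespace MonOTC.Hom

variable {Θ Θ' : MonOTC.{v, u}} (F : MonOTC.Hom Θ Θ')

theorem isIso_testsμ (X Y : OTCData.Coll Θ.ax) : IsIso (F.testsμ X Y) := by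
  obtain ⟨ε, h, -⟩ := F.isSymmMonoidal
  refine isIso_of_bijective (F.testsμ X Y) id Function.bijective_id
    (fun i j n => F.testsμ_ne X Y (Ne.symm n)) (fun i => ?_) (fun i => ?_)
  · exact (congrArg (fun t : _ ⟶ _ => IsIso t) (F.testsμ_self X Y i)).mpr (h.isIso_μ _ _)
  · exact (congrArg Θ'.data.IsDet (F.testsμ_self X Y i)).mpr (F.isDet_μ _ _)

theorem testsμ_natural {X Y X' Y' : OTCData.Coll Θ.ax} (f : X ⟶ Y) (g : X' ⟶ Y') :
    (symmMonData Θ'.ax Θ'.monAx).tensorHom (F.toOTCHom.tests.map f) (F.toOTCHom.tests.map g) ≫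
        F.testsμ Y Y' =
      F.testsμ X X' ≫ F.toOTCHom.tests.map ((symmMonData Θ.ax Θ.monAx).tensorHom f g) := by
  obtain ⟨ε, h, -⟩ := F.isSymmMonoidal
  refine hom_ext fun i j => ?_
  refine (comp_entry_of_right _ (F.testsμ Y Y') i j j fun k n => F.testsμ_ne Y Y' n).trans
    (Eq.trans ?_ (comp_entry_of_left (F.testsμ X X') _ i j i
      fun k n => F.testsμ_ne X X' (Ne.symm n)).symm)
  refine (congrArg (_ ≫ ·) (F.testsμ_self Y Y' j)).trans (Eq.trans ?_
    (congrArg (· ≫ _) (F.testsμ_self X X' i)).symm)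
  exact h.natural _ _

theorem tests_map_singleι (X : OTCData.Coll Θ.ax) (x : X.Idx) :
    F.toOTCHom.tests.map (X.singleι x) = (F.toOTCHom.tests.obj X).singleι x :=
  OTCData.Coll.hom_ext fun _ x' => F.toOTCHom.map_delta X x x'

theorem testsμ_single_entry (A B : Θ.Sys) :
    (F.testsμ (single Θ.ax A) (single Θ.ax B)).entry (pt Θ'.ax (F.toFunctor.obj A ⊗ F.toFunctor.obj B))
      (pt Θ'.ax (F.toFunctor.obj (A ⊗ B))) = F.μ A B :=
  F.testsμ_self (single Θ.ax A) (single Θ.ax B) ()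

theorem testsμ_associativity_single (A B C : Θ.Sys) :
    (symmMonData Θ'.ax Θ'.monAx).tensorHom (F.testsμ (single Θ.ax A) (single Θ.ax B))
          (𝟙 (single Θ'.ax (F.toFunctor.obj C))) ≫
        F.testsμ (single Θ.ax (A ⊗ B)) (single Θ.ax C) ≫ F.toOTCHom.tests.map
          ((symmMonData Θ.ax Θ.monAx).associator (single Θ.ax A) (single Θ.ax B) (single Θ.ax C)) =
      (symmMonData Θ'.ax Θ'.monAx).associator (single Θ'.ax (F.toFunctor.obj A))
          (single Θ'.ax (F.toFunctor.obj B)) (single Θ'.ax (F.toFunctor.obj C)) ≫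
        (symmMonData Θ'.ax Θ'.monAx).tensorHom (𝟙 (single Θ'.ax (F.toFunctor.obj A)))
          (F.testsμ (single Θ.ax B) (single Θ.ax C)) ≫
        F.testsμ (single Θ.ax A) (single Θ.ax (B ⊗ C)) := by
  obtain ⟨ε, h, -⟩ := F.isSymmMonoidal
  let f := F.toFunctor.obj
  refine hom_ext fun i j => ?_
  refine (comp_entry_of_forall_eq Θ'.ax _ _ i j (pt Θ'.ax (f (A ⊗ B) ⊗ f C)) fun _ => rfl).trans
    (Eq.trans ?_ (comp_entry_of_forall_eq Θ'.ax _ _ i j (pt Θ'.ax (f A ⊗ (f B ⊗ f C)))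
      fun _ => rfl).symm)
  refine (congrArg (_ ≫ ·) (comp_entry_of_forall_eq Θ'.ax _ _ (pt Θ'.ax (f (A ⊗ B) ⊗ f C)) j
    (pt Θ'.ax (f ((A ⊗ B) ⊗ C))) fun _ => rfl)).trans (Eq.trans ?_ (congrArg (_ ≫ ·)
    (comp_entry_of_forall_eq Θ'.ax _ _ (pt Θ'.ax (f A ⊗ (f B ⊗ f C))) j
      (pt Θ'.ax (f A ⊗ f (B ⊗ C))) fun _ => rfl)).symm)
  refine (congrArg₂ (· ≫ ·) (congrArg₂ (· ⊗ₘ ·) (F.testsμ_single_entry A B)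
      (delta_self (single Θ'.ax (f C)) ())) (congrArg₂ (· ≫ ·) (F.testsμ_single_entry (A ⊗ B) C)
      (congrArg F.toFunctor.map (associator_single_entry Θ.ax Θ.monAx A B C)))).trans (Eq.trans ?_
    (congrArg₂ (· ≫ ·) (associator_single_entry Θ'.ax Θ'.monAx (f A) (f B) (f C))
      (congrArg₂ (· ≫ ·) (congrArg₂ (· ⊗ₘ ·) (delta_self (single Θ'.ax (f A)) ())
        (F.testsμ_single_entry B C)) (F.testsμ_single_entry A (B ⊗ C)))).symm)
  exact h.associativity A B C

theorem testsμ_braided_single (A B : Θ.Sys) :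
    F.testsμ (single Θ.ax A) (single Θ.ax B) ≫ F.toOTCHom.tests.map
        ((symmMonData Θ.ax Θ.monAx).braiding (single Θ.ax A) (single Θ.ax B)) =
      (symmMonData Θ'.ax Θ'.monAx).braiding (single Θ'.ax (F.toFunctor.obj A))
          (single Θ'.ax (F.toFunctor.obj B)) ≫ F.testsμ (single Θ.ax B) (single Θ.ax A) := by
  obtain ⟨ε, h, -⟩ := F.isSymmMonoidal
  let f := F.toFunctor.obj
  refine hom_ext fun i j => ?_
  refine (comp_entry_of_forall_eq Θ'.ax _ _ i j (pt Θ'.ax (f (A ⊗ B))) fun _ => rfl).trans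
    (Eq.trans ?_ (comp_entry_of_forall_eq Θ'.ax _ _ i j (pt Θ'.ax (f B ⊗ f A))
      fun _ => rfl).symm)
  refine (congrArg₂ (· ≫ ·) (F.testsμ_single_entry A B) (congrArg F.toFunctor.map
    (braiding_single_entry Θ.ax Θ.monAx A B))).trans (Eq.trans ?_ (congrArg₂ (· ≫ ·)
    (braiding_single_entry Θ'.ax Θ'.monAx (f A) (f B)) (F.testsμ_single_entry B A)).symm)
  exact h.braided A B

theorem exists_testsε : ∃ ε : single Θ'.ax (𝟙_ Θ'.Sys) ⟶ F.toOTCHom.tests.obj (single Θ.ax (𝟙_ Θ.Sys)),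
    IsIso ε ∧ ∀ A : Θ.Sys, (symmMonData Θ'.ax Θ'.monAx).tensorHom ε
          (𝟙 (single Θ'.ax (F.toFunctor.obj A))) ≫
        F.testsμ (single Θ.ax (𝟙_ Θ.Sys)) (single Θ.ax A) ≫ F.toOTCHom.tests.map
          ((symmMonData Θ.ax Θ.monAx).leftUnitor (single Θ.ax A)) =
      (symmMonData Θ'.ax Θ'.monAx).leftUnitor (single Θ'.ax (F.toFunctor.obj A)) := by
  obtain ⟨ε, h, e⟩ := F.isSymmMonoidal
  have := h.isIso_ε
  -- Followed by discarding, `ε` is an identity; an event with deterministic discarding is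
  -- deterministic.
  have d : Θ'.data.IsDet ε := OTCData.isDet_of_comp_disc Θ'.ax (by
    rw [e]
    exact Θ'.ax.id_det _)
  let f := F.toFunctor.obj
  let ε' : single Θ'.ax (𝟙_ Θ'.Sys) ⟶ F.toOTCHom.tests.obj (single Θ.ax (𝟙_ Θ.Sys)) :=
    ⟨fun _ _ => ε, fun _ => (isTest_unique_iff (X := Unit) _ Θ'.ax).2 d⟩
  refine ⟨ε', isIso_of_bijective ε' id Function.bijective_id (fun i j n => (n rfl).elim)
    (fun _ => this) (fun _ => d), fun A => OTCData.Coll.hom_ext fun i j => ?_⟩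
  refine (comp_entry_of_forall_eq Θ'.ax _ _ i j (pt Θ'.ax (f (𝟙_ _) ⊗ f A)) fun _ => rfl).trans ?_
  refine (congrArg (_ ≫ ·) (comp_entry_of_forall_eq Θ'.ax _ _ (pt Θ'.ax (f (𝟙_ _) ⊗ f A)) j
    (pt Θ'.ax (f (𝟙_ _ ⊗ A))) fun _ => rfl)).trans ?_
  refine (congrArg₂ (· ≫ ·) (congrArg (ε ⊗ₘ ·)
      (delta_self (single Θ'.ax (f A)) ())) (congrArg₂ (· ≫ ·) (F.testsμ_single_entry (𝟙_ _) A)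
      (congrArg F.toFunctor.map (leftUnitor_single_entry Θ.ax Θ.monAx A)))).trans (Eq.trans ?_
      (leftUnitor_single_entry Θ'.ax Θ'.monAx (f A)).symm)
  exact h.left_unitality A

/-- The functor sends coprojections of single systems to such coprojections, so the laws may be
tested on single systems, where they are the laws of `F`. -/
theorem isSymmMonoidal_tests :
    letI := (laws Θ.ax Θ.monAx).monoidalCategory
    letI := (laws Θ.ax Θ.monAx).symmetricCategory
    letI := (laws Θ'.ax Θ'.monAx).monoidalCategory
    letI := (laws Θ'.ax Θ'.monAx).symmetricCategory
    ∃ ε, IsSymmMonoidal F.toOTCHom.tests ε F.testsμ := by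
  let _ := (laws Θ.ax Θ.monAx).monoidalCategory
  let _ := (laws Θ.ax Θ.monAx).symmetricCategory
  let _ := (laws Θ'.ax Θ'.monAx).monoidalCategory
  let _ := (laws Θ'.ax Θ'.monAx).symmetricCategory
  obtain ⟨ε, i, u⟩ := F.exists_testsε
  refine ⟨ε, IsSymmMonoidal.of_laws i F.isIso_testsμ (fun f g => F.testsμ_natural f g)
    (fun X Y Z => tensor_tensor_hom_ext Θ'.ax Θ'.monAx fun x y z => ?_)
    (fun X => tensor_hom_ext Θ'.ax Θ'.monAx fun _ x => ?_)
    (fun X Y => tensor_hom_ext Θ'.ax Θ'.monAx fun x y => ?_)⟩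
  · have e := associativity_comp (F := F.toOTCHom.tests) (μ := F.testsμ)
      (fun f g => F.testsμ_natural f g) (X.singleι x) (Y.singleι y) (Z.singleι z)
      (F.testsμ_associativity_single _ _ _)
    have k := congrArg₂ (symmMonData Θ'.ax Θ'.monAx).tensorHom (congrArg₂
      (symmMonData Θ'.ax Θ'.monAx).tensorHom (F.tests_map_singleι X x) (F.tests_map_singleι Y y))
      (F.tests_map_singleι Z z)
    exact (congrArg (· ≫ _) k).symm.trans (e.trans (congrArg (· ≫ _) k))
  · have e := left_unitality_comp (F := F.toOTCHom.tests) (μ := F.testsμ) (ε := ε)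
      (fun f g => F.testsμ_natural f g) (X.singleι x) (u _)
    exact (congrArg (fun a => (symmMonData Θ'.ax Θ'.monAx).tensorHom (𝟙 _) a ≫ _)
      (F.tests_map_singleι X x)).symm.trans (e.trans
      (congrArg (fun a => (symmMonData Θ'.ax Θ'.monAx).tensorHom (𝟙 _) a ≫ _)
      (F.tests_map_singleι X x)))
  · have e := braided_comp (F := F.toOTCHom.tests) (μ := F.testsμ)
      (fun f g => F.testsμ_natural f g) (X.singleι x) (Y.singleι y)
      (F.testsμ_braided_single _ _)
    exact (congrArg₂ (fun a b => (symmMonData Θ'.ax Θ'.monAx).tensorHom a b ≫ _)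
      (F.tests_map_singleι X x) (F.tests_map_singleι Y y)).symm.trans (e.trans
      (congrArg₂ (fun a b => (symmMonData Θ'.ax Θ'.monAx).tensorHom a b ≫ _)
      (F.tests_map_singleι X x) (F.tests_map_singleι Y y)))

end MonOTC.Hom

theorem monTestsWellDefined : MonTestsWellDefined.{v, u} where
  laws Θ := laws Θ.ax Θ.monAx
  isMonOperational Θ := isMonOperational Θ.ax Θ.monAx
  isStrict F := testsWellDefined.isStrict F.toOTCHom
  isSymmMonoidal F := F.isSymmMonoidal_tests

open MonoidalCategory

/-! ## Distributivity -/

namespace IsMonOperational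

variable {C : Type u} [Category.{v} C] [MonoidalCategory C] [SpecCoproducts C]
  {T : IsTerminal (𝟙_ C)}

theorem preservesSums_tensorLeft (h : IsMonOperational T) (A : C) :
    PreservesSums (tensorLeft A) where
  isIso B B' := h.isIso_distrib A B B'
  isInitial := by
    have := h.isIso_distrib_zero A
    exact ⟨isInitial.ofIso (asIso (isInitial.to (A ⊗ (zero : C))))⟩

theorem whiskerLeft_hom_ext (h : IsMonOperational T) {A B B' X : C} {f g : A ⊗ sum B B' ⟶ X}
    (h₁ : (A ◁ inl B B') ≫ f = (A ◁ inl B B') ≫ g)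
    (h₂ : (A ◁ inr B B') ≫ f = (A ◁ inr B B') ≫ g) : f = g :=
  (h.preservesSums_tensorLeft A).sum_ext h₁ h₂

theorem whiskerLeft_inl_distrib (h : IsMonOperational T) (A B B' : C) :
    (A ◁ inl B B') ≫ Par.distrib h A B B' = inl _ _ := by
  have := h.isIso_distrib A B B'
  rw [Par.distrib, IsIso.comp_inv_eq, inl_desc]

theorem whiskerLeft_inr_distrib (h : IsMonOperational T) (A B B' : C) :
    (A ◁ inr B B') ≫ Par.distrib h A B B' = inr _ _ := by
  have := h.isIso_distrib A B B'
  rw [Par.distrib, IsIso.comp_inv_eq, inr_desc]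

theorem isCoprod_whiskerLeft (h : IsMonOperational T) (A : C) {X : Type} [Finite X] {B : X → C}
    {P : C} {ι : ∀ x, B x ⟶ P} (hι : IsCoprod ι) : IsCoprod (fun x => A ◁ ι x) :=
  (h.preservesSums_tensorLeft A).isCoprod hι

variable [SymmetricCategory C]

theorem isCoprod_whiskerRight (h : IsMonOperational T) (A : C) {X : Type} [Finite X] {B : X → C}
    {P : C} {ι : ∀ x, B x ⟶ P} (hι : IsCoprod ι) : IsCoprod (fun x => ι x ▷ A) where
  exists_desc f := ⟨(β_ P A).hom ≫ (h.isCoprod_whiskerLeft A hι).desc (fun x => (β_ A (B x)).hom ≫ f x),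
    fun x => by
      rw [BraidedCategory.braiding_naturality_left_assoc]
      exact (congrArg (_ ≫ ·) ((h.isCoprod_whiskerLeft A hι).ι_desc _ x)).trans
        (SymmetricCategory.symmetry_assoc _ _ _)⟩
  hom_ext hh := by
    rw [← cancel_epi (β_ A P).hom]
    refine (h.isCoprod_whiskerLeft A hι).hom_ext fun x => ?_
    simp [hh x]

/-- Tensoring on either side preserves coproducts, so the family of tensors is an iterated
coproduct. Most extensionality arguments for tensor products below rest on this. -/
theorem isCoprod_tensorHom (h : IsMonOperational T) {X Y : Type} [Finite X] [Finite Y]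
    {B : X → C} {P : C} {ι : ∀ x, B x ⟶ P} (hι : IsCoprod ι) {B' : Y → C} {Q : C}
    {κ : ∀ y, B' y ⟶ Q} (hκ : IsCoprod κ) :
    IsCoprod (B := fun p : X × Y => B p.1 ⊗ B' p.2) (fun p => ι p.1 ⊗ₘ κ p.2) := by
  have e := ((h.isCoprod_whiskerRight Q hι).sigma
    (B := fun p : Σ _ : X, Y => B p.1 ⊗ B' p.2)
    fun x => h.isCoprod_whiskerLeft (B x) hκ).reindex (Equiv.sigmaEquivProd X Y).symm
  have e' : (fun p : X × Y => ι p.1 ⊗ₘ κ p.2) = fun p : X × Y => (B p.1 ◁ κ p.2) ≫ (ι p.1 ▷ Q) :=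
    funext fun p => tensorHom_def' _ _
  rw [e']
  exact e

theorem whiskerRight_hom_ext (h : IsMonOperational T) {A B B' X : C} {f g : sum B B' ⊗ A ⟶ X}
    (h₁ : (inl B B' ▷ A) ≫ f = (inl B B' ▷ A) ≫ g)
    (h₂ : (inr B B' ▷ A) ≫ f = (inr B B' ▷ A) ≫ g) : f = g := by
  rw [← cancel_epi (β_ A (sum B B')).hom]
  exact h.whiskerLeft_hom_ext (by simp [h₁]) (by simp [h₂])

/-- The cases overlap on purpose: for `A' = B' = 1` they are that both factors are defined, the
first is not, or the second is not, which is how `both` is described. -/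
theorem tensor_hom_ext (h : IsMonOperational T) {A A' B B' X : C}
    {f g : sum A A' ⊗ sum B B' ⟶ X} (h₁ : (inl A A' ⊗ₘ inl B B') ≫ f = (inl A A' ⊗ₘ inl B B') ≫ g)
    (h₂ : (inr A A' ⊗ₘ 𝟙 (sum B B')) ≫ f = (inr A A' ⊗ₘ 𝟙 (sum B B')) ≫ g)
    (h₃ : (𝟙 (sum A A') ⊗ₘ inr B B') ≫ f = (𝟙 (sum A A') ⊗ₘ inr B B') ≫ g) : f = g := by
  refine h.whiskerRight_hom_ext (h.whiskerLeft_hom_ext ?_ ?_) (by simpa using h₂)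
  · simpa [tensorHom_def'] using h₁
  · rw [id_tensorHom] at h₃
    rw [whisker_exchange_assoc, h₃, ← whisker_exchange_assoc]

end IsMonOperational

/-! ### The tensor product of partial arrows -/

namespace Par

variable {C : Type u} [Category.{v} C] [MonoidalCategory C] [SymmetricCategory C]
  [SpecCoproducts C] {T : IsTerminal (𝟙_ C)} (h : IsMonOperational T)

theorem from_comp {A B X : C} (f : A ⟶ B) (g : 𝟙_ C ⟶ X) : f ≫ T.from B ≫ g = T.from A ≫ g := by
  rw [← Category.assoc, T.hom_ext (f ≫ T.from B) (T.from A)]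

/-- With the next two lemmas this characterises `both`: a tensor is defined exactly where its two
factors are. Its construction from distributivity is not unfolded again. -/
theorem inl_tensor_both (A B : C) :
    (inl A (𝟙_ C) ⊗ₘ inl B (𝟙_ C)) ≫ both h A B = inl (A ⊗ B) (𝟙_ C) := by
  rw [MonoidalCategory.tensorHom_def, both, Category.assoc, reassoc_of% h.whiskerLeft_inl_distrib, inl_desc,
    BraidedCategory.braiding_naturality_left_assoc, reassoc_of% h.whiskerLeft_inl_distrib, inl_desc,
    SymmetricCategory.symmetry_assoc]

theorem inr_tensor_both (A B : C) :
    (inr A (𝟙_ C) ⊗ₘ 𝟙 (sum B (𝟙_ C))) ≫ both h A B = T.from _ ≫ inr (A ⊗ B) (𝟙_ C) := by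
  rw [tensorHom_id]
  refine h.whiskerLeft_hom_ext ?_ ?_
  · rw [whisker_exchange_assoc, both, reassoc_of% h.whiskerLeft_inl_distrib, inl_desc,
      BraidedCategory.braiding_naturality_left_assoc, reassoc_of% h.whiskerLeft_inr_distrib,
      inr_desc, from_comp, from_comp]
  · rw [whisker_exchange_assoc, both, reassoc_of% h.whiskerLeft_inr_distrib, inr_desc, from_comp,
      from_comp]

theorem tensor_inr_both (A B : C) :
    (𝟙 (sum A (𝟙_ C)) ⊗ₘ inr B (𝟙_ C)) ≫ both h A B = T.from _ ≫ inr (A ⊗ B) (𝟙_ C) := by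
  rw [id_tensorHom, both, reassoc_of% h.whiskerLeft_inr_distrib, inr_desc]

/-- The content of functoriality of the tensor. If both factors are defined, the two sides agree
directly; if one is undefined, both sides are the constant undefined arrow. -/
theorem both_desc {A B A' B' : C} (f : A ⟶ sum A' (𝟙_ C)) (g : B ⟶ sum B' (𝟙_ C)) :
    both h A B ≫ desc ((f ⊗ₘ g) ≫ both h A' B') (inr _ _) =
      (desc f (inr _ _) ⊗ₘ desc g (inr _ _)) ≫ both h A' B' := by
  refine h.tensor_hom_ext ?_ ?_ ?_
  · rw [reassoc_of% inl_tensor_both, inl_desc, MonoidalCategory.tensorHom_comp_tensorHom_assoc,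
      inl_desc, inl_desc]
  · rw [reassoc_of% inr_tensor_both, inr_desc, MonoidalCategory.tensorHom_comp_tensorHom_assoc,
      inr_desc, Category.id_comp]
    have e : inr A' (𝟙_ C) ⊗ₘ desc g (inr B' (𝟙_ C)) = (𝟙 _ ⊗ₘ desc g (inr B' (𝟙_ C))) ≫
        (inr A' (𝟙_ C) ⊗ₘ 𝟙 _) := by
      rw [MonoidalCategory.tensorHom_comp_tensorHom, Category.id_comp, Category.comp_id]
    rw [e, Category.assoc, inr_tensor_both, from_comp]
  · rw [reassoc_of% tensor_inr_both, inr_desc, MonoidalCategory.tensorHom_comp_tensorHom_assoc,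
      inr_desc, Category.id_comp]
    have e : desc f (inr A' (𝟙_ C)) ⊗ₘ inr B' (𝟙_ C) = (desc f (inr A' (𝟙_ C)) ⊗ₘ 𝟙 _) ≫
        (𝟙 _ ⊗ₘ inr B' (𝟙_ C)) := by
      rw [MonoidalCategory.tensorHom_comp_tensorHom, Category.id_comp, Category.comp_id]
    rw [e, Category.assoc, tensor_inr_both, from_comp]

/-! ### The laws of the tensor product of partial arrows -/

theorem tensorHom_comp {X₁ Y₁ Z₁ X₂ Y₂ Z₂ : Par T} (f₁ : X₁ ⟶ Y₁) (f₂ : X₂ ⟶ Y₂) (g₁ : Y₁ ⟶ Z₁)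
    (g₂ : Y₂ ⟶ Z₂) :
    (symmMonData h).tensorHom f₁ f₂ ≫ (symmMonData h).tensorHom g₁ g₂ =
      (symmMonData h).tensorHom (f₁ ≫ g₁) (f₂ ≫ g₂) := by
  refine hom_ext ?_
  change ((f₁.arrow ⊗ₘ f₂.arrow) ≫ both h _ _) ≫ desc ((g₁.arrow ⊗ₘ g₂.arrow) ≫ both h _ _) _ =
    ((f₁.arrow ≫ desc g₁.arrow _) ⊗ₘ (f₂.arrow ≫ desc g₂.arrow _)) ≫ both h _ _
  refine (Category.assoc _ _ _).trans ((congrArg (_ ≫ ·) (both_desc h _ _)).trans ?_)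
  rw [MonoidalCategory.tensorHom_comp_tensorHom_assoc]

theorem tensorHom_ofTotal {A A' B B' : C} (f : A ⟶ B) (g : A' ⟶ B') :
    (symmMonData h).tensorHom (ofTotal T f) (ofTotal T g) = ofTotal T (f ⊗ₘ g) := by
  refine hom_ext ?_
  change ((f ≫ inl _ _) ⊗ₘ (g ≫ inl _ _)) ≫ both h _ _ = (f ⊗ₘ g) ≫ inl _ _
  rw [← MonoidalCategory.tensorHom_comp_tensorHom, Category.assoc, inl_tensor_both]

theorem tensorHom_id_id (X Y : Par T) :
    (symmMonData h).tensorHom (𝟙 X) (𝟙 Y) = 𝟙 ((symmMonData h).tensorObj X Y) :=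
  hom_ext (inl_tensor_both h _ _)

theorem zero_tensorHom {X X' Y Y' : Par T} (f : X' ⟶ Y') :
    (symmMonData h).tensorHom (0 : X ⟶ Y) f = 0 := by
  refine hom_ext ?_
  change ((T.from _ ≫ inr _ _) ⊗ₘ f.arrow) ≫ both h _ _ = T.from _ ≫ inr _ _
  have e : (T.from X.of ≫ inr Y.of (𝟙_ C)) ⊗ₘ f.arrow = (T.from X.of ⊗ₘ f.arrow) ≫
      (inr _ _ ⊗ₘ 𝟙 _) := by
    rw [MonoidalCategory.tensorHom_comp_tensorHom, Category.comp_id]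
  rw [e, Category.assoc, inr_tensor_both, from_comp]

theorem tensorHom_zero {X X' Y Y' : Par T} (f : X' ⟶ Y') :
    (symmMonData h).tensorHom f (0 : X ⟶ Y) = 0 := by
  refine hom_ext ?_
  change (f.arrow ⊗ₘ (T.from _ ≫ inr _ _)) ≫ both h _ _ = T.from _ ≫ inr _ _
  have e : f.arrow ⊗ₘ (T.from X.of ≫ inr Y.of (𝟙_ C)) = (f.arrow ⊗ₘ T.from X.of) ≫
      (𝟙 _ ⊗ₘ inr _ _) := by
    rw [MonoidalCategory.tensorHom_comp_tensorHom, Category.comp_id]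
  rw [e, Category.assoc, tensor_inr_both, from_comp]

variable (T) in
/-- The partial arrow from `A + 1` to `A` which is defined on `A`. -/
def part (A : C) : (⟨sum A (𝟙_ C)⟩ : Par T) ⟶ ⟨A⟩ := ⟨𝟙 _⟩

/-- Splits naturality into two cases: total arrows, where it is inherited, and the arrows `part`,
where it is checked on summands. -/
theorem ofTotal_arrow_comp_part {A B : Par T} (f : A ⟶ B) :
    ofTotal T f.arrow ≫ part T B.of = f :=
  hom_ext ((ofTotal_comp_arrow _ _).trans (Category.comp_id _))

theorem inl_comp_part (A : C) : ofTotal T (inl A (𝟙_ C)) ≫ part T A = 𝟙 (⟨A⟩ : Par T) :=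
  hom_ext ((ofTotal_comp_arrow _ _).trans (Category.comp_id _))

theorem inr_comp_part (A : C) : ofTotal T (inr A (𝟙_ C)) ≫ part T A = 0 :=
  hom_ext ((ofTotal_comp_arrow _ _).trans ((Category.comp_id _).trans (by
    change _ = T.from _ ≫ inr _ _
    rw [T.hom_ext (T.from (𝟙_ C)) (𝟙 _), Category.id_comp])))

end Par

open MonoidalCategory

namespace IsMonOperational

variable {C : Type u} [Category.{v} C] [MonoidalCategory C] [SpecCoproducts C]
  {T : IsTerminal (𝟙_ C)} [SymmetricCategory C]

/-- Of the eight summands, all but the first have an undefined component in some factor; the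
identities in the remaining hypotheses cover these cases without enumerating them. -/
theorem tensor_tensor_hom_ext (h : IsMonOperational T) {A A' B B' F F' X : C}
    {f g : (sum A A' ⊗ sum B B') ⊗ sum F F' ⟶ X}
    (h₁ : ((inl A A' ⊗ₘ inl B B') ⊗ₘ inl F F') ≫ f = ((inl A A' ⊗ₘ inl B B') ⊗ₘ inl F F') ≫ g)
    (h₂ : ((inr A A' ⊗ₘ 𝟙 (sum B B')) ⊗ₘ 𝟙 (sum F F')) ≫ f =
      ((inr A A' ⊗ₘ 𝟙 (sum B B')) ⊗ₘ 𝟙 (sum F F')) ≫ g)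
    (h₃ : ((𝟙 (sum A A') ⊗ₘ inr B B') ⊗ₘ 𝟙 (sum F F')) ≫ f =
      ((𝟙 (sum A A') ⊗ₘ inr B B') ⊗ₘ 𝟙 (sum F F')) ≫ g)
    (h₄ : ((𝟙 (sum A A') ⊗ₘ 𝟙 (sum B B')) ⊗ₘ inr F F') ≫ f =
      ((𝟙 (sum A A') ⊗ₘ 𝟙 (sum B B')) ⊗ₘ inr F F') ≫ g) : f = g := by
  have key := h.isCoprod_tensorHom (h.isCoprod_tensorHom (isCoprod_pairι ![A, A'])
    (isCoprod_pairι ![B, B'])) (isCoprod_pairι ![F, F'])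
  refine key.hom_ext ?_
  have e₂ : ∀ {Y Z : C} (y : Y ⟶ sum B B') (z : Z ⟶ sum F F'),
      ((inr A A' ⊗ₘ y) ⊗ₘ z) ≫ f = ((inr A A' ⊗ₘ y) ⊗ₘ z) ≫ g := fun y z => by
    have e : (inr A A' ⊗ₘ y) ⊗ₘ z = ((𝟙 _ ⊗ₘ y) ⊗ₘ z) ≫ ((inr A A' ⊗ₘ 𝟙 _) ⊗ₘ 𝟙 _) := by
      simp only [MonoidalCategory.tensorHom_comp_tensorHom, Category.id_comp, Category.comp_id]
    rw [e, Category.assoc, h₂, Category.assoc]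
  have e₃ : ∀ {Y Z : C} (y : Y ⟶ sum A A') (z : Z ⟶ sum F F'),
      ((y ⊗ₘ inr B B') ⊗ₘ z) ≫ f = ((y ⊗ₘ inr B B') ⊗ₘ z) ≫ g := fun y z => by
    have e : (y ⊗ₘ inr B B') ⊗ₘ z = ((y ⊗ₘ 𝟙 _) ⊗ₘ z) ≫ ((𝟙 _ ⊗ₘ inr B B') ⊗ₘ 𝟙 _) := by
      simp only [MonoidalCategory.tensorHom_comp_tensorHom, Category.id_comp, Category.comp_id]
    rw [e, Category.assoc, h₃, Category.assoc]
  have e₄ : ∀ {Y Z : C} (y : Y ⟶ sum A A') (z : Z ⟶ sum B B'),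
      ((y ⊗ₘ z) ⊗ₘ inr F F') ≫ f = ((y ⊗ₘ z) ⊗ₘ inr F F') ≫ g := fun y z => by
    have e : (y ⊗ₘ z) ⊗ₘ inr F F' = ((y ⊗ₘ z) ⊗ₘ 𝟙 _) ≫ ((𝟙 _ ⊗ₘ 𝟙 _) ⊗ₘ inr F F') := by
      simp only [MonoidalCategory.tensorHom_comp_tensorHom, Category.id_comp, Category.comp_id]
    rw [e, Category.assoc, h₄, Category.assoc]
  rintro ⟨⟨i, j⟩, k⟩
  match i, j, k with
  | 0, 0, 0 => exact h₁
  | 1, _, _ => exact e₂ _ _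
  | 0, 1, _ => exact e₃ _ _
  | 0, 0, 1 => exact e₄ _ _

end IsMonOperational

namespace Par

variable {C : Type u} [Category.{v} C] [MonoidalCategory C] [SymmetricCategory C]
  [SpecCoproducts C] {T : IsTerminal (𝟙_ C)} (h : IsMonOperational T)

theorem comp_arrow_eq {A B : C} {Y : Par T} {f g : (⟨B⟩ : Par T) ⟶ Y} {φ : (⟨A⟩ : Par T) ⟶ ⟨B⟩}
    {ψ : A ⟶ B} (e : φ = ofTotal T ψ) (e' : φ ≫ f = φ ≫ g) : ψ ≫ f.arrow = ψ ≫ g.arrow := by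
  subst e
  exact (ofTotal_comp_arrow _ _).symm.trans ((congrArg Hom.arrow e').trans (ofTotal_comp_arrow _ _))

theorem tensorHom_ofTotal_id {A A' B : C} (f : A ⟶ B) :
    (symmMonData h).tensorHom (ofTotal T f) (𝟙 ⟨A'⟩) = ofTotal T (f ⊗ₘ 𝟙 A') := by
  rw [← ofTotal_id, tensorHom_ofTotal]

theorem tensorHom_id_ofTotal {A A' B : C} (f : A ⟶ B) :
    (symmMonData h).tensorHom (𝟙 ⟨A'⟩) (ofTotal T f) = ofTotal T (𝟙 A' ⊗ₘ f) := by
  rw [← ofTotal_id, tensorHom_ofTotal]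

theorem tensorHom_hom_ext {A A' B B' : C} {Y : Par T}
    {f g : (symmMonData h).tensorObj ⟨sum A A'⟩ ⟨sum B B'⟩ ⟶ Y}
    (h₁ : (symmMonData h).tensorHom (ofTotal T (inl A A')) (ofTotal T (inl B B')) ≫ f =
      (symmMonData h).tensorHom (ofTotal T (inl A A')) (ofTotal T (inl B B')) ≫ g)
    (h₂ : (symmMonData h).tensorHom (ofTotal T (inr A A')) (𝟙 _) ≫ f =
      (symmMonData h).tensorHom (ofTotal T (inr A A')) (𝟙 _) ≫ g)
    (h₃ : (symmMonData h).tensorHom (𝟙 _) (ofTotal T (inr B B')) ≫ f =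
      (symmMonData h).tensorHom (𝟙 _) (ofTotal T (inr B B')) ≫ g) : f = g :=
  hom_ext (h.tensor_hom_ext (comp_arrow_eq (tensorHom_ofTotal h _ _) h₁)
    (comp_arrow_eq (tensorHom_ofTotal_id h _) h₂) (comp_arrow_eq (tensorHom_id_ofTotal h _) h₃))

theorem tensorHom_id_hom_ext {B B' : C} {X Y : Par T}
    {f g : (symmMonData h).tensorObj X ⟨sum B B'⟩ ⟶ Y}
    (h₁ : (symmMonData h).tensorHom (𝟙 X) (ofTotal T (inl B B')) ≫ f =
      (symmMonData h).tensorHom (𝟙 X) (ofTotal T (inl B B')) ≫ g)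
    (h₂ : (symmMonData h).tensorHom (𝟙 X) (ofTotal T (inr B B')) ≫ f =
      (symmMonData h).tensorHom (𝟙 X) (ofTotal T (inr B B')) ≫ g) : f = g :=
  hom_ext (h.whiskerLeft_hom_ext
    (comp_arrow_eq ((tensorHom_id_ofTotal h _).trans (congrArg (ofTotal T) (id_tensorHom _ _))) h₁)
    (comp_arrow_eq ((tensorHom_id_ofTotal h _).trans (congrArg (ofTotal T) (id_tensorHom _ _))) h₂))

theorem tensorHom_tensorHom_hom_ext {A A' B B' F F' : C} {Y : Par T}
    {f g : (symmMonData h).tensorObj ((symmMonData h).tensorObj ⟨sum A A'⟩ ⟨sum B B'⟩)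
      ⟨sum F F'⟩ ⟶ Y}
    (h₁ : (symmMonData h).tensorHom ((symmMonData h).tensorHom (ofTotal T (inl A A'))
        (ofTotal T (inl B B'))) (ofTotal T (inl F F')) ≫ f =
      (symmMonData h).tensorHom ((symmMonData h).tensorHom (ofTotal T (inl A A'))
        (ofTotal T (inl B B'))) (ofTotal T (inl F F')) ≫ g)
    (h₂ : (symmMonData h).tensorHom ((symmMonData h).tensorHom (ofTotal T (inr A A')) (𝟙 _))
        (𝟙 _) ≫ f =
      (symmMonData h).tensorHom ((symmMonData h).tensorHom (ofTotal T (inr A A')) (𝟙 _))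
        (𝟙 _) ≫ g)
    (h₃ : (symmMonData h).tensorHom ((symmMonData h).tensorHom (𝟙 _) (ofTotal T (inr B B')))
        (𝟙 _) ≫ f =
      (symmMonData h).tensorHom ((symmMonData h).tensorHom (𝟙 _) (ofTotal T (inr B B')))
        (𝟙 _) ≫ g)
    (h₄ : (symmMonData h).tensorHom ((symmMonData h).tensorHom (𝟙 _) (𝟙 _))
        (ofTotal T (inr F F')) ≫ f =
      (symmMonData h).tensorHom ((symmMonData h).tensorHom (𝟙 _) (𝟙 _))
        (ofTotal T (inr F F')) ≫ g) : f = g :=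
  hom_ext (h.tensor_tensor_hom_ext
    (comp_arrow_eq ((congrArg ((symmMonData h).tensorHom · _) (tensorHom_ofTotal h _ _)).trans
      (tensorHom_ofTotal h _ _)) h₁)
    (comp_arrow_eq ((congrArg ((symmMonData h).tensorHom · _) (tensorHom_ofTotal_id h _)).trans
      (tensorHom_ofTotal_id h _)) h₂)
    (comp_arrow_eq ((congrArg ((symmMonData h).tensorHom · _) (tensorHom_id_ofTotal h _)).trans
      (tensorHom_ofTotal_id h _)) h₃)
    (comp_arrow_eq ((congrArg ((symmMonData h).tensorHom · _) ((tensorHom_id_id h _ _).trans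
      ((ofTotal_id _).symm.trans (congrArg (ofTotal T)
        (MonoidalCategory.id_tensorHom_id _ _).symm)))).trans
      (tensorHom_ofTotal h _ _)) h₄))

theorem associator_ofTotal {A A' B B' F F' : C} (a : A ⟶ A') (b : B ⟶ B') (f : F ⟶ F') :
    (symmMonData h).tensorHom ((symmMonData h).tensorHom (ofTotal T a) (ofTotal T b))
        (ofTotal T f) ≫ (symmMonData h).associator ⟨A'⟩ ⟨B'⟩ ⟨F'⟩ =
      (symmMonData h).associator ⟨A⟩ ⟨B⟩ ⟨F⟩ ≫ (symmMonData h).tensorHom (ofTotal T a)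
        ((symmMonData h).tensorHom (ofTotal T b) (ofTotal T f)) := by
  refine (congrArg (· ≫ ofTotal T (α_ A' B' F').hom) ((congrArg ((symmMonData h).tensorHom · _)
    (tensorHom_ofTotal h a b)).trans (tensorHom_ofTotal h (a ⊗ₘ b) f))).trans (Eq.trans ?_
    (congrArg (ofTotal T (α_ A B F).hom ≫ ·) ((congrArg ((symmMonData h).tensorHom _ ·)
    (tensorHom_ofTotal h b f)).trans (tensorHom_ofTotal h a (b ⊗ₘ f)))).symm)
  refine (ofTotal_comp _ _).symm.trans (Eq.trans ?_ (ofTotal_comp _ _))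
  rw [MonoidalCategory.associator_naturality]

/-- Where all three factors are defined, the arrows `part` become identities; where one is
undefined, both sides are zero because a tensor with a zero arrow is zero. -/
theorem associator_part (A B F : C) :
    (symmMonData h).tensorHom ((symmMonData h).tensorHom (part T A) (part T B)) (part T F) ≫
        (symmMonData h).associator ⟨A⟩ ⟨B⟩ ⟨F⟩ =
      (symmMonData h).associator _ _ _ ≫ (symmMonData h).tensorHom (part T A)
        ((symmMonData h).tensorHom (part T B) (part T F)) := by
  refine tensorHom_tensorHom_hom_ext h ?_ ?_ ?_ ?_
  · rw [reassoc_of% (associator_ofTotal h), reassoc_of% (tensorHom_comp h)]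
    simp only [tensorHom_comp, inl_comp_part]
    simp only [tensorHom_id_id, Category.id_comp, Category.comp_id]
  · have e := associator_ofTotal h (inr A (𝟙_ C)) (𝟙 (sum B (𝟙_ C))) (𝟙 (sum F (𝟙_ C)))
    simp only [ofTotal_id] at e
    rw [reassoc_of% e, reassoc_of% (tensorHom_comp h)]
    simp only [tensorHom_comp, inr_comp_part, zero_tensorHom, comp_zero, zero_comp]
  · have e := associator_ofTotal h (𝟙 (sum A (𝟙_ C))) (inr B (𝟙_ C)) (𝟙 (sum F (𝟙_ C)))
    simp only [ofTotal_id] at e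
    rw [reassoc_of% e, reassoc_of% (tensorHom_comp h)]
    simp only [tensorHom_comp, inr_comp_part, zero_tensorHom, tensorHom_zero, comp_zero, zero_comp]
  · have e := associator_ofTotal h (𝟙 (sum A (𝟙_ C))) (𝟙 (sum B (𝟙_ C))) (inr F (𝟙_ C))
    simp only [ofTotal_id] at e
    rw [reassoc_of% e, reassoc_of% (tensorHom_comp h)]
    simp only [tensorHom_comp, inr_comp_part, tensorHom_zero, comp_zero, zero_comp]

theorem associator_naturality {X₁ X₂ X₃ Y₁ Y₂ Y₃ : Par T} (f₁ : X₁ ⟶ Y₁) (f₂ : X₂ ⟶ Y₂)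
    (f₃ : X₃ ⟶ Y₃) :
    (symmMonData h).tensorHom ((symmMonData h).tensorHom f₁ f₂) f₃ ≫
        (symmMonData h).associator Y₁ Y₂ Y₃ =
      (symmMonData h).associator X₁ X₂ X₃ ≫
        (symmMonData h).tensorHom f₁ ((symmMonData h).tensorHom f₂ f₃) := by
  -- Each arrow is a total one followed by a `part`, and naturality holds for each of the two
  -- factors.
  rw [← ofTotal_arrow_comp_part f₁, ← ofTotal_arrow_comp_part f₂, ← ofTotal_arrow_comp_part f₃]
  simp only [← tensorHom_comp]
  rw [Category.assoc, associator_part, ← Category.assoc, associator_ofTotal, Category.assoc]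

theorem leftUnitor_naturality {X Y : Par T} (f : X ⟶ Y) :
    (symmMonData h).tensorHom (𝟙 (symmMonData h).tensorUnit) f ≫ (symmMonData h).leftUnitor Y =
      (symmMonData h).leftUnitor X ≫ f := by
  have total : ∀ {A A' : C} (a : A ⟶ A'), (symmMonData h).tensorHom
      (𝟙 (symmMonData h).tensorUnit) (ofTotal T a) ≫ (symmMonData h).leftUnitor ⟨A'⟩ =
      (symmMonData h).leftUnitor ⟨A⟩ ≫ ofTotal T a := fun a => by
    refine (congrArg (· ≫ _) (tensorHom_id_ofTotal h a)).trans ?_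
    refine (ofTotal_comp _ _).symm.trans (Eq.trans ?_ (ofTotal_comp _ _))
    rw [id_tensorHom, MonoidalCategory.leftUnitor_naturality]
  have key : (symmMonData h).tensorHom (𝟙 (symmMonData h).tensorUnit) (part T Y.of) ≫
      (symmMonData h).leftUnitor Y = (symmMonData h).leftUnitor _ ≫ part T Y.of := by
    refine tensorHom_id_hom_ext h (X := (symmMonData h).tensorUnit) ?_ ?_
    · rw [← Category.assoc _ ((symmMonData h).leftUnitor _), total, Category.assoc, inl_comp_part,
        reassoc_of% (tensorHom_comp h), inl_comp_part, Category.comp_id, Category.comp_id,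
        tensorHom_id_id, Category.id_comp]
    · rw [← Category.assoc _ ((symmMonData h).leftUnitor _), total, Category.assoc, inr_comp_part,
        reassoc_of% (tensorHom_comp h), inr_comp_part, tensorHom_zero, comp_zero, zero_comp]
  have e : (symmMonData h).tensorHom (𝟙 (symmMonData h).tensorUnit) (ofTotal T f.arrow ≫ part T Y.of)
      = (symmMonData h).tensorHom (𝟙 (symmMonData h).tensorUnit) (ofTotal T f.arrow) ≫
      (symmMonData h).tensorHom (𝟙 (symmMonData h).tensorUnit) (part T Y.of) := by
    rw [tensorHom_comp, Category.comp_id]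
  rw [← ofTotal_arrow_comp_part f, e, Category.assoc, key, ← Category.assoc, total, Category.assoc]

theorem braiding_naturality {X₁ X₂ Y₁ Y₂ : Par T} (f₁ : X₁ ⟶ Y₁) (f₂ : X₂ ⟶ Y₂) :
    (symmMonData h).tensorHom f₁ f₂ ≫ (symmMonData h).braiding Y₁ Y₂ =
      (symmMonData h).braiding X₁ X₂ ≫ (symmMonData h).tensorHom f₂ f₁ := by
  have total : ∀ {A A' B B' : C} (a : A ⟶ A') (b : B ⟶ B'), (symmMonData h).tensorHom
      (ofTotal T a) (ofTotal T b) ≫ (symmMonData h).braiding ⟨A'⟩ ⟨B'⟩ =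
      (symmMonData h).braiding ⟨A⟩ ⟨B⟩ ≫ (symmMonData h).tensorHom (ofTotal T b) (ofTotal T a) :=
    fun a b => by
    refine (congrArg (· ≫ _) (tensorHom_ofTotal h a b)).trans (Eq.trans ?_
      (congrArg (_ ≫ ·) (tensorHom_ofTotal h b a)).symm)
    refine (ofTotal_comp _ _).symm.trans (Eq.trans ?_ (ofTotal_comp _ _))
    rw [BraidedCategory.braiding_naturality]
  have key : (symmMonData h).tensorHom (part T Y₁.of) (part T Y₂.of) ≫
      (symmMonData h).braiding Y₁ Y₂ = (symmMonData h).braiding _ _ ≫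
        (symmMonData h).tensorHom (part T Y₂.of) (part T Y₁.of) := by
    refine tensorHom_hom_ext h ?_ ?_ ?_
    · rw [reassoc_of% (tensorHom_comp h), ← Category.assoc _ ((symmMonData h).braiding _ _), total,
        Category.assoc]
      simp only [tensorHom_comp, inl_comp_part]
      simp only [tensorHom_id_id, Category.id_comp, Category.comp_id]
    · have e := total (inr Y₁.of (𝟙_ C)) (𝟙 (sum Y₂.of (𝟙_ C)))
      simp only [ofTotal_id] at e
      rw [reassoc_of% e, reassoc_of% (tensorHom_comp h)]
      simp only [tensorHom_comp, inr_comp_part, zero_tensorHom, tensorHom_zero, comp_zero, zero_comp]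
    · have e := total (𝟙 (sum Y₁.of (𝟙_ C))) (inr Y₂.of (𝟙_ C))
      simp only [ofTotal_id] at e
      rw [reassoc_of% e, reassoc_of% (tensorHom_comp h)]
      simp only [tensorHom_comp, inr_comp_part, zero_tensorHom, tensorHom_zero, comp_zero, zero_comp]
  rw [← ofTotal_arrow_comp_part f₁, ← ofTotal_arrow_comp_part f₂]
  simp only [← tensorHom_comp]
  rw [Category.assoc, key, ← Category.assoc, total, Category.assoc]

theorem braiding_leftUnitor (X : Par T) :
    (symmMonData h).braiding X (symmMonData h).tensorUnit ≫ (symmMonData h).leftUnitor X =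
      (symmMonData h).rightUnitor X :=
  (ofTotal_comp _ _).symm.trans (congrArg (ofTotal T) (CategoryTheory.braiding_leftUnitor X.of))

theorem laws : (symmMonData h).Laws where
  isIso_associator X Y Z := isIso_ofTotal _
  isIso_leftUnitor X := isIso_ofTotal _
  isIso_rightUnitor X := isIso_ofTotal _
  id_tensorHom_id := tensorHom_id_id h
  tensorHom_comp_tensorHom := tensorHom_comp h
  associator_naturality := associator_naturality h
  leftUnitor_naturality := leftUnitor_naturality h
  rightUnitor_naturality {X Y} f := by
    -- The right unitor is the left one after the braiding, and both are already natural.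
    rw [← braiding_leftUnitor, ← braiding_leftUnitor, ← Category.assoc, braiding_naturality,
      Category.assoc, leftUnitor_naturality, Category.assoc]
  braiding_naturality := braiding_naturality h
  -- All coherence arrows are total, and `ofTotal` is functorial and compatible with tensors, so the
  -- remaining laws are images of those of the given category.
  pentagon W X Y Z := by
    refine (congrArg₂ (· ≫ ·) (tensorHom_ofTotal_id h _) (congrArg (_ ≫ ·)
      (tensorHom_id_ofTotal h _))).trans ?_
    refine (congrArg (_ ≫ ·) (ofTotal_comp _ _).symm).trans ((ofTotal_comp _ _).symm.trans
      (Eq.trans (congrArg (ofTotal T) ?_) (ofTotal_comp _ _)))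
    exact (congrArg₂ (· ≫ ·) (tensorHom_id _ _) (congrArg (_ ≫ ·) (id_tensorHom _ _))).trans
      (MonoidalCategory.pentagon W.of X.of Y.of Z.of)
  triangle X Y := by
    refine (congrArg (_ ≫ ·) (tensorHom_id_ofTotal h _)).trans
      (Eq.trans ?_ (tensorHom_ofTotal_id h _).symm)
    refine (ofTotal_comp _ _).symm.trans (congrArg (ofTotal T) ?_)
    exact (congrArg (_ ≫ ·) (id_tensorHom _ _)).trans
      ((MonoidalCategory.triangle X.of Y.of).trans (tensorHom_id _ _).symm)
  hexagon X Y Z := by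
    refine Eq.trans ?_ (congrArg₂ (· ≫ ·) (tensorHom_ofTotal_id h _) (congrArg (_ ≫ ·)
      (tensorHom_id_ofTotal h _))).symm
    refine (congrArg (_ ≫ ·) (ofTotal_comp _ _).symm).trans ((ofTotal_comp _ _).symm.trans
      (Eq.trans ?_ (congrArg (_ ≫ ·) (ofTotal_comp _ _))))
    refine Eq.trans (congrArg (ofTotal T) ?_) (ofTotal_comp _ _)
    exact (BraidedCategory.hexagon_forward X.of Y.of Z.of).trans (congrArg₂ (· ≫ ·)
      (tensorHom_id _ _) (congrArg (_ ≫ ·) (id_tensorHom _ _))).symm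
  symmetry X Y := (ofTotal_comp _ _).symm.trans ((congrArg (ofTotal T)
    (SymmetricCategory.symmetry X.of Y.of)).trans (ofTotal_id _))

end Par

open MonoidalCategory

/-! ## The monoidal theory of partial arrows -/

theorem exists_isCoprod {C : Type u} [Category.{v} C] [SpecCoproducts C] {X : Type} [Finite X]
    (B : X → C) : ∃ (P : C) (ι : ∀ x, B x ⟶ P), IsCoprod ι := by
  obtain ⟨s, ⟨e⟩⟩ := Shape.exists_equiv X
  have h := (s.isCoprod fun i => B (e i)).reindex e.symm
  have key : ∃ (B' : X → C) (_ : B' = B) (P : C) (ι : ∀ x, B' x ⟶ P), IsCoprod ι :=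
    ⟨_, funext fun x => congrArg B (e.apply_symm_apply x), _, _, h⟩
  obtain ⟨_, rfl, h'⟩ := key
  exact h'

theorem IsStrict.preservesSums {C : Type u} [Category.{v} C] [SpecCoproducts C] {C' : Type u}
    [Category.{v} C'] [SpecCoproducts C'] {one : C} {F : C ⥤ C'} (hF : IsStrict one F) :
    PreservesSums F where
  isIso A B := by
    have e : desc (F.map (inl A B)) (F.map (inr A B)) = eqToHom (hF.obj_sum A B).symm :=
      SpecCoproducts.hom_ext ((inl_desc _ _).trans (hF.map_inl_eq A B))
        ((inr_desc _ _).trans (hF.map_inr_eq A B))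
    rw [e]
    infer_instance
  isInitial := ⟨SpecCoproducts.isInitial.ofIso (eqToIso hF.obj_zero.symm)⟩

namespace Par

section

variable {C : Type u} [Category.{v} C] [MonoidalCategory C] [SymmetricCategory C]
  [SpecCoproducts C] {T : IsTerminal (𝟙_ C)} (h : IsMonOperational T)

/-- Composites with the coprojections are tensors of identities on the diagonal, and off it one
factor is zero. -/
theorem tensorHom_proj {X Y : Type} [Finite X] [Finite Y] {B : X → C} {P : C} {ι : ∀ x, B x ⟶ P}
    (hι : IsCoprod ι) {B' : Y → C} {Q : C} {κ : ∀ y, B' y ⟶ Q} (hκ : IsCoprod κ) (p : X × Y) :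
    (symmMonData h).tensorHom ((hι.ofTotal T).proj p.1) ((hκ.ofTotal T).proj p.2) =
      ((h.isCoprod_tensorHom hι hκ).ofTotal T).proj p := by
  refine IsCoprod.eq_proj ((h.isCoprod_tensorHom hι hκ).ofTotal T) ?_ fun q n => ?_
  · refine (congrArg (· ≫ _) (tensorHom_ofTotal h (ι p.1) (κ p.2)).symm).trans ?_
    refine (tensorHom_comp h _ _ _ _).trans ((congrArg₂ _ ((hι.ofTotal T).ι_proj_self p.1)
      ((hκ.ofTotal T).ι_proj_self p.2)).trans ?_)
    exact tensorHom_id_id h _ _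
  · refine (congrArg (· ≫ _) (tensorHom_ofTotal h (ι q.1) (κ q.2)).symm).trans ((tensorHom_comp h _ _ _ _).trans ?_)
    by_cases e : q.1 = p.1
    · have e' : q.2 ≠ p.2 := fun e' => n (Prod.ext e e')
      exact (congrArg _ ((hκ.ofTotal T).ι_proj_ne e')).trans (tensorHom_zero h _)
    · exact (congrArg ((symmMonData h).tensorHom · _) ((hι.ofTotal T).ι_proj_ne e)).trans
        (zero_tensorHom h _)

/-- If `k` and `l` code the two tests, then `k ⊗ l` is an arrow into the tensor of the coproducts,
which is the coproduct of the tensors, and it codes the parallel test. -/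
theorem isTest_tensor {X Y : Type} [Finite X] [Finite Y] {A F : Par T} (f : X → Out A)
    (g : Y → Out F) (tf : (otcPar T).IsTest f) (tg : (otcPar T).IsTest g) :
    (otcPar T).IsTest (fun p : X × Y =>
      (ev ((symmMonData h).tensorHom (f p.1).2 (g p.2).2) :
        Out ((symmMonData h).tensorObj A F))) := by
  obtain ⟨P, ι, hι⟩ := exists_isCoprod (fun x => (f x).1.of)
  obtain ⟨Q, κ, hκ⟩ := exists_isCoprod (fun y => (g y).1.of)
  obtain ⟨k, tk, hk⟩ := (IsPartialForm.isTest_iff f (hι.ofTotal T)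
    (fun x => ofTotal_discard (ι x))).1 tf
  obtain ⟨l, tl, hl⟩ := (IsPartialForm.isTest_iff g (hκ.ofTotal T)
    (fun y => ofTotal_discard (κ y))).1 tg
  obtain ⟨k, rfl⟩ := exists_ofTotal h.toIsOperational k tk
  obtain ⟨l, rfl⟩ := exists_ofTotal h.toIsOperational l tl
  refine (IsPartialForm.isTest_iff _ ((h.isCoprod_tensorHom hι hκ).ofTotal T)
    (fun p => ofTotal_discard (ι p.1 ⊗ₘ κ p.2))).2 ⟨ofTotal T (k ⊗ₘ l), ofTotal_discard _,
      fun p => ?_⟩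
  refine (congrArg₂ (· ≫ ·) (tensorHom_ofTotal h k l).symm
    (tensorHom_proj h hι hκ p).symm).trans ?_
  exact (tensorHom_comp h _ _ _ _).trans (congrArg₂ _ (hk p.1) (hl p.2))

theorem distrib_desc {A A' F Y : Par T} (f : A ⟶ Y) (a b : F ⟶ A') :
    ofTotal T (distrib h A.of F.of F.of) ≫ desc ((symmMonData h).tensorHom f a)
      ((symmMonData h).tensorHom f b) = (symmMonData h).tensorHom f (desc a b) := by
  have e : ∀ c : F ⟶ A', (symmMonData h).tensorHom f c =
      (symmMonData h).tensorHom (𝟙 A) c ≫ (symmMonData h).tensorHom f (𝟙 A') := fun c => by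
    rw [tensorHom_comp, Category.id_comp, Category.comp_id]
  refine tensorHom_id_hom_ext h (X := A) (B := F.of) (B' := F.of) ?_ ?_
  · rw [tensorHom_comp, Category.id_comp]
    refine Eq.trans ?_ (congrArg _ (inl_desc a b)).symm
    refine (Category.assoc _ _ _).symm.trans ?_
    refine (congrArg (· ≫ _) ((congrArg (· ≫ _) ((tensorHom_id_ofTotal h _).trans
      (congrArg (ofTotal T) (id_tensorHom _ _)))).trans ((ofTotal_comp _ _).symm.trans
      (congrArg (ofTotal T) (h.whiskerLeft_inl_distrib A.of F.of F.of))))).trans ?_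
    exact inl_desc ((symmMonData h).tensorHom f a) _
  · rw [tensorHom_comp, Category.id_comp]
    refine Eq.trans ?_ (congrArg _ (inr_desc a b)).symm
    refine (Category.assoc _ _ _).symm.trans ?_
    refine (congrArg (· ≫ _) ((congrArg (· ≫ _) ((tensorHom_id_ofTotal h _).trans
      (congrArg (ofTotal T) (id_tensorHom _ _)))).trans ((ofTotal_comp _ _).symm.trans
      (congrArg (ofTotal T) (h.whiskerLeft_inr_distrib A.of F.of F.of))))).trans ?_
    exact inr_desc ((symmMonData h).tensorHom f a) _

/-- From a witness `k` for the pair `a`, `b`, a witness for the tensored pair is `f ⊗ k` followed by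
distributivity; by `distrib_desc` copairings commute with this. -/
theorem tensorHom_ovee {A B F G : Par T} (f : A ⟶ B) (a b : F ⟶ G) (c : (otcPar T).Compat a b)
    (c' : (otcPar T).Compat ((symmMonData h).tensorHom f a) ((symmMonData h).tensorHom f b)) :
    (symmMonData h).tensorHom f ((otcPar T).ovee a b c) =
      (otcPar T).ovee ((symmMonData h).tensorHom f a) ((symmMonData h).tensorHom f b) c' := by
  have p := isPartialForm h.toIsOperational
  obtain ⟨k, rfl, rfl⟩ := (p.compat_iff a b).1 c
  have key : ∀ x y : G ⟶ G, ((symmMonData h).tensorHom f k ≫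
      ofTotal T (distrib h B.of G.of G.of)) ≫ desc ((symmMonData h).tensorHom (𝟙 B) x)
      ((symmMonData h).tensorHom (𝟙 B) y) = (symmMonData h).tensorHom f (k ≫ desc x y) := by
    intro x y
    refine (Category.assoc _ _ _).trans ((congrArg (_ ≫ ·) (distrib_desc h (𝟙 B) x y)).trans ?_)
    exact (tensorHom_comp h _ _ _ _).trans (congrArg₂ _ (Category.comp_id _) rfl)
  refine (congrArg _ (p.ovee_eq c k rfl rfl)).trans (Eq.trans ?_
    (p.ovee_eq c' ((symmMonData h).tensorHom f k ≫ ofTotal T (distrib h B.of G.of G.of)) ?_ ?_).symm)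
  · refine (key _ _).symm.trans ?_
    rw [tensorHom_id_id]
    rfl
  · refine Eq.trans ?_ (key (𝟙 G) 0)
    rw [tensorHom_id_id, tensorHom_zero]
    rfl
  · refine Eq.trans ?_ (key 0 (𝟙 G))
    rw [tensorHom_id_id, tensorHom_zero]
    rfl

theorem monoidalAxioms :
    let _ := (laws h).monoidalCategory
    OTCData.MonoidalAxioms (otcPar T) :=
  let _ := (laws h).monoidalCategory
  { parallel := isTest_tensor h
    tensor_ovee := tensorHom_ovee h
    tensor_zero := fun f _ _ => tensorHom_zero h f
    unitor_det := (IsPartialForm.isDet_iff _).2 (ofTotal_discard _) }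

end

/-! ### Monoidality of functors between categories of partial arrows -/

section

variable {C : Type u} [Category.{v} C] [MonoidalCategory C] [SymmetricCategory C]
  [SpecCoproducts C] {T : IsTerminal (𝟙_ C)} (h : IsMonOperational T)
  {C' : Type u} [Category.{v} C'] [MonoidalCategory C'] [SymmetricCategory C']
  [SpecCoproducts C'] {T' : IsTerminal (𝟙_ C')} (h' : IsMonOperational T') {F : C ⥤ C'}
  (hF : IsStrict (𝟙_ C) F)

include h' hF in
-- A strict functor preserves sums, so the images of coprojections can be tensored to give
-- coprojections.
theorem map_tensor_hom_ext {A A' B B' : C} {X : C'}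
    {f g : F.obj (sum A A') ⊗ F.obj (sum B B') ⟶ X}
    (h₁ : (F.map (inl A A') ⊗ₘ F.map (inl B B')) ≫ f = (F.map (inl A A') ⊗ₘ F.map (inl B B')) ≫ g)
    (h₂ : (F.map (inr A A') ⊗ₘ 𝟙 (F.obj (sum B B'))) ≫ f =
      (F.map (inr A A') ⊗ₘ 𝟙 (F.obj (sum B B'))) ≫ g)
    (h₃ : (𝟙 (F.obj (sum A A')) ⊗ₘ F.map (inr B B')) ≫ f =
      (𝟙 (F.obj (sum A A')) ⊗ₘ F.map (inr B B')) ≫ g) : f = g := by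
  have hS := hF.preservesSums
  refine (h'.isCoprod_tensorHom (hS.isCoprod (isCoprod_pairι ![A, A']))
    (hS.isCoprod (isCoprod_pairι ![B, B']))).hom_ext ?_
  have e₂ : ∀ {Y : C'} (y : Y ⟶ F.obj (sum B B')), (F.map (inr A A') ⊗ₘ y) ≫ f =
      (F.map (inr A A') ⊗ₘ y) ≫ g := fun y => by
    have e : F.map (inr A A') ⊗ₘ y = (𝟙 _ ⊗ₘ y) ≫ (F.map (inr A A') ⊗ₘ 𝟙 _) := by
      rw [MonoidalCategory.tensorHom_comp_tensorHom, Category.id_comp, Category.comp_id]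
    rw [e, Category.assoc, h₂, Category.assoc]
  have e₃ : ∀ {Y : C'} (y : Y ⟶ F.obj (sum A A')), (y ⊗ₘ F.map (inr B B')) ≫ f =
      (y ⊗ₘ F.map (inr B B')) ≫ g := fun y => by
    have e : y ⊗ₘ F.map (inr B B') = (y ⊗ₘ 𝟙 _) ≫ (𝟙 _ ⊗ₘ F.map (inr B B')) := by
      rw [MonoidalCategory.tensorHom_comp_tensorHom, Category.id_comp, Category.comp_id]
    rw [e, Category.assoc, h₃, Category.assoc]
  rintro ⟨i, j⟩
  match i, j with
  | 0, 0 => exact h₁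
  | 1, _ => exact e₂ _
  | 0, 1 => exact e₃ _

theorem functor_tensorHom_hom_ext {A A' B B' : C} {Y : Par T'}
    {f g : (symmMonData h').tensorObj ((functor T T' hF).obj ⟨sum A A'⟩)
      ((functor T T' hF).obj ⟨sum B B'⟩) ⟶ Y}
    (h₁ : (symmMonData h').tensorHom ((functor T T' hF).map (ofTotal T (inl A A')))
        ((functor T T' hF).map (ofTotal T (inl B B'))) ≫ f =
      (symmMonData h').tensorHom ((functor T T' hF).map (ofTotal T (inl A A')))
        ((functor T T' hF).map (ofTotal T (inl B B'))) ≫ g)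
    (h₂ : (symmMonData h').tensorHom ((functor T T' hF).map (ofTotal T (inr A A'))) (𝟙 _) ≫ f =
      (symmMonData h').tensorHom ((functor T T' hF).map (ofTotal T (inr A A'))) (𝟙 _) ≫ g)
    (h₃ : (symmMonData h').tensorHom (𝟙 _) ((functor T T' hF).map (ofTotal T (inr B B'))) ≫ f =
      (symmMonData h').tensorHom (𝟙 _) ((functor T T' hF).map (ofTotal T (inr B B'))) ≫ g) :
    f = g := by
  refine hom_ext (map_tensor_hom_ext h' hF
    (comp_arrow_eq ((congrArg₂ _ (functor_map_ofTotal hF _) (functor_map_ofTotal hF _)).trans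
      (tensorHom_ofTotal h' _ _)) h₁)
    (comp_arrow_eq ((congrArg ((symmMonData h').tensorHom · _) (functor_map_ofTotal hF _)).trans
      (tensorHom_ofTotal_id h' _)) h₂)
    (comp_arrow_eq ((congrArg ((symmMonData h').tensorHom _ ·) (functor_map_ofTotal hF _)).trans
      (tensorHom_id_ofTotal h' _)) h₃))

variable {ε : 𝟙_ C' ⟶ F.obj (𝟙_ C)} {μ : ∀ X Y : C, F.obj X ⊗ F.obj Y ⟶ F.obj (X ⊗ Y)}

/-- The comparison map of the functor of partial arrows. -/
def functorμ (hF : IsStrict (𝟙_ C) F) (μ : ∀ X Y : C, F.obj X ⊗ F.obj Y ⟶ F.obj (X ⊗ Y))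
    (X Y : Par T) : (symmMonData h').tensorObj ((functor T T' hF).obj X)
      ((functor T T' hF).obj Y) ⟶ (functor T T' hF).obj ((symmMonData h).tensorObj X Y) :=
  ofTotal T' (μ X.of Y.of)

/-- For total arrows this is naturality of `μ`. For the arrows `part` it is checked on summands,
where they become identities or zero arrows, and a general partial arrow factors through the two
kinds. -/
theorem functor_μ_natural (i : IsSymmMonoidal F ε μ) {X Y X' Y' : Par T} (f : X ⟶ Y)
    (g : X' ⟶ Y') :
    (symmMonData h').tensorHom ((functor T T' hF).map f) ((functor T T' hF).map g) ≫
        functorμ h h' hF μ Y Y' =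
      functorμ h h' hF μ X X' ≫ (functor T T' hF).map ((symmMonData h).tensorHom f g) := by
  have total : ∀ {A A' B B' : C} (a : A ⟶ A') (b : B ⟶ B'),
      (symmMonData h').tensorHom ((functor T T' hF).map (ofTotal T a))
          ((functor T T' hF).map (ofTotal T b)) ≫ functorμ h h' hF μ ⟨A'⟩ ⟨B'⟩ =
        functorμ h h' hF μ ⟨A⟩ ⟨B⟩ ≫ (functor T T' hF).map ((symmMonData h).tensorHom (ofTotal T a)
          (ofTotal T b)) := fun {A A' B B'} a b => by
    refine (congrArg (· ≫ _) ((congrArg₂ _ (functor_map_ofTotal hF a)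
      (functor_map_ofTotal hF b)).trans (tensorHom_ofTotal h' _ _))).trans (Eq.trans ?_
      (congrArg (_ ≫ ·) ((congrArg _ (tensorHom_ofTotal h a b)).trans
        (functor_map_ofTotal hF _))).symm)
    exact (ofTotal_comp _ _).symm.trans ((congrArg (ofTotal T') (i.natural a b)).trans
      (ofTotal_comp _ _))
  have map_ofTotal_id : ∀ A : C, (functor T T' hF).map (ofTotal T (𝟙 A)) = 𝟙 _ := fun A =>
    (congrArg _ (ofTotal_id A)).trans (CategoryTheory.Functor.map_id _ _)
  have hz := (isPartialFunctor (T := T) (T' := T') hF).map_zero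
  have key : (symmMonData h').tensorHom ((functor T T' hF).map (part T Y.of))
        ((functor T T' hF).map (part T Y'.of)) ≫ functorμ h h' hF μ Y Y' =
      functorμ h h' hF μ _ _ ≫ (functor T T' hF).map ((symmMonData h).tensorHom (part T Y.of)
        (part T Y'.of)) := by
    refine functor_tensorHom_hom_ext h' hF ?_ ?_ ?_
    · rw [reassoc_of% total, reassoc_of% (tensorHom_comp h'), ← Functor.map_comp,
        ← Functor.map_comp, ← Functor.map_comp, tensorHom_comp, inl_comp_part, inl_comp_part]
      refine (congrArg (· ≫ _) ((congrArg₂ _ (CategoryTheory.Functor.map_id _ _)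
        (CategoryTheory.Functor.map_id _ _)).trans (tensorHom_id_id h' _ _))).trans
        ((Category.id_comp _).trans (Eq.trans ?_ (congrArg (_ ≫ ·) ((congrArg _
        (tensorHom_id_id h _ _)).trans (CategoryTheory.Functor.map_id _ _))).symm))
      exact (Category.comp_id _).symm
    · have e := (congrArg ((symmMonData h').tensorHom _ · ≫ _) (map_ofTotal_id _)).symm.trans
        (total (inr Y.of (𝟙_ C)) (𝟙 (sum Y'.of (𝟙_ C))))
      rw [reassoc_of% e, reassoc_of% (tensorHom_comp h'), ← Functor.map_comp,
        ← Functor.map_comp, tensorHom_comp, inr_comp_part, hz, zero_tensorHom, zero_tensorHom, hz,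
        zero_comp, comp_zero]
    · have e := (congrArg ((symmMonData h').tensorHom · _ ≫ _) (map_ofTotal_id _)).symm.trans
        (total (𝟙 (sum Y.of (𝟙_ C))) (inr Y'.of (𝟙_ C)))
      rw [reassoc_of% e, reassoc_of% (tensorHom_comp h'), ← Functor.map_comp,
        ← Functor.map_comp, tensorHom_comp, inr_comp_part, hz, tensorHom_zero, tensorHom_zero, hz,
        zero_comp, comp_zero]
  rw [← ofTotal_arrow_comp_part f, ← ofTotal_arrow_comp_part g]
  simp only [Functor.map_comp]
  rw [← tensorHom_comp, ← tensorHom_comp, Category.assoc, key, reassoc_of% total, Functor.map_comp]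

theorem isSymmMonoidal_functor (i : IsSymmMonoidal F ε μ) :
    letI := (laws h).monoidalCategory
    letI := (laws h).symmetricCategory
    letI := (laws h').monoidalCategory
    letI := (laws h').symmetricCategory
    IsSymmMonoidal (functor T T' hF) (ofTotal T' ε) (fun X Y => ofTotal T' (μ X.of Y.of)) := by
  let _ := (laws h).monoidalCategory
  let _ := (laws h).symmetricCategory
  let _ := (laws h').monoidalCategory
  let _ := (laws h').symmetricCategory
  have := i.isIso_ε
  have := i.isIso_μ
  refine IsSymmMonoidal.of_laws (isIso_ofTotal ε) (fun X Y => isIso_ofTotal (μ X.of Y.of))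
    (fun f g => functor_μ_natural h h' hF i f g) (fun X Y Z => ?_) (fun X => ?_) (fun X Y => ?_)
  · refine (congrArg₂ (· ≫ ·) (tensorHom_ofTotal_id h' _) (congrArg (_ ≫ ·)
      (functor_map_ofTotal hF _))).trans (Eq.trans ?_ (congrArg (_ ≫ ·) (congrArg (· ≫ _)
      (tensorHom_id_ofTotal h' _))).symm)
    refine (congrArg (_ ≫ ·) (ofTotal_comp _ _).symm).trans ((ofTotal_comp _ _).symm.trans
      (Eq.trans ?_ (congrArg (_ ≫ ·) (ofTotal_comp _ _))))
    exact (congrArg (ofTotal T') (i.associativity X.of Y.of Z.of)).trans (ofTotal_comp _ _)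
  · refine (congrArg₂ (· ≫ ·) (tensorHom_ofTotal_id h' _) (congrArg (_ ≫ ·)
      (functor_map_ofTotal hF _))).trans ?_
    refine (congrArg (_ ≫ ·) (ofTotal_comp _ _).symm).trans ((ofTotal_comp _ _).symm.trans ?_)
    exact congrArg (ofTotal T') (i.left_unitality X.of)
  · refine (congrArg (_ ≫ ·) (functor_map_ofTotal hF _)).trans ?_
    refine (ofTotal_comp _ _).symm.trans (Eq.trans ?_ (ofTotal_comp _ _))
    exact congrArg (ofTotal T') (i.braided X.of Y.of)

end

end Par

theorem monParWellDefined : MonParWellDefined.{v, u} where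
  laws B := Par.laws B.isMonOperational
  axioms B := parWellDefined.axioms B.toOpCatStrict
  monoidalAxioms B := Par.monoidalAxioms B.isMonOperational
  isMorphism {B B'} F := parWellDefined.isMorphism (B := B.toOpCatStrict) (B' := B'.toOpCatStrict)
    ⟨F.toFunctor, F.isStrict⟩
  isSymmMonoidal {B B'} F := by
    obtain ⟨ε, i⟩ := F.isSymmMonoidal
    refine ⟨Par.ofTotal _ ε, Par.isSymmMonoidal_functor _ _ _ i, ?_⟩
    have p := Par.isPartialForm B'.isMonOperational.toIsOperational
    refine (congrArg (_ ≫ ·) (IsPartialForm.disc_eq _ _ p.d_I)).trans ?_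
    -- The coherence arrow is total, so followed by discarding it is discarding on the unit, which
    -- is the identity.
    exact (Par.ofTotal_discard ε).trans p.d_I

open MonoidalCategory

/-! ## The unit as a monoidal functor -/

namespace Par

open OTCData.Coll

variable {E : Type u} [Category.{v} E] [MonoidalCategory E] [SymmetricCategory E]
  {D : OTCData E (𝟙_ E)} {ax : D.Axioms} (m : D.MonoidalAxioms)

/-- The symmetric monoidal structure on partial arrows between collections. -/
def collData (m : D.MonoidalAxioms) : SymmMonData (Par (isTerminal ax)) :=
  let _ := (OTCData.Coll.laws ax m).monoidalCategory
  let _ := (OTCData.Coll.laws ax m).symmetricCategory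
  symmMonData (OTCData.Coll.isMonOperational ax m)

theorem collData_comp {X₁ Y₁ Z₁ X₂ Y₂ Z₂ : Par (isTerminal ax)} (f₁ : X₁ ⟶ Y₁) (f₂ : X₂ ⟶ Y₂)
    (g₁ : Y₁ ⟶ Z₁) (g₂ : Y₂ ⟶ Z₂) :
    (collData m).tensorHom f₁ f₂ ≫ (collData m).tensorHom g₁ g₂ =
      (collData m).tensorHom (f₁ ≫ g₁) (f₂ ≫ g₂) :=
  let _ := (OTCData.Coll.laws ax m).monoidalCategory
  let _ := (OTCData.Coll.laws ax m).symmetricCategory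
  tensorHom_comp (OTCData.Coll.isMonOperational ax m) f₁ f₂ g₁ g₂

theorem collData_id (X Y : Par (isTerminal ax)) :
    (collData m).tensorHom (𝟙 X) (𝟙 Y) = 𝟙 ((collData m).tensorObj X Y) :=
  let _ := (OTCData.Coll.laws ax m).monoidalCategory
  let _ := (OTCData.Coll.laws ax m).symmetricCategory
  tensorHom_id_id (OTCData.Coll.isMonOperational ax m) X Y

theorem collData_ofTotal {X Y X' Y' : OTCData.Coll ax} (f : X ⟶ Y) (g : X' ⟶ Y') :
    (collData m).tensorHom (ofTotal (isTerminal ax) f) (ofTotal (isTerminal ax) g) =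
      ofTotal (isTerminal ax) ((OTCData.Coll.symmMonData ax m).tensorHom f g) :=
  let _ := (OTCData.Coll.laws ax m).monoidalCategory
  let _ := (OTCData.Coll.laws ax m).symmetricCategory
  tensorHom_ofTotal (OTCData.Coll.isMonOperational ax m) f g

theorem zero_collData {X X' Y Y' : Par (isTerminal ax)} (f : X' ⟶ Y') :
    (collData m).tensorHom (0 : X ⟶ Y) f = 0 :=
  let _ := (OTCData.Coll.laws ax m).monoidalCategory
  let _ := (OTCData.Coll.laws ax m).symmetricCategory
  zero_tensorHom (OTCData.Coll.isMonOperational ax m) f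

theorem collData_zero {X X' Y Y' : Par (isTerminal ax)} (f : X' ⟶ Y') :
    (collData m).tensorHom f (0 : X ⟶ Y) = 0 :=
  let _ := (OTCData.Coll.laws ax m).monoidalCategory
  let _ := (OTCData.Coll.laws ax m).symmetricCategory
  tensorHom_zero (OTCData.Coll.isMonOperational ax m) f

theorem collLaws (m : D.MonoidalAxioms) : (collData (ax := ax) m).Laws :=
  let _ := (OTCData.Coll.laws ax m).monoidalCategory
  let _ := (OTCData.Coll.laws ax m).symmetricCategory
  laws (OTCData.Coll.isMonOperational ax m)

/-- The partial arrow which is defined on the system `A` only. -/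
def singlePart (ax : D.Axioms) (A : E) :
    (⟨plus (single ax A) (single ax (𝟙_ E))⟩ : Par (isTerminal ax)) ⟶ ⟨single ax A⟩ :=
  ⟨𝟙 _⟩

theorem inl_comp_singlePart (A : E) : ofTotal (isTerminal ax)
    (inl (single ax A) (single ax (𝟙_ E))) ≫ singlePart ax A = 𝟙 _ :=
  hom_ext ((ofTotal_comp_arrow _ _).trans (Category.comp_id _))

theorem inr_comp_singlePart (A : E) : ofTotal (isTerminal ax)
    (inr (single ax A) (single ax (𝟙_ E))) ≫ singlePart ax A = 0 := by
  refine hom_ext ((ofTotal_comp_arrow _ _).trans ((Category.comp_id _).trans ?_))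
  refine ((congrArg (· ≫ inr (single ax A) (single ax (𝟙_ E)))
    ((isTerminal ax).hom_ext ((isTerminal ax).from _) (𝟙 _))).trans (Category.id_comp _)).symm

theorem collι_comp_singlePart_inl (A : E) :
    collι (plus (single ax A) (single ax (𝟙_ E))) (.inl ()) ≫ singlePart ax A =
      𝟙 ((unit ax).obj A) := by
  refine (congrArg (· ≫ _) (congrArg (ofTotal (isTerminal ax))
    ((singleι_plus_inl (single ax A) (single ax (𝟙_ E)) (pt ax A)).trans
      (Category.id_comp _)))).trans ?_
  exact inl_comp_singlePart A

theorem collι_comp_singlePart_inr (A : E) :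
    collι (plus (single ax A) (single ax (𝟙_ E))) (.inr ()) ≫ singlePart ax A = 0 := by
  refine (congrArg (· ≫ _) (congrArg (ofTotal (isTerminal ax))
    ((singleι_plus_inr (single ax A) (single ax (𝟙_ E)) (pt ax (𝟙_ E))).trans
      (Category.id_comp _)))).trans ?_
  exact inr_comp_singlePart A

/-- Write each event as a total arrow followed by `singlePart`. Of the four indices of `(B + 1) ⊗
(B' + 1)` only the one with both components defined contributes, and its entry is `f ⊗ g`. -/
theorem collData_tensorHom_unit {A A' B B' : E} (f : A ⟶ B) (g : A' ⟶ B') :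
    (collData m).tensorHom ((unit ax).map f) ((unit ax).map g) = (unit ax).map (f ⊗ₘ g) := by
  let F := ((unit ax).map f).arrow
  let G := ((unit ax).map g).arrow
  have eF : (unit ax).map f = ofTotal (isTerminal ax) F ≫ singlePart ax B :=
    hom_ext ((ofTotal_comp_arrow _ _).trans (Category.comp_id _)).symm
  have eG : (unit ax).map g = ofTotal (isTerminal ax) G ≫ singlePart ax B' :=
    hom_ext ((ofTotal_comp_arrow _ _).trans (Category.comp_id _)).symm
  have e : (collData m).tensorHom ((unit ax).map f) ((unit ax).map g) =
      ofTotal (isTerminal ax) ((OTCData.Coll.symmMonData ax m).tensorHom F G) ≫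
        (collData m).tensorHom (singlePart ax B) (singlePart ax B') :=
    (congrArg₂ _ eF eG).trans ((collData_comp m _ _ _ _).symm.trans
      (congrArg (· ≫ _) (collData_ofTotal m F G)))
  -- On the other three summands at least one factor lies in the summand `1`, where `singlePart`
  -- vanishes.
  have hz : ∀ k : (OTCData.Coll.tensor (plus (single ax B) (single ax (𝟙_ E)))
      (plus (single ax B') (single ax (𝟙_ E)))).Idx, k ≠ Sum.inl (Sum.inl ()) →
      collι _ k ≫ (collData m).tensorHom (singlePart ax B) (singlePart ax B') = 0 := by
    intro k n
    refine (congrArg (· ≫ _) ((congrArg (ofTotal (isTerminal ax))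
      (tensorHom_singleι ax m _ _ k).symm).trans (collData_ofTotal m _ _).symm)).trans
      ((collData_comp m _ _ _ _).trans ?_)
    rcases k with (k | k) | (k | k)
    · exact (n rfl).elim
    · exact (congrArg _ (collι_comp_singlePart_inr B')).trans (collData_zero m _)
    · exact (congrArg ((collData m).tensorHom · _) (collι_comp_singlePart_inr B)).trans
        (zero_collData m _)
    · exact (congrArg ((collData m).tensorHom · _) (collι_comp_singlePart_inr B)).trans
        (zero_collData m _)
  have ho : collι (OTCData.Coll.tensor (plus (single ax B) (single ax (𝟙_ E)))
      (plus (single ax B') (single ax (𝟙_ E)))) (Sum.inl (Sum.inl ())) ≫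
      (collData m).tensorHom (singlePart ax B) (singlePart ax B') =
      𝟙 ((unit ax).obj (B ⊗ B')) := by
    refine (congrArg (· ≫ _) ((congrArg (ofTotal (isTerminal ax))
      (tensorHom_singleι ax m _ _ _).symm).trans (collData_ofTotal m _ _).symm)).trans
      ((collData_comp m _ _ _ _).trans ?_)
    exact (congrArg₂ _ (collι_comp_singlePart_inl B) (collι_comp_singlePart_inl B')).trans
      (collData_id m _ _)
  refine entry_ext fun _ _ => Eq.trans ?_ (unit_map_entry (ax := ax) (f ⊗ₘ g)).symm
  refine (congrArg (fun k => entry k (pt ax (A ⊗ A')) (pt ax (B ⊗ B'))) e).trans ?_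
  refine (comp_entry _ _ (pt ax (A ⊗ A')) (pt ax (B ⊗ B'))).trans ?_
  refine (OTCData.bigOvee_eq_single ax _ (Sum.inl (Sum.inl ())) fun k n => ?_).trans ?_
  · refine (congrArg (_ ≫ ·) ((collι_comp_entry (X := OTCData.Coll.tensor
      (plus (single ax B) (single ax (𝟙_ E))) (plus (single ax B') (single ax (𝟙_ E)))) k _
      (pt ax (B ⊗ B'))).symm.trans
      ((congrArg (fun k => entry k (pt ax _) (pt ax (B ⊗ B'))) (hz k n)).trans
        (zero_entry (pt ax _) (pt ax (B ⊗ B')))))).trans ?_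
    exact ax.comp_zero _
  · refine (congrArg₂ (· ≫ ·) ?_ ((collι_comp_entry _ _ (pt ax (B ⊗ B'))).symm.trans
      ((congrArg (fun k => entry k (pt ax (B ⊗ B')) (pt ax (B ⊗ B'))) ho).trans
        ((id_entry (pt ax (B ⊗ B')) (pt ax (B ⊗ B'))).trans (delta_self _ _))))).trans
        (Category.comp_id (f ⊗ₘ g))
    refine (ofTotal_entry ((OTCData.Coll.symmMonData ax m).tensorHom F G) (pt ax (A ⊗ A'))
      (Sum.inl (Sum.inl ()))).trans ?_
    exact congrArg₂ (· ⊗ₘ ·) (unit_map_entry f) (unit_map_entry g)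

/-- The comparison map of the unit. -/
def unitμ (m : D.MonoidalAxioms) (A B : E) :
    (collData (ax := ax) m).tensorObj ((unit ax).obj A) ((unit ax).obj B) ⟶ (unit ax).obj (A ⊗ B) :=
  ofTotal (isTerminal ax) (𝟙 (single ax (A ⊗ B)))

theorem unitμ_eq (A B : E) : unitμ m A B = 𝟙 ((unit ax).obj (A ⊗ B)) := ofTotal_id _

theorem functor_map_unitμ {C : Type u} [Category.{v} C] [SpecCoproducts C] {one : C}
    {T : IsTerminal one} {H : OTCData.Coll ax ⥤ C} (hH : IsStrict (single ax (𝟙_ E)) H) (A B : E) :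
    (functor (isTerminal ax) T hH).map (unitμ m A B) =
      𝟙 (Par.mk (T := T) (H.obj (single ax (A ⊗ B)))) :=
  (congrArg _ (unitμ_eq m A B)).trans (CategoryTheory.Functor.map_id _ _)

theorem unit_map_eq_ofTotal {A B : E} (f : A ⟶ B) (M : single ax A ⟶ single ax B)
    (h : M.entry (pt ax A) (pt ax B) = f) : (unit ax).map f = ofTotal (isTerminal ax) M :=
  entry_ext fun _ _ => (unit_map_entry f).trans
    (h.symm.trans (ofTotal_entry M (pt ax A) (pt ax B)).symm)

theorem unitμ_tensor_id (A B F : E) : (collData (ax := ax) m).tensorHom (unitμ m A B)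
    (𝟙 ((unit ax).obj F)) = 𝟙 ((unit ax).obj ((A ⊗ B) ⊗ F)) :=
  (congrArg ((collData m).tensorHom · (𝟙 ((unit ax).obj F))) (unitμ_eq m A B)).trans
    (collData_id m ((unit ax).obj (A ⊗ B)) ((unit ax).obj F))

theorem id_tensor_unitμ (A B F : E) : (collData (ax := ax) m).tensorHom
    (𝟙 ((unit ax).obj A)) (unitμ m B F) = 𝟙 ((unit ax).obj (A ⊗ (B ⊗ F))) :=
  (congrArg ((collData m).tensorHom (𝟙 ((unit ax).obj A))) (unitμ_eq m B F)).trans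
    (collData_id m ((unit ax).obj A) ((unit ax).obj (B ⊗ F)))

theorem unitμ_comp {A B : E} {Y : Par (isTerminal ax)} (f : (unit ax).obj (A ⊗ B) ⟶ Y) :
    unitμ m A B ≫ f = f :=
  (congrArg (· ≫ f) (unitμ_eq m A B)).trans (Category.id_comp f)

theorem comp_unitμ {A B : E} {Y : Par (isTerminal ax)} (f : Y ⟶ (unit ax).obj (A ⊗ B)) :
    f ≫ unitμ m A B = f :=
  (congrArg (f ≫ ·) (unitμ_eq m A B)).trans (Category.comp_id f)

/-- The tensor of two single systems is by definition the single tensor system, so the comparison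
maps are identities and the laws only say that coherence matrices on single systems have the
coherence events as entries. -/
theorem isSymmMonoidal_unit :
    letI := (collLaws (ax := ax) m).monoidalCategory
    letI := (collLaws (ax := ax) m).symmetricCategory
    IsSymmMonoidal (unit ax) (𝟙 ((unit ax).obj (𝟙_ E))) (unitμ m) := by
  let _ := (collLaws (ax := ax) m).monoidalCategory
  let _ := (collLaws (ax := ax) m).symmetricCategory
  refine IsSymmMonoidal.of_laws (inferInstanceAs (IsIso (𝟙 ((unit ax).obj (𝟙_ E)))))
    (fun A B => ?_) (fun f g => ?_) (fun A B F => ?_) (fun A => ?_) (fun A B => ?_)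
  · exact (congrArg (fun t : (unit ax).obj (A ⊗ B) ⟶ (unit ax).obj (A ⊗ B) => IsIso t)
      (unitμ_eq m A B)).mpr inferInstance
  · exact (comp_unitμ m _).trans ((collData_tensorHom_unit m f g).trans (unitμ_comp m _).symm)
  · refine (congrArg₂ (· ≫ ·) (unitμ_tensor_id m A B F) (unitμ_comp m _)).trans
      ((Category.id_comp _).trans (Eq.trans ?_ (congrArg (_ ≫ ·) ((comp_unitμ m _).trans
      (id_tensor_unitμ m A B F))).symm))
    exact (unit_map_eq_ofTotal _ _ (associator_single_entry ax m A B F)).trans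
      (Category.comp_id _).symm
  · refine (congrArg₂ (· ≫ ·) (collData_id m ((unit ax).obj (𝟙_ E)) ((unit ax).obj A))
      (unitμ_comp m _)).trans ((Category.id_comp _).trans ?_)
    exact unit_map_eq_ofTotal _ _ (leftUnitor_single_entry ax m A)
  · refine (unitμ_comp m _).trans (Eq.trans ?_ (comp_unitμ m _).symm)
    exact unit_map_eq_ofTotal _ _ (braiding_single_entry ax m A B)

end Par

/-- The unit of the adjunction between monoidal theories and monoidal operational categories. -/
def monUnitHom (Θ : MonOTC.{v, u}) :
    Θ ⟶ (monOTCOfPar monParWellDefined).obj ((monOpCat monTestsWellDefined).obj Θ) :=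
  ⟨Par.unit Θ.ax, Par.unitμ Θ.monAx,
    Par.isMorphism_unit (Par.isPartialForm (OTCData.Coll.isOperational Θ.ax)) _,
    𝟙 _, Par.isSymmMonoidal_unit Θ.monAx, by
      have p := Par.isPartialForm (OTCData.Coll.isOperational Θ.ax)
      exact (Category.id_comp _).trans ((IsPartialForm.disc_eq _ _ p.d_I).trans p.d_I)⟩

open OTCData.Coll in
theorem monUnitHom_naturality {Θ Θ' : MonOTC.{v, u}} (F : Θ ⟶ Θ') :
    monUnitHom Θ ≫ (monOTCOfPar monParWellDefined).map ((monOpCat monTestsWellDefined).map F) =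
      F ≫ monUnitHom Θ' :=
  MonOTC.Hom.ext_of_heq (unit_comp_functor_tests F.toOTCHom (testsWellDefined.isStrict F.toOTCHom))
    fun A B => heq_of_eq (by
      -- The comparison maps contributed by the units are identities; what is left on both sides is
      -- the one-by-one matrix with entry `F.μ A B`.
      have e₁ := Par.functor_map_unitμ (T := isTerminal Θ'.ax) Θ.monAx
        (testsWellDefined.isStrict F.toOTCHom) A B
      have e₂ := Par.unit_map_eq_ofTotal (A := F.toFunctor.obj A ⊗ F.toFunctor.obj B)
        (B := F.toFunctor.obj (A ⊗ B)) (F.μ A B) (F.testsμ (single Θ.ax A) (single Θ.ax B))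
        (F.testsμ_single_entry A B)
      exact ((congrArg (_ ≫ ·) e₁).trans (Category.comp_id _)).trans
        (e₂.symm.trans (Par.unitμ_comp Θ'.monAx _).symm))

open MonoidalCategory

/-! ## The counit as a monoidal functor -/

namespace Par

open OTCData.Coll IsPartialForm

section

variable {C : Type u} [Category.{v} C] [SpecCoproducts C] {one : C} {T : IsTerminal one}
  (op : IsOperational T) {ax : (otcPar T).Axioms}

include op in
-- The copairing of total arrows is total, so it comes from an arrow of the original category;
-- uniqueness holds since `ofTotal` is faithful.
theorem isCoprod_of_ofTotal {X : Type} {B : X → C} {P : C} {ι : ∀ x, B x ⟶ P}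
    (h : IsCoprod (B := fun x => Par.mk (T := T) (B x)) (P := ⟨P⟩) fun x => ofTotal T (ι x)) :
    IsCoprod ι where
  exists_desc f := by
    obtain ⟨g, hg⟩ := exists_ofTotal op (h.desc fun x => ofTotal T (f x))
      (h.desc_total (d := discard T) (fun x => ofTotal_discard (ι x))
        (fun x => ofTotal_discard (f x)))
    exact ⟨g, fun x => ofTotal_injective op ((ofTotal_comp _ _).trans
      ((congrArg (_ ≫ ·) hg).trans (h.ι_desc _ x)))⟩
  hom_ext hh := ofTotal_injective op (h.hom_ext fun x => (ofTotal_comp _ _).symm.trans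
    ((congrArg (ofTotal T) (hh x)).trans (ofTotal_comp _ _)))

/-- The coprojections of the coproduct of the members of a collection, as total arrows. -/
def counitι (X : OTCData.Coll ax) (x : X.Idx) : (X.fam x).of ⟶ (counit op ax).obj X :=
  (exists_ofTotal op _ ((isPartialForm op).totalι_d X x)).choose

theorem ofTotal_counitι (X : OTCData.Coll ax) (x : X.Idx) :
    ofTotal T (counitι op X x) = totalι X x :=
  (exists_ofTotal op _ ((isPartialForm op).totalι_d X x)).choose_spec

theorem isCoprod_counitι (X : OTCData.Coll ax) : IsCoprod (counitι op X) := by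
  refine isCoprod_of_ofTotal op ?_
  have e : (fun x => ofTotal T (counitι op X x)) = totalι X := funext (ofTotal_counitι op X)
  rw [e]
  exact isCoprod_total X

theorem counit_map_singleι (X : OTCData.Coll ax) (x : X.Idx) :
    (counit op ax).map (X.singleι x) = counitι op X x :=
  ofTotal_injective op ((ofTotal_counit_map op _).trans (Eq.trans
    ((isPartialForm op).eq_totalMap (X.singleι x) (f := totalι X x)
      fun _ x' => (Category.id_comp _).trans (totalι_proj_entry x x')).symm
    (ofTotal_counitι op X x).symm))

theorem counitι_single (A : Par T) : counitι op (single ax A) (pt ax A) = 𝟙 A.of :=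
  ofTotal_injective op ((ofTotal_counitι op (single ax A) (pt ax A)).trans (ofTotal_id _).symm)

theorem ofTotal_counit_map_single {A B : Par T} (M : single ax A ⟶ single ax B) :
    ofTotal T ((counit op ax).map M) = M.entry (pt ax A) (pt ax B) := by
  have e : (isCoprod_total (single ax B)).proj (pt ax B) = 𝟙 B :=
    (IsCoprod.eq_proj (isCoprod_total (single ax B)) (Category.id_comp (𝟙 B))
      (fun y n => absurd rfl n)).symm
  refine (ofTotal_counit_map op M).trans (Eq.trans ?_
    ((isPartialForm op).ι_totalMap_proj M (pt ax A) (pt ax B)))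
  exact ((Category.id_comp _).trans ((congrArg (_ ≫ ·) e).trans (Category.comp_id _))).symm

end

/-! ### The comparison map of the counit -/

section

variable {C : Type u} [Category.{v} C] [MonoidalCategory C] [SymmetricCategory C]
  [SpecCoproducts C] {T : IsTerminal (𝟙_ C)} (h : IsMonOperational T) (ax : (otcPar T).Axioms)

/-- The symmetric monoidal structure on tests of partial arrows. -/
def parCollData : SymmMonData (OTCData.Coll ax) :=
  let _ := (laws h).monoidalCategory
  let _ := (laws h).symmetricCategory
  OTCData.Coll.symmMonData ax (monoidalAxioms h)

theorem parCollLaws : (parCollData h ax).Laws :=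
  let _ := (laws h).monoidalCategory
  let _ := (laws h).symmetricCategory
  OTCData.Coll.laws ax (monoidalAxioms h)

variable {ax}

/-- By distributivity the tensor of the two coproducts is a coproduct of the tensored members, so it
is canonically isomorphic to the coproduct of the tensored collection. -/
theorem isCoprod_tensor_counitι (X Y : OTCData.Coll ax) :
    IsCoprod (B := fun i : (X.shape.mul Y.shape).Idx =>
        (X.fam (X.shape.pair Y.shape i).1).of ⊗ (Y.fam (X.shape.pair Y.shape i).2).of)
      (fun i => counitι h.toIsOperational X (X.shape.pair Y.shape i).1 ⊗ₘ
        counitι h.toIsOperational Y (X.shape.pair Y.shape i).2) :=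
  (h.isCoprod_tensorHom (isCoprod_counitι _ X) (isCoprod_counitι _ Y)).reindex
    (X.shape.pair Y.shape)

/-- The comparison map of the counit. -/
def counitμ (X Y : OTCData.Coll ax) :
    (counit h.toIsOperational ax).obj X ⊗ (counit h.toIsOperational ax).obj Y ⟶
      (counit h.toIsOperational ax).obj ((parCollData h ax).tensorObj X Y) :=
  (isCoprod_tensor_counitι h X Y).desc
    (counitι h.toIsOperational ((parCollData h ax).tensorObj X Y))

theorem isIso_counitμ (X Y : OTCData.Coll ax) : IsIso (counitμ h X Y) :=
  (isCoprod_tensor_counitι h X Y).isIso_desc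
    (isCoprod_counitι h.toIsOperational ((parCollData h ax).tensorObj X Y))

theorem tensor_counitι_counitμ (X Y : OTCData.Coll ax) (i : (X.shape.mul Y.shape).Idx) :
    (counitι h.toIsOperational X (X.shape.pair Y.shape i).1 ⊗ₘ
        counitι h.toIsOperational Y (X.shape.pair Y.shape i).2) ≫ counitμ h X Y =
      counitι h.toIsOperational ((parCollData h ax).tensorObj X Y) i :=
  (isCoprod_tensor_counitι h X Y).ι_desc
    (counitι h.toIsOperational ((parCollData h ax).tensorObj X Y)) i

theorem counitμ_single (A B : Par T) :
    counitμ h (single ax A) (single ax B) = 𝟙 (A.of ⊗ B.of) := by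
  refine Eq.trans ?_ ((tensor_counitι_counitμ h (single ax A) (single ax B) ()).trans
    (counitι_single h.toIsOperational ((symmMonData h).tensorObj A B)))
  refine (Category.id_comp _).symm.trans (congrArg (· ≫ _) ?_)
  exact ((congrArg₂ (· ⊗ₘ ·) (counitι_single h.toIsOperational A)
    (counitι_single h.toIsOperational B)).trans (MonoidalCategory.id_tensorHom_id _ _)).symm

theorem tensor_totalι_counitμ (X Y : OTCData.Coll ax) (i : (X.shape.mul Y.shape).Idx) :
    (symmMonData h).tensorHom (totalι X (X.shape.pair Y.shape i).1)
        (totalι Y (X.shape.pair Y.shape i).2) ≫ ofTotal T (counitμ h X Y) =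
      totalι ((parCollData h ax).tensorObj X Y) i := by
  refine (congrArg (· ≫ _) ((congrArg₂ _ (ofTotal_counitι h.toIsOperational X _).symm
    (ofTotal_counitι h.toIsOperational Y _).symm).trans (tensorHom_ofTotal h _ _))).trans ?_
  exact (ofTotal_comp _ _).symm.trans ((congrArg (ofTotal T) (tensor_counitι_counitμ h X Y i)).trans
    (ofTotal_counitι h.toIsOperational ((parCollData h ax).tensorObj X Y) i))

theorem tensor_totalι_hom_ext {X Y : OTCData.Coll ax} {Z : Par T}
    {f g : (symmMonData h).tensorObj (total X) (total Y) ⟶ Z}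
    (hh : ∀ i : (X.shape.mul Y.shape).Idx,
      (symmMonData h).tensorHom (totalι X (X.shape.pair Y.shape i).1)
          (totalι Y (X.shape.pair Y.shape i).2) ≫ f =
        (symmMonData h).tensorHom (totalι X (X.shape.pair Y.shape i).1)
          (totalι Y (X.shape.pair Y.shape i).2) ≫ g) : f = g := by
  refine ((isCoprod_tensor_counitι h X Y).ofTotal T).hom_ext fun i => ?_
  have e := (tensorHom_ofTotal h _ _).symm.trans (congrArg₂ (symmMonData h).tensorHom
    (ofTotal_counitι h.toIsOperational X (X.shape.pair Y.shape i).1)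
    (ofTotal_counitι h.toIsOperational Y (X.shape.pair Y.shape i).2))
  exact (congrArg (· ≫ f) e).trans ((hh i).trans (congrArg (· ≫ g) e).symm)

theorem counitμ_proj (X Y : OTCData.Coll ax) (j : (X.shape.mul Y.shape).Idx) :
    ofTotal T (counitμ h X Y) ≫ (isCoprod_total ((parCollData h ax).tensorObj X Y)).proj j =
      (symmMonData h).tensorHom ((isCoprod_total X).proj (X.shape.pair Y.shape j).1)
        ((isCoprod_total Y).proj (X.shape.pair Y.shape j).2) := by
  refine tensor_totalι_hom_ext h fun i => ?_
  refine (Category.assoc _ _ _).symm.trans ((congrArg (· ≫ _)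
    (tensor_totalι_counitμ h X Y i)).trans ((totalι_proj_entry _ _).trans (Eq.trans ?_
      (tensorHom_comp h _ _ _ _).symm)))
  refine Eq.trans ?_ (congrArg₂ (symmMonData h).tensorHom (totalι_proj_entry _ _)
    (totalι_proj_entry _ _)).symm
  let _ := (laws h).monoidalCategory
  let _ := (laws h).symmetricCategory
  exact (OTCData.Coll.delta_tensor (monoidalAxioms h) X Y i j).symm

/-- Both sides are compared after coprojections and projections, hence entry by entry; each entry is
the tensor of an entry of `f` with one of `g`. -/
theorem counitμ_natural {X Y X' Y' : OTCData.Coll ax} (f : X ⟶ Y) (g : X' ⟶ Y') :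
    ((counit h.toIsOperational ax).map f ⊗ₘ (counit h.toIsOperational ax).map g) ≫
        counitμ h Y Y' =
      counitμ h X X' ≫ (counit h.toIsOperational ax).map ((parCollData h ax).tensorHom f g) := by
  have p := isPartialForm h.toIsOperational
  refine ofTotal_injective h.toIsOperational (tensor_totalι_hom_ext h fun i =>
    p.coprod_ext (isCoprod_total ((parCollData h ax).tensorObj Y Y')) fun j => ?_)
  have e₁ : ofTotal T (((counit h.toIsOperational ax).map f ⊗ₘ
      (counit h.toIsOperational ax).map g) ≫ counitμ h Y Y') ≫
      (isCoprod_total ((parCollData h ax).tensorObj Y Y')).proj j =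
      (symmMonData h).tensorHom
        (p.totalMap f ≫ (isCoprod_total Y).proj (Y.shape.pair Y'.shape j).1)
        (p.totalMap g ≫ (isCoprod_total Y').proj (Y.shape.pair Y'.shape j).2) := by
    refine (congrArg (· ≫ _) (ofTotal_comp _ _)).trans ((Category.assoc _ _ _).trans
      ((congrArg (_ ≫ ·) (counitμ_proj h Y Y' j)).trans ?_))
    refine (congrArg (· ≫ _) ((tensorHom_ofTotal h _ _).symm.trans (congrArg₂
      (symmMonData h).tensorHom (ofTotal_counit_map _ f) (ofTotal_counit_map _ g)))).trans ?_
    exact tensorHom_comp h _ _ _ _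
  have e₂ : (symmMonData h).tensorHom (totalι X (X.shape.pair X'.shape i).1)
        (totalι X' (X.shape.pair X'.shape i).2) ≫ ofTotal T (counitμ h X X' ≫
        (counit h.toIsOperational ax).map ((parCollData h ax).tensorHom f g)) =
      totalι ((parCollData h ax).tensorObj X X') i ≫
        p.totalMap ((parCollData h ax).tensorHom f g) := by
    refine (congrArg (_ ≫ ·) (ofTotal_comp _ _)).trans ((Category.assoc _ _ _).symm.trans ?_)
    exact congrArg₂ (· ≫ ·) (tensor_totalι_counitμ h X X' i) (ofTotal_counit_map _ _)
  refine (Category.assoc _ _ _).trans ((congrArg (_ ≫ ·) e₁).trans ?_)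
  refine Eq.trans ?_ ((congrArg (· ≫ _) e₂).trans ((Category.assoc _ _ _).trans
    (p.ι_totalMap_proj ((parCollData h ax).tensorHom f g) i j))).symm
  exact (tensorHom_comp h _ _ _ _).trans (congrArg₂ (symmMonData h).tensorHom
    (p.ι_totalMap_proj f _ _) (p.ι_totalMap_proj g _ _))

theorem counit_associator_single (A B F : Par T) :
    (counit h.toIsOperational ax).map ((parCollData h ax).associator (single ax A) (single ax B)
      (single ax F)) = (α_ A.of B.of F.of).hom := by
  refine ofTotal_injective h.toIsOperational (Eq.trans (ofTotal_counit_map_single h.toIsOperational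
    (A := (symmMonData h).tensorObj ((symmMonData h).tensorObj A B) F)
    (B := (symmMonData h).tensorObj A ((symmMonData h).tensorObj B F)) _) ?_)
  let _ := (laws h).monoidalCategory
  let _ := (laws h).symmetricCategory
  exact associator_single_entry ax (monoidalAxioms h) A B F

theorem counit_leftUnitor_single (A : Par T) :
    (counit h.toIsOperational ax).map ((parCollData h ax).leftUnitor (single ax A)) =
      (λ_ A.of).hom := by
  refine ofTotal_injective h.toIsOperational (Eq.trans (ofTotal_counit_map_single h.toIsOperational
    (A := (symmMonData h).tensorObj (symmMonData h).tensorUnit A) (B := A) _) ?_)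
  let _ := (laws h).monoidalCategory
  let _ := (laws h).symmetricCategory
  exact leftUnitor_single_entry ax (monoidalAxioms h) A

theorem counit_braiding_single (A B : Par T) :
    (counit h.toIsOperational ax).map ((parCollData h ax).braiding (single ax A) (single ax B)) =
      (β_ A.of B.of).hom := by
  refine ofTotal_injective h.toIsOperational (Eq.trans (ofTotal_counit_map_single h.toIsOperational
    (A := (symmMonData h).tensorObj A B) (B := (symmMonData h).tensorObj B A) _) ?_)
  let _ := (laws h).monoidalCategory
  let _ := (laws h).symmetricCategory
  exact braiding_single_entry ax (monoidalAxioms h) A B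

theorem counitμ_associativity_single (A B F : Par T) :
    (counitμ h (single ax A) (single ax B) ⊗ₘ 𝟙 F.of) ≫
        counitμ h (single ax ((symmMonData h).tensorObj A B)) (single ax F) ≫
        (counit h.toIsOperational ax).map ((parCollData h ax).associator (single ax A) (single ax B)
          (single ax F)) =
      (α_ A.of B.of F.of).hom ≫ (𝟙 A.of ⊗ₘ counitμ h (single ax B) (single ax F)) ≫
        counitμ h (single ax A) (single ax ((symmMonData h).tensorObj B F)) := by
  refine (congrArg₂ (· ≫ ·) ((congrArg (· ⊗ₘ 𝟙 F.of) (counitμ_single h A B)).trans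
    (MonoidalCategory.id_tensorHom_id _ _)) ((congrArg₂ (· ≫ ·) (counitμ_single h
    ((symmMonData h).tensorObj A B) F) (counit_associator_single h A B F)).trans
    (Category.id_comp _))).trans ((Category.id_comp _).trans ?_)
  exact ((congrArg (_ ≫ ·) ((congrArg₂ (· ≫ ·) ((congrArg (𝟙 A.of ⊗ₘ ·)
    (counitμ_single h B F)).trans (MonoidalCategory.id_tensorHom_id _ _)) (counitμ_single h A
    ((symmMonData h).tensorObj B F))).trans (Category.id_comp _))).trans (Category.comp_id _)).symm

theorem counitμ_left_unitality_single (A : Par T) :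
    (𝟙 (𝟙_ C) ⊗ₘ 𝟙 A.of) ≫ counitμ h (single ax (symmMonData h).tensorUnit) (single ax A) ≫
        (counit h.toIsOperational ax).map ((parCollData h ax).leftUnitor (single ax A)) =
      (λ_ A.of).hom :=
  (congrArg₂ (· ≫ ·) (MonoidalCategory.id_tensorHom_id _ _) ((congrArg₂ (· ≫ ·) (counitμ_single h
    (symmMonData h).tensorUnit A) (counit_leftUnitor_single h A)).trans
    (Category.id_comp _))).trans (Category.id_comp _)

theorem counitμ_braided_single (A B : Par T) :
    counitμ h (single ax A) (single ax B) ≫ (counit h.toIsOperational ax).map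
        ((parCollData h ax).braiding (single ax A) (single ax B)) =
      (β_ A.of B.of).hom ≫ counitμ h (single ax B) (single ax A) :=
  ((congrArg₂ (· ≫ ·) (counitμ_single h A B) (counit_braiding_single h A B)).trans
    (Category.id_comp _)).trans ((congrArg (_ ≫ ·) (counitμ_single h B A)).trans
    (Category.comp_id _)).symm

/-- The counit sends the inclusions of single systems to the coprojections of a coproduct, whose
tensors are jointly epic. The laws thus reduce to single systems, where the comparison map is an
identity. -/
theorem isSymmMonoidal_counit :
    letI := (parCollLaws h ax).monoidalCategory
    letI := (parCollLaws h ax).symmetricCategory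
    IsSymmMonoidal (counit h.toIsOperational ax) (𝟙 (𝟙_ C)) (counitμ h) := by
  let _ := (parCollLaws h ax).monoidalCategory
  let _ := (parCollLaws h ax).symmetricCategory
  have op := h.toIsOperational
  refine IsSymmMonoidal.of_laws (inferInstanceAs (IsIso (𝟙 (𝟙_ C)))) (isIso_counitμ h)
    (fun f g => counitμ_natural h f g)
    (fun X Y Z => (h.isCoprod_tensorHom (h.isCoprod_tensorHom (isCoprod_counitι op X)
      (isCoprod_counitι op Y)) (isCoprod_counitι op Z)).hom_ext fun p => ?_)
    (fun X => (h.isCoprod_whiskerLeft (𝟙_ C) (isCoprod_counitι op X)).hom_ext fun x => ?_)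
    (fun X Y => (h.isCoprod_tensorHom (isCoprod_counitι op X)
      (isCoprod_counitι op Y)).hom_ext fun p => ?_)
  · have e := associativity_comp (F := counit op ax) (μ := counitμ h)
      (fun f g => counitμ_natural h f g) (X.singleι p.1.1) (Y.singleι p.1.2) (Z.singleι p.2)
      (counitμ_associativity_single h _ _ _)
    rw [counit_map_singleι, counit_map_singleι, counit_map_singleι] at e
    exact e
  · have e := left_unitality_comp (F := counit op ax) (μ := counitμ h) (ε := 𝟙 (𝟙_ C))
      (fun f g => counitμ_natural h f g) (X.singleι x)
      (counitμ_left_unitality_single h _)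
    rw [counit_map_singleι] at e
    rw [← id_tensorHom]
    exact e
  · have e := braided_comp (F := counit op ax) (μ := counitμ h)
      (fun f g => counitμ_natural h f g) (X.singleι p.1) (Y.singleι p.2)
      (counitμ_braided_single h _ _)
    rw [counit_map_singleι, counit_map_singleι] at e
    exact e

end

end Par

open MonoidalCategory

/-! ## The monoidal adjunction -/

/-- The counit of the adjunction between monoidal theories and monoidal operational categories. -/
def monCounitHom (B : MonOpCatStrict.{v, u}) :
    (monOpCat monTestsWellDefined).obj ((monOTCOfPar monParWellDefined).obj B) ⟶ B :=
  ⟨Par.counit B.isMonOperational.toIsOperational (monParWellDefined.axioms B),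
    Par.counitμ B.isMonOperational, Par.isStrict_counit B.isMonOperational.toIsOperational _,
    _, Par.isSymmMonoidal_counit (ax := monParWellDefined.axioms B) B.isMonOperational⟩

theorem monUnitHom_comp_monCounitHom (B : MonOpCatStrict.{v, u}) :
    monUnitHom ((monOTCOfPar monParWellDefined).obj B) ≫
      (monOTCOfPar monParWellDefined).map (monCounitHom B) = 𝟙 _ :=
  MonOTC.Hom.ext_of_heq (Par.unit_comp_functor_counit B.isMonOperational.toIsOperational
    (monParWellDefined.axioms B)) fun X Y => heq_of_eq (by
      let Θ := (monOTCOfPar monParWellDefined).obj B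
      have e₁ := Par.functor_map_unitμ (T := B.isTerminal) Θ.monAx (Par.isStrict_counit
        B.isMonOperational.toIsOperational (monParWellDefined.axioms B)) X Y
      exact ((congrArg (_ ≫ ·) e₁).trans (Category.comp_id _)).trans
        ((congrArg (Par.ofTotal B.isTerminal) (Par.counitμ_single B.isMonOperational X Y)).trans
          (Par.ofTotal_id _)))

/-- Naturality along the inclusions of single systems expresses the comparison map on jointly epic
tensors through its values on single systems. -/
theorem OTCData.Coll.μ_eq_of_single {E : Type u} [Category.{v} E] [MonoidalCategory E]
    [SymmetricCategory E] {D : OTCData E (𝟙_ E)} {ax : D.Axioms} (m : D.MonoidalAxioms)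
    {C : Type u} [Category.{v} C] [MonoidalCategory C] [SymmetricCategory C] [SpecCoproducts C]
    {T : IsTerminal (𝟙_ C)} (h : IsMonOperational T) {H : Coll ax ⥤ C}
    (hH : IsStrict (single ax (𝟙_ E)) H)
    {μ ν : ∀ X Y : Coll ax, H.obj X ⊗ H.obj Y ⟶ H.obj (X.tensor Y)}
    (hμ : ∀ {X Y X' Y' : Coll ax} (f : X ⟶ Y) (g : X' ⟶ Y'),
      (H.map f ⊗ₘ H.map g) ≫ μ Y Y' = μ X X' ≫ H.map ((symmMonData ax m).tensorHom f g))
    (hν : ∀ {X Y X' Y' : Coll ax} (f : X ⟶ Y) (g : X' ⟶ Y'),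
      (H.map f ⊗ₘ H.map g) ≫ ν Y Y' = ν X X' ≫ H.map ((symmMonData ax m).tensorHom f g))
    (e : ∀ A B : E, μ (single ax A) (single ax B) = ν (single ax A) (single ax B))
    (X Y : Coll ax) : μ X Y = ν X Y := by
  have hS : PreservesSums H := hH.preservesSums
  refine (h.isCoprod_tensorHom (hS.isCoprod X.isCoprod_singleι)
    (hS.isCoprod Y.isCoprod_singleι)).hom_ext fun p => ?_
  rw [hμ, hν, e]

theorem monUnitHom_comp_injective {Θ : MonOTC.{v, u}} {B : MonOpCatStrict.{v, u}}
    {f g : (monOpCat monTestsWellDefined).obj Θ ⟶ B}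
    (h : monUnitHom Θ ≫ (monOTCOfPar monParWellDefined).map f =
      monUnitHom Θ ≫ (monOTCOfPar monParWellDefined).map g) : f = g := by
  have e := Par.eq_of_unit_comp_eq (ax := Θ.ax) B.isMonOperational.toIsOperational
    (MonOpCatStrict.Hom.isStrict f) (MonOpCatStrict.Hom.isStrict g)
    (congrArg MonOTC.Hom.toFunctor h)
  obtain ⟨H, μ, hH, ε, hμ⟩ := f
  obtain ⟨H', ν, hH', ε', hν⟩ := g
  obtain rfl : H = H' := e
  refine MonOpCatStrict.Hom.ext rfl (heq_of_eq (funext fun X => funext fun Y => ?_))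
  refine OTCData.Coll.μ_eq_of_single Θ.monAx B.isMonOperational hH (fun f g => hμ.natural f g)
    (fun f g => hν.natural f g) (fun A A' => ?_) X Y
  refine Par.ofTotal_injective (T := B.isTerminal) B.isMonOperational.toIsOperational ?_
  -- The unit's own comparison map is sent to an identity, so equality of the composites gives
  -- equality of `μ` and `ν` on single systems.
  have k := Par.functor_map_unitμ (T := B.isTerminal) Θ.monAx hH A A'
  have h' := congrFun (congrFun (eq_of_heq (MonOTC.Hom.mk.inj h).2) A) A'
  exact ((congrArg (_ ≫ ·) k).trans (Category.comp_id _)).symm.trans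
    (h'.trans ((congrArg (_ ≫ ·) k).trans (Category.comp_id _)))

theorem exists_adjunction_monOpCat :
    Nonempty (monOpCat monTestsWellDefined.{v, u} ⊣ monOTCOfPar monParWellDefined.{v, u}) :=
  exists_adjunction monUnitHom (fun F => monUnitHom_naturality F)
    (fun B => ⟨monCounitHom B, monUnitHom_comp_monCounitHom B⟩)
    (fun {_ _ _ _} h => monUnitHom_comp_injective h)

theorem adjunction_monOpCat :
    ∃ (hL : MonTestsWellDefined.{v, u}) (hR : MonParWellDefined.{v, u})
      (adj : monOpCat hL ⊣ monOTCOfPar hR),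
      RestrictsTo adj MonOTC.positiveCombining MonOpCatStrict.effectus :=
  ⟨monTestsWellDefined, monParWellDefined, exists_adjunction_monOpCat.some, restrictsTo_of _ _ _
    (fun Θ h => OTCData.Coll.isEffectus (ax := Θ.ax) h.1 h.2)
    (fun B h => ⟨Par.isPositive B.isMonOperational.toIsOperational h,
      Par.isCombining B.isMonOperational.toIsOperational h _⟩)⟩

end OpTheory

end

theorem corollary7p5 :
    (∃ (hL : OpTheory.TestsWellDefined.{v, u}) (hR : OpTheory.ParWellDefined.{v, u})
      (adj : OpTheory.opCat hL ⊣ OpTheory.otcOfPar hR),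
      OpTheory.RestrictsTo adj OpTheory.OTC.positiveCombining OpTheory.OpCatStrict.effectus) ∧
    (∃ (hL : OpTheory.MonTestsWellDefined.{v, u}) (hR : OpTheory.MonParWellDefined.{v, u})
      (adj : OpTheory.monOpCat hL ⊣ OpTheory.monOTCOfPar hR),
      OpTheory.RestrictsTo adj OpTheory.MonOTC.positiveCombining
        OpTheory.MonOpCatStrict.effectus) :=
  ⟨OpTheory.adjunction_opCat, OpTheory.adjunction_monOpCat⟩
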